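/- All graphs are finite, simple and undirected. A class $\mathcal H$ of graphs (closed under isomorphism) is hereditary if every induced subgraph of a member is a member, and union-closed if the disjoint union of two members is a member. An $\mathcal H$-deletion set of a graph $G$ is a set $X\subseteq V(G)$ with $G-X\in\mathcal H$. An algorithm $\mathcal A$ solves $\mathcal H$-deletion if, given a graph $G$ and a parameter $\ell\in\mathbb N$, it either outputs a minimum-size $\mathcal H$-deletion set of $G$ or correctly reports that $G$ has no $\mathcal H$-deletion set of size at most $\ell$. A tree $\mathcal H$-decomposition of $G$ is a triple $(T,\chi,L)$, where $T$ is a finite rooted tree, $\chi\colon V(T)\to 2^{V(G)}$ and $L\subseteq V(G)$, such that (1) for each $v\in V(G)$ the nodes $t$ with $v\in\chi(t)$ form a non-empty connected subtree of $T$; (2) for each edge $uv$ of $G$ there is a node $t$ with $\{u,v\}\subseteq\chi(t)$; (3) for each $v\in L$ there is a unique node $t$ with $v\in\chi(t)$, and $t$ is a leaf of $T$ (a node without children); (4) $G[\chi(t)\cap L]\in\mathcal H$ for each node $t$. Its width is $\max(0,\max_t|\chi(t)\setminus L|-1)$, and the $\mathcal H$-treewidth $\mathrm{tw}_{\mathcal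 H}(G)$ is the minimum width of a tree $\mathcal H$-decomposition of $G$ ($\infty$ if there is none). Theorem. Let $\mathcal H$ be a hereditary and union-closed class of graphs. There is an algorithm that, using oracle access to any algorithm $\mathcal A$ that solves $\mathcal H$-deletion, takes as input an $n$-vertex $m$-edge graph $G$ (as adjacency lists) and an integer $k\ge 0$, and either outputs a tree $\mathcal H$-decomposition of $G$ of width at most $5k+5$ with $O(n+1)$ nodes, or correctly reports that $\mathrm{tw}_{\mathcal H}(G)>k$. On a word RAM whose words have $O(\log(n+k+2))$ bits, and not counting the computations of $\mathcal A$, the algorithm runs in time $O\bigl(8^k\cdot(k+1)\,(n+1)\,(n+m+1)\bigr)$ and uses a number of memory cells polynomial in $n+2$. It makes $O(8^k\cdot n)$ calls to $\mathcal A$, each on an induced subgraph of $G$ (with its vertices renumbered) and with parameter $2k+2$. The constants hidden in the $O$-notation and the polynomial may depend on $\mathcal H$, but not on $\mathcal A$, $G$ or $k$. -/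

import Mathlib

/-! ### Graph classes -/

/-- A class of finite simple graphs, closed under isomorphism. -/
structure GraphClass where
  mem : ∀ {V : Type} [Finite V], SimpleGraph V → Prop
  mem_of_iso : ∀ {V W : Type} [Finite V] [Finite W] (G : SimpleGraph V) (G' : SimpleGraph W),
    Nonempty (G ≃g G') → mem G → mem G'

namespace GraphClass

/-- Every induced subgraph of a member is a member. -/
def Hereditary (H : GraphClass) : Prop :=
  ∀ (V : Type) [Finite V] (G : SimpleGraph V), H.mem G → ∀ S : Set V, H.mem (G.induce S)

/-- The disjoint union of two members is a member. -/
def UnionClosed (H : GraphClass) : Prop :=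
  ∀ (V W : Type) [Finite V] [Finite W] (G₁ : SimpleGraph V) (G₂ : SimpleGraph W),
    H.mem G₁ → H.mem G₂ → H.mem (SimpleGraph.sum G₁ G₂)

/-- `X` is a deletion set of `G` for the class: `G - X` is a member. -/
def IsDeletionSet (H : GraphClass) {V : Type} [Finite V] (G : SimpleGraph V) (X : Finset V) :
    Prop :=
  H.mem (G.induce ((X : Set V)ᶜ))

/-- `X` is a deletion set of minimum size. -/
def IsMinDeletionSet (H : GraphClass) {V : Type} [Finite V] (G : SimpleGraph V) (X : Finset V) :
    Prop :=
  H.IsDeletionSet G X ∧ ∀ Y : Finset V, H.IsDeletionSet G Y → X.card ≤ Y.card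

end GraphClass

/-! ### Tree decompositions relative to a graph class -/

/-- In the tree `T` rooted at `r`, the node `t` is a child of the node `p`. -/
def IsChild {N : Type} (T : SimpleGraph N) (r p t : N) : Prop :=
  T.Adj p t ∧ T.dist r t = T.dist r p + 1

/-- In the tree `T` rooted at `r`, the node `t` is a leaf, i.e. it has no children. -/
def IsRootedLeaf {N : Type} (T : SimpleGraph N) (r t : N) : Prop :=
  ∀ t' : N, ¬ IsChild T r t t'

/-- A tree `H`-decomposition `(T, χ, L)` of `G`, where `T` is a finite rooted tree whose nodes are
numbered `0, …, nodes - 1`. -/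
structure TreeHDecomposition (H : GraphClass) {V : Type} [Fintype V] [DecidableEq V]
    (G : SimpleGraph V) where
  nodes : ℕ
  T : SimpleGraph (Fin nodes)
  isTree : T.IsTree
  root : Fin nodes
  χ : Fin nodes → Finset V
  L : Finset V
  /-- The nodes whose bags contain `v` form a non-empty connected subtree. -/
  connected : ∀ v : V, (T.induce {t | v ∈ χ t}).Connected
  edge : ∀ u v : V, G.Adj u v → ∃ t, u ∈ χ t ∧ v ∈ χ t
  leaf : ∀ v ∈ L, ∃ t, (∀ t', v ∈ χ t' ↔ t' = t) ∧ IsRootedLeaf T root t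
  base : ∀ t, H.mem (G.induce ((χ t ∩ L : Finset V) : Set V))

/-- The width `max (0, max_t |χ(t) \ L| - 1)` (subtraction of natural numbers is truncated). -/
def TreeHDecomposition.width {H : GraphClass} {V : Type} [Fintype V] [DecidableEq V]
    {G : SimpleGraph V} (D : TreeHDecomposition H G) : ℕ :=
  Finset.univ.sup fun t => (D.χ t \ D.L).card - 1

/-- The `H`-treewidth of `G`, the minimum width of a tree `H`-decomposition of `G`
(`⊤` if there is none; for a hereditary class this happens only if the class is empty). -/
noncomputable def hTreewidth (H : GraphClass) {V : Type} [Fintype V] [DecidableEq V]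
    (G : SimpleGraph V) : ℕ∞ :=
  ⨅ D : TreeHDecomposition H G, (D.width : ℕ∞)

/-! ### A word random-access machine with an oracle

Programs are structured imperative programs over finitely many registers and finitely many
zero-initialised arrays of machine words. All operations have unit cost. The machine has two
resource limits: every word that it computes has to be smaller than `B` (so that a word has
`log₂ B` bits), and every array index that it uses has to be smaller than `M` (so that each array
consists of `M` cells). A computation that exceeds a limit has no valid execution. -/

namespace WordRAM

/-- The contents of the registers and of the arrays. -/
structure State where
  reg : ℕ → ℕ
  arr : ℕ → ℕ → ℕ

/-- The binary operations on words. -/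
inductive Op where
  | add | sub | mul | div | mod | lt | eq

def Op.eval : Op → ℕ → ℕ → ℕ
  | .add, a, b => a + b
  | .sub, a, b => a - b
  | .mul, a, b => a * b
  | .div, a, b => a / b
  | .mod, a, b => a % b
  | .lt, a, b => if a < b then 1 else 0
  | .eq, a, b => if a = b then 1 else 0

/-- Expressions: constants, registers, array cells, and binary operations. The names of registers
and arrays are literals, the index of an array cell is an expression. -/
inductive Expr where
  | const (c : ℕ)
  | reg (x : ℕ)
  | arr (a : ℕ) (i : Expr)
  | bin (o : Op) (e f : Expr)

def Expr.eval (s : State) : Expr → ℕ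
  | .const c => c
  | .reg x => s.reg x
  | .arr a i => s.arr a (i.eval s)
  | .bin o e f => o.eval (e.eval s) (f.eval s)

/-- The evaluation of the expression respects the limits of the machine. -/
def Expr.Ok (B M : ℕ) (s : State) : Expr → Prop
  | .const c => c < B
  | .reg x => s.reg x < B
  | .arr a i => i.Ok B M s ∧ i.eval s < M ∧ s.arr a (i.eval s) < B
  | .bin o e f => e.Ok B M s ∧ f.Ok B M s ∧ o.eval (e.eval s) (f.eval s) < B

/-- The number of unit-cost steps in an evaluation of the expression. -/
def Expr.cost : Expr → ℕ
  | .const _ => 1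
  | .reg _ => 1
  | .arr _ i => i.cost + 1
  | .bin _ e f => e.cost + f.cost + 1

/-- Programs. `query a len b` submits the first `len` cells of array `a` to the oracle, whose
answer is written to the first cells of array `b`. -/
inductive Cmd where
  | skip
  | assign (x : ℕ) (e : Expr)
  | store (a : ℕ) (i e : Expr)
  | seq (c d : Cmd)
  | cond (e : Expr) (c d : Cmd)
  | loop (e : Expr) (c : Cmd)
  | query (a : ℕ) (len : Expr) (b : ℕ)

def State.setReg (s : State) (x v : ℕ) : State :=
  { s with reg := Function.update s.reg x v }

def State.setArr (s : State) (a i v : ℕ) : State :=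
  { s with arr := Function.update s.arr a (Function.update (s.arr a) i v) }

/-- Overwrite the first cells of array `a` by the list `l`. -/
def State.writeList (s : State) (a : ℕ) (l : List ℕ) : State :=
  { s with arr := Function.update s.arr a fun i => l.getD i (s.arr a i) }

/-- The first `len` cells of array `a`. -/
def State.readList (s : State) (a len : ℕ) : List ℕ :=
  (List.range len).map (s.arr a)

/-- `Exec A B M c s s' t qs`: with oracle `A`, word limit `B` and memory limit `M`, the program `c`
started in state `s` terminates in state `s'` after `t` steps, and `qs` is the list of the queries
it has made. The cost of a query includes the lengths of the query and of the answer, but not the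
computation of the answer. -/
inductive Exec (A : List ℕ → List ℕ) (B M : ℕ) :
    Cmd → State → State → ℕ → List (List ℕ) → Prop
  | skip (s : State) : Exec A B M .skip s s 1 []
  | assign (s : State) (x : ℕ) (e : Expr) (he : e.Ok B M s) :
      Exec A B M (.assign x e) s (s.setReg x (e.eval s)) (e.cost + 1) []
  | store (s : State) (a : ℕ) (i e : Expr) (hi : i.Ok B M s) (he : e.Ok B M s)
      (hM : i.eval s < M) :
      Exec A B M (.store a i e) s (s.setArr a (i.eval s) (e.eval s)) (i.cost + e.cost + 1) []
  | seq {c d : Cmd} {s s' s'' : State} {t t' : ℕ} {qs qs' : List (List ℕ)}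
      (hc : Exec A B M c s s' t qs) (hd : Exec A B M d s' s'' t' qs') :
      Exec A B M (.seq c d) s s'' (t + t') (qs ++ qs')
  | cond_true {e : Expr} {c d : Cmd} {s s' : State} {t : ℕ} {qs : List (List ℕ)}
      (he : e.Ok B M s) (h : e.eval s ≠ 0) (hc : Exec A B M c s s' t qs) :
      Exec A B M (.cond e c d) s s' (e.cost + 1 + t) qs
  | cond_false {e : Expr} {c d : Cmd} {s s' : State} {t : ℕ} {qs : List (List ℕ)}
      (he : e.Ok B M s) (h : e.eval s = 0) (hd : Exec A B M d s s' t qs) :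
      Exec A B M (.cond e c d) s s' (e.cost + 1 + t) qs
  | loop_true {e : Expr} {c : Cmd} {s s' s'' : State} {t t' : ℕ} {qs qs' : List (List ℕ)}
      (he : e.Ok B M s) (h : e.eval s ≠ 0) (hc : Exec A B M c s s' t qs)
      (hl : Exec A B M (.loop e c) s' s'' t' qs') :
      Exec A B M (.loop e c) s s'' (e.cost + 1 + t + t') (qs ++ qs')
  | loop_false {e : Expr} {c : Cmd} {s : State} (he : e.Ok B M s) (h : e.eval s = 0) :
      Exec A B M (.loop e c) s s (e.cost + 1) []
  | query (s : State) (a : ℕ) (len : Expr) (b : ℕ) (hlen : len.Ok B M s)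
      (hM : len.eval s ≤ M) (hA : (A (s.readList a (len.eval s))).length ≤ M)
      (hq : ∀ w ∈ s.readList a (len.eval s), w < B)
      (hB : ∀ w ∈ A (s.readList a (len.eval s)), w < B) :
      Exec A B M (.query a len b) s (s.writeList b (A (s.readList a (len.eval s))))
        (len.cost + 1 + len.eval s + (A (s.readList a (len.eval s))).length)
        [s.readList a (len.eval s)]

/-- The initial state: array `0` holds the input list, register `0` holds the parameter `k`,
everything else is zero. -/
def State.init (input : List ℕ) (k : ℕ) : State where
  reg := fun x => if x = 0 then k else 0
  arr := fun a i => if a = 0 then input.getD i 0 else 0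

/-- Array `1` starts with the list `out`. -/
def State.Outputs (s : State) (out : List ℕ) : Prop :=
  s.readList 1 out.length = out

end WordRAM

/-! ### Encodings by lists of words -/

/-- A list of vertices, preceded by its length. -/
def codeList {n : ℕ} (l : List (Fin n)) : List ℕ :=
  l.length :: l.map Fin.val

/-- `code` is an adjacency-list encoding of `G`: the number of vertices, followed by the list of
neighbours of each vertex, in any order. -/
def IsGraphCode {n : ℕ} (G : SimpleGraph (Fin n)) (code : List ℕ) : Prop :=
  ∃ adj : Fin n → List (Fin n),
    (∀ v, (adj v).Nodup ∧ ∀ u, u ∈ adj v ↔ G.Adj v u) ∧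
    code = n :: (List.ofFn fun v => codeList (adj v)).flatten

/-- `ans` is a correct answer for the `H`-deletion problem on `G` with parameter `l`: either `[0]`,
if there is no deletion set of size at most `l`, or `1` followed by a minimum-size deletion set. -/
def IsDeletionAnswer (H : GraphClass) {n : ℕ} (G : SimpleGraph (Fin n)) (l : ℕ)
    (ans : List ℕ) : Prop :=
  (ans = [0] ∧ ∀ X : Finset (Fin n), H.IsDeletionSet G X → l < X.card) ∨
  ∃ X : List (Fin n), X.Nodup ∧ H.IsMinDeletionSet G X.toFinset ∧ ans = 1 :: codeList X

/-- The oracle `A` solves the `H`-deletion problem; a query is the parameter followed by an encoding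
of the graph. -/
def SolvesDeletion (H : GraphClass) (A : List ℕ → List ℕ) : Prop :=
  ∀ (n : ℕ) (G : SimpleGraph (Fin n)) (code : List ℕ) (l : ℕ),
    IsGraphCode G code → IsDeletionAnswer H G l (A (l :: code))

/-- `q` is a query on (a numbered copy of) an induced subgraph of `G` with parameter `l`. -/
def IsInducedQuery {n : ℕ} (G : SimpleGraph (Fin n)) (l : ℕ) (q : List ℕ) : Prop :=
  ∃ (U : Set (Fin n)) (n' : ℕ) (Q : SimpleGraph (Fin n')) (code : List ℕ),
    Nonempty (Q ≃g G.induce U) ∧ IsGraphCode Q code ∧ q = l :: code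

/-- `out` encodes the decomposition `D`: the number `1`, the number of nodes, the root, the parent of
each node (the root itself for the root), the list of the vertices in `L`, and the list of the
vertices in each bag. -/
def IsDecompositionCode {H : GraphClass} {n : ℕ} {G : SimpleGraph (Fin n)}
    (D : TreeHDecomposition H G) (out : List ℕ) : Prop :=
  ∃ (par : Fin D.nodes → Fin D.nodes) (L : List (Fin n)) (bag : Fin D.nodes → List (Fin n)),
    par D.root = D.root ∧ (∀ t, t ≠ D.root → IsChild D.T D.root (par t) t) ∧
    (L.Nodup ∧ L.toFinset = D.L) ∧ (∀ t, (bag t).Nodup ∧ (bag t).toFinset = D.χ t) ∧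
    out = [1, D.nodes, (D.root : ℕ)] ++ List.ofFn (fun t => (par t : ℕ)) ++ codeList L ++
      (List.ofFn fun t => codeList (bag t)).flatten

/-! The decomposition is built from the root downwards, in the manner of Robertson and Seymour. A
pending node with untreated vertices carries a bag `Z` of exactly 3k+4 vertices and a set `S` of
untreated vertices, all of whose neighbours lie in `S ∪ Z`. The 2^(3k+4) = 16·8^k subsets `M` of `Z`
are tried, in one of two modes.

Balanced mode: `M` and `Z \ M` both have at least k+2, hence at most 2k+2 elements. A separator `Y`
of at most k+1 vertices between them in G[S ∪ Z] gives two children with the bags `M ∪ Y` and `(Z \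
M) ∪ Y`, of at most 3k+3 vertices each.

Base mode: `Z \ M` has at most k+1 elements. A set `Q` is maintained such that `Q ∩ S` induces a
member of the class. A separator `Y` of at most 2k+2 vertices between `M` and `S \ Q` cuts off a
subset of `Q ∩ S`, which is a member by heredity and is put into a leaf. The other child has the bag
`(Z \ M) ∪ Y`, again of at most 3k+3 vertices. The node itself gets the bag `Z ∪ Y` of at most 5k+6
vertices, which explains the width 5k+5. If there is no such `Y`, then 2k+3 disjoint paths lead from
`M` to a set `E ⊆ S \ Q`, and the oracle is asked about `(Q ∩ S) ∪ E`. A deletion set `D` of at most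
2k+2 vertices yields the larger set `(Q ∪ E) \ D`.

Correctness of a rejection (`lt_width_of_partFails`): suppose that all parts fail, but some
decomposition has width at most k. A node of its tree that is a centroid with respect to `Z` yields
a separation (`TreeHDecomposition.exists_separation`). Either it is balanced with k+1 vertices, and
no k+2 disjoint paths can cross it; or almost all of `Z` lies in a base component `C` with at most
k+1 neighbours `X`. In the latter case at most k+1 vertices of `E` are outside `C`, and deleting
these together with `X` leaves a disjoint union of members, so that 2k+2 deletions suffice, contrary
to the answer of the oracle.

Progress: a child bag has at most 3k+3 vertices before it is filled up to 3k+4, so every branching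
treats at least one more vertex (`Conf.split_inv`); an improvement of `Q` reduces the number of
untreated vertices outside `Q` (`Conf.commit_rest`). The potential 2·todo + rest is at most 3n,
which bounds the calls by 48·8^k·n; since a branching adds two nodes, there are at most 2n+1 nodes.

Disjoint paths and separators are found by augmenting a bipartite matching
(`Linkage.Matching.isLinked`, `Linkage.Search.isCut`), with O(k) searches of cost O(n+m) for each
part. All of this is written as a program for the word RAM and verified in a logic that counts steps
and queries. -/

/-! ### A program logic for the machine -/

namespace WordRAM

infix:62 " ::= " => Cmd.assign
infixr:60 " ;; " => Cmd.seq
prefix:max "ρ" => Expr.reg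
prefix:max "κ" => Expr.const
infixl:65 " +ᵣ " => Expr.bin Op.add
infixl:65 " -ᵣ " => Expr.bin Op.sub
infixl:70 " *ᵣ " => Expr.bin Op.mul
infix:63 " <ᵣ " => Expr.bin Op.lt
infix:63 " =ᵣ " => Expr.bin Op.eq

/-- The register `x` may be written by the program. -/
def Cmd.wr : Cmd → ℕ → Bool
  | .skip, _ => false
  | .assign x _, y => x == y
  | .store _ _ _, _ => false
  | .seq c d, y => c.wr y || d.wr y
  | .cond _ c d, y => c.wr y || d.wr y
  | .loop _ c, y => c.wr y
  | .query _ _ _, _ => false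

/-- The array `a` may be written by the program. -/
def Cmd.wa : Cmd → ℕ → Bool
  | .skip, _ => false
  | .assign _ _, _ => false
  | .store a _ _, b => a == b
  | .seq c d, y => c.wa y || d.wa y
  | .cond _ c d, y => c.wa y || d.wa y
  | .loop _ c, y => c.wa y
  | .query _ _ b, y => b == y

/-- The states agree on everything that the program does not write. -/
structure Frame (c : Cmd) (s s' : State) : Prop where
  reg : ∀ x, c.wr x = false → s'.reg x = s.reg x
  arr : ∀ a, c.wa a = false → s'.arr a = s.arr a

theorem Frame.refl (c : Cmd) (s : State) : Frame c s s := ⟨fun _ _ => rfl, fun _ _ => rfl⟩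

theorem Frame.trans {c : Cmd} {s s' s'' : State} (h : Frame c s s') (h' : Frame c s' s'') :
    Frame c s s'' :=
  ⟨fun x hx => (h'.reg x hx).trans (h.reg x hx), fun a ha => (h'.arr a ha).trans (h.arr a ha)⟩

theorem Frame.mono {c d : Cmd} {s s' : State} (h : Frame c s s')
    (hr : ∀ x, d.wr x = false → c.wr x = false) (ha : ∀ x, d.wa x = false → c.wa x = false) :
    Frame d s s' :=
  ⟨fun x hx => h.reg x (hr x hx), fun a hx => h.arr a (ha a hx)⟩

theorem Exec.frame {A : List ℕ → List ℕ} {B M : ℕ} {c : Cmd} {s s' : State} {t : ℕ}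
    {qs : List (List ℕ)} (h : Exec A B M c s s' t qs) : Frame c s s' := by
  induction h with
  | skip s => exact Frame.refl _ _
  | assign s x e he =>
    refine ⟨fun y hy => ?_, fun _ _ => rfl⟩
    have : y ≠ x := by rintro rfl; simp [Cmd.wr] at hy
    simp [State.setReg, Function.update_of_ne this]
  | store s a i e hi he hM =>
    refine ⟨fun _ _ => rfl, fun y hy => ?_⟩
    have : y ≠ a := by rintro rfl; simp [Cmd.wa] at hy
    simp [State.setArr, Function.update_of_ne this]
  | seq hc hd ihc ihd =>
    exact (ihc.mono (by simp +contextual [Cmd.wr]) (by simp +contextual [Cmd.wa])).trans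
      (ihd.mono (by simp +contextual [Cmd.wr]) (by simp +contextual [Cmd.wa]))
  | cond_true he h hc ih =>
    exact ih.mono (by simp +contextual [Cmd.wr]) (by simp +contextual [Cmd.wa])
  | cond_false he h hc ih =>
    exact ih.mono (by simp +contextual [Cmd.wr]) (by simp +contextual [Cmd.wa])
  | loop_true he h hc hl ihc ihl =>
    exact (ihc.mono (by simp [Cmd.wr]) (by simp [Cmd.wa])).trans ihl
  | loop_false he h => exact Frame.refl _ _
  | query s a len b hlen hM hA hq hB =>
    refine ⟨fun _ _ => rfl, fun y hy => ?_⟩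
    have : y ≠ b := by rintro rfl; simp [Cmd.wa] at hy
    simp [State.writeList, Function.update_of_ne this]

/-- The oracle, the limits of the machine, and the admissible queries. -/
structure Machine where
  A : List ℕ → List ℕ
  B : ℕ
  M : ℕ
  ok : List ℕ → Prop

/-- From `s`, the program terminates within `T` steps and with at most `K` queries, all of them
admissible, in a state satisfying `P`. -/
def WP (E : Machine) (c : Cmd) (s : State) (T K : ℕ) (P : State → Prop) : Prop :=
  ∃ s' t qs, Exec E.A E.B E.M c s s' t qs ∧ t ≤ T ∧ qs.length ≤ K ∧ (∀ q ∈ qs, E.ok q) ∧ P s'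

variable {E : Machine}

/-- Here and in `WP.seq` the postcondition is passed on together with the frame of the program. For
a concrete program the side conditions of the frame hold by `rfl`, so postconditions need only
mention what changes. -/
theorem WP.mono {c : Cmd} {s : State} {T T' K K' : ℕ} {P P' : State → Prop}
    (h : WP E c s T K P) (hT : T ≤ T') (hK : K ≤ K')
    (hP : ∀ s', Frame c s s' → P s' → P' s') : WP E c s T' K' P' := by
  obtain ⟨s', t, qs, he, ht, hk, hq, hp⟩ := h
  exact ⟨s', t, qs, he, ht.trans hT, hk.trans hK, hq, hP s' he.frame hp⟩

theorem WP.seq {c d : Cmd} {s : State} {T₁ K₁ T₂ K₂ T K : ℕ} {Q P : State → Prop}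
    (h₁ : WP E c s T₁ K₁ Q) (h₂ : ∀ s', Frame c s s' → Q s' → WP E d s' T₂ K₂ P)
    (hT : T₁ + T₂ ≤ T) (hK : K₁ + K₂ ≤ K) : WP E (c ;; d) s T K P := by
  obtain ⟨s', t, qs, he, ht, hk, hq, hp⟩ := h₁
  obtain ⟨s'', t', qs', he', ht', hk', hq', hp'⟩ := h₂ s' he.frame hp
  refine ⟨s'', t + t', qs ++ qs', .seq he he', by omega, by simp; omega, ?_, hp'⟩
  intro q hqq
  rcases List.mem_append.1 hqq with h | h
  · exact hq q h
  · exact hq' q h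

theorem WP.cond {e : Expr} {c d : Cmd} {s : State} {T T' K : ℕ} {P : State → Prop}
    (he : e.Ok E.B E.M s) (h₁ : e.eval s ≠ 0 → WP E c s T K P)
    (h₂ : e.eval s = 0 → WP E d s T K P) (hT : e.cost + 1 + T ≤ T') :
    WP E (.cond e c d) s T' K P := by
  by_cases h : e.eval s = 0
  · obtain ⟨s', t, qs, hx, ht, hk, hq, hp⟩ := h₂ h
    exact ⟨s', _, qs, .cond_false he h hx, by omega, hk, hq, hp⟩
  · obtain ⟨s', t, qs, hx, ht, hk, hq, hp⟩ := h₁ h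
    exact ⟨s', _, qs, .cond_true he h hx, by omega, hk, hq, hp⟩

/-- The final state of a program without loops and queries. -/
def Cmd.run : Cmd → State → State
  | .skip, s => s
  | .assign x e, s => s.setReg x (e.eval s)
  | .store a i e, s => s.setArr a (i.eval s) (e.eval s)
  | .seq c d, s => d.run (c.run s)
  | .cond e c d, s => if e.eval s = 0 then d.run s else c.run s
  | .loop _ _, s => s
  | .query _ _ _, s => s

/-- A program without loops and queries respects the limits of the machine. -/
def Cmd.Safe (B M : ℕ) : Cmd → State → Prop
  | .skip, _ => True
  | .assign _ e, s => e.Ok B M s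
  | .store _ i e, s => i.Ok B M s ∧ e.Ok B M s ∧ i.eval s < M
  | .seq c d, s => c.Safe B M s ∧ d.Safe B M (c.run s)
  | .cond e c d, s =>
    e.Ok B M s ∧ (e.eval s = 0 → d.Safe B M s) ∧ (e.eval s ≠ 0 → c.Safe B M s)
  | .loop _ _, _ => False
  | .query _ _ _, _ => False

/-- A bound on the running time of a program without loops and queries. -/
def Cmd.cst : Cmd → ℕ
  | .skip => 1
  | .assign _ e => e.cost + 1
  | .store _ i e => i.cost + e.cost + 1
  | .seq c d => c.cst + d.cst
  | .cond e c d => e.cost + 1 + max c.cst d.cst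
  | .loop _ _ => 0
  | .query _ _ _ => 0

theorem Cmd.exec_run {A : List ℕ → List ℕ} {B M : ℕ} (c : Cmd) (s : State) (hs : c.Safe B M s) :
    ∃ t, t ≤ c.cst ∧ Exec A B M c s (c.run s) t [] := by
  induction c generalizing s with
  | skip => exact ⟨_, le_rfl, .skip s⟩
  | assign x e => exact ⟨_, le_rfl, .assign s x e hs⟩
  | store a i e => exact ⟨_, le_rfl, .store s a i e hs.1 hs.2.1 hs.2.2⟩
  | seq c d ihc ihd =>
    obtain ⟨t, ht, h⟩ := ihc s hs.1
    obtain ⟨t', ht', h'⟩ := ihd _ hs.2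
    exact ⟨t + t', by simp only [Cmd.cst]; omega, .seq h h'⟩
  | cond e c d ihc ihd =>
    by_cases h0 : e.eval s = 0
    · obtain ⟨t, ht, h⟩ := ihd s (hs.2.1 h0)
      refine ⟨e.cost + 1 + t, by simp only [Cmd.cst]; omega, ?_⟩
      simpa [Cmd.run, h0] using Exec.cond_false hs.1 h0 h
    · obtain ⟨t, ht, h⟩ := ihc s (hs.2.2 h0)
      refine ⟨e.cost + 1 + t, by simp only [Cmd.cst]; omega, ?_⟩
      simpa [Cmd.run, h0] using Exec.cond_true hs.1 h0 h
  | loop e c => exact hs.elim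
  | query a l b => exact hs.elim

/-- Loop-free code is executed symbolically: `Cmd.run` computes the final state, so safety, cost and
postcondition become goals for `simp`. -/
theorem WP.simple {c : Cmd} {s : State} {T K : ℕ} {P : State → Prop} (hs : c.Safe E.B E.M s)
    (hT : c.cst ≤ T) (hP : Frame c s (c.run s) → P (c.run s)) : WP E c s T K P := by
  obtain ⟨t, ht, h⟩ := c.exec_run (A := E.A) s hs
  exact ⟨_, t, [], h, ht.trans hT, by simp, by simp, hP h.frame⟩

/-- A loop is paid for by credits for time and for queries. -/
theorem WP.loop {e : Expr} {c : Cmd} (I : State → ℕ → ℕ → Prop) {s₀ : State} {Φ Ψ T K : ℕ}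
    {P : State → Prop} (h0 : I s₀ Φ Ψ)
    (step : ∀ s φ ψ, Frame (.loop e c) s₀ s → I s φ ψ → e.Ok E.B E.M s ∧ (e.eval s ≠ 0 →
      ∃ T K, WP E c s T K fun s' => ∃ φ' ψ', I s' φ' ψ' ∧ e.cost + 1 + T + φ' ≤ φ ∧ K + ψ' ≤ ψ))
    (post : ∀ s φ ψ, Frame (.loop e c) s₀ s → I s φ ψ → e.eval s = 0 → P s)
    (hT : Φ + e.cost + 1 ≤ T) (hK : Ψ ≤ K) : WP E (.loop e c) s₀ T K P := by
  -- Induction on a bound for the time credit. Every iteration pays at least for its test, so the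
  -- credit strictly decreases, and the same induction proves termination.
  suffices H : ∀ N s φ ψ, φ ≤ N → Frame (.loop e c) s₀ s → I s φ ψ →
      WP E (.loop e c) s (φ + e.cost + 1) ψ P from
    (H _ s₀ Φ Ψ le_rfl (Frame.refl _ _) h0).mono hT hK fun _ _ h => h
  intro N
  induction N with
  | zero =>
    intro s φ ψ hN hf hI
    obtain ⟨hok, hst⟩ := step s φ ψ hf hI
    by_cases h : e.eval s = 0
    · exact ⟨s, _, [], .loop_false hok h, by omega, by simp, by simp, post s φ ψ hf hI h⟩
    · obtain ⟨T, K, s', t, qs, he, ht, hk, hq, φ', ψ', hI', hΦ, hΨ⟩ := hst h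
      omega
  | succ N ih =>
    intro s φ ψ hN hf hI
    obtain ⟨hok, hst⟩ := step s φ ψ hf hI
    by_cases h : e.eval s = 0
    · exact ⟨s, _, [], .loop_false hok h, by omega, by simp, by simp, post s φ ψ hf hI h⟩
    · obtain ⟨T, K, s', t, qs, he, ht, hk, hq, φ', ψ', hI', hΦ, hΨ⟩ := hst h
      obtain ⟨s'', t', qs', he', ht', hk', hq', hp⟩ :=
        ih s' φ' ψ' (by omega) (hf.trans (he.frame.mono (by simp [Cmd.wr]) (by simp [Cmd.wa]))) hI'
      refine ⟨s'', _, _, .loop_true hok h he he', by omega, by simp; omega, ?_, hp⟩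
      intro q hqq
      rcases List.mem_append.1 hqq with h | h
      · exact hq q h
      · exact hq' q h

/-- `for x = 0, …, b - 1 do c`, where `x` and `b` are registers. -/
def Cmd.for (x b : ℕ) (c : Cmd) : Cmd :=
  x ::= κ 0 ;; .loop (ρ x <ᵣ ρ b) (c ;; x ::= (ρ x +ᵣ κ 1))

@[simp] theorem State.setReg_reg (s : State) (x v y : ℕ) :
    (s.setReg x v).reg y = if y = x then v else s.reg y := by
  simp [State.setReg, Function.update_apply]

@[simp] theorem State.setReg_arr (s : State) (x v : ℕ) : (s.setReg x v).arr = s.arr := rfl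

@[simp] theorem State.setArr_reg (s : State) (a i v : ℕ) : (s.setArr a i v).reg = s.reg := rfl

@[simp] theorem State.setArr_arr (s : State) (a i v b : ℕ) :
    (s.setArr a i v).arr b = if b = a then Function.update (s.arr a) i v else s.arr b := by
  by_cases h : b = a
  · subst h; simp [State.setArr]
  · simp [State.setArr, h]

/-- The counter advances after the body, which therefore has to establish the next invariant in the
state with the new counter. A round costs 8 steps besides the body, namely 4 for the test and 4 for
the increment; the remaining 6 are the initial assignment and the last test. -/
theorem WP.for {x b : ℕ} {c : Cmd} {s : State} {T K : ℕ} {P : State → Prop} (n : ℕ)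
    (I : ℕ → State → Prop) (Tb : ℕ → ℕ) (hx : c.wr x = false) (hb : c.wr b = false)
    (hxb : b ≠ x) (hn : s.reg b = n) (hB : n < E.B) (h0 : I 0 (s.setReg x 0))
    (step : ∀ i s', i < n → Frame (Cmd.for x b c) s s' → s'.reg x = i → I i s' →
      WP E c s' (Tb i) 0 fun s'' => I (i + 1) (s''.setReg x (i + 1)))
    (post : ∀ s', Frame (Cmd.for x b c) s s' → s'.reg x = n → I n s' → P s')
    (hT : (∑ i ∈ Finset.range n, (Tb i + 8)) + 6 ≤ T) :
    WP E (Cmd.for x b c) s T K P := by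
  have hwb : (Cmd.for x b c).wr b = false := by
    simp [Cmd.for, Cmd.wr, hb, Ne.symm hxb]
  have hfr : ∀ s' s'', Frame (.loop (ρ x <ᵣ ρ b) (c ;; x ::= (ρ x +ᵣ κ 1))) s' s'' →
      Frame (Cmd.for x b c) s' s'' := fun s' s'' h =>
    h.mono (by simp [Cmd.for, Cmd.wr]) (by simp [Cmd.for, Cmd.wa])
  have hf0 : Frame (Cmd.for x b c) s (s.setReg x 0) := by
    refine ⟨fun y hy => ?_, fun _ _ => rfl⟩
    have : y ≠ x := by rintro rfl; simp [Cmd.for, Cmd.wr] at hy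
    simp [this]
  refine WP.seq (T₁ := 2) (K₁ := 0) (Q := fun s' => s' = s.setReg x 0)
    (WP.simple (by simp [Cmd.Safe, Expr.Ok]; omega) (by simp [Cmd.cst, Expr.cost])
      (fun _ => by simp [Cmd.run, Expr.eval])) ?_ (T₂ := (∑ i ∈ Finset.range n, (Tb i + 8)) + 4)
    (K₂ := 0) (by omega) (by omega)
  rintro _ - rfl
  refine WP.loop (fun s' φ ψ => s'.reg x ≤ n ∧ I (s'.reg x) s' ∧ ψ = 0 ∧
    φ = ∑ i ∈ Finset.Ico (s'.reg x) n, (Tb i + 8)) (Ψ := 0) ⟨by simp, by simpa using h0, rfl, rfl⟩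
    ?_ ?_ ?_ le_rfl
  · rintro s' φ ψ hf ⟨hle, hI, rfl, rfl⟩
    have hf' := hf0.trans (hfr _ _ hf)
    have hbn : s'.reg b = n := (hf'.reg b hwb).trans hn
    refine ⟨by simp [Expr.Ok, Expr.eval, Op.eval, hbn]; split_ifs <;> omega, fun hne => ?_⟩
    have hlt : s'.reg x < n := by
      simp only [Expr.eval, Op.eval, hbn, ne_eq, ite_eq_right_iff, Classical.not_imp] at hne
      exact hne.1
    refine ⟨Tb (s'.reg x) + 4, 0, WP.seq (step _ s' hlt hf' rfl hI) (T₂ := 4) (K₂ := 0) ?_ le_rfl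
      le_rfl⟩
    intro s'' hf'' hI''
    have hxx : s''.reg x = s'.reg x := hf''.reg x hx
    refine WP.simple ?_ (by simp [Cmd.cst, Expr.cost]) fun _ => ?_
    · simp [Cmd.Safe, Expr.Ok, Expr.eval, Op.eval, hxx]; omega
    · simp only [Cmd.run, Expr.eval, Op.eval, hxx, State.setReg_reg, if_true]
      refine ⟨_, 0, ⟨by omega, hI'', rfl, rfl⟩, ?_, by omega⟩
      rw [Finset.sum_eq_sum_Ico_succ_bot hlt]
      simp only [Expr.cost]; omega
  · rintro s' φ ψ hf ⟨hle, hI, -⟩ he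
    have hf' := hf0.trans (hfr _ _ hf)
    have hbn : s'.reg b = n := (hf'.reg b hwb).trans hn
    have : s'.reg x = n := by
      simp only [Expr.eval, Op.eval, hbn] at he
      split_ifs at he; omega
    exact post s' hf' this (this ▸ hI)
  · simp only [State.setReg_reg, if_true, Expr.cost]
    rw [Finset.range_eq_Ico]

/-- A `for` loop whose body takes a constant number of steps. -/
theorem WP.for_const {x b : ℕ} {c : Cmd} {s : State} {T K : ℕ} {P : State → Prop} (n : ℕ)
    (I : ℕ → State → Prop) (Tb : ℕ) (hx : c.wr x = false) (hb : c.wr b = false)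
    (hxb : b ≠ x) (hn : s.reg b = n) (hB : n < E.B) (h0 : I 0 (s.setReg x 0))
    (step : ∀ i s', i < n → Frame (Cmd.for x b c) s s' → s'.reg x = i → I i s' →
      WP E c s' Tb 0 fun s'' => I (i + 1) (s''.setReg x (i + 1)))
    (post : ∀ s', Frame (Cmd.for x b c) s s' → s'.reg x = n → I n s' → P s')
    (hT : n * (Tb + 8) + 6 ≤ T) :
    WP E (Cmd.for x b c) s T K P :=
  WP.for n I (fun _ => Tb) hx hb hxb hn hB h0 step post (by simpa using hT)

theorem WP.query {a : ℕ} {len : Expr} {b : ℕ} {s : State} {T K : ℕ} {P : State → Prop}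
    (hlen : len.Ok E.B E.M s) (hM : len.eval s ≤ E.M)
    (hA : (E.A (s.readList a (len.eval s))).length ≤ E.M)
    (hq : ∀ w ∈ s.readList a (len.eval s), w < E.B)
    (hB : ∀ w ∈ E.A (s.readList a (len.eval s)), w < E.B)
    (hok : E.ok (s.readList a (len.eval s)))
    (hT : len.cost + 1 + len.eval s + (E.A (s.readList a (len.eval s))).length ≤ T) (hK : 1 ≤ K)
    (hP : P (s.writeList b (E.A (s.readList a (len.eval s))))) :
    WP E (.query a len b) s T K P :=
  ⟨_, _, _, .query s a len b hlen hM hA hq hB, hT, by simpa using hK, by simpa using hok, hP⟩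

end WordRAM

/-! ### Graph classes -/

namespace GraphClass

variable {H : GraphClass} {V : Type} [Finite V] {G : SimpleGraph V}

theorem Hereditary.mem_induce_mono (hH : H.Hereditary) {S S' : Set V} (hS : S ⊆ S')
    (h : H.mem (G.induce S')) : H.mem (G.induce S) := by
  refine H.mem_of_iso _ _ ⟨?_⟩ (hH _ _ h {x | x.1 ∈ S})
  exact
    { toFun := fun x => ⟨x.1.1, x.2⟩
      invFun := fun x => ⟨⟨x.1, hS x.2⟩, x.2⟩
      left_inv := fun _ => rfl
      right_inv := fun _ => rfl
      map_rel_iff' := Iff.rfl }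

theorem UnionClosed.mem_induce_union (hH : H.UnionClosed) {S S' : Set V} (hd : Disjoint S S')
    (hadj : ∀ u ∈ S, ∀ w ∈ S', ¬ G.Adj u w) (h : H.mem (G.induce S)) (h' : H.mem (G.induce S')) :
    H.mem (G.induce (S ∪ S')) := by
  classical
  refine H.mem_of_iso _ _ ⟨RelIso.symm ⟨Equiv.Set.union hd, ?_⟩⟩ (hH _ _ _ _ h h')
  rintro ⟨a, ha⟩ ⟨b, hb⟩
  by_cases ha' : a ∈ S <;> by_cases hb' : b ∈ S
  · rw [Equiv.Set.union_apply_left hd ha', Equiv.Set.union_apply_left hd hb']; simp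
  · have hb2 : b ∈ S' := hb.resolve_left hb'
    rw [Equiv.Set.union_apply_left hd ha', Equiv.Set.union_apply_right hd hb2]
    simpa [SimpleGraph.sum] using hadj a ha' b hb2
  · have ha2 : a ∈ S' := ha.resolve_left ha'
    rw [Equiv.Set.union_apply_right hd ha2, Equiv.Set.union_apply_left hd hb']
    simpa [SimpleGraph.sum] using fun h => hadj b hb' a ha2 h.symm
  · have hb2 : b ∈ S' := hb.resolve_left hb'
    have ha2 : a ∈ S' := ha.resolve_left ha'
    rw [Equiv.Set.union_apply_right hd ha2, Equiv.Set.union_apply_right hd hb2]; simp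

end GraphClass

/-! ### Balanced separations of tree decompositions -/

/-- If all fibres over a set of at most `3k + 4` elements have at most `2k + 2` elements, then the
fibres can be divided into two groups of at most `2k + 2` elements. -/
theorem Finset.exists_balanced_fibers {α ι : Type*} [DecidableEq α] [DecidableEq ι] (W : Finset α)
    (f : α → ι) (k : ℕ) (hW : W.card ≤ 3 * k + 4)
    (hf : ∀ i, (W.filter fun v => f v = i).card ≤ 2 * k + 2) :
    ∃ I : Finset ι, (W.filter fun v => f v ∈ I).card ≤ 2 * k + 2 ∧
      (W.filter fun v => f v ∉ I).card ≤ 2 * k + 2 := by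
  have hsum : ∀ I : Finset ι,
      (W.filter fun v => f v ∈ I).card + (W.filter fun v => f v ∉ I).card = W.card :=
    fun I => Finset.card_filter_add_card_filter_not _
  -- `I` is a smallest set of indices whose complement is light. If `I` itself is heavy, then one of
  -- its elements alone will form a group.
  obtain ⟨I, hI, hmin⟩ := Finset.exists_min_image
    ((W.image f).powerset.filter fun I => (W.filter fun v => f v ∉ I).card ≤ 2 * k + 2) Finset.card
    ⟨W.image f, by
      simp only [mem_filter, mem_powerset, subset_refl, true_and]
      rw [Finset.filter_false_of_mem]
      · simp
      · intro v hv h; exact h (Finset.mem_image_of_mem f hv)⟩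
  rw [mem_filter, mem_powerset] at hI
  by_cases h : (W.filter fun v => f v ∈ I).card ≤ 2 * k + 2
  · exact ⟨I, h, hI.2⟩
  have hne : I.Nonempty := by
    rw [Finset.nonempty_iff_ne_empty]; rintro rfl; simp at h
  obtain ⟨i, hi⟩ := hne
  -- By minimality, at least 2k+3 elements lie outside `I.erase i`, which leaves at most k+1 over
  -- `I.erase i`. As `I` is heavy, at most k+1 lie outside `I`. So the fibres other than that of `i`
  -- have at most 2k+2 elements together.
  refine ⟨{i}, by simpa using hf i, ?_⟩
  have h1 : ¬ (W.filter fun v => f v ∉ I.erase i).card ≤ 2 * k + 2 := by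
    intro h2
    have := hmin (I.erase i) (by
      rw [mem_filter, mem_powerset]; exact ⟨(Finset.erase_subset _ _).trans hI.1, h2⟩)
    rw [Finset.card_erase_of_mem hi] at this
    have := Finset.card_pos.2 ⟨i, hi⟩
    omega
  have h2 : (W.filter fun v => f v ∉ ({i} : Finset ι)).card ≤
      (W.filter fun v => f v ∉ I).card + (W.filter fun v => f v ∈ I.erase i).card := by
    refine (Finset.card_le_card ?_).trans (Finset.card_union_le _ _)
    intro v
    simp only [mem_filter, mem_union, mem_singleton, mem_erase]
    tauto
  have := hsum I
  have := hsum (I.erase i)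
  omega

namespace TreeHDecomposition

open Finset

variable {H : GraphClass} {V : Type} [Fintype V] [DecidableEq V] {G : SimpleGraph V}
  (D : TreeHDecomposition H G)

/-- `deleteIncidenceSet t` keeps `t` as an isolated node and so plays the part of `T - t` without a
change of the node type. The subtree of a vertex outside the bag of `t` uses no edge at `t`, so it
stays within one component. -/
theorem reachable_of_mem {v : V} {t a b : Fin D.nodes} (ht : v ∉ D.χ t) (ha : v ∈ D.χ a)
    (hb : v ∈ D.χ b) : (D.T.deleteIncidenceSet t).Reachable a b := by
  obtain ⟨p⟩ := (D.connected v).preconnected ⟨a, ha⟩ ⟨b, hb⟩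
  have : ∀ x y : {t | v ∈ D.χ t}, (D.T.induce {t | v ∈ D.χ t}).Reachable x y →
      (D.T.deleteIncidenceSet t).Reachable x.1 y.1 := by
    rintro x y ⟨p⟩
    induction p with
    | nil => rfl
    | @cons x y _ h q ih =>
      refine SimpleGraph.Reachable.trans (SimpleGraph.Adj.reachable ?_) ih
      rw [SimpleGraph.deleteIncidenceSet_adj]
      refine ⟨h, ?_, ?_⟩
      · rintro rfl; exact ht x.2
      · rintro rfl; exact ht y.2
  exact this ⟨a, ha⟩ ⟨b, hb⟩ ⟨p⟩

theorem exists_mem (v : V) : ∃ t, v ∈ D.χ t := by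
  obtain ⟨⟨t, ht⟩⟩ := (D.connected v).nonempty
  exact ⟨t, ht⟩

/-- The neighbour is the second node of the path from `t` to `s`; the rest of the path avoids `t`.
-/
theorem exists_adj_reachable {t s : Fin D.nodes} (h : s ≠ t) :
    ∃ c, D.T.Adj t c ∧ (D.T.deleteIncidenceSet t).Reachable c s := by
  obtain ⟨p, hp⟩ := (D.isTree.connected.preconnected t s).exists_isPath
  cases p with
  | nil => exact absurd rfl h
  | cons hc q =>
    rename_i c
    refine ⟨c, hc, ?_⟩
    have ht := (SimpleGraph.Walk.cons_isPath_iff _ _).1 hp |>.2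
    clear hp
    clear hc
    induction q with
    | nil => rfl
    | cons h' q ih =>
      rw [SimpleGraph.Walk.support_cons, List.mem_cons, not_or] at ht
      refine SimpleGraph.Reachable.trans (SimpleGraph.Adj.reachable ?_) (ih h ht.2)
      rw [SimpleGraph.deleteIncidenceSet_adj]
      refine ⟨h', Ne.symm ht.1, ?_⟩
      rintro rfl
      exact ht.2 q.start_mem_support

open Classical in
/-- There is a node `t` such that no component of `T - t` contains too many vertices of `Z`. -/
theorem exists_light (Z : Finset V) (m : ℕ) (hm : Z.card < 2 * m) :
    ∃ t, ∀ c,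
    (Z.filter fun v => v ∉ D.χ t ∧
      ∀ s, v ∈ D.χ s → (D.T.deleteIncidenceSet t).Reachable c s).card < m := by
  by_contra! hcon
  -- Otherwise each `T - t` has a heavy component. As `m > 0`, some vertex of `Z` lives in it, so
  -- the component can be represented by a neighbour of `t`.
  have hcon' : ∀ t, ∃ c, D.T.Adj t c ∧ m ≤ (Z.filter fun v => v ∉ D.χ t ∧
      ∀ s, v ∈ D.χ s → (D.T.deleteIncidenceSet t).Reachable c s).card := by
    intro t
    obtain ⟨c, hc⟩ := hcon t
    have hpos : 0 < (Z.filter fun v => v ∉ D.χ t ∧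
      ∀ s, v ∈ D.χ s → (D.T.deleteIncidenceSet t).Reachable c s).card := by omega
    obtain ⟨v, hv⟩ := Finset.card_pos.1 hpos
    rw [mem_filter] at hv
    obtain ⟨s, hs⟩ := D.exists_mem v
    have hst : s ≠ t := by rintro rfl; exact hv.2.1 hs
    obtain ⟨c', hadj, hr⟩ := D.exists_adj_reachable hst
    refine ⟨c', hadj, hc.trans (Finset.card_le_card ?_)⟩
    intro u hu
    rw [mem_filter] at hu ⊢
    exact ⟨hu.1, hu.2.1, fun s' hs' =>
      hr.trans ((hv.2.2 s hs).symm.trans (hu.2.2 s' hs'))⟩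
  choose c hadj hc using hcon'
  -- A tree has fewer edges than nodes, so two nodes select the same edge, that is, they point at
  -- each other.
  have hcard : D.T.edgeFinset.card < (Finset.univ : Finset (Fin D.nodes)).card := by
    have := D.isTree.card_edgeFinset
    rw [Finset.card_univ]
    omega
  obtain ⟨t, -, t', -, hne, he⟩ := Finset.exists_ne_map_eq_of_card_lt_of_maps_to hcard
    (f := fun t => s(t, c t)) (fun t _ => by simpa using hadj t)
  have hswap : c t = t' ∧ c t' = t := by
    rcases Sym2.eq_iff.1 he with ⟨h, -⟩ | ⟨h1, h2⟩
    · exact absurd h hne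
    · exact ⟨h2, h1.symm⟩
  -- The common edge is a bridge. The two heavy components lie on different sides of it, so they
  -- hold disjoint sets of at least `m` vertices of `Z`, too many for `Z.card < 2 * m`.
  have hbr := (SimpleGraph.isAcyclic_iff_forall_adj_isBridge.1 D.isTree.isAcyclic) (hadj t)
  rw [SimpleGraph.isBridge_iff] at hbr
  have hle : D.T.deleteIncidenceSet t ≤ D.T.deleteEdges {s(t, c t)} := by
    intro x y h
    rw [SimpleGraph.deleteIncidenceSet_adj] at h
    rw [SimpleGraph.deleteEdges_adj]
    refine ⟨h.1, ?_⟩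
    rw [Set.mem_singleton_iff, Sym2.eq_iff]
    rintro (⟨h1, -⟩ | ⟨-, h2⟩)
    · exact h.2.1 h1
    · exact h.2.2 h2
  have hle' : D.T.deleteIncidenceSet t' ≤ D.T.deleteEdges {s(t, c t)} := by
    intro x y h
    rw [SimpleGraph.deleteIncidenceSet_adj] at h
    rw [SimpleGraph.deleteEdges_adj, hswap.1]
    refine ⟨h.1, ?_⟩
    rw [Set.mem_singleton_iff, Sym2.eq_iff]
    rintro (⟨-, h1⟩ | ⟨h2, -⟩)
    · exact h.2.2 h1
    · exact h.2.1 h2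
  have hdisj : Disjoint
      (Z.filter fun v => v ∉ D.χ t ∧
        ∀ s, v ∈ D.χ s → (D.T.deleteIncidenceSet t).Reachable (c t) s)
      (Z.filter fun v => v ∉ D.χ t' ∧
        ∀ s, v ∈ D.χ s → (D.T.deleteIncidenceSet t').Reachable (c t') s) := by
    rw [Finset.disjoint_left]
    intro v hv hv'
    rw [mem_filter] at hv hv'
    obtain ⟨s, hs⟩ := D.exists_mem v
    have h1 := (hv.2.2 s hs).mono hle
    have h2 := (hv'.2.2 s hs).mono hle'
    rw [hswap.2] at h2
    exact hbr (h2.trans h1.symm)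
  have := Finset.card_union_of_disjoint hdisj
  have h3 := Finset.card_le_card (Finset.union_subset
    (Finset.filter_subset (fun v => v ∉ D.χ t ∧
        ∀ s, v ∈ D.χ s → (D.T.deleteIncidenceSet t).Reachable (c t) s) Z)
    (Finset.filter_subset (fun v => v ∉ D.χ t' ∧
        ∀ s, v ∈ D.χ s → (D.T.deleteIncidenceSet t').Reachable (c t') s) Z))
  have := hc t
  have := hc t'
  omega

/-- A set of `3k + 4` vertices of a graph of `H`-treewidth at most `k` is mostly contained in a base
component with at most `k + 1` neighbours, or it can be separated in a balanced way by `k + 1`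
vertices. -/
theorem exists_separation {k : ℕ} (hw : D.width ≤ k) (Z : Finset V) (hZ : Z.card = 3 * k + 4) :
    (∃ C X : Finset V, H.mem (G.induce (C : Set V)) ∧ X.card ≤ k + 1 ∧ Disjoint C X ∧
      (∀ u ∈ C, ∀ w, G.Adj u w → w ∈ C ∪ X) ∧ (Z \ C).card ≤ k + 1) ∨
    (∃ C X M : Finset V, M ⊆ Z ∧ k + 2 ≤ M.card ∧ k + 2 ≤ (Z \ M).card ∧ X.card ≤ k + 1 ∧
      M ⊆ C ∪ X ∧ Disjoint (Z \ M) C ∧ ∀ u ∈ C, ∀ w, G.Adj u w → w ∈ C ∪ X) := by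
  classical
  -- Since 3k+4 < 2(2k+3), some node `t` leaves at most 2k+2 vertices of `Z` in each component. The
  -- separator will be `D.χ t \ D.L`.
  obtain ⟨t, ht⟩ := D.exists_light Z (2 * k + 3) (by omega)
  have hXcard : (D.χ t \ D.L).card ≤ k + 1 := by
    have : (D.χ t \ D.L).card - 1 ≤ k :=
      (Finset.le_sup (f := fun t => (D.χ t \ D.L).card - 1) (Finset.mem_univ t)).trans hw
    omega
  -- A vertex of `L` in the bag of `t` is in no other bag, so its neighbours are in this bag as
  -- well.
  have hbase : ∀ u ∈ D.χ t ∩ D.L, ∀ w, G.Adj u w → w ∈ D.χ t := by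
    intro u hu w huw
    rw [mem_inter] at hu
    obtain ⟨s, hs, hsw⟩ := D.edge u w huw
    obtain ⟨t₁, ht₁, -⟩ := D.leaf u hu.2
    have h1 := (ht₁ s).1 hs
    have h2 := (ht₁ t).1 hu.1
    rw [h2, ← h1]; exact hsw
  by_cases hbig : (Z \ (D.χ t ∩ D.L)).card ≤ k + 1
  · left
    refine ⟨D.χ t ∩ D.L, D.χ t \ D.L, D.base t, hXcard, ?_, ?_, hbig⟩
    · rw [Finset.disjoint_left]; intro a; simp only [mem_inter, mem_sdiff]; tauto
    · intro u hu w huw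
      have := hbase u hu w huw
      simp only [mem_union, mem_inter, mem_sdiff]; tauto
  right
  choose node hnode using D.exists_mem
  -- Off the separator, adjacent vertices have equal values of `f`: the base vertices at `t` form
  -- the fibre `none`, and the other vertices are sorted by the component of `T - t` that contains
  -- their nodes. Hence any union of fibres is closed up to the separator.
  let f : V → Option (D.T.deleteIncidenceSet t).ConnectedComponent := fun v =>
    if v ∈ D.χ t then none
    else some ((D.T.deleteIncidenceSet t).connectedComponentMk (node v))
  have hZL : (Z ∩ (D.χ t ∩ D.L)).card ≤ 2 * k + 2 := by
    have := Finset.card_sdiff_add_card_inter Z (D.χ t ∩ D.L)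
    omega
  have hfib : ∀ i, ((Z \ (D.χ t \ D.L)).filter fun v => f v = i).card ≤ 2 * k + 2 := by
    intro i
    cases i with
    | none =>
      refine le_trans (Finset.card_le_card ?_) hZL
      intro v hv
      simp only [mem_filter, mem_sdiff, f, ite_eq_left_iff, reduceCtorEq, imp_false, not_not] at hv
      simp only [mem_inter]; tauto
    | some K =>
      obtain ⟨c, rfl⟩ := K.exists_rep
      refine Nat.le_of_lt_succ (lt_of_le_of_lt (Finset.card_le_card ?_) (ht c))
      intro v hv
      rw [mem_filter] at hv ⊢
      have hvt : v ∉ D.χ t := by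
        intro h
        simp [f, h] at hv
      refine ⟨(mem_sdiff.1 hv.1).1, hvt, fun s hs => ?_⟩
      have h1 : (D.T.deleteIncidenceSet t).Reachable (node v) c := by
        have := hv.2
        simp only [f, hvt, if_false] at this
        exact SimpleGraph.ConnectedComponent.exact (Option.some.inj this)
      exact h1.symm.trans (D.reachable_of_mem hvt (hnode v) hs)
  have hXZ : (Z \ (D.χ t \ D.L)).card + (Z ∩ (D.χ t \ D.L)).card = 3 * k + 4 := by
    rw [← hZ]; exact Finset.card_sdiff_add_card_inter _ _
  obtain ⟨I, hI, hI'⟩ := Finset.exists_balanced_fibers (Z \ (D.χ t \ D.L)) f k (by omega) hfib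
  have hsum : ((Z \ (D.χ t \ D.L)).filter fun v => f v ∈ I).card +
      ((Z \ (D.χ t \ D.L)).filter fun v => f v ∉ I).card = (Z \ (D.χ t \ D.L)).card :=
    Finset.card_filter_add_card_filter_not _
  -- Vertices of `Z` in the separator may be counted on either side. `A` takes as many of them as
  -- `M` needs to reach k+2 elements, possibly none. There are enough, because the group outside `I`
  -- has at most 2k+2 of the 3k+4 vertices.
  obtain ⟨A, hA, hAc⟩ := Finset.exists_subset_card_eq (s := Z ∩ (D.χ t \ D.L))
    (n := k + 2 - ((Z \ (D.χ t \ D.L)).filter fun v => f v ∈ I).card) (by omega)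
  have hMcard : (((Z \ (D.χ t \ D.L)).filter fun v => f v ∈ I) ∪ A).card =
      ((Z \ (D.χ t \ D.L)).filter fun v => f v ∈ I).card + A.card := by
    refine Finset.card_union_of_disjoint (Finset.disjoint_left.2 fun a ha ha' => ?_)
    have := hA ha'
    simp only [mem_filter, mem_sdiff, mem_inter] at ha this
    tauto
  have hMsub : ((Z \ (D.χ t \ D.L)).filter fun v => f v ∈ I) ∪ A ⊆ Z := by
    intro a ha
    rcases mem_union.1 ha with h | h
    · exact (mem_sdiff.1 (mem_filter.1 h).1).1
    · exact (mem_inter.1 (hA h)).1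
  refine ⟨Finset.univ.filter fun v => v ∉ D.χ t \ D.L ∧ f v ∈ I, D.χ t \ D.L,
    ((Z \ (D.χ t \ D.L)).filter fun v => f v ∈ I) ∪ A, hMsub, by omega, ?_, hXcard, ?_, ?_, ?_⟩
  · rw [Finset.card_sdiff_of_subset hMsub]; omega
  · intro a ha
    rcases mem_union.1 ha with h | h
    · simp only [mem_filter, mem_sdiff] at h
      simp only [mem_union, mem_filter, mem_univ, true_and, mem_sdiff]; tauto
    · exact mem_union_right _ (mem_inter.1 (hA h)).2
  · rw [Finset.disjoint_left]
    intro a ha ha'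
    simp only [mem_union, mem_filter, mem_univ, true_and, mem_sdiff] at ha ha'
    tauto
  · intro u hu w huw
    simp only [mem_filter, mem_univ, true_and] at hu
    by_cases hwX : w ∈ D.χ t \ D.L
    · exact mem_union_right _ hwX
    refine mem_union_left _ ?_
    simp only [mem_filter, mem_univ, true_and]
    refine ⟨hwX, ?_⟩
    suffices f w = f u by rw [this]; exact hu.2
    by_cases hut : u ∈ D.χ t
    · have hwt := hbase u (by simp only [mem_sdiff, mem_inter] at hu ⊢; tauto) w huw
      simp [f, hut, hwt]
    · by_cases hwt : w ∈ D.χ t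
      · exact absurd (hbase w (by simp only [mem_sdiff, mem_inter] at hwX ⊢; tauto) u huw.symm) hut
      · simp only [f, hut, hwt, if_false, Option.some.injEq]
        obtain ⟨s, hs, hs'⟩ := D.edge u w huw
        exact SimpleGraph.ConnectedComponent.sound
          ((D.reachable_of_mem hwt (hnode w) hs').trans (D.reachable_of_mem hut hs (hnode u)))

end TreeHDecomposition

/-! ### Vertex-disjoint paths as bipartite matchings

Vertices are numbers below `n`. The role of a vertex is `0` (forbidden), `1` (source), `2` (inner
vertex) or `3` (sink). A system of disjoint paths is a matching between a left copy of the sources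
and inner vertices and a right copy of the inner vertices and sinks; an inner vertex that is on no
path is matched to itself. -/

namespace Linkage

open Finset

/-- A cut of fewer than `cap` vertices with source side `C`. -/
structure IsCut (adj : ℕ → ℕ → Prop) (n : ℕ) (role : ℕ → ℕ) (C Y : Finset ℕ) (cap : ℕ) : Prop where
  card : Y.card < cap
  subC : ∀ v ∈ C, v < n ∧ (role v = 1 ∨ role v = 2)
  subY : ∀ v ∈ Y, v < n ∧ role v ≠ 0
  disj : ∀ v ∈ C, v ∉ Y
  src : ∀ v < n, role v = 1 → v ∈ C ∨ v ∈ Y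
  closed : ∀ u ∈ C, ∀ w < n, adj u w → role w ≠ 0 → w ∈ C ∨ w ∈ Y

/-- The set `E` is linked to the sources: every separator has to be large. -/
def IsLinked (adj : ℕ → ℕ → Prop) (n : ℕ) (role : ℕ → ℕ) (E : Finset ℕ) : Prop :=
  ∀ C X : Finset ℕ, (∀ u ∈ C, ∀ w < n, adj u w → w ∈ C ∨ w ∈ X) →
    (∀ v < n, role v = 1 → v ∈ C ∨ v ∈ X) → (E \ C).card ≤ X.card

/-- `mR` is a matching if the right vertex `w` is ignored: it maps a right vertex to its left
partner, or to `n`. All inner vertices and the used sources are matched. -/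
structure Matching (adj : ℕ → ℕ → Prop) (n : ℕ) (role used mR : ℕ → ℕ) (w : ℕ) : Prop where
  inner : ∀ x < n, role x = 2 → x ≠ w → mR x < n
  none : ∀ x < n, 2 ≤ role x → x ≠ w → ¬ mR x < n → mR x = n
  edge : ∀ x < n, 2 ≤ role x → x ≠ w → mR x < n → mR x = x ∨ adj (mR x) x
  left : ∀ x < n, 2 ≤ role x → x ≠ w → mR x < n →
    role (mR x) = 2 ∨ (role (mR x) = 1 ∧ used (mR x) = 1)
  inj : ∀ x < n, ∀ y < n, 2 ≤ role x → 2 ≤ role y → x ≠ w → y ≠ w → mR x < n → mR x = mR y → x = y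
  surj : ∀ u < n, (role u = 2 ∨ (role u = 1 ∧ used u = 1)) →
    ∃ x < n, 2 ≤ role x ∧ x ≠ w ∧ mR x = u

/-- The number of used sources. -/
def value (n : ℕ) (role used : ℕ → ℕ) : ℕ :=
  ((range n).filter fun u => role u = 1 ∧ used u = 1).card

/-- The matched sinks. -/
def ends (n : ℕ) (role mR : ℕ → ℕ) : Finset ℕ :=
  (range n).filter fun w => role w = 3 ∧ mR w < n

variable {adj : ℕ → ℕ → Prop} {n : ℕ} {role used mR : ℕ → ℕ}

/-- The matching is a bijection between the matched right and the matched left vertices. Both sides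
contain all inner vertices; cancelling these leaves the matched sinks and the used sources. -/
theorem Matching.card_ends (h : Matching adj n role used mR n) (hrole : ∀ v < n, role v ≤ 3) :
    (ends n role mR).card = value n role used := by
  have h1 : ((range n).filter fun w => 2 ≤ role w ∧ mR w < n).card =
      ((range n).filter fun u => role u = 2 ∨ (role u = 1 ∧ used u = 1)).card := by
    refine Finset.card_bij (fun w _ => mR w) ?_ ?_ ?_
    · intro w hw
      simp only [mem_filter, mem_range] at hw ⊢
      exact ⟨hw.2.2, h.left w hw.1 hw.2.1 hw.1.ne hw.2.2⟩
    · intro x hx y hy hxy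
      simp only [mem_filter, mem_range] at hx hy
      exact h.inj x hx.1 y hy.1 hx.2.1 hy.2.1 hx.1.ne hy.1.ne hx.2.2 hxy
    · intro u hu
      simp only [mem_filter, mem_range] at hu
      obtain ⟨x, hx, hr, -, rfl⟩ := h.surj u hu.1 hu.2
      exact ⟨x, by simp only [mem_filter, mem_range]; exact ⟨hx, hr, hu.1⟩, rfl⟩
  have h2 : ((range n).filter fun w => 2 ≤ role w ∧ mR w < n) =
      ((range n).filter fun w => role w = 2) ∪ ends n role mR := by
    ext w
    simp only [mem_filter, mem_range, mem_union, ends]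
    constructor
    · rintro ⟨h1, h2, h3⟩
      have := hrole w h1
      have : role w = 2 ∨ role w = 3 := by omega
      tauto
    · rintro (⟨h1, h2⟩ | ⟨h1, h2, h3⟩)
      · exact ⟨h1, by omega, h.inner w h1 h2 h1.ne⟩
      · exact ⟨h1, by omega, h3⟩
  have h3 : ((range n).filter fun u => role u = 2 ∨ (role u = 1 ∧ used u = 1)) =
      ((range n).filter fun w => role w = 2) ∪
        ((range n).filter fun u => role u = 1 ∧ used u = 1) := by
    ext w; simp only [mem_filter, mem_range, mem_union]; tauto
  rw [h2, h3, card_union_of_disjoint, card_union_of_disjoint] at h1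
  · exact Nat.add_left_cancel h1
  · rw [Finset.disjoint_left]; intro a; simp only [mem_filter]; omega
  · rw [Finset.disjoint_left]; intro a; simp only [mem_filter, ends]; omega

/-- The easy half of Menger's theorem as a count over the inner vertices and matched sinks outside
`C`. If the partner of such a right vertex lies in `C`, then the vertex itself is in `X`. Otherwise
the partner is an inner vertex outside `C`, or a source outside `C` and hence in `X`. Partners are
distinct, so the inner vertices outside `C` cancel; splitting `X` by roles prevents double counting.
-/
theorem Matching.isLinked (h : Matching adj n role used mR n) :
    IsLinked adj n role (ends n role mR) := by
  classical
  intro C X hC hsrc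
  set I := (range n).filter fun w => role w = 2 with hI
  have hO : ((I ∪ ends n role mR) \ C).card = (I \ C).card + (ends n role mR \ C).card := by
    rw [Finset.union_sdiff_distrib, card_union_of_disjoint]
    refine (Finset.disjoint_left.2 ?_)
    intro a; simp only [hI, ends, mem_sdiff, mem_filter]; omega
  have hmem : ∀ w ∈ (I ∪ ends n role mR) \ C, w < n ∧ 2 ≤ role w ∧ mR w < n ∧ w ∉ C := by
    intro w hw
    simp only [hI, ends, mem_sdiff, mem_filter, mem_union, mem_range] at hw
    rcases hw.1 with h1 | h1
    · exact ⟨h1.1, by omega, h.inner w h1.1 h1.2 h1.1.ne, hw.2⟩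
    · exact ⟨h1.1, by omega, h1.2.2, hw.2⟩
  have hsplit := Finset.card_filter_add_card_filter_not (s := (I ∪ ends n role mR) \ C)
    (fun w => mR w ∈ C)
  have h1 : (((I ∪ ends n role mR) \ C).filter fun w => mR w ∈ C).card ≤
      (X.filter fun w => 2 ≤ role w).card := by
    refine Finset.card_le_card fun w hw => ?_
    rw [mem_filter] at hw
    obtain ⟨hwn, hr, hm, hwC⟩ := hmem w hw.1
    rw [mem_filter]
    refine ⟨?_, hr⟩
    rcases h.edge w hwn hr hwn.ne hm with he | he
    · rw [he] at hw; exact absurd hw.2 hwC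
    · exact (hC _ hw.2 w hwn he).resolve_left hwC
  have h2 : (((I ∪ ends n role mR) \ C).filter fun w => ¬ mR w ∈ C).card ≤
      ((I \ C) ∪ (X.filter fun w => ¬ 2 ≤ role w)).card := by
    refine Finset.card_le_card_of_injOn mR ?_ ?_
    · intro w hw
      rw [mem_coe, mem_filter] at hw
      obtain ⟨hwn, hr, hm, hwC⟩ := hmem w hw.1
      simp only [hI, mem_coe, mem_union, mem_sdiff, mem_filter, mem_range]
      rcases h.left w hwn hr hwn.ne hm with h3 | ⟨h3, -⟩
      · left; exact ⟨⟨hm, h3⟩, hw.2⟩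
      · right; exact ⟨(hsrc _ hm h3).resolve_left hw.2, by omega⟩
    · intro x hx y hy hxy
      rw [mem_coe, mem_filter] at hx hy
      obtain ⟨hxn, hxr, hxm, -⟩ := hmem x hx.1
      obtain ⟨hyn, hyr, hym, -⟩ := hmem y hy.1
      exact h.inj x hxn y hyn hxr hyr hxn.ne hyn.ne hxm hxy
  have h3 := Finset.card_union_le (I \ C) (X.filter fun w => ¬ 2 ≤ role w)
  have h4 := Finset.card_filter_add_card_filter_not (s := X) (fun w => 2 ≤ role w)
  omega

/-- The data of a breadth-first search for an augmenting path. The queue consists of the visited left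
vertices; `via i` is the right vertex whose partner is the `i`-th entry, and `pr w` is the position
of the left vertex from which the right vertex `w` was reached. -/
structure Search (adj : ℕ → ℕ → Prop) (n : ℕ) (role used mR VR VL pr via queue : ℕ → ℕ)
    (qt found : ℕ) : Prop where
  queue_lt : ∀ i < qt, queue i < n ∧ VL (queue i) = 1
  queue_inj : ∀ i < qt, ∀ j < qt, queue i = queue j → i = j
  queue_surj : ∀ u < n, VL u = 1 → ∃ i < qt, queue i = u
  src : ∀ u < n, role u = 1 → used u ≠ 1 → VL u = 1
  entry : ∀ i < qt, (via i = n ∧ role (queue i) = 1 ∧ used (queue i) ≠ 1) ∨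
    (via i < n ∧ VR (via i) = 1 ∧ mR (via i) = queue i ∧ pr (via i) < i)
  right : ∀ w < n, VR w = 1 → 2 ≤ role w ∧ pr w < qt ∧ (w = queue (pr w) ∨ adj (queue (pr w)) w)
  push : ∀ w < n, VR w = 1 → mR w < n → VL (mR w) = 1
  found : (found = n ∧ ∀ w < n, VR w = 1 → mR w < n) ∨ (found < n ∧ VR found = 1 ∧ mR found = n)

variable {VR VL pr via queue : ℕ → ℕ} {qt found : ℕ}

theorem Search.qt_le (h : Search adj n role used mR VR VL pr via queue qt found) : qt ≤ n := by
  have := Finset.card_le_card_of_injOn (s := range qt) (t := range n) queue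
    (fun i hi => by simpa using (h.queue_lt i (by simpa using hi)).1)
    (fun i hi j hj hij => h.queue_inj i (by simpa using hi) j (by simpa using hj) hij)
  simpa using this

theorem Search.visit_found (h : Search adj n role used mR VR VL pr via queue qt found) {p w : ℕ}
    (hp : p < qt) (hw : w < n) (hr : 2 ≤ role w) (hadj : w = queue p ∨ adj (queue p) w)
    (hv : VR w ≠ 1) (hm : mR w = n) :
    Search adj n role used mR (Function.update VR w 1) VL (Function.update pr w p) via queue qt
      w := by
  refine ⟨h.queue_lt, h.queue_inj, h.queue_surj, h.src, ?_, ?_, ?_, ?_⟩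
  · intro i hi
    rcases h.entry i hi with h1 | ⟨h1, h2, h3, h4⟩
    · exact Or.inl h1
    · have : via i ≠ w := by rintro rfl; exact hv h2
      exact Or.inr ⟨h1, by simp [Function.update_of_ne this, h2], h3,
        by simp [Function.update_of_ne this, h4]⟩
  · intro x hx hx1
    by_cases hxw : x = w
    · subst hxw; simp [hr, hp, hadj]
    · rw [Function.update_of_ne hxw] at hx1 ⊢
      exact h.right x hx hx1
  · intro x hx hx1 hxm
    by_cases hxw : x = w
    · subst hxw; omega
    · rw [Function.update_of_ne hxw] at hx1
      exact h.push x hx hx1 hxm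
  · right; simp [hw, hm]

theorem Search.visit_push (h : Search adj n role used mR VR VL pr via queue qt found)
    (hM : Matching adj n role used mR n) {p w : ℕ}
    (hp : p < qt) (hw : w < n) (hr : 2 ≤ role w) (hadj : w = queue p ∨ adj (queue p) w)
    (hv : VR w ≠ 1) (hm : mR w < n) :
    Search adj n role used mR (Function.update VR w 1) (Function.update VL (mR w) 1)
      (Function.update pr w p) (Function.update via qt w) (Function.update queue qt (mR w)) (qt + 1)
      found := by
  -- The partner of `w` is new in the queue: the starting entries are unused sources and have no
  -- partner, and any other entry is the partner of a right vertex visited before, which `w` is not.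
  have hnew : ∀ i < qt, queue i ≠ mR w := by
    intro i hi he
    rcases h.entry i hi with ⟨-, h2, h3⟩ | ⟨h1, h2, h3, -⟩
    · rw [he] at h2 h3
      rcases hM.left w hw hr hw.ne hm with h4 | h4
      · omega
      · exact h3 h4.2
    · have hr' := (h.right _ h1 h2).1
      have := hM.inj _ h1 w hw hr' hr h1.ne hw.ne (by rw [h3, he]; exact hm) (h3.trans he)
      rw [this] at h2; exact hv h2
  refine ⟨?_, ?_, ?_, ?_, ?_, ?_, ?_, ?_⟩
  · intro i hi
    by_cases hiq : i = qt
    · subst hiq; simp [hm]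
    · have hi' : i < qt := by omega
      rw [Function.update_of_ne hiq, Function.update_of_ne (hnew i hi')]
      exact h.queue_lt i hi'
  · intro i hi j hj hij
    by_cases hiq : i = qt <;> by_cases hjq : j = qt
    · omega
    · rw [hiq, Function.update_self, Function.update_of_ne hjq] at hij
      exact absurd hij.symm (hnew j (by omega))
    · rw [hjq, Function.update_self, Function.update_of_ne hiq] at hij
      exact absurd hij (hnew i (by omega))
    · rw [Function.update_of_ne hiq, Function.update_of_ne hjq] at hij
      exact h.queue_inj i (by omega) j (by omega) hij
  · intro u hu hu1
    by_cases hum : u = mR w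
    · exact ⟨qt, by omega, by simp [hum]⟩
    · rw [Function.update_of_ne hum] at hu1
      obtain ⟨i, hi, he⟩ := h.queue_surj u hu hu1
      exact ⟨i, by omega, by rw [Function.update_of_ne hi.ne, he]⟩
  · intro u hu h1 h2
    by_cases hum : u = mR w
    · simp [hum]
    · rw [Function.update_of_ne hum]; exact h.src u hu h1 h2
  · intro i hi
    by_cases hiq : i = qt
    · subst hiq; right; simp [hw, hp]
    · rw [Function.update_of_ne hiq, Function.update_of_ne hiq]
      rcases h.entry i (by omega) with h1 | ⟨h1, h2, h3, h4⟩
      · exact Or.inl h1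
      · have : via i ≠ w := by rintro h5; rw [h5] at h2; exact hv h2
        exact Or.inr ⟨h1, by simp [Function.update_of_ne this, h2], h3,
          by simp [Function.update_of_ne this, h4]⟩
  · intro x hx hx1
    by_cases hxw : x = w
    · subst hxw
      simp only [Function.update_self, Function.update_of_ne hp.ne]
      exact ⟨hr, by omega, hadj⟩
    · rw [Function.update_of_ne hxw] at hx1 ⊢
      obtain ⟨h1, h2, h3⟩ := h.right x hx hx1
      rw [Function.update_of_ne h2.ne]
      exact ⟨h1, by omega, h3⟩
  · intro x hx hx1 hxm
    by_cases hxm' : mR x = mR w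
    · simp [hxm']
    · rw [Function.update_of_ne hxm']
      have hxw : x ≠ w := by rintro rfl; exact hxm' rfl
      rw [Function.update_of_ne hxw] at hx1
      exact h.push x hx hx1 hxm
  · rcases h.found with ⟨h1, h2⟩ | ⟨h1, h2, h3⟩
    · left
      refine ⟨h1, fun x hx hx1 => ?_⟩
      by_cases hxw : x = w
      · rw [hxw]; exact hm
      · rw [Function.update_of_ne hxw] at hx1; exact h2 x hx hx1
    · right
      refine ⟨h1, ?_, h3⟩
      by_cases hxw : found = w
      · rw [hxw]; simp
      · rw [Function.update_of_ne hxw]; exact h2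

/-- If a complete search finds no augmenting path, then it yields a cut. -/
theorem Search.isCut (h : Search adj n role used mR VR VL pr via queue qt n)
    (hM : Matching adj n role used mR n)
    (hclosed : ∀ i < qt, ∀ w < n, 2 ≤ role w → (w = queue i ∨ adj (queue i) w) → VR w = 1)
    {cap : ℕ} (hcap : value n role used < cap) :
    IsCut adj n role ((range n).filter fun v => VL v = 1)
      ((range n).filter fun v => (VR v = 1 ∨ role v = 1) ∧ VL v ≠ 1) cap := by
  have hall : ∀ w < n, VR w = 1 → mR w < n := by
    rcases h.found with ⟨-, h2⟩ | ⟨h1, -⟩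
    · exact h2
    · omega
  have hVL : ∀ u < n, VL u = 1 → (role u = 1 ∧ used u ≠ 1) ∨
      (∃ w < n, VR w = 1 ∧ mR w = u) := by
    intro u hu hu1
    obtain ⟨i, hi, rfl⟩ := h.queue_surj u hu hu1
    rcases h.entry i hi with h1 | ⟨h1, h2, h3, -⟩
    · exact Or.inl h1.2
    · exact Or.inr ⟨_, h1, h2, h3⟩
  have hrole : ∀ u < n, VL u = 1 → role u = 1 ∨ role u = 2 := by
    intro u hu hu1
    rcases hVL u hu hu1 with h1 | ⟨w, hw, h1, rfl⟩
    · exact Or.inl h1.1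
    · have := hM.left w hw (h.right w hw h1).1 hw.ne hu
      tauto
  refine ⟨?_, ?_, ?_, ?_, ?_, ?_⟩
  -- König's count: the cut has as many vertices as there are used sources. The matching maps the
  -- visited right vertices bijectively to the visited left vertices other than unused sources
  -- (`e1`). Vertices with both copies visited are the visited inner vertices and cancel (`e2`,
  -- `e3`), so those visited only on the right are as many as the visited used sources. The rest of
  -- the cut consists of the unvisited used sources (`e4`).
  · refine lt_of_le_of_lt (le_of_eq ?_) hcap
    have e1 : ((range n).filter fun v => VR v = 1).card =
        ((range n).filter fun u => VL u = 1 ∧ ¬ (role u = 1 ∧ used u ≠ 1)).card := by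
      refine Finset.card_bij (fun w _ => mR w) ?_ ?_ ?_
      · intro w hw
        simp only [mem_filter, mem_range] at hw ⊢
        have hm := hall w hw.1 hw.2
        refine ⟨hm, h.push w hw.1 hw.2 hm, fun h2 => ?_⟩
        rcases hM.left w hw.1 (h.right w hw.1 hw.2).1 hw.1.ne hm with h3 | h3
        · omega
        · exact h2.2 h3.2
      · intro x hx y hy hxy
        simp only [mem_filter, mem_range] at hx hy
        exact hM.inj x hx.1 y hy.1 (h.right x hx.1 hx.2).1 (h.right y hy.1 hy.2).1 hx.1.ne hy.1.ne
          (hall x hx.1 hx.2) hxy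
      · intro u hu
        simp only [mem_filter, mem_range] at hu
        rcases hVL u hu.1 hu.2.1 with h1 | ⟨w, hw, h1, h2⟩
        · exact absurd h1 hu.2.2
        · exact ⟨w, by simp [hw, h1], h2⟩
    -- A left vertex is joined to its own right copy, so a visited inner vertex has both copies
    -- visited.
    have hself : ∀ u < n, VL u = 1 → role u = 2 → VR u = 1 := by
      intro u hu hu1 hr
      obtain ⟨i, hi, rfl⟩ := h.queue_surj u hu hu1
      exact hclosed i hi _ hu hr.ge (Or.inl rfl)
    have e2 : ((range n).filter fun v => VR v = 1) =
        ((range n).filter fun v => VR v = 1 ∧ VL v ≠ 1) ∪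
          ((range n).filter fun v => VL v = 1 ∧ role v = 2) := by
      ext v
      simp only [mem_filter, mem_range, mem_union]
      constructor
      · rintro ⟨h1, h2⟩
        by_cases h3 : VL v = 1
        · have := hrole v h1 h3
          have := (h.right v h1 h2).1
          right; exact ⟨h1, h3, by omega⟩
        · exact Or.inl ⟨h1, h2, h3⟩
      · rintro (h1 | ⟨h1, h2, h3⟩)
        · exact ⟨h1.1, h1.2.1⟩
        · exact ⟨h1, hself v h1 h2 h3⟩
    have e3 : ((range n).filter fun u => VL u = 1 ∧ ¬ (role u = 1 ∧ used u ≠ 1)) =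
        ((range n).filter fun v => VL v = 1 ∧ role v = 2) ∪
          ((range n).filter fun v => VL v = 1 ∧ role v = 1 ∧ used v = 1) := by
      ext v
      simp only [mem_filter, mem_range, mem_union]
      constructor
      · rintro ⟨h1, h2, h3⟩
        rcases hrole v h1 h2 with h4 | h4
        · right; tauto
        · left; exact ⟨h1, h2, h4⟩
      · rintro (⟨h1, h2, h3⟩ | ⟨h1, h2, h3⟩)
        · exact ⟨h1, h2, by omega⟩
        · exact ⟨h1, h2, by tauto⟩
    have e4 : ((range n).filter fun v => (VR v = 1 ∨ role v = 1) ∧ VL v ≠ 1) =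
        ((range n).filter fun v => VR v = 1 ∧ VL v ≠ 1) ∪
          ((range n).filter fun v => VL v ≠ 1 ∧ role v = 1 ∧ used v = 1) := by
      ext v
      simp only [mem_filter, mem_range, mem_union]
      constructor
      · rintro ⟨h1, h2 | h2, h3⟩
        · exact Or.inl ⟨h1, h2, h3⟩
        · right
          refine ⟨h1, h3, h2, ?_⟩
          by_contra h4
          exact h3 (h.src v h1 h2 h4)
      · tauto
    have e5 : ((range n).filter fun u => role u = 1 ∧ used u = 1) =
        ((range n).filter fun v => VL v = 1 ∧ role v = 1 ∧ used v = 1) ∪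
          ((range n).filter fun v => VL v ≠ 1 ∧ role v = 1 ∧ used v = 1) := by
      ext v; simp only [mem_filter, mem_range, mem_union]; tauto
    rw [value, e4, e5, card_union_of_disjoint, card_union_of_disjoint]
    · rw [e2, e3, card_union_of_disjoint, card_union_of_disjoint] at e1
      · omega
      · rw [Finset.disjoint_left]; intro a; simp only [mem_filter]; omega
      · rw [Finset.disjoint_left]; intro a; simp only [mem_filter]; tauto
    · rw [Finset.disjoint_left]; intro a; simp only [mem_filter]; tauto
    · rw [Finset.disjoint_left]; intro a; simp only [mem_filter]
      rintro ⟨h1, h2, -⟩ ⟨-, -, h3, -⟩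
      have := (h.right a (by simpa using h1) h2).1
      omega
  · intro v hv
    simp only [mem_filter, mem_range] at hv
    exact ⟨hv.1, hrole v hv.1 hv.2⟩
  · intro v hv
    simp only [mem_filter, mem_range] at hv
    refine ⟨hv.1, ?_⟩
    rcases hv.2.1 with h1 | h1
    · have := (h.right v hv.1 h1).1; omega
    · omega
  · intro v hv hv'
    simp only [mem_filter, mem_range] at hv hv'
    exact hv'.2.2 hv.2
  · intro v hv hv1
    simp only [mem_filter, mem_range]
    tauto
  · intro u hu w hw hadj hr
    simp only [mem_filter, mem_range] at hu ⊢
    obtain ⟨i, hi, rfl⟩ := h.queue_surj u hu.1 hu.2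
    by_cases h1 : role w = 1
    · tauto
    · have := hclosed i hi w hw (by omega) (Or.inr hadj)
      tauto

/-- One step of the augmentation: the right vertex `w` is matched to the left vertex from which it
was reached. -/
theorem Matching.augment_step (hM : Matching adj n role used mR w) (hw : w < n) (hr : 2 ≤ role w)
    {i w' : ℕ} (hun : queue i < n) (hrole : role (queue i) = 2 ∨ (role (queue i) = 1 ∧ used (queue i) = 1))
    (hadj : w = queue i ∨ adj (queue i) w) (hw' : w' < n) (hr' : 2 ≤ role w') (hne : w' ≠ w)
    (hm : mR w' = queue i) :
    Matching adj n role used (Function.update mR w (queue i)) w' := by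
  refine ⟨?_, ?_, ?_, ?_, ?_, ?_⟩
  · intro x hx h1 h2
    by_cases hxw : x = w
    · subst hxw; simpa using hun
    · rw [Function.update_of_ne hxw]; exact hM.inner x hx h1 hxw
  · intro x hx h1 h2 h3
    by_cases hxw : x = w
    · subst hxw; simp at h3; omega
    · rw [Function.update_of_ne hxw] at h3 ⊢; exact hM.none x hx h1 hxw h3
  · intro x hx h1 h2 h3
    by_cases hxw : x = w
    · subst hxw
      simp only [Function.update_self]
      rcases hadj with h | h
      · exact Or.inl h.symm
      · exact Or.inr h
    · rw [Function.update_of_ne hxw] at h3 ⊢; exact hM.edge x hx h1 hxw h3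
  · intro x hx h1 h2 h3
    by_cases hxw : x = w
    · subst hxw; simpa using hrole
    · rw [Function.update_of_ne hxw] at h3 ⊢; exact hM.left x hx h1 hxw h3
  · intro x hx y hy h1 h2 h3 h4 h5 h6
    by_cases hxw : x = w <;> by_cases hyw : y = w
    · omega
    · rw [hxw, Function.update_self, Function.update_of_ne hyw] at h6
      exact absurd (hM.inj y hy w' hw' h2 hr' hyw hne (by omega) (by omega)) h4
    · rw [hyw, Function.update_self, Function.update_of_ne hxw] at h6
      exact absurd (hM.inj x hx w' hw' h1 hr' hxw hne (by omega) (by omega)) h3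
    · rw [Function.update_of_ne hxw] at h5 h6
      rw [Function.update_of_ne hyw] at h6
      exact hM.inj x hx y hy h1 h2 hxw hyw h5 h6
  · intro u hu h1
    obtain ⟨x, hx, h2, h3, h4⟩ := hM.surj u hu h1
    by_cases hxw' : x = w'
    · refine ⟨w, hw, hr, hne.symm, ?_⟩
      rw [Function.update_self, ← hm, ← hxw', h4]
    · exact ⟨x, hx, h2, hxw', by rw [Function.update_of_ne h3, h4]⟩

/-- The last step of the augmentation, which uses a new source. -/
theorem Matching.augment_last (hM : Matching adj n role used mR w) (hw : w < n) (hr : 2 ≤ role w)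
    {u : ℕ} (hun : u < n) (hrole : role u = 1) (hused : used u ≠ 1) (hadj : w = u ∨ adj u w) :
    Matching adj n role (Function.update used u 1) (Function.update mR w u) n := by
  -- An unused source has no partner yet, so the new pair does not spoil injectivity.
  have hnu : ∀ x < n, 2 ≤ role x → x ≠ w → mR x < n → mR x ≠ u := by
    rintro x hx h1 h2 h3 rfl
    rcases hM.left x hx h1 h2 h3 with h | h
    · omega
    · exact hused h.2
  refine ⟨?_, ?_, ?_, ?_, ?_, ?_⟩
  · intro x hx h1 h2
    by_cases hxw : x = w
    · subst hxw; simpa using hun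
    · rw [Function.update_of_ne hxw]; exact hM.inner x hx h1 hxw
  · intro x hx h1 h2 h3
    by_cases hxw : x = w
    · subst hxw; simp at h3; omega
    · rw [Function.update_of_ne hxw] at h3 ⊢; exact hM.none x hx h1 hxw h3
  · intro x hx h1 h2 h3
    by_cases hxw : x = w
    · subst hxw
      simp only [Function.update_self]
      rcases hadj with h | h
      · exact Or.inl h.symm
      · exact Or.inr h
    · rw [Function.update_of_ne hxw] at h3 ⊢; exact hM.edge x hx h1 hxw h3
  · intro x hx h1 h2 h3
    by_cases hxw : x = w
    · subst hxw; simp [hrole]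
    · rw [Function.update_of_ne hxw] at h3 ⊢
      rw [Function.update_of_ne (hnu x hx h1 hxw h3)]
      exact hM.left x hx h1 hxw h3
  · intro x hx y hy h1 h2 h3 h4 h5 h6
    by_cases hxw : x = w <;> by_cases hyw : y = w
    · omega
    · rw [hxw, Function.update_self, Function.update_of_ne hyw] at h6
      exact absurd h6.symm (hnu y hy h2 hyw (by omega))
    · rw [hyw, Function.update_self, Function.update_of_ne hxw] at h6
      exact absurd h6 (hnu x hx h1 hxw (by omega))
    · rw [Function.update_of_ne hxw] at h5 h6
      rw [Function.update_of_ne hyw] at h6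
      exact hM.inj x hx y hy h1 h2 hxw hyw h5 h6
  · intro v hv h1
    by_cases hvu : v = u
    · exact ⟨w, hw, hr, hw.ne, by simp [hvu]⟩
    · rw [Function.update_of_ne hvu] at h1
      obtain ⟨x, hx, h2, h3, h4⟩ := hM.surj v hv h1
      exact ⟨x, hx, h2, hx.ne, by rw [Function.update_of_ne h3, h4]⟩

theorem value_update {u : ℕ} (hu : u < n) (hrole : role u = 1) (hused : used u ≠ 1) :
    value n role (Function.update used u 1) = value n role used + 1 := by
  rw [value, value, ← Finset.card_insert_of_notMem (a := u)]
  · congr 1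
    ext x
    simp only [mem_filter, mem_range, mem_insert]
    by_cases hx : x = u
    · subst hx; simp [hu, hrole]
    · rw [Function.update_of_ne hx]; tauto
  · simp [hused]

end Linkage

/-! ### Graphs on an initial segment of the natural numbers -/

open Finset

/-- The adjacency of `G` as a relation between natural numbers. -/
def SimpleGraph.adjNat {n : ℕ} (G : SimpleGraph (Fin n)) (u w : ℕ) : Prop :=
  ∃ (hu : u < n) (hw : w < n), G.Adj ⟨u, hu⟩ ⟨w, hw⟩

theorem SimpleGraph.adjNat_symm {n : ℕ} {G : SimpleGraph (Fin n)} {u w : ℕ} (h : G.adjNat u w) :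
    G.adjNat w u :=
  ⟨h.2.1, h.1, h.2.2.symm⟩

namespace GraphClass

variable {H : GraphClass} {n : ℕ} {G : SimpleGraph (Fin n)}

/-- The set `S` of numbers induces a member of the class in `G`. -/
def MemNat (H : GraphClass) (G : SimpleGraph (Fin n)) (S : Finset ℕ) : Prop :=
  H.mem (G.induce {v : Fin n | (v : ℕ) ∈ S})

theorem MemNat.mono (hH : H.Hereditary) {S S' : Finset ℕ} (hS : ∀ v ∈ S, v < n → v ∈ S')
    (h : H.MemNat G S') : H.MemNat G S :=
  hH.mem_induce_mono (fun v hv => hS _ hv v.2) h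

theorem MemNat.union (hH : H.Hereditary) (hU : H.UnionClosed) {S A B : Finset ℕ}
    (hS : ∀ v ∈ S, v < n → v ∈ A ∨ v ∈ B) (hd : ∀ v ∈ A, v ∉ B)
    (hadj : ∀ u ∈ A, ∀ w ∈ B, ¬ G.adjNat u w) (hA : H.MemNat G A) (hB : H.MemNat G B) :
    H.MemNat G S := by
  refine hH.mem_induce_mono (S' := {v : Fin n | (v : ℕ) ∈ A} ∪ {v : Fin n | (v : ℕ) ∈ B}) ?_ ?_
  · intro v hv; exact hS _ hv v.2
  · refine hU.mem_induce_union ?_ ?_ hA hB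
    · rw [Set.disjoint_left]; intro v hv hv'; exact hd _ hv hv'
    · intro u hu w hw h; exact hadj u hu w hw ⟨u.2, w.2, h⟩

theorem memNat_empty (hH : H.Hereditary) (hne : ∃ (V : Type) (_ : Finite V) (G : SimpleGraph V),
    H.mem G) : H.MemNat G ∅ := by
  obtain ⟨V, _, G', h⟩ := hne
  refine H.mem_of_iso _ _ ⟨?_⟩ (hH V G' h ∅)
  exact ⟨⟨fun x => x.2.elim, fun x => by simpa using x.2, fun x => x.2.elim,
    fun x => by simpa using x.2⟩, fun {x} => x.2.elim⟩

end GraphClass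

/-! ### Certificates that the width exceeds the parameter -/

/-- The roles for the search of a balanced separator. -/
def balancedRole (S Z M : Finset ℕ) (v : ℕ) : ℕ :=
  if v ∈ S then 2 else if v ∈ Z then (if v ∈ M then 1 else 3) else 0

/-- The roles for the search of a base component. -/
def baseRole (S Q Z M : Finset ℕ) (v : ℕ) : ℕ :=
  if v ∈ S then (if v ∈ Q then 2 else 3) else if v ∈ Z then (if v ∈ M then 1 else 0) else 0

variable {H : GraphClass} {n : ℕ} {G : SimpleGraph (Fin n)}

/-- For the part `M` of `Z`, there is neither a balanced separator nor a base component nor an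
improvement of `Q`. -/
structure PartFails (H : GraphClass) (G : SimpleGraph (Fin n)) (k : ℕ) (S Q Z M : Finset ℕ) :
    Prop where
  balanced : k + 2 ≤ (Z \ M).card → k + 2 ≤ M.card → ∃ E : Finset ℕ, E.card = k + 2 ∧
    (∀ v ∈ E, v < n ∧ balancedRole S Z M v = 3) ∧
    Linkage.IsLinked G.adjNat n (balancedRole S Z M) E
  base : (Z \ M).card ≤ k + 1 → ∃ E : Finset ℕ, E.card = 2 * k + 3 ∧
    (∀ v ∈ E, v < n ∧ baseRole S Q Z M v = 3) ∧
    Linkage.IsLinked G.adjNat n (baseRole S Q Z M) E ∧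
    ∀ D : Finset ℕ, H.MemNat G (((Q ∩ S) ∪ E) \ D) → 2 * k + 3 ≤ D.card

/-- A decomposition of width at most `k` has, by `TreeHDecomposition.exists_separation`, a
separation that one of the parts should have revealed. If it comes from a base component `C`, this
part is `Z ∩ C`; if it is balanced, the part is the set `M` of the separation. The linkage of `E` is
then tested against this very separation. -/
theorem lt_width_of_partFails (hH : H.Hereditary) (hU : H.UnionClosed) {k : ℕ}
    {S Q Z : Finset ℕ} (hZn : ∀ v ∈ Z, v < n) (hZ : Z.card = 3 * k + 4)
    (hQ : H.MemNat G (Q ∩ S)) (hfail : ∀ M ⊆ Z, PartFails H G k S Q Z M)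
    (D : TreeHDecomposition H G) : k < D.width := by
  classical
  by_contra! hw
  have hcard : ∀ A : Finset (Fin n), (A.map Fin.valEmbedding).card = A.card :=
    fun A => Finset.card_map _
  have hmem : ∀ (A : Finset (Fin n)) (v : ℕ) (hv : v < n),
      v ∈ A.map Fin.valEmbedding ↔ (⟨v, hv⟩ : Fin n) ∈ A := by
    intro A v hv
    simp only [mem_map, Fin.valEmbedding_apply]
    constructor
    · rintro ⟨a, ha, rfl⟩; exact ha
    · intro h; exact ⟨_, h, rfl⟩
  have hlt : ∀ (A : Finset (Fin n)) (v : ℕ), v ∈ A.map Fin.valEmbedding → v < n := by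
    intro A v hv
    simp only [mem_map, Fin.valEmbedding_apply] at hv
    obtain ⟨a, -, rfl⟩ := hv; exact a.2
  have hclosed : ∀ C X : Finset (Fin n), (∀ u ∈ C, ∀ w, G.Adj u w → w ∈ C ∪ X) →
      ∀ u ∈ C.map Fin.valEmbedding, ∀ w < n, G.adjNat u w →
        w ∈ C.map Fin.valEmbedding ∨ w ∈ X.map Fin.valEmbedding := by
    rintro C X h u hu w hw ⟨hun, hwn, hadj⟩
    rw [hmem _ _ hun] at hu
    rw [hmem _ _ hw, hmem _ _ hw]
    exact mem_union.1 (h _ hu _ hadj)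
  set Z' : Finset (Fin n) := univ.filter fun v => (v : ℕ) ∈ Z with hZ'
  have hZZ : Z'.map Fin.valEmbedding = Z := by
    ext v
    constructor
    · intro h; rw [hmem _ _ (hlt _ _ h)] at h; simpa [hZ'] using h
    · intro h; rw [hmem _ _ (hZn v h)]; simpa [hZ'] using h
  rcases D.exists_separation hw Z' (by rw [← hcard, hZZ, hZ]) with
    ⟨C, X, hC, hX, hCX, hcl, hZC⟩ | ⟨C, X, M, hMZ, hM, hZM, hX, hMC, hZMC, hcl⟩
  · have hsd : Z \ (Z ∩ C.map Fin.valEmbedding) = (Z' \ C).map Fin.valEmbedding := by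
      ext v
      by_cases hv : v < n
      · rw [hmem _ _ hv]
        simp only [mem_sdiff, mem_inter, hmem _ _ hv, hZ', mem_filter, mem_univ, true_and]; tauto
      · constructor
        · intro h; exact absurd (hZn v (mem_sdiff.1 h).1) hv
        · intro h; exact absurd (hlt _ _ h) hv
    obtain ⟨E, hE, hE3, hlink, hdel⟩ :=
      (hfail (Z ∩ C.map Fin.valEmbedding) inter_subset_left).base (by rw [hsd, hcard]; exact hZC)
    have h1 := hlink (C.map Fin.valEmbedding) (X.map Fin.valEmbedding) (hclosed C X hcl) (by
      intro v hv hr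
      simp only [baseRole] at hr
      split_ifs at hr with h1 h2 h3 h4 <;> try omega
      exact Or.inl (mem_inter.1 h4).2)
    rw [hcard] at h1
    -- The deletion set consists of the linked vertices outside `C` and of the separator, at most
    -- k+1 vertices each. What remains splits into a part of `C` and a part of `Q ∩ S` without edges
    -- between them, so union-closedness applies.
    have h2 := hdel ((E \ C.map Fin.valEmbedding) ∪ X.map Fin.valEmbedding) (by
      refine GraphClass.MemNat.union hH hU (A := C.map Fin.valEmbedding)
        (B := ((Q ∩ S) \ C.map Fin.valEmbedding) \ X.map Fin.valEmbedding) ?_ ?_ ?_ ?_ ?_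
      · intro v hv _
        simp only [mem_sdiff, mem_union, mem_inter] at hv ⊢
        tauto
      · intro v hv hv'
        simp only [mem_sdiff] at hv'
        exact hv'.1.2 hv
      · intro u hu w hw hadj
        simp only [mem_sdiff] at hw
        have := hclosed C X hcl u hu w hadj.2.1 hadj
        tauto
      · exact hH.mem_induce_mono (fun v hv => (hmem C v v.2).1 hv) hC
      · refine hQ.mono hH fun v hv _ => ?_
        exact (mem_sdiff.1 (mem_sdiff.1 hv).1).1)
    have h3 := Finset.card_union_le (E \ C.map Fin.valEmbedding) (X.map Fin.valEmbedding)
    rw [hcard] at h3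
    omega
  · have hsub : M.map Fin.valEmbedding ⊆ Z := by rw [← hZZ]; exact Finset.map_subset_map.2 hMZ
    have hsd : Z \ M.map Fin.valEmbedding = (Z' \ M).map Fin.valEmbedding := by
      rw [← hZZ]
      ext v
      by_cases hv : v < n
      · simp only [mem_sdiff, hmem _ _ hv]
      · constructor
        · intro h; exact absurd (hlt _ _ (mem_sdiff.1 h).1) hv
        · intro h; exact absurd (hlt _ _ h) hv
    obtain ⟨E, hE, hE3, hlink⟩ := (hfail _ hsub).balanced (by rw [hsd, hcard]; exact hZM)
      (by rw [hcard]; exact hM)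
    have h1 := hlink (C.map Fin.valEmbedding) (X.map Fin.valEmbedding) (hclosed C X hcl) (by
      intro v hv hr
      have h3 : v ∈ M.map Fin.valEmbedding := by
        by_contra h3
        simp only [balancedRole, h3, if_false] at hr
        split_ifs at hr <;> omega
      rw [hmem _ _ hv] at h3 ⊢
      rw [hmem _ _ hv]
      exact mem_union.1 (hMC h3))
    -- The linked vertices are sinks and thus in `Z \ M`, which does not meet `C`. The linkage then
    -- forces k+2 vertices into the separator.
    have h2 : E \ C.map Fin.valEmbedding = E := by
      rw [Finset.sdiff_eq_self_iff_disjoint, Finset.disjoint_left]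
      intro v hv hvC
      obtain ⟨hvn, hr⟩ := hE3 v hv
      have h2 : v ∈ Z ∧ v ∉ M.map Fin.valEmbedding := by
        simp only [balancedRole] at hr
        by_cases h1 : v ∈ S
        · simp [h1] at hr
        · by_cases h2 : v ∈ Z
          · by_cases h3 : v ∈ M.map Fin.valEmbedding
            · rw [if_neg h1, if_pos h2, if_pos h3] at hr; omega
            · exact ⟨h2, h3⟩
          · simp [h1, h2] at hr
      have h3 := h2.2
      rw [hmem _ _ hvn] at h3 hvC
      exact Finset.disjoint_left.1 hZMC (mem_sdiff.2 ⟨by simpa [hZ'] using h2.1, h3⟩) hvC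
    rw [h2, hE, hcard] at h1
    omega

/-! ### Trees given by parent pointers -/

open Finset

/-- The graph on `0, …, N - 1` in which every positive number is adjacent to its parent. -/
def parentTree (N : ℕ) (par : ℕ → ℕ) : SimpleGraph (Fin N) :=
  SimpleGraph.fromRel fun i p => 0 < (i : ℕ) ∧ par i = p

section ParentTree

variable {N : ℕ} {par : ℕ → ℕ}

theorem parentTree_adj {i p : Fin N} : (parentTree N par).Adj i p ↔
    i ≠ p ∧ ((0 < (i : ℕ) ∧ par i = p) ∨ (0 < (p : ℕ) ∧ par p = i)) := by
  simp [parentTree, SimpleGraph.fromRel_adj]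

theorem parentTree_adj_par (hpar : ∀ i < N, 0 < i → par i < i) {i p : Fin N} (hi : 0 < (i : ℕ))
    (hp : par i = p) : (parentTree N par).Adj i p := by
  rw [parentTree_adj]
  refine ⟨?_, Or.inl ⟨hi, hp⟩⟩
  rintro rfl
  have := hpar i i.2 hi
  omega

/-- Parents have smaller numbers, so the ascent from any element of `S` ends, and within `S` it can
end only at `t`. -/
theorem parentTree_connected_induce (hpar : ∀ i < N, 0 < i → par i < i) (S : Set (Fin N))
    (t : Fin N) (ht : t ∈ S)
    (hS : ∀ i ∈ S, i ≠ t → 0 < (i : ℕ) ∧ ∃ p ∈ S, par i = (p : Fin N)) :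
    ((parentTree N par).induce S).Connected := by
  have key : ∀ m, ∀ i : S, (i.1 : ℕ) ≤ m →
      ((parentTree N par).induce S).Reachable i ⟨t, ht⟩ := by
    intro m
    induction m with
    | zero =>
      rintro ⟨i, hi⟩ hm
      by_cases hit : i = t
      · subst hit; rfl
      · have := (hS i hi hit).1; simp only at hm; omega
    | succ m ih =>
      rintro ⟨i, hi⟩ hm
      by_cases hit : i = t
      · subst hit; rfl
      · obtain ⟨h0, p, hp, hip⟩ := hS i hi hit
        have hlt := hpar i i.2 h0
        refine SimpleGraph.Reachable.trans (SimpleGraph.Adj.reachable (v := ⟨p, hp⟩) ?_)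
          (ih ⟨p, hp⟩ (by simp only at hm ⊢; omega))
        exact parentTree_adj_par hpar h0 hip
  have : Nonempty S := ⟨⟨t, ht⟩⟩
  exact ⟨fun a b => (key _ a le_rfl).trans (key _ b le_rfl).symm⟩

theorem parentTree_isTree (hpar : ∀ i < N, 0 < i → par i < i) (hN : 0 < N) :
    (parentTree N par).IsTree := by
  classical
  have hconn : (parentTree N par).Connected := by
    have := parentTree_connected_induce hpar Set.univ ⟨0, hN⟩ trivial (fun i _ hi => by
      have h0 : 0 < (i : ℕ) := Nat.pos_of_ne_zero fun h => hi (Fin.ext h)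
      exact ⟨h0, ⟨par i, (hpar i i.2 h0).trans i.2⟩, trivial, rfl⟩)
    exact (SimpleGraph.induceUnivIso _).connected_iff.1 this
  rw [SimpleGraph.isTree_iff_connected_and_card]
  refine ⟨hconn, le_antisymm ?_ hconn.card_vert_le_card_edgeSet_add_one⟩
  -- Each edge joins a positive node to its parent, so there are at most `N - 1` edges; a connected
  -- graph with so few edges is a tree.
  have hsub : (parentTree N par).edgeFinset ⊆ (univ.erase (⟨0, hN⟩ : Fin N)).image fun i : Fin N =>
      if h : par i < N then s(i, (⟨par i, h⟩ : Fin N)) else s(i, i) := by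
    intro e he
    induction e using Sym2.ind with
    | _ x y =>
      rw [SimpleGraph.mem_edgeFinset, SimpleGraph.mem_edgeSet, parentTree_adj] at he
      rw [mem_image]
      rcases he.2 with ⟨h1, h2⟩ | ⟨h1, h2⟩
      · refine ⟨x, by simp [Fin.ext_iff]; omega, ?_⟩
        rw [dif_pos (by rw [h2]; exact y.2)]
        simp only [h2]
      · refine ⟨y, by simp [Fin.ext_iff]; omega, ?_⟩
        rw [dif_pos (by rw [h2]; exact x.2), Sym2.eq_swap]
        simp only [h2]
  have h1 := (Finset.card_le_card hsub).trans Finset.card_image_le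
  rw [Finset.card_erase_of_mem (mem_univ _), Finset.card_univ, Fintype.card_fin] at h1
  rw [Nat.card_eq_fintype_card, ← SimpleGraph.edgeFinset_card, Nat.card_eq_fintype_card,
    Fintype.card_fin]
  omega

/-- The distance from the root is the depth: following the parents gives a walk of that length, and
the depth changes by one along each edge, so no walk is shorter. -/
theorem parentTree_dist (hpar : ∀ i < N, 0 < i → par i < i) (hN : 0 < N) :
    ∃ dep : ℕ → ℕ, (∀ i : Fin N, 0 < (i : ℕ) → dep i = dep (par i) + 1) ∧
      ∀ i : Fin N, (parentTree N par).dist ⟨0, hN⟩ i = dep i := by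
  obtain ⟨dep, h0, hdep⟩ : ∃ dep : ℕ → ℕ, dep 0 = 0 ∧
      ∀ i < N, 0 < i → dep i = dep (par i) + 1 := by
    clear hN
    induction N with
    | zero => exact ⟨fun _ => 0, rfl, by simp⟩
    | succ N ih =>
      obtain ⟨dep, h0, hd⟩ := ih fun i hi => hpar i (by omega)
      by_cases hN : 0 < N
      · have hp := hpar N (by omega) hN
        refine ⟨Function.update dep N (dep (par N) + 1), ?_, ?_⟩
        · rw [Function.update_of_ne (by omega), h0]
        · intro i hi h1
          by_cases hiN : i = N
          · subst hiN; rw [Function.update_self, Function.update_of_ne hp.ne]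
          · have := hpar i hi h1
            rw [Function.update_of_ne hiN, Function.update_of_ne (by omega)]
            exact hd i (by omega) h1
      · exact ⟨dep, h0, fun i hi h1 => by omega⟩
  refine ⟨dep, fun i hi => hdep i i.2 hi, fun i => le_antisymm ?_ ?_⟩
  · have : ∀ m, ∀ i : Fin N, (i : ℕ) ≤ m →
        ∃ p : (parentTree N par).Walk i ⟨0, hN⟩, p.length = dep i := by
      intro m
      induction m with
      | zero =>
        intro i hi
        have : i = ⟨0, hN⟩ := Fin.ext (by simpa using hi)
        subst this
        exact ⟨.nil, by simp [h0]⟩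
      | succ m ih =>
        intro i hi
        by_cases hi0 : (i : ℕ) = 0
        · have : i = ⟨0, hN⟩ := Fin.ext (by simpa using hi0)
          subst this
          exact ⟨.nil, by simp [h0]⟩
        · have hlt := hpar i i.2 (by omega)
          obtain ⟨p, hp⟩ := ih ⟨par i, hlt.trans i.2⟩ (by simp only; omega)
          refine ⟨.cons (parentTree_adj_par hpar (by omega) rfl) p, ?_⟩
          rw [SimpleGraph.Walk.length_cons, hp, hdep i i.2 (by omega)]
    obtain ⟨p, hp⟩ := this _ i le_rfl
    rw [← hp, SimpleGraph.dist_comm]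
    exact SimpleGraph.dist_le p
  · obtain ⟨p, hp⟩ := ((parentTree_isTree hpar hN).connected ⟨0, hN⟩ i).exists_walk_length_eq_dist
    rw [← hp]
    have : ∀ (a b : Fin N) (p : (parentTree N par).Walk a b), dep b ≤ dep a + p.length := by
      intro a b p
      induction p with
      | nil => simp
      | @cons x y z h q ih =>
        rw [SimpleGraph.Walk.length_cons]
        rcases (parentTree_adj.1 h).2 with ⟨h1, h2⟩ | ⟨h1, h2⟩
        · have := hdep x x.2 h1; rw [h2] at this; omega
        · have := hdep y y.2 h1; rw [h2] at this; omega
    simpa [h0] using this _ _ p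

theorem isChild_parentTree (hpar : ∀ i < N, 0 < i → par i < i) (hN : 0 < N) {i p : Fin N} :
    IsChild (parentTree N par) ⟨0, hN⟩ p i ↔ 0 < (i : ℕ) ∧ par i = p := by
  obtain ⟨dep, hdep, hdist⟩ := parentTree_dist hpar hN
  rw [IsChild, hdist, hdist]
  constructor
  · rintro ⟨hadj, hd⟩
    rcases (parentTree_adj.1 hadj).2 with ⟨h1, h2⟩ | h
    · have := hdep p h1; rw [h2] at this; omega
    · exact h
  · rintro ⟨h1, h2⟩
    refine ⟨(parentTree_adj_par hpar h1 h2).symm, ?_⟩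
    rw [hdep i h1, h2]

end ParentTree

/-! ### Partial tree decompositions -/

/-- A partial tree decomposition with `N` nodes, of which those before `j` are finished. A vertex
`v` with `lab v = i + 1` still has to be treated below the node `i`; the vertices with `lab v = 0`
are treated. -/
structure Conf where
  N : ℕ
  j : ℕ
  par : ℕ → ℕ
  bag : ℕ → Finset ℕ
  lab : ℕ → ℕ
  L : Finset ℕ
  Q : Finset ℕ

namespace Conf

/-- The vertices that have to be treated below the node `i`. -/
def part (n : ℕ) (c : Conf) (i : ℕ) : Finset ℕ := (range n).filter fun v => c.lab v = i + 1

variable {H : GraphClass} {n : ℕ} {G : SimpleGraph (Fin n)} {k : ℕ}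

theorem mem_part {c : Conf} {i v : ℕ} : v ∈ c.part n i ↔ v < n ∧ c.lab v = i + 1 := by
  simp [part]

/-- The number of untreated vertices. -/
def todo (n : ℕ) (c : Conf) : ℕ := ((range n).filter fun v => c.lab v ≠ 0).card

/-- The number of untreated vertices outside `Q`. -/
def rest (n : ℕ) (c : Conf) : ℕ := ((range n).filter fun v => c.lab v ≠ 0 ∧ v ∉ c.Q).card

/-- The invariant of partial tree decompositions. -/
structure Inv (H : GraphClass) (G : SimpleGraph (Fin n)) (k : ℕ) (c : Conf) : Prop where
  pos : 0 < c.N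
  j_le : c.j ≤ c.N
  par_zero : c.par 0 = 0
  par_lt : ∀ i < c.N, 0 < i → c.par i < i
  bag_lt : ∀ i < c.N, ∀ v ∈ c.bag i, v < n
  lab_le : ∀ v < n, c.lab v ≤ c.N
  lab_gt : ∀ v < n, c.lab v ≠ 0 → c.j < c.lab v
  fresh : ∀ v < n, c.lab v ≠ 0 → v ∉ c.L ∧ ∀ i < c.N, v ∉ c.bag i
  -- The form in which `parentTree_connected_induce` takes the connectivity of the nodes of `v`:
  -- they hang together below a topmost node `t`.
  top : ∀ v < n, c.lab v = 0 → ∃ t < c.N, v ∈ c.bag t ∧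
    ∀ i < c.N, v ∈ c.bag i → i ≠ t → 0 < i ∧ v ∈ c.bag (c.par i)
  edge : ∀ u v, G.adjNat u v → c.lab u = 0 → c.lab v = 0 → ∃ i < c.N, u ∈ c.bag i ∧ v ∈ c.bag i
  -- Together with `inside`, this confines the neighbours of a part to the part and the bag of its
  -- node, so that the parts can be treated independently.
  border : ∀ u v i, G.adjNat u v → c.lab u = i + 1 → c.lab v = 0 → v ∈ c.bag i
  inside : ∀ u v, G.adjNat u v → c.lab u ≠ 0 → c.lab v ≠ 0 → c.lab u = c.lab v
  L_lt : ∀ v ∈ c.L, v < n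
  leaf : ∀ v ∈ c.L, ∃ t < c.N, (∀ i < c.N, v ∈ c.bag i ↔ i = t) ∧
    (∀ i < c.N, 0 < i → c.par i ≠ t) ∧ c.part n t = ∅
  base : ∀ i < c.N, H.MemNat G (c.bag i ∩ c.L)
  -- 5k+6 = (3k+4) + (2k+2), a full bag together with a cut of the base mode.
  width : ∀ i < c.N, (c.bag i \ c.L).card ≤ 5 * k + 6
  small : ∀ i < c.N, c.part n i ≠ ∅ → (c.bag i).card ≤ 3 * k + 4
  Q_mem : ∀ i < c.N, H.MemNat G (c.Q ∩ c.part n i)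

/-- The partial decomposition at the start. -/
def init : Conf where
  N := 1
  j := 0
  par := fun _ => 0
  bag := fun _ => ∅
  lab := fun _ => 1
  L := ∅
  Q := ∅

theorem init_inv (he : H.MemNat G ∅) : (init.Inv H G k) := by
  refine ⟨by simp [init], by simp [init], rfl, ?_, ?_, ?_, ?_, ?_, ?_, ?_, ?_, ?_, ?_, ?_, ?_, ?_,
    ?_, ?_⟩ <;> simp [init, he]

/-- Add the untreated vertices `A` below the node `i` to the bag of `i`. -/
def extend (c : Conf) (i : ℕ) (A : Finset ℕ) : Conf :=
  { c with
    bag := Function.update c.bag i (c.bag i ∪ A)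
    lab := fun v => if v ∈ A then 0 else c.lab v }

theorem part_extend {c : Conf} {i i' : ℕ} {A : Finset ℕ} :
    (c.extend i A).part n i' = c.part n i' \ A := by
  ext v
  simp only [mem_part, extend, mem_sdiff]
  by_cases hv : v ∈ A <;> simp [hv]

/-- The treated neighbours of the vertices of `A` are in the bag of `i` already (`border`), so all
edges that become treated are covered by this bag. The alternative `A = ∅` is there for base leaves,
whose bags may exceed 3k+4. -/
theorem extend_inv {c : Conf} (h : c.Inv H G k) (hH : H.Hereditary) {i : ℕ} (hi : i < c.N)
    {A : Finset ℕ}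
    (hA : A ⊆ c.part n i) (hcard : (c.bag i ∪ A).card ≤ 3 * k + 4 ∨ A = ∅) :
    (c.extend i A).Inv H G k := by
  have hAn : ∀ v ∈ A, v < n := fun v hv => (mem_part.1 (hA hv)).1
  have hAl : ∀ v ∈ A, c.lab v = i + 1 := fun v hv => (mem_part.1 (hA hv)).2
  have hfr : ∀ v ∈ A, v ∉ c.L ∧ ∀ i < c.N, v ∉ c.bag i := fun v hv =>
    h.fresh v (hAn v hv) (by rw [hAl v hv]; omega)
  have hbag : ∀ i' v, v ∈ (c.extend i A).bag i' ↔ v ∈ c.bag i' ∨ (i' = i ∧ v ∈ A) := by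
    intro i' v
    by_cases hii : i' = i
    · subst hii; simp [extend]
    · simp [extend, hii]
  have hlab : ∀ v, (c.extend i A).lab v = if v ∈ A then 0 else c.lab v := fun _ => rfl
  refine ⟨h.pos, h.j_le, h.par_zero, h.par_lt, ?_, ?_, ?_, ?_, ?_, ?_, ?_, ?_, h.L_lt, ?_, ?_, ?_,
    ?_, ?_⟩
  · intro i' hi' v hv
    rcases (hbag _ _).1 hv with h1 | h1
    · exact h.bag_lt i' hi' v h1
    · exact hAn v h1.2
  · intro v hv
    rw [hlab]; split_ifs
    · omega
    · exact h.lab_le v hv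
  · intro v hv hl
    rw [hlab] at hl ⊢
    split_ifs at hl ⊢ with h1
    all_goals first | exact h.lab_gt v hv hl | exact absurd rfl hl
  · intro v hv hl
    rw [hlab] at hl
    split_ifs at hl with h1
    · omega
    refine ⟨(h.fresh v hv hl).1, fun i' hi' hvb => ?_⟩
    rcases (hbag _ _).1 hvb with h2 | h2
    · exact (h.fresh v hv hl).2 i' hi' h2
    · exact h1 h2.2
  · intro v hv hl
    by_cases hvA : v ∈ A
    · refine ⟨i, hi, (hbag _ _).2 (Or.inr ⟨rfl, hvA⟩), fun i' hi' hvb hne => ?_⟩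
      rcases (hbag _ _).1 hvb with h2 | h2
      · exact absurd h2 ((hfr v hvA).2 i' hi')
      · exact absurd h2.1 hne
    · rw [hlab, if_neg hvA] at hl
      obtain ⟨t, ht, hvt, htop⟩ := h.top v hv hl
      refine ⟨t, ht, (hbag _ _).2 (Or.inl hvt), fun i' hi' hvb hne => ?_⟩
      rcases (hbag _ _).1 hvb with h2 | h2
      · exact ⟨(htop i' hi' h2 hne).1, (hbag _ _).2 (Or.inl (htop i' hi' h2 hne).2)⟩
      · exact absurd h2.2 hvA
  · intro u v hadj hu hv
    rw [hlab] at hu hv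
    split_ifs at hu hv with huA hvA hvA
    · exact ⟨i, hi, (hbag _ _).2 (Or.inr ⟨rfl, huA⟩), (hbag _ _).2 (Or.inr ⟨rfl, hvA⟩)⟩
    · exact ⟨i, hi, (hbag _ _).2 (Or.inr ⟨rfl, huA⟩),
        (hbag _ _).2 (Or.inl (h.border u v i hadj (hAl u huA) hv))⟩
    · exact ⟨i, hi, (hbag _ _).2 (Or.inl (h.border v u i (SimpleGraph.adjNat_symm hadj)
        (hAl v hvA) hu)), (hbag _ _).2 (Or.inr ⟨rfl, hvA⟩)⟩
    · obtain ⟨i', hi', h1, h2⟩ := h.edge u v hadj hu hv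
      exact ⟨i', hi', (hbag _ _).2 (Or.inl h1), (hbag _ _).2 (Or.inl h2)⟩
  · intro u v i' hadj hu hv
    rw [hlab] at hu hv
    split_ifs at hu hv with huA hvA
    · have := h.inside u v hadj (by omega) (by rw [hAl v hvA]; omega)
      rw [hAl v hvA, hu] at this
      exact (hbag _ _).2 (Or.inr ⟨by omega, hvA⟩)
    · exact (hbag _ _).2 (Or.inl (h.border u v i' hadj hu hv))
  · intro u v hadj hu hv
    rw [hlab] at hu hv
    rw [hlab, hlab]
    split_ifs at hu hv ⊢ with huA hvA
    all_goals first | exact h.inside u v hadj hu hv | exact absurd rfl hu | exact absurd rfl hv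
  · intro v hv
    obtain ⟨t, ht, h1, h2, h3⟩ := h.leaf v hv
    refine ⟨t, ht, fun i' hi' => ?_, h2, ?_⟩
    · rw [hbag, h1 i' hi']
      constructor
      · rintro (h4 | h4)
        · exact h4
        · exact absurd hv (hfr v h4.2).1
      · exact Or.inl
    · rw [part_extend, h3]; simp
  · intro i' hi'
    refine (h.base i' hi').mono hH fun v hv _ => ?_
    rw [mem_inter, hbag] at hv
    rcases hv.1 with h1 | h1
    · exact mem_inter.2 ⟨h1, hv.2⟩
    · exact absurd hv.2 (hfr v h1.2).1
  · intro i' hi'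
    by_cases hii : i' = i
    · subst hii
      have : (c.extend i' A).bag i' = c.bag i' ∪ A := by simp [extend]
      rw [this]
      rcases hcard with h1 | h1
      · have := Finset.card_le_card (Finset.sdiff_subset (s := c.bag i' ∪ A) (t := c.L))
        show ((c.bag i' ∪ A) \ c.L).card ≤ _
        omega
      · rw [h1, union_empty]; exact h.width i' hi'
    · have : (c.extend i A).bag i' = c.bag i' := by simp [extend, hii]
      rw [this]; exact h.width i' hi'
  · intro i' hi' hp
    have hp' : c.part n i' ≠ ∅ := by
      rintro h1; rw [part_extend, h1] at hp; simp at hp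
    by_cases hii : i' = i
    · subst hii
      have : (c.extend i' A).bag i' = c.bag i' ∪ A := by simp [extend]
      rw [this]
      rcases hcard with h1 | h1
      · exact h1
      · rw [h1, union_empty]; exact h.small i' hi' hp'
    · have : (c.extend i A).bag i' = c.bag i' := by simp [extend, hii]
      rw [this]; exact h.small i' hi' hp'
  · intro i' hi'
    refine (h.Q_mem i' hi').mono hH fun v hv _ => ?_
    rw [mem_inter, part_extend, mem_sdiff] at hv
    exact mem_inter.2 ⟨hv.1, hv.2.1⟩

/-- Treat the node `j` as finished if nothing is left to do below it. -/
theorem skip_inv {c : Conf} (h : c.Inv H G k) (hj : c.j < c.N) (hp : c.part n c.j = ∅) :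
    ({ c with j := c.j + 1 } : Conf).Inv H G k where
  pos := h.pos
  j_le := hj
  par_zero := h.par_zero
  par_lt := h.par_lt
  bag_lt := h.bag_lt
  lab_le := h.lab_le
  lab_gt := by
    intro v hv hl
    have h1 := h.lab_gt v hv hl
    have h2 : c.lab v ≠ c.j + 1 := fun h2 => by
      have : v ∈ c.part n c.j := mem_part.2 ⟨hv, h2⟩
      rw [hp] at this; simp at this
    show c.j + 1 < c.lab v
    omega
  fresh := h.fresh
  top := h.top
  edge := h.edge
  border := h.border
  inside := h.inside
  L_lt := h.L_lt
  leaf := h.leaf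
  base := h.base
  width := h.width
  small := h.small
  Q_mem := h.Q_mem

/-- Replace `Q` below the node `j`. -/
theorem commit_inv {c : Conf} (h : c.Inv H G k) (hH : H.Hereditary) {Q' : Finset ℕ}
    (hQ : ∀ v, c.lab v ≠ c.j + 1 → (v ∈ Q' ↔ v ∈ c.Q)) (hmem : H.MemNat G (Q' ∩ c.part n c.j)) :
    ({ c with Q := Q' } : Conf).Inv H G k where
  pos := h.pos
  j_le := h.j_le
  par_zero := h.par_zero
  par_lt := h.par_lt
  bag_lt := h.bag_lt
  lab_le := h.lab_le
  lab_gt := h.lab_gt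
  fresh := h.fresh
  top := h.top
  edge := h.edge
  border := h.border
  inside := h.inside
  L_lt := h.L_lt
  leaf := h.leaf
  base := h.base
  width := h.width
  small := h.small
  Q_mem := by
    intro i hi
    by_cases hij : i = c.j
    · rw [hij]; exact hmem
    · refine (h.Q_mem i hi).mono hH fun v hv _ => ?_
      rw [mem_inter] at hv ⊢
      have h1 := (mem_part.1 hv.2).2
      refine ⟨(hQ v ?_).1 hv.1, hv.2⟩
      change c.lab v = i + 1 at h1
      omega

/-- Finish the node `j` with the bag `X₀`, and give it two children with the bags `X₁` and `X₂`.
The untreated vertices below `j` outside these bags are `S₁` and the remaining ones; `L₁` is a base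
component. -/
def branch (n : ℕ) (c : Conf) (X₀ X₁ X₂ S₁ L₁ : Finset ℕ) : Conf where
  N := c.N + 2
  j := c.j + 1
  par := fun i => if i < c.N then c.par i else c.j
  bag := fun i => if i = c.j then X₀ else if i = c.N then X₁ else if i = c.N + 1 then X₂ else c.bag i
  lab := fun v => if v ∈ c.part n c.j then
      (if v ∈ X₀ ∪ L₁ then 0 else if v ∈ S₁ then c.N + 1 else c.N + 2) else c.lab v
  L := c.L ∪ L₁
  Q := c.Q

/-- The conditions under which a node may be finished with two children. -/
structure CanBranch (H : GraphClass) (G : SimpleGraph (Fin n)) (k : ℕ) (c : Conf)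
    (X₀ X₁ X₂ S₁ L₁ : Finset ℕ) : Prop where
  lt : c.j < c.N
  ne : c.part n c.j ≠ ∅
  sub₀ : c.bag c.j ⊆ X₀
  X₀_sub : X₀ ⊆ c.bag c.j ∪ c.part n c.j
  S₁_sub : S₁ ⊆ c.part n c.j
  L₁_sub : L₁ ⊆ c.part n c.j
  disj : ∀ v ∈ L₁, v ∉ X₀ ∧ v ∉ S₁
  X₁_sub : X₁ ⊆ X₀ ∪ L₁
  L₁_X₁ : L₁ ⊆ X₁
  X₂_sub : X₂ ⊆ X₀
  -- No edge joins the two sides outside the bags: within the old bag and part, the first side sees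
  -- only `X₁` and its own untreated vertices, the second side only `X₂` and its own.
  closed₁ : ∀ u ∈ S₁ ∪ L₁, u ∉ X₀ → ∀ v, G.adjNat u v → v ∈ c.bag c.j ∪ c.part n c.j →
    v ∈ X₁ ∨ (v ∈ S₁ ∧ v ∉ X₀)
  closed₂ : ∀ u ∈ c.part n c.j, u ∉ X₀ → u ∉ S₁ → u ∉ L₁ → ∀ v, G.adjNat u v →
    v ∈ c.bag c.j ∪ c.part n c.j → v ∈ X₂ ∨ (v ∈ c.part n c.j ∧ v ∉ X₀ ∧ v ∉ S₁ ∧ v ∉ L₁)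
  -- Base vertices require a node that remains a leaf, so the first child has either untreated
  -- vertices or base vertices.
  empty : S₁ = ∅ ∨ L₁ = ∅
  base : H.MemNat G L₁
  card₀ : X₀.card ≤ 5 * k + 6
  card₁ : (X₁ \ L₁).card ≤ 5 * k + 6
  card₁' : S₁ = ∅ ∨ X₁.card ≤ 3 * k + 4
  card₂ : X₂.card ≤ 3 * k + 4

/-- The neighbours of the part below `j` lie in this part and in the bag of `j` (`nbr`), so
everything is decided by the bags of `j` and of the two new nodes. A newly treated vertex of `X₀`
has its topmost node at `j`, a base vertex of `L₁` has it at the new leaf `c.N`, and older vertices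
keep theirs. -/
theorem branch_inv {c : Conf} (h : c.Inv H G k) (hH : H.Hereditary)
    {X₀ X₁ X₂ S₁ L₁ : Finset ℕ}
    (hb : c.CanBranch H G k X₀ X₁ X₂ S₁ L₁) : (c.branch n X₀ X₁ X₂ S₁ L₁).Inv H G k := by
  have hj := hb.lt
  set c' := c.branch n X₀ X₁ X₂ S₁ L₁ with hc'
  have hN : c'.N = c.N + 2 := rfl
  have bag_j : c'.bag c.j = X₀ := by simp [hc', branch]
  have bag_N : c'.bag c.N = X₁ := by simp [hc', branch, hj.ne']
  have bag_N1 : c'.bag (c.N + 1) = X₂ := by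
    have : c.N + 1 ≠ c.j := by omega
    simp [hc', branch, this]
  have bag_old : ∀ i < c.N, i ≠ c.j → c'.bag i = c.bag i := by
    intro i hi hij
    have h1 : i ≠ c.N := by omega
    have h2 : i ≠ c.N + 1 := by omega
    simp [hc', branch, hij, h1, h2]
  have par_old : ∀ i < c.N, c'.par i = c.par i := by
    intro i hi; simp [hc', branch, hi]
  have par_new : ∀ i, c.N ≤ i → c'.par i = c.j := by
    intro i hi; simp [hc', branch, hi]
  have cases : ∀ i < c'.N, (i < c.N ∧ i ≠ c.j) ∨ i = c.j ∨ i = c.N ∨ i = c.N + 1 := by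
    intro i hi; rw [hN] at hi; omega
  have lab_out : ∀ v, v ∉ c.part n c.j → c'.lab v = c.lab v := by
    intro v hv; simp [hc', branch, hv]
  have lab_in : ∀ v ∈ c.part n c.j, c'.lab v =
      if v ∈ X₀ ∪ L₁ then 0 else if v ∈ S₁ then c.N + 1 else c.N + 2 := by
    intro v hv; simp only [hc', branch, hv, if_true]
  have hlabj : ∀ v ∈ c.part n c.j, v < n ∧ c.lab v = c.j + 1 := fun v hv => mem_part.1 hv
  have hbagj : ∀ v ∈ c.bag c.j, v < n ∧ c.lab v = 0 := by
    intro v hv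
    refine ⟨h.bag_lt _ hj v hv, ?_⟩
    by_contra h1
    exact (h.fresh v (h.bag_lt _ hj v hv) h1).2 _ hj hv
  have hX0 : ∀ v ∈ X₀, v < n := by
    intro v hv
    rcases mem_union.1 (hb.X₀_sub hv) with h1 | h1
    · exact (hbagj v h1).1
    · exact (hlabj v h1).1
  have hX1 : ∀ v ∈ X₁, v < n := by
    intro v hv
    rcases mem_union.1 (hb.X₁_sub hv) with h1 | h1
    · exact hX0 v h1
    · exact (hlabj v (hb.L₁_sub h1)).1
  have old_mem : ∀ v, v < n → c.lab v = 0 → ∀ i < c.N, v ∈ c'.bag i ↔ v ∈ c.bag i := by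
    intro v hv hl i hi
    by_cases hij : i = c.j
    · subst hij
      rw [bag_j]
      constructor
      · intro h1
        rcases mem_union.1 (hb.X₀_sub h1) with h2 | h2
        · exact h2
        · have := (hlabj v h2).2; omega
      · intro h1; exact hb.sub₀ h1
    · rw [bag_old i hi hij]
  have hpart : ∀ v, v ∈ c.part n c.j → c.lab v ≠ 0 := by
    intro v hv; rw [(hlabj v hv).2]; omega
  have lab_zero : ∀ v, c'.lab v = 0 → (v ∉ c.part n c.j ∧ c.lab v = 0) ∨
      (v ∈ c.part n c.j ∧ v ∈ X₀ ∪ L₁) := by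
    intro v hv
    by_cases hvp : v ∈ c.part n c.j
    · rw [lab_in v hvp] at hv
      split_ifs at hv with h1
      exact Or.inr ⟨hvp, h1⟩
    · rw [lab_out v hvp] at hv; exact Or.inl ⟨hvp, hv⟩
  have lab_ne : ∀ v, c'.lab v ≠ 0 → (v ∉ c.part n c.j ∧ c'.lab v = c.lab v) ∨
      (v ∈ c.part n c.j ∧ v ∉ X₀ ∧ v ∉ L₁ ∧ v ∈ S₁ ∧ c'.lab v = c.N + 1) ∨
      (v ∈ c.part n c.j ∧ v ∉ X₀ ∧ v ∉ L₁ ∧ v ∉ S₁ ∧ c'.lab v = c.N + 2) := by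
    intro v hv
    by_cases hvp : v ∈ c.part n c.j
    · right
      rw [lab_in v hvp] at hv ⊢
      by_cases h1 : v ∈ X₀ ∪ L₁
      · rw [if_pos h1] at hv; exact absurd rfl hv
      · rw [if_neg h1]
        rw [mem_union, not_or] at h1
        by_cases h2 : v ∈ S₁
        · rw [if_pos h2]; exact Or.inl ⟨hvp, h1.1, h1.2, h2, rfl⟩
        · rw [if_neg h2]; exact Or.inr ⟨hvp, h1.1, h1.2, h2, rfl⟩
    · exact Or.inl ⟨hvp, lab_out v hvp⟩
  have part_old : ∀ i < c.N, ∀ v ∈ c'.part n i, i ≠ c.j ∧ v ∈ c.part n i := by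
    intro i hi v hv
    obtain ⟨h1, h2⟩ := mem_part.1 hv
    rcases lab_ne v (by omega) with ⟨h3, h4⟩ | ⟨-, -, -, -, h4⟩ | ⟨-, -, -, -, h4⟩
    · refine ⟨?_, mem_part.2 ⟨h1, by omega⟩⟩
      rintro rfl
      exact h3 (mem_part.2 ⟨h1, by omega⟩)
    · omega
    · omega
  have nbr : ∀ u ∈ c.part n c.j, ∀ v, G.adjNat u v → v ∈ c.bag c.j ∪ c.part n c.j := by
    intro u hu v hadj
    by_cases hv : c.lab v = 0
    · exact mem_union_left _ (h.border u v c.j hadj (hlabj u hu).2 hv)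
    · have := h.inside u v hadj (hpart u hu) hv
      exact mem_union_right _ (mem_part.2 ⟨hadj.2.1, by rw [← this, (hlabj u hu).2]⟩)
  refine ⟨by omega, by show c.j + 1 ≤ c.N + 2; omega, ?_, ?_, ?_, ?_, ?_, ?_, ?_, ?_, ?_, ?_, ?_, ?_,
    ?_, ?_, ?_, ?_⟩
  · rw [par_old 0 h.pos]; exact h.par_zero
  · intro i hi h0
    by_cases hiN : i < c.N
    · rw [par_old i hiN]; exact h.par_lt i hiN h0
    · rw [par_new i (by omega)]; omega
  · intro i hi v hv
    rcases cases i hi with ⟨h1, h2⟩ | rfl | rfl | rfl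
    · rw [bag_old i h1 h2] at hv; exact h.bag_lt i h1 v hv
    · rw [bag_j] at hv; exact hX0 v hv
    · rw [bag_N] at hv; exact hX1 v hv
    · rw [bag_N1] at hv; exact hX0 v (hb.X₂_sub hv)
  · intro v hv
    by_cases h0 : c'.lab v = 0
    · omega
    rcases lab_ne v h0 with ⟨h3, h4⟩ | ⟨-, -, -, -, h4⟩ | ⟨-, -, -, -, h4⟩
    · have := h.lab_le v hv; omega
    · omega
    · omega
  · intro v hv h0
    show c.j + 1 < _
    rcases lab_ne v h0 with ⟨h3, h4⟩ | ⟨-, -, -, -, h4⟩ | ⟨-, -, -, -, h4⟩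
    · have h5 := h.lab_gt v hv (by omega)
      have : c.lab v ≠ c.j + 1 := fun h6 => h3 (mem_part.2 ⟨hv, h6⟩)
      omega
    · omega
    · omega
  · intro v hv h0
    have key : v ∉ X₀ ∧ v ∉ L₁ ∧ c.lab v ≠ 0 := by
      rcases lab_ne v h0 with ⟨h3, h4⟩ | ⟨h1, h2, h3, -⟩ | ⟨h1, h2, h3, -⟩
      · have hl : c.lab v ≠ 0 := by omega
        refine ⟨fun h5 => ?_, fun h5 => h3 (hb.L₁_sub h5), hl⟩
        rcases mem_union.1 (hb.X₀_sub h5) with h6 | h6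
        · exact hl (hbagj v h6).2
        · exact h3 h6
      · exact ⟨h2, h3, hpart v h1⟩
      · exact ⟨h2, h3, hpart v h1⟩
    obtain ⟨k1, k2, k3⟩ := key
    have hf := h.fresh v hv k3
    refine ⟨?_, fun i hi hvb => ?_⟩
    · show v ∉ c.L ∪ L₁
      simp [hf.1, k2]
    · rcases cases i hi with ⟨h1, h2⟩ | rfl | rfl | rfl
      · rw [bag_old i h1 h2] at hvb; exact hf.2 i h1 hvb
      · rw [bag_j] at hvb; exact k1 hvb
      · rw [bag_N] at hvb
        rcases mem_union.1 (hb.X₁_sub hvb) with h1 | h1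
        · exact k1 h1
        · exact k2 h1
      · rw [bag_N1] at hvb; exact k1 (hb.X₂_sub hvb)
  · intro v hv h0
    rcases lab_zero v h0 with ⟨h1, h2⟩ | ⟨h1, h2⟩
    · obtain ⟨t, ht, hvt, htop⟩ := h.top v hv h2
      have hL : v ∉ L₁ := fun h5 => h1 (hb.L₁_sub h5)
      refine ⟨t, by omega, (old_mem v hv h2 t ht).2 hvt, fun i hi hvb hne => ?_⟩
      by_cases hiN : i < c.N
      · rw [old_mem v hv h2 i hiN] at hvb
        obtain ⟨h3, h4⟩ := htop i hiN hvb hne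
        rw [par_old i hiN, old_mem v hv h2 _ ((h.par_lt i hiN h3).trans hiN)]
        exact ⟨h3, h4⟩
      · rw [par_new i (by omega), bag_j]
        refine ⟨by omega, ?_⟩
        rcases cases i hi with ⟨h3, -⟩ | h3 | rfl | rfl
        · omega
        · omega
        · rw [bag_N] at hvb
          exact (mem_union.1 (hb.X₁_sub hvb)).resolve_right hL
        · rw [bag_N1] at hvb; exact hb.X₂_sub hvb
    · have hf := h.fresh v hv (hpart v h1)
      by_cases hvX : v ∈ X₀
      · refine ⟨c.j, by omega, by rw [bag_j]; exact hvX, fun i hi hvb hne => ?_⟩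
        rcases cases i hi with ⟨h3, h4⟩ | h3 | rfl | rfl
        · rw [bag_old i h3 h4] at hvb; exact absurd hvb (hf.2 i h3)
        · exact absurd h3 hne
        · rw [par_new _ le_rfl, bag_j]; exact ⟨h.pos, hvX⟩
        · rw [par_new _ (by omega), bag_j]; exact ⟨by omega, hvX⟩
      · have hvL : v ∈ L₁ := (mem_union.1 h2).resolve_left hvX
        refine ⟨c.N, by omega, by rw [bag_N]; exact hb.L₁_X₁ hvL, fun i hi hvb hne => ?_⟩
        rcases cases i hi with ⟨h3, h4⟩ | rfl | h3 | rfl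
        · rw [bag_old i h3 h4] at hvb; exact absurd hvb (hf.2 i h3)
        · rw [bag_j] at hvb; exact absurd hvb hvX
        · exact absurd h3 hne
        · rw [bag_N1] at hvb; exact absurd (hb.X₂_sub hvb) hvX
  · have aux : ∀ u v, G.adjNat u v → c'.lab u = 0 → c'.lab v = 0 → u ∈ c.part n c.j →
        ∃ i < c'.N, u ∈ c'.bag i ∧ v ∈ c'.bag i := by
      intro u v hadj hu hv hup
      rcases lab_zero u hu with h1 | ⟨-, h1⟩
      · exact absurd hup h1.1
      have hvU := nbr u hup v hadj
      have hv' : v ∈ X₀ ∪ L₁ := by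
        rcases lab_zero v hv with ⟨h2, -⟩ | ⟨-, h2⟩
        · exact mem_union_left _ (hb.sub₀ ((mem_union.1 hvU).resolve_right h2))
        · exact h2
      by_cases huX : u ∈ X₀
      · by_cases hvX : v ∈ X₀
        · exact ⟨c.j, by omega, by rw [bag_j]; exact huX, by rw [bag_j]; exact hvX⟩
        · have hvL := (mem_union.1 hv').resolve_left hvX
          refine ⟨c.N, by omega, ?_, by rw [bag_N]; exact hb.L₁_X₁ hvL⟩
          rw [bag_N]
          rcases hb.closed₁ v (mem_union_right _ hvL) hvX u (SimpleGraph.adjNat_symm hadj)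
            (mem_union_right _ hup) with h2 | h2
          · exact h2
          · exact absurd huX h2.2
      · have huL := (mem_union.1 h1).resolve_left huX
        refine ⟨c.N, by omega, by rw [bag_N]; exact hb.L₁_X₁ huL, ?_⟩
        rw [bag_N]
        rcases hb.closed₁ u (mem_union_right _ huL) huX v hadj hvU with h2 | h2
        · exact h2
        · rcases mem_union.1 hv' with h3 | h3
          · exact absurd h3 h2.2
          · exact absurd h2.1 (hb.disj v h3).2
    intro u v hadj hu hv
    by_cases hup : u ∈ c.part n c.j
    · exact aux u v hadj hu hv hup
    by_cases hvp : v ∈ c.part n c.j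
    · obtain ⟨i, hi, h1, h2⟩ := aux v u (SimpleGraph.adjNat_symm hadj) hv hu hvp
      exact ⟨i, hi, h2, h1⟩
    · rw [lab_out u hup] at hu
      rw [lab_out v hvp] at hv
      obtain ⟨i, hi, h1, h2⟩ := h.edge u v hadj hu hv
      exact ⟨i, by omega, (old_mem u hadj.1 hu i hi).2 h1, (old_mem v hadj.2.1 hv i hi).2 h2⟩
  · intro u v i hadj hu hv
    rcases lab_ne u (by omega) with ⟨h1, h2⟩ | ⟨h1, h2, h3, h4, h5⟩ | ⟨h1, h2, h3, h4, h5⟩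
    · have hvp : v ∉ c.part n c.j := by
        intro hvp
        rcases mem_union.1 (nbr v hvp u (SimpleGraph.adjNat_symm hadj)) with h3 | h3
        · have := (hbagj u h3).2; omega
        · exact h1 h3
      rw [lab_out v hvp] at hv
      have hiN : i < c.N := by have := h.lab_le u hadj.1; omega
      rw [old_mem v hadj.2.1 hv i hiN]
      exact h.border u v i hadj (by omega) hv
    · obtain rfl : i = c.N := by omega
      rw [bag_N]
      rcases hb.closed₁ u (mem_union_left _ h4) h2 v hadj (nbr u h1 v hadj) with h6 | h6
      · exact h6
      · rcases lab_zero v hv with h7 | ⟨-, h7⟩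
        · exact absurd (hb.S₁_sub h6.1) h7.1
        · rcases mem_union.1 h7 with h8 | h8
          · exact absurd h8 h6.2
          · exact absurd h6.1 (hb.disj v h8).2
    · obtain rfl : i = c.N + 1 := by omega
      rw [bag_N1]
      rcases hb.closed₂ u h1 h2 h4 h3 v hadj (nbr u h1 v hadj) with h6 | h6
      · exact h6
      · rcases lab_zero v hv with h7 | ⟨-, h7⟩
        · exact absurd h6.1 h7.1
        · rcases mem_union.1 h7 with h8 | h8
          · exact absurd h8 h6.2.1
          · exact absurd h8 h6.2.2.2
  · have aux : ∀ u v, G.adjNat u v → c'.lab u ≠ 0 → c'.lab v ≠ 0 → v ∈ c.part n c.j →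
        u ∈ c.part n c.j := by
      intro u v hadj hu hv hvp
      rcases mem_union.1 (nbr v hvp u (SimpleGraph.adjNat_symm hadj)) with h3 | h3
      · exfalso
        have h4 := (hbagj u h3).2
        by_cases hup : u ∈ c.part n c.j
        · exact hpart u hup h4
        · rw [lab_out u hup] at hu; exact hu h4
      · exact h3
    intro u v hadj hu hv
    rcases lab_ne u hu with ⟨h1, h2⟩ | ⟨h1, h2, h3, h4, h5⟩ | ⟨h1, h2, h3, h4, h5⟩
    · have hvp : v ∉ c.part n c.j := fun hvp => h1 (aux u v hadj hu hv hvp)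
      rw [lab_out v hvp] at hv ⊢
      rw [h2] at hu ⊢
      exact h.inside u v hadj hu hv
    · rcases lab_ne v hv with ⟨k1, k2⟩ | ⟨k1, k2, k3, k4, k5⟩ | ⟨k1, k2, k3, k4, k5⟩
      · exact absurd (aux v u (SimpleGraph.adjNat_symm hadj) hv hu h1) k1
      · rw [h5, k5]
      · rcases hb.closed₁ u (mem_union_left _ h4) h2 v hadj (mem_union_right _ k1) with h6 | h6
        · rcases mem_union.1 (hb.X₁_sub h6) with h7 | h7
          · exact absurd h7 k2
          · exact absurd h7 k3
        · exact absurd h6.1 k4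
    · rcases lab_ne v hv with ⟨k1, k2⟩ | ⟨k1, k2, k3, k4, k5⟩ | ⟨k1, k2, k3, k4, k5⟩
      · exact absurd (aux v u (SimpleGraph.adjNat_symm hadj) hv hu h1) k1
      · rcases hb.closed₂ u h1 h2 h4 h3 v hadj (mem_union_right _ k1) with h6 | h6
        · exact absurd (hb.X₂_sub h6) k2
        · exact absurd k4 h6.2.2.1
      · rw [h5, k5]
  · intro v hv
    rcases mem_union.1 (show v ∈ c.L ∪ L₁ from hv) with h1 | h1
    · exact h.L_lt v h1
    · exact (hlabj v (hb.L₁_sub h1)).1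
  · intro v hv
    rcases mem_union.1 (show v ∈ c.L ∪ L₁ from hv) with h1 | h1
    · have hvn := h.L_lt v h1
      have hl : c.lab v = 0 := by
        by_contra hl; exact (h.fresh v hvn hl).1 h1
      have hvL : v ∉ L₁ := fun h2 => hpart v (hb.L₁_sub h2) hl
      obtain ⟨t, ht, h2, h3, h4⟩ := h.leaf v h1
      -- The node of an older base vertex has an empty part, so it is not `j` and gets no children.
      have htj : t ≠ c.j := by rintro rfl; exact hb.ne h4
      have hX : v ∉ X₀ := by
        intro h5
        have := (old_mem v hvn hl c.j hj).1 (by rw [bag_j]; exact h5)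
        exact htj ((h2 c.j hj).1 this).symm
      refine ⟨t, by omega, fun i hi => ?_, fun i hi h0 => ?_, ?_⟩
      · by_cases hiN : i < c.N
        · rw [old_mem v hvn hl i hiN]; exact h2 i hiN
        · constructor
          · intro h5
            rcases cases i hi with ⟨h6, -⟩ | h6 | rfl | rfl
            · omega
            · omega
            · rw [bag_N] at h5
              rcases mem_union.1 (hb.X₁_sub h5) with h7 | h7
              · exact absurd h7 hX
              · exact absurd h7 hvL
            · rw [bag_N1] at h5; exact absurd (hb.X₂_sub h5) hX
          · intro h5; omega
      · by_cases hiN : i < c.N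
        · rw [par_old i hiN]; exact h3 i hiN h0
        · rw [par_new i (by omega)]; exact htj.symm
      · rw [Finset.eq_empty_iff_forall_notMem]
        intro x hx
        have := (part_old t ht x hx).2
        rw [h4] at this; simp at this
    · have hS : S₁ = ∅ := by
        rcases hb.empty with h2 | h2
        · exact h2
        · rw [h2] at h1; simp at h1
      have hvp := hb.L₁_sub h1
      have hf := h.fresh v (hlabj v hvp).1 (hpart v hvp)
      refine ⟨c.N, by omega, fun i hi => ?_, fun i hi h0 => ?_, ?_⟩
      · constructor
        · intro h5
          rcases cases i hi with ⟨h6, h7⟩ | rfl | rfl | rfl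
          · rw [bag_old i h6 h7] at h5; exact absurd h5 (hf.2 i h6)
          · rw [bag_j] at h5; exact absurd h5 (hb.disj v h1).1
          · rfl
          · rw [bag_N1] at h5; exact absurd (hb.X₂_sub h5) (hb.disj v h1).1
        · rintro rfl; rw [bag_N]; exact hb.L₁_X₁ h1
      · by_cases hiN : i < c.N
        · rw [par_old i hiN]
          have := h.par_lt i hiN h0
          omega
        · rw [par_new i (by omega)]; omega
      · rw [Finset.eq_empty_iff_forall_notMem]
        intro x hx
        obtain ⟨h5, h6⟩ := mem_part.1 hx
        rcases lab_ne x (by omega) with ⟨k1, k2⟩ | ⟨k1, k2, k3, k4, k5⟩ | ⟨k1, k2, k3, k4, k5⟩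
        · have := h.lab_le x h5; omega
        · rw [hS] at k4; simp at k4
        · omega
  · have hLX : ∀ i < c.N, ∀ v ∈ c'.bag i ∩ (c.L ∪ L₁), v ∈ c.bag i ∩ c.L := by
      intro i hi v hv
      rw [mem_inter, mem_union] at hv
      rcases hv.2 with h1 | h1
      · have hvn := h.L_lt v h1
        have hl : c.lab v = 0 := by
          by_contra hl; exact (h.fresh v hvn hl).1 h1
        exact mem_inter.2 ⟨(old_mem v hvn hl i hi).1 hv.1, h1⟩
      · exfalso
        have hvp := hb.L₁_sub h1
        have hf := h.fresh v (hlabj v hvp).1 (hpart v hvp)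
        by_cases hij : i = c.j
        · rw [hij, bag_j] at hv; exact (hb.disj v h1).1 hv.1
        · rw [bag_old i hi hij] at hv; exact hf.2 i hi hv.1
    -- The bag of `j` contains no older base vertices, since their nodes have nothing left to treat.
    have hX0L : ∀ v ∈ X₀, v ∉ c.L := by
      intro v hv hvL
      rcases mem_union.1 (hb.X₀_sub hv) with h1 | h1
      · obtain ⟨t, ht, h2, h3, h4⟩ := h.leaf v hvL
        have := (h2 c.j hj).1 h1
        rw [← this] at h4; exact hb.ne h4
      · exact (h.fresh v (hlabj v h1).1 (hpart v h1)).1 hvL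
    intro i hi
    rcases cases i hi with ⟨h1, h2⟩ | rfl | rfl | rfl
    · exact (h.base i h1).mono hH fun v hv _ => hLX i h1 v hv
    · exact (h.base c.j hj).mono hH fun v hv _ => hLX c.j hj v hv
    · refine hb.base.mono hH fun v hv _ => ?_
      rw [bag_N] at hv
      obtain ⟨h1, h2⟩ := mem_inter.1 hv
      rcases mem_union.1 h2 with h3 | h3
      · rcases mem_union.1 (hb.X₁_sub h1) with h4 | h4
        · exact absurd h3 (hX0L v h4)
        · exact h4
      · exact h3
    · refine hb.base.mono hH fun v hv _ => ?_
      rw [bag_N1] at hv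
      obtain ⟨h1, h2⟩ := mem_inter.1 hv
      rcases mem_union.1 h2 with h3 | h3
      · exact absurd h3 (hX0L v (hb.X₂_sub h1))
      · exact h3
  · intro i hi
    show (c'.bag i \ (c.L ∪ L₁)).card ≤ _
    rcases cases i hi with ⟨h1, h2⟩ | rfl | rfl | rfl
    · rw [bag_old i h1 h2]
      exact (Finset.card_le_card (Finset.sdiff_subset_sdiff (Finset.Subset.refl _)
        Finset.subset_union_left)).trans (h.width i h1)
    · rw [bag_j]; exact (Finset.card_le_card Finset.sdiff_subset).trans hb.card₀
    · rw [bag_N]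
      exact (Finset.card_le_card (Finset.sdiff_subset_sdiff (Finset.Subset.refl _)
        Finset.subset_union_right)).trans hb.card₁
    · rw [bag_N1]
      have := Finset.card_le_card (Finset.sdiff_subset (s := X₂) (t := c.L ∪ L₁))
      have := hb.card₂
      omega
  · intro i hi hp
    rcases cases i hi with ⟨h1, h2⟩ | rfl | rfl | rfl
    · rw [bag_old i h1 h2]
      refine h.small i h1 fun h3 => hp ?_
      rw [Finset.eq_empty_iff_forall_notMem]
      intro x hx
      have := (part_old i h1 x hx).2
      rw [h3] at this; simp at this
    · obtain ⟨x, hx⟩ := Finset.nonempty_iff_ne_empty.2 hp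
      exact absurd rfl (part_old _ hj x hx).1
    · rw [bag_N]
      rcases hb.card₁' with h1 | h1
      · obtain ⟨x, hx⟩ := Finset.nonempty_iff_ne_empty.2 hp
        obtain ⟨h5, h6⟩ := mem_part.1 hx
        rcases lab_ne x (by omega) with ⟨k1, k2⟩ | ⟨k1, k2, k3, k4, k5⟩ | ⟨k1, k2, k3, k4, k5⟩
        · have := h.lab_le x h5; omega
        · rw [h1] at k4; simp at k4
        · omega
      · exact h1
    · rw [bag_N1]; exact hb.card₂
  · intro i hi
    by_cases hiN : i < c.N
    · refine (h.Q_mem i hiN).mono hH fun v hv _ => ?_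
      rw [mem_inter] at hv ⊢
      exact ⟨hv.1, (part_old i hiN v hv.2).2⟩
    · refine (h.Q_mem c.j hj).mono hH fun v hv _ => ?_
      rw [mem_inter] at hv ⊢
      refine ⟨hv.1, ?_⟩
      obtain ⟨h5, h6⟩ := mem_part.1 hv.2
      rcases lab_ne v (by omega) with ⟨k1, k2⟩ | ⟨k1, -⟩ | ⟨k1, -⟩
      · have := h.lab_le v h5; omega
      · exact k1
      · exact k1

end Conf

/-! ### Filling the bags and branching along a cut -/

open Finset

namespace Conf

variable {H : GraphClass} {n : ℕ} {G : SimpleGraph (Fin n)} {k : ℕ}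

/-- The bags of the pending nodes with untreated vertices have their full size. -/
def Filled (n k : ℕ) (c : Conf) : Prop :=
  ∀ i, c.j ≤ i → i < c.N → c.part n i ≠ ∅ → (c.bag i).card = 3 * k + 4

/-- The set `A` fills the bag of the node `i`. -/
structure Fills (n k : ℕ) (c : Conf) (i : ℕ) (A : Finset ℕ) : Prop where
  sub : A ⊆ c.part n i
  card : (c.bag i ∪ A).card ≤ 3 * k + 4 ∨ A = ∅
  full : c.part n i ⊆ A ∨ (c.bag i ∪ A).card = 3 * k + 4

/-- The number of nodes is bounded in terms of the number of untreated vertices. -/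
def Bounded (n : ℕ) (c : Conf) : Prop := c.N + 2 * c.todo n ≤ 2 * n + 1

/-- The configuration after branching at the node `j` and filling the bags of its children. -/
def split (n : ℕ) (c : Conf) (X₀ X₁ X₂ S₁ L₁ A₁ A₂ : Finset ℕ) : Conf :=
  ((c.branch n X₀ X₁ X₂ S₁ L₁).extend c.N A₁).extend (c.N + 1) A₂

theorem extend_filled {c : Conf} {i : ℕ} {A : Finset ℕ} (hA : c.Fills n k i A) :
    (c.extend i A).part n i ≠ ∅ → ((c.extend i A).bag i).card = 3 * k + 4 := by
  intro hne
  rw [part_extend] at hne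
  have : (c.extend i A).bag i = c.bag i ∪ A := by simp [extend]
  rw [this]
  rcases hA.full with h | h
  · exact absurd (sdiff_eq_empty_iff_subset.2 h) hne
  · exact h

/-- For the strict decrease of `todo`, take any vertex of the part below `j`. If it is still
untreated at the end, it is in the part of a child whose filling did not exhaust this part. The bag
of that child then grew to 3k+4 from at most 3k+3 vertices, so some other vertex was moved into it.
`Q` is unchanged, so `rest` cannot grow. -/
theorem split_inv {c : Conf} (h : c.Inv H G k) (hH : H.Hereditary) (hf : c.Filled n k)
    {X₀ X₁ X₂ S₁ L₁ A₁ A₂ : Finset ℕ} (hb : c.CanBranch H G k X₀ X₁ X₂ S₁ L₁)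
    (hX₁ : S₁ = ∅ ∨ X₁.card ≤ 3 * k + 3) (hX₂ : X₂.card ≤ 3 * k + 3)
    (hA₁ : (c.branch n X₀ X₁ X₂ S₁ L₁).Fills n k c.N A₁)
    (hA₂ : ((c.branch n X₀ X₁ X₂ S₁ L₁).extend c.N A₁).Fills n k (c.N + 1) A₂) :
    (c.split n X₀ X₁ X₂ S₁ L₁ A₁ A₂).Inv H G k ∧ (c.split n X₀ X₁ X₂ S₁ L₁ A₁ A₂).Filled n k ∧
      (c.split n X₀ X₁ X₂ S₁ L₁ A₁ A₂).todo n < c.todo n ∧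
      (c.split n X₀ X₁ X₂ S₁ L₁ A₁ A₂).rest n ≤ c.rest n := by
  have hj := hb.lt
  have hjN1 : c.N + 1 ≠ c.j := by omega
  unfold split
  set c₁ := c.branch n X₀ X₁ X₂ S₁ L₁ with hc₁
  have h₁ := branch_inv h hH hb
  have h₂ := extend_inv h₁ hH (i := c.N) (show c.N < c.N + 2 by omega) hA₁.sub hA₁.card
  have h₃ := extend_inv h₂ hH (i := c.N + 1) (show c.N + 1 < c.N + 2 by omega) hA₂.sub hA₂.card
  set c₂ := c₁.extend c.N A₁ with hc₂
  set c₃ := c₂.extend (c.N + 1) A₂ with hc₃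
  have l₁ : ∀ v, c₁.lab v ≠ 0 → (v ∉ c.part n c.j ∧ c₁.lab v = c.lab v) ∨
      (v ∈ c.part n c.j ∧ v ∈ S₁ ∧ c₁.lab v = c.N + 1) ∨ (v ∈ c.part n c.j ∧ c₁.lab v = c.N + 2) := by
    intro v hv
    by_cases hvp : v ∈ c.part n c.j
    · have e : c₁.lab v = if v ∈ X₀ ∪ L₁ then 0 else if v ∈ S₁ then c.N + 1 else c.N + 2 := by
        simp only [hc₁, branch, hvp, if_true]
      rw [e] at hv ⊢
      by_cases h1 : v ∈ X₀ ∪ L₁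
      · rw [if_pos h1] at hv; exact absurd rfl hv
      · rw [if_neg h1]
        by_cases h2 : v ∈ S₁
        · rw [if_pos h2]; exact Or.inr (Or.inl ⟨hvp, h2, rfl⟩)
        · rw [if_neg h2]; exact Or.inr (Or.inr ⟨hvp, rfl⟩)
    · exact Or.inl ⟨hvp, by simp only [hc₁, branch, hvp, if_false]⟩
  have ne₁ : ∀ v, c₁.lab v ≠ 0 → c.lab v ≠ 0 := by
    intro v hv
    rcases l₁ v hv with ⟨-, h1⟩ | ⟨h1, -⟩ | ⟨h1, -⟩
    · rwa [← h1]
    · have := (mem_part.1 h1).2; omega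
    · have := (mem_part.1 h1).2; omega
  have l₂ : ∀ v, c₂.lab v = if v ∈ A₁ then 0 else c₁.lab v := fun _ => rfl
  have l₃ : ∀ v, c₃.lab v = if v ∈ A₂ then 0 else c₂.lab v := fun _ => rfl
  have ne₂ : ∀ v, c₂.lab v ≠ 0 → c₁.lab v ≠ 0 := by
    intro v hv hv'; apply hv; rw [l₂, hv', ite_self]
  have ne₃ : ∀ v, c₃.lab v ≠ 0 → c₂.lab v ≠ 0 := by
    intro v hv hv'; apply hv; rw [l₃, hv', ite_self]
  have Qe : c₃.Q = c.Q := rfl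
  have bag_N : c₁.bag c.N = X₁ := by simp [hc₁, branch, hj.ne']
  have bag_N1 : c₂.bag (c.N + 1) = X₂ := by simp [hc₁, hc₂, extend, branch, hjN1]
  refine ⟨h₃, ?_, ?_, ?_⟩
  · intro i hi hiN hne
    have hi' : c.j + 1 ≤ i := hi
    have hiN' : i < c.N + 2 := hiN
    have hcase : i < c.N ∨ i = c.N ∨ i = c.N + 1 := by omega
    rcases hcase with h1 | rfl | rfl
    · have e : c₃.bag i = c.bag i := by
        have e1 : i ≠ c.N := h1.ne
        have e2 : i ≠ c.N + 1 := by omega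
        have e3 : i ≠ c.j := by omega
        simp [hc₃, hc₂, hc₁, extend, branch, e1, e2, e3]
      rw [e]
      obtain ⟨x, hx⟩ := Finset.nonempty_iff_ne_empty.2 hne
      obtain ⟨hxn, hxl⟩ := mem_part.1 hx
      have hx3 : c₃.lab x ≠ 0 := by omega
      have hx2 := ne₃ x hx3
      have e2 : c₃.lab x = c₂.lab x := by
        rw [l₃] at hx3 ⊢
        split_ifs at hx3 ⊢ with h2
        · exact absurd rfl hx3
        · rfl
      have e1 : c₂.lab x = c₁.lab x := by
        rw [l₂] at hx2 ⊢
        split_ifs at hx2 ⊢ with h2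
        · exact absurd rfl hx2
        · rfl
      refine hf i (by omega) h1 (Finset.nonempty_iff_ne_empty.1 ⟨x, mem_part.2 ⟨hxn, ?_⟩⟩)
      rcases l₁ x (ne₂ x hx2) with ⟨-, h2⟩ | ⟨-, -, h2⟩ | ⟨-, h2⟩ <;> omega
    · have e : c₃.bag c.N = c₂.bag c.N := by simp [hc₃, extend]
      rw [e]
      refine extend_filled hA₁ fun h2 => hne ?_
      rw [hc₃, part_extend]
      rw [← hc₂] at h2
      rw [h2, Finset.empty_sdiff]
    · exact extend_filled hA₂ hne
  · refine Finset.card_lt_card ⟨?_, ?_⟩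
    · intro v hv
      simp only [mem_filter] at hv ⊢
      exact ⟨hv.1, ne₁ v (ne₂ v (ne₃ v hv.2))⟩
    · suffices hs : ∃ v < n, c.lab v ≠ 0 ∧ c₃.lab v = 0 by
        obtain ⟨v, hv, h1, h2⟩ := hs
        intro hsub
        have := hsub (mem_filter.2 ⟨mem_range.2 hv, h1⟩)
        exact (mem_filter.1 this).2 h2
      obtain ⟨v, hv⟩ := Finset.nonempty_iff_ne_empty.2 hb.ne
      obtain ⟨hvn, hvl⟩ := mem_part.1 hv
      by_cases hv3 : c₃.lab v = 0
      · exact ⟨v, hvn, by omega, hv3⟩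
      have hv2 := ne₃ v hv3
      have e2 : c₃.lab v = c₂.lab v := by
        rw [l₃] at hv3 ⊢
        split_ifs at hv3 ⊢ with h2
        · exact absurd rfl hv3
        · rfl
      have e1 : c₂.lab v = c₁.lab v := by
        rw [l₂] at hv2 ⊢
        split_ifs at hv2 ⊢ with h2
        · exact absurd rfl hv2
        · rfl
      rcases l₁ v (ne₂ v hv2) with ⟨h1, -⟩ | ⟨-, h1, h2⟩ | ⟨-, h2⟩
      · exact absurd hv h1
      · rcases hA₁.full with h4 | h4
        · have : v ∈ A₁ := h4 (mem_part.2 ⟨hvn, h2⟩)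
          rw [l₂, if_pos this] at hv2; exact absurd rfl hv2
        · have hA : A₁.Nonempty := by
            rw [Finset.nonempty_iff_ne_empty]
            rintro rfl
            rw [union_empty, bag_N] at h4
            rcases hX₁ with h5 | h5
            · rw [h5] at h1; simp at h1
            · omega
          obtain ⟨a, ha⟩ := hA
          obtain ⟨h5, h6⟩ := mem_part.1 (hA₁.sub ha)
          refine ⟨a, h5, ne₁ a (by omega), ?_⟩
          rw [l₃, l₂, if_pos ha, ite_self]
      · rcases hA₂.full with h4 | h4
        · have : v ∈ A₂ := h4 (mem_part.2 ⟨hvn, by omega⟩)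
          rw [l₃, if_pos this] at hv3; exact absurd rfl hv3
        · have hA : A₂.Nonempty := by
            rw [Finset.nonempty_iff_ne_empty]
            rintro rfl
            rw [union_empty, bag_N1] at h4
            omega
          obtain ⟨a, ha⟩ := hA
          obtain ⟨h5, h6⟩ := mem_part.1 (hA₂.sub ha)
          refine ⟨a, h5, ne₁ a (ne₂ a (by omega)), ?_⟩
          rw [l₃, if_pos ha]
  · refine Finset.card_le_card fun v hv => ?_
    simp only [mem_filter] at hv ⊢
    exact ⟨hv.1, ne₁ v (ne₂ v (ne₃ v hv.2.1)), hv.2.2⟩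

theorem bag_lab {c : Conf} (h : c.Inv H G k) (hj : c.j < c.N) :
    ∀ v ∈ c.bag c.j, v < n ∧ v ∉ c.part n c.j := by
  intro v hv
  have hvn := h.bag_lt _ hj v hv
  refine ⟨hvn, fun h2 => ?_⟩
  exact (h.fresh v hvn (by rw [(mem_part.1 h2).2]; omega)).2 _ hj hv

/-- `M` and `Z \ M` have at least k+2, hence at most 2k+2 of the 3k+4 vertices each. With the at
most k+1 vertices of `Y`, both child bags have at most 3k+3 vertices, one less than a full bag. -/
theorem canBranch_of_balanced {c : Conf} (h : c.Inv H G k) (hj : c.j < c.N) (hf : c.Filled n k)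
    (hne : c.part n c.j ≠ ∅) (he : H.MemNat G ∅) {M C Y : Finset ℕ} (hM : M ⊆ c.bag c.j)
    (hM₁ : k + 2 ≤ M.card) (hM₂ : k + 2 ≤ (c.bag c.j \ M).card)
    (hcut : Linkage.IsCut G.adjNat n (balancedRole (c.part n c.j) (c.bag c.j) M) C Y (k + 2)) :
    c.CanBranch H G k (c.bag c.j ∪ Y) (M ∪ Y) ((c.bag c.j \ M) ∪ Y) (C ∩ c.part n c.j) ∅ ∧
      (M ∪ Y).card ≤ 3 * k + 3 ∧ ((c.bag c.j \ M) ∪ Y).card ≤ 3 * k + 3 := by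
  have hZ := hf c.j le_rfl hj hne
  have hbl := bag_lab h hj
  set S := c.part n c.j with hS
  set Z := c.bag c.j with hZd
  have hSn : ∀ v ∈ S, v < n := fun v hv => (mem_part.1 hv).1
  have r2 : ∀ v ∈ S, balancedRole S Z M v = 2 := fun v hv => by simp [balancedRole, hv]
  have r1 : ∀ v ∈ M, balancedRole S Z M v = 1 := fun v hv => by
    simp [balancedRole, (hbl v (hM hv)).2, hM hv, hv]
  have rz : ∀ v ∈ Z ∪ S, balancedRole S Z M v ≠ 0 := fun v hv => by
    rcases mem_union.1 hv with h1 | h1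
    · simp only [balancedRole, (hbl v h1).2, h1, if_true, if_false]; split_ifs <;> omega
    · rw [r2 v h1]; omega
  have rs : ∀ v, balancedRole S Z M v ≠ 0 → v ∈ Z ∪ S := fun v hv => by
    by_contra h1
    rw [mem_union, not_or] at h1
    simp [balancedRole, h1] at hv
  have rM : ∀ v, balancedRole S Z M v = 1 → v ∈ M := fun v hv => by
    unfold balancedRole at hv; split_ifs at hv <;> first | assumption | omega
  have rS : ∀ v, balancedRole S Z M v = 2 → v ∈ S := fun v hv => by
    unfold balancedRole at hv; split_ifs at hv <;> first | assumption | omega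
  have hYk : Y.card ≤ k + 1 := by have := hcut.card; omega
  have hsum := Finset.card_sdiff_add_card_eq_card hM
  have c1 := card_union_le M Y
  have c2 := card_union_le (Z \ M) Y
  have c0 := card_union_le Z Y
  have hYsub : Y ⊆ Z ∪ S := fun v hv => rs v (hcut.subY v hv).2
  -- The source side is closed up to `Y`; read backwards, a vertex of `S` outside `C ∪ Y` has no
  -- neighbour in `C`.
  have back : ∀ u ∈ S, u ∉ C → u ∉ Y → ∀ v, G.adjNat u v → v ∉ C := by
    intro u hu h1 h2 v hadj hv
    rcases hcut.closed v hv u (hSn u hu) (SimpleGraph.adjNat_symm hadj)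
      (rz u (mem_union_right _ hu)) with h3 | h3
    · exact h1 h3
    · exact h2 h3
  refine ⟨⟨hj, hne, subset_union_left, ?_, inter_subset_right, by simp, by simp, ?_, by simp, ?_,
    ?_, ?_, Or.inr rfl, he, by omega, by simp; omega, Or.inr (by omega), by omega⟩, by omega,
    by omega⟩
  · exact union_subset subset_union_left hYsub
  · rw [union_empty]; exact union_subset_union_left hM
  · exact union_subset_union_left sdiff_subset
  · intro u hu huX v hadj hv
    rw [union_empty, mem_inter] at hu
    rcases hcut.closed u hu.1 v hadj.2.1 hadj (rz v hv) with h1 | h1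
    · rcases (hcut.subC v h1).2 with h2 | h2
      · left; exact mem_union_left _ (rM v h2)
      · right
        have := rS v h2
        refine ⟨mem_inter.2 ⟨h1, this⟩, fun h3 => ?_⟩
        rcases mem_union.1 h3 with h4 | h4
        · exact (hbl v h4).2 this
        · exact hcut.disj v h1 h4
    · left; exact mem_union_right _ h1
  · intro u hu huX huS _ v hadj hv
    rw [mem_union, not_or] at huX
    have huC : u ∉ C := fun h1 => huS (mem_inter.2 ⟨h1, hu⟩)
    have hvC := back u hu huC huX.2 v hadj
    by_cases hvY : v ∈ Y
    · left; exact mem_union_right _ hvY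
    rcases mem_union.1 hv with h1 | h1
    · left
      refine mem_union_left _ (mem_sdiff.2 ⟨h1, fun h2 => ?_⟩)
      rcases hcut.src v hadj.2.1 (r1 v h2) with h3 | h3
      · exact hvC h3
      · exact hvY h3
    · right
      refine ⟨h1, fun h2 => ?_, fun h2 => hvC (mem_inter.1 h2).1, by simp⟩
      rcases mem_union.1 h2 with h4 | h4
      · exact (hbl v h4).2 h1
      · exact hvY h4

/-- Sinks are never on the source side of a cut, so `C ∩ S ⊆ Q ∩ S`, which gives a base component by
heredity. The search ignores `Z \ M`, but these vertices are in both child bags and cannot spoil the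
separation. The second child has at most (k+1) + (2k+2) vertices in its bag. -/
theorem canBranch_of_base {c : Conf} (h : c.Inv H G k) (hH : H.Hereditary) (hj : c.j < c.N)
    (hf : c.Filled n k) (hne : c.part n c.j ≠ ∅) {M C Y : Finset ℕ} (hM : M ⊆ c.bag c.j)
    (hM₂ : (c.bag c.j \ M).card ≤ k + 1)
    (hcut : Linkage.IsCut G.adjNat n (baseRole (c.part n c.j) c.Q (c.bag c.j) M) C Y
      (2 * k + 3)) :
    c.CanBranch H G k (c.bag c.j ∪ Y) (c.bag c.j ∪ Y ∪ C) ((c.bag c.j \ M) ∪ Y) ∅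
      (C ∩ c.part n c.j) ∧ ((c.bag c.j \ M) ∪ Y).card ≤ 3 * k + 3 := by
  have hZ := hf c.j le_rfl hj hne
  have hbl := bag_lab h hj
  have hQ := h.Q_mem c.j hj
  set S := c.part n c.j with hS
  set Z := c.bag c.j with hZd
  set Q := c.Q with hQd
  have hSn : ∀ v ∈ S, v < n := fun v hv => (mem_part.1 hv).1
  have r1 : ∀ v ∈ M, baseRole S Q Z M v = 1 := fun v hv => by
    simp [baseRole, (hbl v (hM hv)).2, hM hv, hv]
  have rz : ∀ v ∈ S, baseRole S Q Z M v ≠ 0 := fun v hv => by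
    simp only [baseRole, hv, if_true]; split_ifs <;> omega
  have rs : ∀ v, baseRole S Q Z M v ≠ 0 → v ∈ Z ∪ S := fun v hv => by
    by_contra h1
    rw [mem_union, not_or] at h1
    simp [baseRole, h1] at hv
  have rM : ∀ v, baseRole S Q Z M v = 1 → v ∈ M := fun v hv => by
    unfold baseRole at hv; split_ifs at hv <;> first | assumption | omega
  have rS : ∀ v, baseRole S Q Z M v = 2 → v ∈ S ∧ v ∈ Q := fun v hv => by
    unfold baseRole at hv
    split_ifs at hv with h1 h2 <;> first | exact ⟨h1, h2⟩ | omega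
  have hYk : Y.card ≤ 2 * k + 2 := by have := hcut.card; omega
  have c2 := card_union_le (Z \ M) Y
  have c0 := card_union_le Z Y
  have hYsub : Y ⊆ Z ∪ S := fun v hv => rs v (hcut.subY v hv).2
  have hCcase : ∀ v ∈ C, v ∈ M ∨ (v ∈ S ∧ v ∈ Q) := fun v hv =>
    (hcut.subC v hv).2.imp (rM v) (rS v)
  have hdisj : ∀ v ∈ C ∩ S, v ∉ Z ∪ Y := by
    intro v hv h2
    rw [mem_inter] at hv
    rcases mem_union.1 h2 with h4 | h4
    · exact (hbl v h4).2 hv.2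
    · exact hcut.disj v hv.1 h4
  have back : ∀ u ∈ S, u ∉ C → u ∉ Y → ∀ v, G.adjNat u v → v ∉ C := by
    intro u hu h1 h2 v hadj hv
    rcases hcut.closed v hv u (hSn u hu) (SimpleGraph.adjNat_symm hadj) (rz u hu) with h3 | h3
    · exact h1 h3
    · exact h2 h3
  refine ⟨⟨hj, hne, subset_union_left, ?_, by simp, inter_subset_right, ?_, ?_, ?_, ?_, ?_, ?_,
    Or.inl rfl, ?_, by omega, ?_, Or.inl rfl, by omega⟩, by omega⟩
  · exact union_subset subset_union_left hYsub
  · intro v hv; exact ⟨hdisj v hv, by simp⟩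
  · refine union_subset subset_union_left fun v hv => ?_
    rcases hCcase v hv with h1 | h1
    · exact mem_union_left _ (mem_union_left _ (hM h1))
    · exact mem_union_right _ (mem_inter.2 ⟨hv, h1.1⟩)
  · exact fun v hv => mem_union_right _ (mem_inter.1 hv).1
  · exact union_subset_union_left sdiff_subset
  · intro u hu huX v hadj hv
    rw [empty_union, mem_inter] at hu
    left
    rcases mem_union.1 hv with h1 | h1
    · exact mem_union_left _ (mem_union_left _ h1)
    · rcases hcut.closed u hu.1 v hadj.2.1 hadj (rz v h1) with h1 | h1
      · exact mem_union_right _ h1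
      · exact mem_union_left _ (mem_union_right _ h1)
  · intro u hu huX _ huS v hadj hv
    rw [mem_union, not_or] at huX
    have huC : u ∉ C := fun h1 => huS (mem_inter.2 ⟨h1, hu⟩)
    have hvC := back u hu huC huX.2 v hadj
    by_cases hvY : v ∈ Y
    · left; exact mem_union_right _ hvY
    rcases mem_union.1 hv with h1 | h1
    · left
      refine mem_union_left _ (mem_sdiff.2 ⟨h1, fun h2 => ?_⟩)
      rcases hcut.src v hadj.2.1 (r1 v h2) with h3 | h3
      · exact hvC h3
      · exact hvY h3
    · right
      refine ⟨h1, fun h2 => ?_, by simp, fun h2 => hvC (mem_inter.1 h2).1⟩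
      rcases mem_union.1 h2 with h4 | h4
      · exact (hbl v h4).2 h1
      · exact hvY h4
  · refine hQ.mono hH fun v hv _ => ?_
    rw [mem_inter] at hv ⊢
    rcases hCcase v hv.1 with h1 | h1
    · exact absurd hv.2 (hbl v (hM h1)).2
    · exact ⟨h1.2, hv.2⟩
  · refine le_trans (Finset.card_le_card (t := Z ∪ Y) fun v hv => ?_) (by omega)
    rw [mem_sdiff, mem_inter, not_and] at hv
    rcases mem_union.1 hv.1 with h1 | h1
    · exact h1
    · rcases hCcase v h1 with h2 | h2
      · exact mem_union_left _ (hM h2)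
      · exact absurd h2.1 (hv.2 h1)

/-- Adding `E` to `Q` takes `E.card` vertices out of the count, and discarding `D` brings back at
most `D.card` of them. -/
theorem commit_rest {c : Conf} {E D : Finset ℕ} (hE : E ⊆ c.part n c.j) (hEQ : ∀ v ∈ E, v ∉ c.Q)
    (hD : D.card < E.card) : ({ c with Q := (c.Q ∪ E) \ D } : Conf).rest n < c.rest n := by
  unfold rest
  dsimp only
  have h1 : ((range n).filter fun v => c.lab v ≠ 0 ∧ v ∉ c.Q).card =
      ((range n).filter fun v => c.lab v ≠ 0 ∧ v ∉ c.Q ∪ E).card + E.card := by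
    rw [← card_union_of_disjoint]
    · congr 1
      ext v
      simp only [mem_filter, mem_union, mem_range]
      constructor
      · rintro ⟨h1, h2, h3⟩
        by_cases hv : v ∈ E
        · exact Or.inr hv
        · left; exact ⟨h1, h2, by tauto⟩
      · rintro (h1 | h1)
        · tauto
        · have := mem_part.1 (hE h1)
          exact ⟨this.1, by omega, hEQ v h1⟩
    · rw [Finset.disjoint_left]
      intro v; simp only [mem_filter, mem_union]; tauto
  have h2 : ((range n).filter fun v => c.lab v ≠ 0 ∧ v ∉ (c.Q ∪ E) \ D) ⊆
      ((range n).filter fun v => c.lab v ≠ 0 ∧ v ∉ c.Q ∪ E) ∪ D := by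
    intro v
    simp only [mem_filter, mem_sdiff, mem_union, mem_range]
    by_cases hv : v ∈ D <;> simp [hv]
  have h3 := (Finset.card_le_card h2).trans (card_union_le _ _)
  omega

/-! ### The output of a finished configuration -/

/-- The list of the elements of a set of numbers below `n`, preceded by its length. -/
def rowCode (n : ℕ) (S : Finset ℕ) : List ℕ :=
  (S.filter (· < n)).card :: (List.range n).filter (· ∈ S)

/-- The output for a finished decomposition. -/
def out (n : ℕ) (c : Conf) : List ℕ :=
  [1, c.N, 0] ++ (List.range c.N).map c.par ++ rowCode n c.L ++
    (List.range c.N).flatMap fun i => rowCode n (c.bag i)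

theorem rowCode_eq (S : Finset ℕ) :
    rowCode n S = codeList ((List.finRange n).filter fun v : Fin n => (v : ℕ) ∈ S) := by
  have h : (List.range n).filter (· ∈ S) =
      ((List.finRange n).filter fun v : Fin n => (v : ℕ) ∈ S).map Fin.val := by
    rw [← List.map_coe_finRange_eq_range, List.filter_map]; rfl
  have hc : (S.filter (· < n)).card = ((List.range n).filter (· ∈ S)).length := by
    rw [← List.toFinset_card_of_nodup (List.nodup_range.filter _)]
    congr 1
    ext v; simp [and_comm]
  rw [rowCode, codeList, hc, h, List.length_map]

theorem exists_decomposition {c : Conf} (h : c.Inv H G k) (hj : c.j = c.N) :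
    ∃ D : TreeHDecomposition H G, D.width ≤ 5 * k + 5 ∧ D.nodes = c.N ∧
      IsDecompositionCode D (c.out n) := by
  classical
  -- A pending label would be larger than `j = N`, but labels are at most `N`. So everything is
  -- treated.
  have hlab : ∀ v < n, c.lab v = 0 := by
    intro v hv
    by_contra h0
    have := h.lab_gt v hv h0
    have := h.lab_le v hv
    omega
  have hdown := h.par_lt
  let D : TreeHDecomposition H G :=
    { nodes := c.N
      T := parentTree c.N c.par
      isTree := parentTree_isTree hdown h.pos
      root := ⟨0, h.pos⟩
      χ := fun t => univ.filter fun v : Fin n => (v : ℕ) ∈ c.bag t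
      L := univ.filter fun v : Fin n => (v : ℕ) ∈ c.L
      connected := by
        intro v
        obtain ⟨t, ht, hvt, htop⟩ := h.top v v.2 (hlab v v.2)
        refine parentTree_connected_induce hdown _ ⟨t, ht⟩ (by simpa using hvt) ?_
        intro i hi hne
        have hi' : (v : ℕ) ∈ c.bag i := by simpa using hi
        obtain ⟨h0, hp⟩ := htop i i.2 hi' fun h1 => hne (Fin.ext h1)
        exact ⟨h0, ⟨c.par i, (hdown i i.2 h0).trans i.2⟩, by simpa using hp, rfl⟩
      edge := by
        intro u v hadj
        obtain ⟨i, hi, h1, h2⟩ := h.edge u v ⟨u.2, v.2, hadj⟩ (hlab u u.2) (hlab v v.2)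
        exact ⟨⟨i, hi⟩, by simpa using h1, by simpa using h2⟩
      leaf := by
        intro v hv
        obtain ⟨t, ht, h1, h2, -⟩ := h.leaf v (by simpa using hv)
        refine ⟨⟨t, ht⟩, fun t' => ?_, fun t' hc => ?_⟩
        · simp only [mem_filter, mem_univ, true_and, h1 t' t'.2, Fin.ext_iff]
        · rw [isChild_parentTree hdown] at hc
          exact h2 t' t'.2 hc.1 hc.2
      base := by
        intro t
        have := h.base t t.2
        unfold GraphClass.MemNat at this
        convert this using 3 <;> (ext v; simp) }
  refine ⟨D, ?_, rfl, ?_⟩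
  · refine Finset.sup_le fun t _ => ?_
    have h1 := h.width t t.2
    have h2 : (D.χ t \ D.L).card ≤ (c.bag t \ c.L).card := by
      refine Finset.card_le_card_of_injOn (fun v : Fin n => (v : ℕ)) ?_ (by
        intro a _ b _ hab; exact Fin.ext hab)
      intro v hv
      simpa [D] using hv
    omega
  · refine ⟨fun t => ⟨c.par t, ?_⟩, (List.finRange n).filter fun v => (v : ℕ) ∈ c.L,
      fun t => (List.finRange n).filter fun v => (v : ℕ) ∈ c.bag t, ?_, ?_, ⟨?_, ?_⟩, ?_, ?_⟩
    · by_cases h0 : 0 < (t : ℕ)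
      · exact (hdown t t.2 h0).trans t.2
      · have : (t : ℕ) = 0 := by omega
        rw [this, h.par_zero]; exact h.pos
    · exact Fin.ext h.par_zero
    · intro t ht
      refine (isChild_parentTree hdown h.pos).2 ⟨?_, rfl⟩
      exact Nat.pos_of_ne_zero fun h0 => ht (Fin.ext h0)
    · exact (List.nodup_finRange n).filter _
    · ext v; simp [D]
    · intro t
      refine ⟨(List.nodup_finRange n).filter _, ?_⟩
      ext v; simp [D]
    · rw [out, rowCode_eq]
      congr 1
      · congr 2
        exact (List.ofFn_eq_map (f := fun t : Fin c.N => c.par t)).symm ▸ by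
          rw [← List.map_coe_finRange_eq_range, List.map_map]; rfl
      · rw [List.flatMap, ← List.map_coe_finRange_eq_range, List.map_map, List.ofFn_eq_map]
        congr 1
        refine List.map_congr_left fun t _ => ?_
        simp only [Function.comp, rowCode_eq]

end Conf

/-! ### Loops over the vertices -/

namespace WordRAM

variable {E : Machine}

/-- Set the cells `v < n` of array `a` to the value of an expression; `v` is register `4`. -/
def Cmd.fill (a : ℕ) (e : Expr) : Cmd := Cmd.for 4 1 (.store a (ρ 4) e)

/-- Sum the values of an expression for `v < n` in register `x`; `v` is register `4`. -/
def Cmd.sum (x : ℕ) (e : Expr) : Cmd := x ::= κ 0 ;; Cmd.for 4 1 (x ::= (ρ x +ᵣ e))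

/-- When cell `i` is computed, the cells from `i` on still have their old values, so the expression
may read the array that is being overwritten. -/
theorem WP.fill {a : ℕ} {e : Expr} {s : State} {T K : ℕ} {P : State → Prop} (n : ℕ) (f : ℕ → ℕ)
    (hn : s.reg 1 = n) (hB : n < E.B) (hM : n ≤ E.M)
    (step : ∀ i s', i < n → Frame (Cmd.fill a e) s s' → s'.reg 4 = i →
      (∀ v, i ≤ v → s'.arr a v = s.arr a v) → e.Ok E.B E.M s' ∧ e.eval s' = f i)
    (post : ∀ s', Frame (Cmd.fill a e) s s' → (∀ v < n, s'.arr a v = f v) →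
      (∀ v, n ≤ v → s'.arr a v = s.arr a v) → P s')
    (hT : (e.cost + 10) * (n + 1) ≤ T) : WP E (Cmd.fill a e) s T K P := by
  refine WP.for_const n (fun i s' => (∀ v < i, s'.arr a v = f v) ∧
    ∀ v, i ≤ v → s'.arr a v = s.arr a v) (e.cost + 2) rfl rfl (by decide) hn hB
    (by simp) ?_ ?_ ?_
  · rintro i s' hi hf hx ⟨h1, h2⟩
    obtain ⟨hok, hev⟩ := step i s' hi hf hx h2
    refine WP.simple ?_ (by simp [Cmd.cst, Expr.cost]; omega) fun _ => ?_
    · exact ⟨by simp [Expr.Ok, hx]; omega, hok, by simp [Expr.eval, hx]; omega⟩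
    · simp only [Cmd.run, State.setReg_arr, State.setArr_arr, if_true, Expr.eval, hx, hev]
      refine ⟨fun v hv => ?_, fun v hv => ?_⟩
      · by_cases hvi : v = i
        · subst hvi; simp
        · rw [Function.update_of_ne hvi]; exact h1 v (by omega)
      · rw [Function.update_of_ne (by omega)]; exact h2 v (by omega)
  · rintro s' hf - ⟨h1, h2⟩
    exact post s' hf h1 h2
  · refine le_trans ?_ hT; nlinarith

theorem WP.sum {x : ℕ} {e : Expr} {s : State} {T K : ℕ} {P : State → Prop} (n : ℕ) (f : ℕ → ℕ)
    (hx1 : x ≠ 1) (hx4 : x ≠ 4)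
    (hn : s.reg 1 = n) (hB : n < E.B) (hsum : ∑ v ∈ Finset.range n, f v < E.B)
    (step : ∀ i s', i < n → Frame (Cmd.sum x e) s s' → s'.reg 4 = i →
      e.Ok E.B E.M s' ∧ e.eval s' = f i)
    (post : ∀ s', Frame (Cmd.sum x e) s s' → s'.reg x = ∑ v ∈ Finset.range n, f v → P s')
    (hT : (e.cost + 14) * (n + 1) ≤ T) : WP E (Cmd.sum x e) s T K P := by
  have hx1' : (x == 1) = false := by simpa using hx1
  have hx4' : (x == 4) = false := by simpa using hx4
  have hfr : ∀ s₁ s₂, Frame (Cmd.for 4 1 (x ::= (ρ x +ᵣ e))) s₁ s₂ → Frame (Cmd.sum x e) s₁ s₂ :=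
    fun s₁ s₂ h => h.mono (by simp +contextual [Cmd.sum, Cmd.wr]) (by simp +contextual [Cmd.sum, Cmd.wa])
  have hf0 : Frame (Cmd.sum x e) s (s.setReg x 0) := by
    refine ⟨fun y hy => ?_, fun _ _ => rfl⟩
    have : y ≠ x := by rintro rfl; simp [Cmd.sum, Cmd.wr] at hy
    simp [this]
  refine WP.seq (T₁ := 2) (K₁ := 0) (Q := fun s' => s' = s.setReg x 0)
    (WP.simple (by simp [Cmd.Safe, Expr.Ok]; omega) (by simp [Cmd.cst, Expr.cost])
      (fun _ => by simp [Cmd.run, Expr.eval])) ?_ (T₂ := n * (e.cost + 3 + 8) + 6)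
    (K₂ := 0) (by nlinarith) (by omega)
  rintro _ - rfl
  have hle : ∀ i, i < n → ∑ v ∈ Finset.range i, f v + f i ≤ ∑ v ∈ Finset.range n, f v := by
    intro i hi
    rw [← Finset.sum_range_succ]
    exact Finset.sum_le_sum_of_subset (by simpa using hi)
  refine WP.for_const n (fun i s' => s'.reg x = ∑ v ∈ Finset.range i, f v) (e.cost + 3)
    (by simpa [Cmd.wr] using hx4) (by simpa [Cmd.wr] using hx1) (by decide)
    (by simpa [hx1.symm] using hn) hB
    (by simp [hx4]) ?_ ?_ le_rfl
  · rintro i s' hi hf hx h1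
    obtain ⟨hok, hev⟩ := step i s' hi (hf0.trans (hfr _ _ hf)) hx
    have := hle i hi
    refine WP.simple ?_ (by simp [Cmd.cst, Expr.cost]; omega) fun _ => ?_
    · simp only [Cmd.Safe, Expr.Ok, Expr.eval, Op.eval, hok, hev, h1, true_and]
      exact ⟨by omega, by omega⟩
    · simp [Cmd.run, Expr.eval, Op.eval, h1, hev, hx4, Finset.sum_range_succ]
  · rintro s' hf - h1
    exact post s' (hf0.trans (hfr _ _ hf)) h1

/-- A sequence whose first part has neither loops nor queries. -/
theorem WP.step {c d : Cmd} {s : State} {T₂ T K : ℕ} {P : State → Prop}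
    (hs : c.Safe E.B E.M s) (h : Frame c s (c.run s) → WP E d (c.run s) T₂ K P)
    (hT : c.cst + T₂ ≤ T) : WP E (c ;; d) s T K P := by
  refine WP.seq (T₁ := c.cst) (K₁ := 0) (Q := fun s' => s' = c.run s)
    (WP.simple hs le_rfl fun _ => rfl) ?_ hT (Nat.zero_add K).le
  rintro _ hf rfl
  exact h hf

/-- The truth value of `a < b`. -/
def ltN (a b : ℕ) : ℕ := if a < b then 1 else 0

/-- The truth value of `a = b`. -/
def eqN (a b : ℕ) : ℕ := if a = b then 1 else 0

@[simp] theorem ltN_eq_zero {a b : ℕ} : ltN a b = 0 ↔ b ≤ a := by simp [ltN]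

@[simp] theorem eqN_eq_zero {a b : ℕ} : eqN a b = 0 ↔ a ≠ b := by simp [eqN]

theorem ltN_lt {a b B : ℕ} (hB : 1 < B) : ltN a b < B := by unfold ltN; split_ifs <;> omega

theorem eqN_lt {a b B : ℕ} (hB : 1 < B) : eqN a b < B := by unfold eqN; split_ifs <;> omega

theorem eqN_le (a b : ℕ) : eqN a b ≤ 1 := by unfold eqN; split_ifs <;> omega

theorem ltN_le (a b : ℕ) : ltN a b ≤ 1 := by unfold ltN; split_ifs <;> omega

@[simp] theorem eqN_self (a : ℕ) : eqN a a = 1 := by simp [eqN]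

theorem eqN_of_ne {a b : ℕ} (h : a ≠ b) : eqN a b = 0 := by simpa using h

@[simp] theorem Op.eval_add (a b : ℕ) : Op.add.eval a b = a + b := rfl
@[simp] theorem Op.eval_sub (a b : ℕ) : Op.sub.eval a b = a - b := rfl
@[simp] theorem Op.eval_mul (a b : ℕ) : Op.mul.eval a b = a * b := rfl
@[simp] theorem Op.eval_lt (a b : ℕ) : Op.lt.eval a b = ltN a b := rfl
@[simp] theorem Op.eval_eq (a b : ℕ) : Op.eq.eval a b = eqN a b := rfl

attribute [simp] Expr.eval Expr.Ok Expr.cost Cmd.cst Cmd.Safe Cmd.run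

end WordRAM

/-! ### The input graph -/

open Finset WordRAM

/-- The input graph with its adjacency lists, where `nb u 0 = u` and `nb u 1, …, nb u (dg u)` are the
neighbours of `u`, the parameter, and the machine. -/
structure Ctx where
  n : ℕ
  k : ℕ
  m : ℕ
  adj : ℕ → ℕ → Prop
  dg : ℕ → ℕ
  off : ℕ → ℕ
  nb : ℕ → ℕ → ℕ
  E : Machine

namespace Ctx

/-- The convention `nb u 0 = u` reflects that a left vertex is joined to its own right copy.
`cube_le` makes room for the matrix of bags, with up to 2n+1 rows and n columns, and for encodings
of quadratic size; `k_le` lets small multiples of `n` and `k` fit into a word. -/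
structure Valid (X : Ctx) : Prop where
  nb_lt : ∀ u < X.n, ∀ i ≤ X.dg u, X.nb u i < X.n
  nb_zero : ∀ u, X.nb u 0 = u
  nb_adj : ∀ u < X.n, ∀ w, X.adj u w ↔ ∃ i, 0 < i ∧ i ≤ X.dg u ∧ X.nb u i = w
  nb_inj : ∀ u < X.n, ∀ i ≤ X.dg u, ∀ j ≤ X.dg u, X.nb u i = X.nb u j → i = j
  sum_dg : ∑ u ∈ range X.n, X.dg u ≤ 2 * X.m
  off_lt : ∀ u < X.n, X.off u + X.dg u < X.E.M
  cube_le : 64 * (X.n + 2) ^ 3 ≤ X.E.M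
  M_le : X.E.M ≤ X.E.B
  k_le : 512 * (X.n + X.k + 2) ≤ X.E.B

variable {X : Ctx}

theorem Valid.n_le (h : X.Valid) : 256 * (X.n + 2) ≤ X.E.M := by
  have := h.cube_le
  nlinarith [Nat.zero_le X.n, Nat.zero_le (X.n * X.n), Nat.zero_le (X.n * X.n * X.n)]

theorem Valid.cell_lt (h : X.Valid) {i v : ℕ} (hi : i ≤ 2 * X.n + 2) (hv : v ≤ X.n) :
    i * X.n + v < X.E.M := by
  have := h.cube_le
  have h1 : i * X.n ≤ (2 * X.n + 2) * X.n := Nat.mul_le_mul_right _ hi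
  nlinarith [Nat.zero_le X.n, Nat.zero_le (X.n * X.n), Nat.zero_le (X.n * X.n * X.n)]

theorem Valid.dg_lt (h : X.Valid) {u : ℕ} (hu : u < X.n) : X.dg u < X.n := by
  have := Finset.card_le_card_of_injOn (s := range (X.dg u + 1)) (t := range X.n) (X.nb u)
    (fun i hi => by simpa using h.nb_lt u hu i (by simpa [Nat.lt_succ_iff] using hi))
    (fun i hi j hj hij => h.nb_inj u hu i (by simpa [Nat.lt_succ_iff] using hi) j
      (by simpa [Nat.lt_succ_iff] using hj) hij)
  simpa using this

/-- The state contains the input and the positions of the adjacency lists. -/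
structure Has (X : Ctx) (s : State) : Prop where
  k : s.reg 0 = X.k
  n : s.reg 1 = X.n
  off : ∀ u < X.n, s.arr 2 u = X.off u
  dg : ∀ u < X.n, s.arr 0 (X.off u) = X.dg u
  nb : ∀ u < X.n, ∀ i, 0 < i → i ≤ X.dg u → s.arr 0 (X.off u + i) = X.nb u i

theorem Has.of_eq {s s' : State} (h : X.Has s) (h0 : s'.reg 0 = s.reg 0) (h1 : s'.reg 1 = s.reg 1)
    (h2 : s'.arr 0 = s.arr 0) (h3 : s'.arr 2 = s.arr 2) : X.Has s' :=
  ⟨h0.trans h.k, h1.trans h.n, fun u hu => by rw [h3]; exact h.off u hu,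
    fun u hu => by rw [h2]; exact h.dg u hu, fun u hu i h0 hi => by rw [h2]; exact h.nb u hu i h0 hi⟩

/-- The program does not write the input. -/
def _root_.WordRAM.Cmd.keeps (c : Cmd) : Bool := !(c.wr 0 || c.wr 1 || c.wa 0 || c.wa 2)

theorem Has.frame {s s' : State} (h : X.Has s) {c : Cmd} (hf : Frame c s s')
    (hc : c.keeps = true) : X.Has s' := by
  simp only [Cmd.keeps, Bool.not_eq_true', Bool.or_eq_false_iff] at hc
  exact h.of_eq (hf.reg 0 hc.1.1.1) (hf.reg 1 hc.1.1.2) (hf.arr 0 hc.1.2) (hf.arr 2 hc.2)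

/-- The entries of the queue are distinct, so the work for them is charged to distinct vertices.
This makes a search linear in n+m. -/
theorem sum_dg_queue_le {f : ℕ → ℕ} {n q : ℕ} {queue : ℕ → ℕ} (hlt : ∀ i < q, queue i < n)
    (hinj : ∀ i < q, ∀ j < q, queue i = queue j → i = j) :
    ∑ i ∈ range q, f (queue i) ≤ ∑ u ∈ range n, f u := by
  rw [← Finset.sum_image (f := f) (g := queue) (s := range q)
    (fun i hi j hj hij => hinj i (by simpa using hi) j (by simpa using hj) hij)]
  refine Finset.sum_le_sum_of_subset fun u hu => ?_
  obtain ⟨i, hi, rfl⟩ := Finset.mem_image.1 hu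
  simpa using hlt i (by simpa using hi)

end Ctx

/-! ### Augmenting paths -/

open Finset WordRAM

namespace Prog

/-- Visit the right vertex in register `16` from the left vertex at the queue position in
register `11`. -/
def visit : Cmd :=
  .cond (.arr 12 (ρ 16) =ᵣ κ 1) .skip (.cond (κ 1 <ᵣ .arr 9 (ρ 16))
    (.store 12 (ρ 16) (κ 1) ;; .store 14 (ρ 16) (ρ 11) ;;
      .cond (.arr 10 (ρ 16) =ᵣ ρ 1) (10 ::= ρ 16)
        (.store 15 (ρ 12) (ρ 16) ;; .store 16 (ρ 12) (.arr 10 (ρ 16)) ;;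
          .store 13 (.arr 10 (ρ 16)) (κ 1) ;; 12 ::= ρ 12 +ᵣ κ 1)) .skip)

/-- Load the entry with the index in register `14` of the adjacency list of register `13`. -/
def nbr : Cmd := .cond (ρ 14) (16 ::= .arr 0 (.arr 2 (ρ 13) +ᵣ ρ 14)) (16 ::= ρ 13)

/-- Handle the next vertex of the queue. -/
def scan : Cmd :=
  13 ::= .arr 16 (ρ 11) ;; 15 ::= (.arr 0 (.arr 2 (ρ 13)) +ᵣ κ 1) ;;
    Cmd.for 14 15 (nbr ;; visit) ;; 11 ::= ρ 11 +ᵣ κ 1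

/-- Start the queue with the unused sources. -/
def start : Cmd :=
  Cmd.fill 12 (κ 0) ;; Cmd.fill 13 (κ 0) ;; 12 ::= κ 0 ;;
    Cmd.for 4 1 (.cond ((.arr 9 (ρ 4) =ᵣ κ 1) *ᵣ (.arr 11 (ρ 4) =ᵣ κ 0))
      (.store 16 (ρ 12) (ρ 4) ;; .store 15 (ρ 12) (ρ 1) ;; .store 13 (ρ 4) (κ 1) ;;
        12 ::= ρ 12 +ᵣ κ 1) .skip) ;;
    11 ::= κ 0 ;; 10 ::= ρ 1

def bfs : Cmd := start ;; .loop ((ρ 11 <ᵣ ρ 12) *ᵣ (ρ 10 =ᵣ ρ 1)) scan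

/-- Flip the path that ends at the right vertex in register `10`. -/
def augment : Cmd :=
  16 ::= ρ 10 ;;
    .loop (ρ 16 <ᵣ ρ 1) (14 ::= .arr 14 (ρ 16) ;; 13 ::= .arr 16 (ρ 14) ;;
      .store 10 (ρ 16) (ρ 13) ;; 16 ::= .arr 15 (ρ 14)) ;;
    .store 11 (ρ 13) (κ 1) ;; 9 ::= ρ 9 +ᵣ κ 1

/-- Look for as many disjoint paths as register `8` says. The result in register `21` is `1` if the
search finds a cut, and `2` if it finds the paths. -/
def flow : Cmd :=
  Cmd.fill 11 (κ 0) ;; Cmd.fill 10 ((.arr 9 (ρ 4) =ᵣ κ 2) *ᵣ ρ 4 +ᵣ (κ 1 -ᵣ (.arr 9 (ρ 4) =ᵣ κ 2)) *ᵣ ρ 1) ;;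
    9 ::= κ 0 ;; 21 ::= κ 0 ;;
    .loop (ρ 21 =ᵣ κ 0)
      (.cond (ρ 9 =ᵣ ρ 8) (21 ::= κ 2) (bfs ;; .cond (ρ 10 =ᵣ ρ 1) (21 ::= κ 1) augment))

end Prog

namespace Ctx

variable {X : Ctx}

/-- The state contains a matching. -/
structure FlowOk (X : Ctx) (s : State) : Prop where
  has : X.Has s
  role_le : ∀ v < X.n, s.arr 9 v ≤ 3
  used_le : ∀ v < X.n, s.arr 11 v ≤ 1
  mR_le : ∀ v < X.n, s.arr 10 v ≤ X.n
  matching : Linkage.Matching X.adj X.n (s.arr 9) (s.arr 11) (s.arr 10) X.n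

/-- The state contains a breadth-first search. -/
structure BfsOk (X : Ctx) (s : State) : Prop extends X.FlowOk s where
  search : Linkage.Search X.adj X.n (s.arr 9) (s.arr 11) (s.arr 10) (s.arr 12) (s.arr 13) (s.arr 14)
    (s.arr 15) (s.arr 16) (s.reg 12) (s.reg 10)
  VR_le : ∀ v < X.n, s.arr 12 v ≤ 1
  VL_le : ∀ v < X.n, s.arr 13 v ≤ 1

/-- The right vertices that can be reached from the first `q` entries of the queue are visited. -/
def Closed (X : Ctx) (s : State) (q : ℕ) : Prop :=
  ∀ i < q, ∀ w < X.n, 2 ≤ s.arr 9 w → (w = s.arr 16 i ∨ X.adj (s.arr 16 i) w) → s.arr 12 w = 1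

/-- The state `s'` extends the search in the state `s`. -/
structure SearchLe (X : Ctx) (s s' : State) : Prop where
  qt : s.reg 12 ≤ s'.reg 12
  queue : ∀ i < s.reg 12, s'.arr 16 i = s.arr 16 i
  VR : ∀ w < X.n, s.arr 12 w = 1 → s'.arr 12 w = 1

theorem SearchLe.refl (s : State) : X.SearchLe s s := ⟨le_rfl, fun _ _ => rfl, fun _ _ h => h⟩

theorem visit_wp (hX : X.Valid) {s : State} (h : X.BfsOk s) (hp : s.reg 11 < s.reg 12)
    (hw : s.reg 16 < X.n)
    (hadj : s.reg 16 = s.arr 16 (s.reg 11) ∨ X.adj (s.arr 16 (s.reg 11)) (s.reg 16)) :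
    WP X.E Prog.visit s 40 0 fun s' => X.BfsOk s' ∧ X.SearchLe s s' ∧
      (2 ≤ s.arr 9 (s.reg 16) → s'.arr 12 (s.reg 16) = 1) := by
  have hn := hX.n_le
  have hMB := hX.M_le
  have hV := h.VR_le _ hw
  have hr3 := h.role_le _ hw
  have hqt := h.search.qt_le
  have h1n := h.has.n
  have hB1 : 1 < X.E.B := by omega
  refine WP.cond (T := 32) ?_ ?_ ?_ (by simp)
  · simp [eqN_lt hB1]
    omega
  · intro he
    have hv : s.arr 12 (s.reg 16) = 1 := by
      simpa using he
    exact WP.simple trivial (by simp) fun _ => ⟨h, SearchLe.refl s, fun _ => hv⟩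
  · intro he
    have hv : s.arr 12 (s.reg 16) ≠ 1 := by
      simpa using he
    refine WP.cond (T := 27) ?_ ?_ ?_ (by simp)
    · simp [ltN_lt hB1]
      omega
    · intro he
      have hr : 2 ≤ s.arr 9 (s.reg 16) := by
        simpa [Nat.succ_le_iff] using he
      have hm := h.mR_le _ hw
      refine WP.step (T₂ := 3 + (2 + 18)) ?_ ?_ (by simp)
      · simp; omega
      intro _
      refine WP.step (T₂ := 2 + 18) ?_ ?_ (by simp)
      · simp; omega
      intro _
      refine WP.cond (T := 15) ?_ ?_ ?_ (by simp)
      · simp [eqN_lt hB1]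
        omega
      · intro he
        have hmn : s.arr 10 (s.reg 16) = X.n := by
          simpa [h1n] using he
        refine WP.simple ?_ (by simp) fun _ => ?_
        · simp; omega
        have key := h.search.visit_found hp hw hr hadj hv hmn
        refine ⟨⟨⟨h.has.of_eq ?_ ?_ ?_ ?_, ?_, ?_, ?_, ?_⟩, ?_, ?_, ?_⟩, ⟨?_, ?_, ?_⟩, ?_⟩
        · simp
        · simp
        · simp
        · simp
        · simpa using h.role_le
        · simpa using h.used_le
        · simpa using h.mR_le
        · simpa using h.matching
        · simpa using key
        · intro v hv'
          simp [Function.update_apply]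
          split_ifs
          · omega
          · exact h.VR_le v hv'
        · simpa using h.VL_le
        · simp
        · simp
        · intro v hv'
          simp +contextual [Function.update_apply]
        · simp
      · intro he
        have hmn : s.arr 10 (s.reg 16) ≠ X.n := by
          simpa [h1n] using he
        have key := h.search.visit_push h.matching hp hw hr hadj hv (by omega)
        refine WP.simple ?_ (by simp) fun _ => ?_
        · simp; omega
        refine ⟨⟨⟨h.has.of_eq ?_ ?_ ?_ ?_, ?_, ?_, ?_, ?_⟩, ?_, ?_, ?_⟩, ⟨?_, ?_, ?_⟩, ?_⟩
        · simp
        · simp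
        · simp
        · simp
        · simpa using h.role_le
        · simpa using h.used_le
        · simpa using h.mR_le
        · simpa using h.matching
        · simpa using key
        · intro v hv'
          simp [Function.update_apply]
          split_ifs
          · omega
          · exact h.VR_le v hv'
        · intro v hv'
          simp [Function.update_apply]
          split_ifs
          · omega
          · exact h.VL_le v hv'
        · simp
        · intro i hi
          simp [Function.update_apply]
          omega
        · intro v hv'
          simp +contextual [Function.update_apply]
        · simp
    · intro he
      have hr : ¬ 2 ≤ s.arr 9 (s.reg 16) := by
        simpa using he
      exact WP.simple trivial (by simp) fun _ => ⟨h, SearchLe.refl s, fun h1 => absurd h1 hr⟩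

theorem nbr_wp (hX : X.Valid) {s : State} (h : X.Has s) {P : State → Prop} {K : ℕ}
    (hu : s.reg 13 < X.n)
    (hi : s.reg 14 ≤ X.dg (s.reg 13)) (hP : P (s.setReg 16 (X.nb (s.reg 13) (s.reg 14)))) :
    WP X.E Prog.nbr s 10 K P := by
  have hn := hX.n_le
  have hMB := hX.M_le
  have hoff := hX.off_lt _ hu
  have hnb := hX.nb_lt _ hu _ hi
  refine WP.cond (T := 8) ?_ ?_ ?_ (by simp)
  · simp; omega
  · intro he
    have he' : 0 < s.reg 14 := Nat.pos_of_ne_zero he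
    have e1 := h.off _ hu
    have e2 := h.nb _ hu _ he' hi
    refine WP.simple ?_ (by simp) fun _ => ?_
    · simp [e1, e2]; omega
    · simpa [e1, e2] using hP
  · intro he
    have he' : s.reg 14 = 0 := he
    refine WP.simple ?_ (by simp) fun _ => ?_
    · simp; omega
    · rw [he', hX.nb_zero] at hP
      simpa using hP

theorem BfsOk.of_eq {s s' : State} (h : X.BfsOk s) (h0 : s'.reg 0 = s.reg 0)
    (h1 : s'.reg 1 = s.reg 1) (h10 : s'.reg 10 = s.reg 10) (h12 : s'.reg 12 = s.reg 12)
    (ha : s'.arr = s.arr) : X.BfsOk s' where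
  has := h.has.of_eq h0 h1 (by rw [ha]) (by rw [ha])
  role_le := by rw [ha]; exact h.role_le
  used_le := by rw [ha]; exact h.used_le
  mR_le := by rw [ha]; exact h.mR_le
  matching := by rw [ha]; exact h.matching
  search := by rw [ha, h10, h12]; exact h.search
  VR_le := by rw [ha]; exact h.VR_le
  VL_le := by rw [ha]; exact h.VL_le

theorem scan_wp (hX : X.Valid) {s : State} (h : X.BfsOk s) (hp : s.reg 11 < s.reg 12)
    (hcl : X.Closed s (s.reg 11)) :
    WP X.E Prog.scan s (90 * (X.dg (s.arr 16 (s.reg 11)) + 1)) 0 fun s' => X.BfsOk s' ∧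
      X.SearchLe s s' ∧ s'.reg 11 = s.reg 11 + 1 ∧ X.Closed s' (s.reg 11 + 1) := by
  have hn := hX.n_le
  have hMB := hX.M_le
  have hqt := h.search.qt_le
  have hu := (h.search.queue_lt _ hp).1
  set u := s.arr 16 (s.reg 11) with hud
  have hoff := hX.off_lt _ hu
  have hdg := hX.dg_lt hu
  have e1 := h.has.off _ hu
  have e2 := h.has.dg _ hu
  refine WP.step (T₂ := 90 * X.dg u + 87) ?_ ?_ (by simp; omega)
  · simp; omega
  intro _
  refine WP.step (T₂ := 90 * X.dg u + 81) ?_ ?_ (by simp; omega)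
  · simp [← hud, e1, e2]; omega
  intro _
  set s₀ := (15 ::= (.arr 0 (.arr 2 (ρ 13)) +ᵣ κ 1)).run ((13 ::= .arr 16 (ρ 11)).run s) with hs₀
  have hs13 : s₀.reg 13 = u := by simp [hs₀, hud]
  have hs15 : s₀.reg 15 = X.dg u + 1 := by
    simp [hs₀, ← hud, e1, e2]
  have hs : ∀ x, x ≠ 13 → x ≠ 15 → s₀.reg x = s.reg x := by
    intro x h1 h2; simp [hs₀, h1, h2]
  have hsa : s₀.arr = s.arr := by simp [hs₀]
  have h₀ : X.BfsOk s₀ := h.of_eq (hs _ (by decide) (by decide)) (hs _ (by decide) (by decide))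
    (hs _ (by decide) (by decide)) (hs _ (by decide) (by decide)) hsa
  clear_value s₀
  refine WP.seq (T₁ := (X.dg u + 1) * (60 + 8) + 6) (K₁ := 0) (T₂ := 4) (K₂ := 0)
    (Q := fun s' => X.BfsOk s' ∧ X.SearchLe s s' ∧ X.Closed s' (s.reg 11 + 1)) ?_ ?_ (by omega)
    (by omega)
  -- The loop runs over the closed neighbourhood, index 0 standing for `u` itself; hence `dg u + 1`
  -- rounds.
  · refine WP.for_const (X.dg u + 1) (fun i s' => X.BfsOk s' ∧ X.SearchLe s s' ∧
      X.Closed s' (s.reg 11) ∧ ∀ i' < i, 2 ≤ s'.arr 9 (X.nb u i') → s'.arr 12 (X.nb u i') = 1) 60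
      rfl rfl (by decide) hs15 (by omega) ?_ ?_ ?_ le_rfl
    · refine ⟨h₀.of_eq (by simp) (by simp) (by simp) (by simp) (by simp),
        ⟨by simp [hs], by simp [hsa], by simp [hsa]⟩, ?_, by omega⟩
      exact fun i hi w hw h1 h2 => by
        simp only [State.setReg_arr, hsa] at h1 h2 ⊢
        exact hcl i hi w hw h1 h2
    · rintro i s' hi hf hx ⟨k1, k2, k3, k4⟩
      have hr13 : s'.reg 13 = u := (hf.reg 13 rfl).trans hs13
      have hr11 : s'.reg 11 = s.reg 11 := (hf.reg 11 rfl).trans (hs _ (by decide) (by decide))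
      have hlt' : s'.reg 11 < s'.reg 12 := by have := k2.qt; omega
      have hqu : s'.arr 16 (s'.reg 11) = u := by rw [hr11]; exact k2.queue _ hp
      have hwn : X.nb u i < X.n := hX.nb_lt u hu i (by omega)
      have hwadj : X.nb u i = u ∨ X.adj u (X.nb u i) := by
        rcases Nat.eq_zero_or_pos i with h1 | h1
        · left; rw [h1, hX.nb_zero]
        · right; exact (hX.nb_adj u hu _).2 ⟨i, h1, by omega, rfl⟩
      refine WP.seq (T₁ := 10) (K₁ := 0) (T₂ := 40) (K₂ := 0)
        (Q := fun s'' => s'' = s'.setReg 16 (X.nb u i)) ?_ ?_ (by omega) (by omega)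
      · refine nbr_wp hX k1.has (by rw [hr13]; exact hu) (by rw [hr13, hx]; omega) ?_
        rw [hr13, hx]
      · rintro _ - rfl
        set s₁ := s'.setReg 16 (X.nb u i) with hs₁
        have b1 : X.BfsOk s₁ := k1.of_eq (by simp [hs₁]) (by simp [hs₁]) (by simp [hs₁])
          (by simp [hs₁]) (by simp [hs₁])
        have w1 : s₁.reg 16 = X.nb u i := by simp [hs₁]
        have w2 : s₁.reg 11 = s'.reg 11 := by simp [hs₁]
        have w3 : s₁.reg 12 = s'.reg 12 := by simp [hs₁]
        have w4 : s₁.arr = s'.arr := by simp [hs₁]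
        clear_value s₁
        refine (visit_wp hX b1 (by rw [w2, w3]; exact hlt') (by rw [w1]; exact hwn)
          (by rw [w1, w4, w2, hqu]; exact hwadj)).mono le_rfl le_rfl ?_
        rintro s₂ hf₂ ⟨q1, q2, q3⟩
        rw [w1, w4] at q3
        have hrole : s₂.arr 9 = s'.arr 9 := (hf₂.arr 9 rfl).trans (by rw [w4])
        refine ⟨q1.of_eq (by simp) (by simp) (by simp) (by simp) (by simp), ⟨?_, ?_, ?_⟩, ?_, ?_⟩
        · have := q2.qt; have := k2.qt; simp; omega
        · intro i' hi'
          have h1 := q2.queue i' (by rw [w3]; exact hi'.trans_le k2.qt)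
          rw [w4] at h1
          simpa using h1.trans (k2.queue i' hi')
        · intro w hw h1
          simpa using q2.VR w hw (by rw [w4]; exact k2.VR w hw h1)
        · intro i' hi' w hw h1 h2
          simp only [State.setReg_arr] at h1 h2 ⊢
          have h3 := q2.queue i' (by have := k2.qt; omega)
          rw [w4] at h3
          rw [h3] at h2
          rw [hrole] at h1
          exact q2.VR w hw (by rw [w4]; exact k3 i' hi' w hw h1 h2)
        · intro i' hi' h1
          simp only [State.setReg_arr] at h1 ⊢
          rw [hrole] at h1
          by_cases hii : i' = i
          · subst hii; exact q3 h1
          · exact q2.VR _ (hX.nb_lt u hu i' (by omega)) (by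
              rw [w4]; exact k4 i' (by omega) h1)
    · rintro s' hf hx ⟨k1, k2, k3, k4⟩
      refine ⟨k1, k2, fun i hi w hw h1 h2 => ?_⟩
      by_cases hip : i = s.reg 11
      · rw [hip, k2.queue _ hp, ← hud] at h2
        obtain ⟨i', hi', rfl⟩ : ∃ i' < X.dg u + 1, X.nb u i' = w := by
          rcases h2 with h2 | h2
          · exact ⟨0, by omega, by rw [hX.nb_zero, h2]⟩
          · obtain ⟨i', -, h3, h4⟩ := (hX.nb_adj u hu _).1 h2
            exact ⟨i', by omega, h4⟩
        exact k4 i' hi' h1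
      · exact k3 i (by omega) w hw h1 h2
  · rintro s' hf ⟨k1, k2, k3⟩
    have hr11 : s'.reg 11 = s.reg 11 := (hf.reg 11 rfl).trans (hs _ (by decide) (by decide))
    refine WP.simple ?_ (by simp) fun _ => ?_
    · simp; omega
    · refine ⟨k1.of_eq ?_ ?_ ?_ ?_ ?_, ⟨?_, ?_, ?_⟩, ?_, ?_⟩
      · simp
      · simp
      · simp
      · simp
      · simp
      · simpa using k2.qt
      · simpa using k2.queue
      · simpa using k2.VR
      · simp [hr11]
      · simpa [Closed] using k3

theorem FlowOk.frame {s s' : State} (h : X.FlowOk s) {c : Cmd} (hf : Frame c s s')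
    (hc : c.keeps = true) (h9 : c.wa 9 = false) (h10 : c.wa 10 = false) (h11 : c.wa 11 = false) :
    X.FlowOk s' := by
  have e9 := hf.arr 9 h9
  have e10 := hf.arr 10 h10
  have e11 := hf.arr 11 h11
  exact ⟨h.has.frame hf hc, by rw [e9]; exact h.role_le, by rw [e11]; exact h.used_le,
    by rw [e10]; exact h.mR_le, by rw [e9, e10, e11]; exact h.matching⟩

theorem start_wp (hX : X.Valid) {s : State} (h : X.FlowOk s) :
    WP X.E Prog.start s (90 * (X.n + 1)) 0 fun s' => X.BfsOk s' ∧ s'.reg 11 = 0 := by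
  have hn := hX.n_le
  have hMB := hX.M_le
  have hB1 : 1 < X.E.B := by omega
  refine WP.seq (T₁ := 11 * (X.n + 1)) (K₁ := 0) (T₂ := 79 * (X.n + 1)) (K₂ := 0)
    (Q := fun s' => ∀ v < X.n, s'.arr 12 v = 0)
    (WP.fill X.n (fun _ => 0) h.has.n (by omega) (by omega) (by simp; omega)
      (fun _ _ h1 _ => h1) (by simp)) ?_ (by omega) (by omega)
  intro s₁ f₁ a₁
  have h₁ := h.frame f₁ rfl rfl rfl rfl
  refine WP.seq (T₁ := 11 * (X.n + 1)) (K₁ := 0) (T₂ := 68 * (X.n + 1)) (K₂ := 0)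
    (Q := fun s' => ∀ v < X.n, s'.arr 13 v = 0)
    (WP.fill X.n (fun _ => 0) h₁.has.n (by omega) (by omega) (by simp; omega)
      (fun _ _ h1 _ => h1) (by simp)) ?_ (by omega) (by omega)
  intro s₂ f₂ b₂
  have h₂ := h₁.frame f₂ rfl rfl rfl rfl
  have a₂ : ∀ v < X.n, s₂.arr 12 v = 0 := by rw [f₂.arr 12 rfl]; exact a₁
  clear f₁ a₁ h₁ h f₂
  refine WP.step (T₂ := 40 * (X.n + 1)) (by simp; omega) ?_ (by simp; omega)
  intro f₃
  have h₃ := h₂.frame f₃ rfl rfl rfl rfl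
  have c₃ : ((12 ::= κ 0).run s₂).reg 12 = 0 := by simp
  have a₃ : ∀ v < X.n, ((12 ::= κ 0).run s₂).arr 12 v = 0 := by rw [f₃.arr 12 rfl]; exact a₂
  have b₃ : ∀ v < X.n, ((12 ::= κ 0).run s₂).arr 13 v = 0 := by rw [f₃.arr 13 rfl]; exact b₂
  generalize (12 ::= κ 0).run s₂ = s₃ at h₃ c₃ a₃ b₃
  clear f₃ a₂ b₂ h₂
  refine WP.seq (T₁ := X.n * (23 + 8) + 6) (K₁ := 0) (T₂ := 4) (K₂ := 0)
    (Q := fun s' => X.FlowOk s' ∧ (∀ v < X.n, s'.arr 12 v = 0) ∧ (∀ v < X.n, s'.arr 13 v ≤ 1) ∧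
      Linkage.Search X.adj X.n (s'.arr 9) (s'.arr 11) (s'.arr 10) (s'.arr 12) (s'.arr 13)
        (s'.arr 14) (s'.arr 15) (s'.arr 16) (s'.reg 12) X.n) ?_ ?_ (by omega) (by omega)
  -- After `i` rounds the queue consists of the unused sources below `i`, each with `via = n`, which
  -- marks a starting point.
  · refine WP.for_const X.n (fun i s' => s'.reg 12 ≤ i ∧
      (∀ j < s'.reg 12, s'.arr 16 j < i ∧ s'.arr 9 (s'.arr 16 j) = 1 ∧
        s'.arr 11 (s'.arr 16 j) ≠ 1 ∧ s'.arr 15 j = X.n ∧ s'.arr 13 (s'.arr 16 j) = 1) ∧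
      (∀ j < s'.reg 12, ∀ j' < s'.reg 12, s'.arr 16 j = s'.arr 16 j' → j = j') ∧
      (∀ v < X.n, s'.arr 13 v ≤ 1) ∧
      (∀ v < X.n, s'.arr 13 v = 1 → ∃ j < s'.reg 12, s'.arr 16 j = v) ∧
      (∀ v < i, s'.arr 9 v = 1 → s'.arr 11 v ≠ 1 → s'.arr 13 v = 1)) 23 rfl rfl (by decide)
      h₃.has.n (by omega) ?_ ?_ ?_ le_rfl
    · refine ⟨by simp [c₃], by simp [c₃], by simp [c₃], ?_, ?_, by simp⟩
      · intro v hv; simp [b₃ v hv]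
      · intro v hv hv1; simp [b₃ v hv] at hv1
    · rintro i s' hi hf hx ⟨i1, i2, i3, i4, i5, i6⟩
      have h' := h₃.frame hf rfl rfl rfl rfl
      have r9 := h'.role_le i hi
      have r11 := h'.used_le i hi
      have hn' := h'.has.n
      refine WP.cond (T := 13) ?_ ?_ ?_ (by simp)
      · simp [hx, eqN_lt hB1]
        have := eqN_le (s'.arr 9 i) 1
        have := eqN_le (s'.arr 11 i) 0
        refine ⟨by omega, by omega, ?_⟩
        calc _ ≤ 1 * 1 := Nat.mul_le_mul (eqN_le _ _) (eqN_le _ _)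
          _ < _ := by omega
      · intro he
        have he' : s'.arr 9 i = 1 ∧ s'.arr 11 i = 0 := by
          simpa [hx, not_or] using he
        refine WP.simple ?_ (by simp) fun _ => ?_
        · simp [hx]; omega
        simp only [Cmd.run, Expr.eval, State.setReg_arr, State.setArr_arr, State.setArr_reg,
          State.setReg_reg, Op.eval_add, hx, hn']
        simp only [reduceIte, Nat.reduceEqDiff]
        have hnew : ∀ j < s'.reg 12, s'.arr 16 j ≠ i := fun j hj => (i2 j hj).1.ne
        refine ⟨by omega, ?_, ?_, ?_, ?_, ?_⟩
        · intro j hj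
          by_cases hjq : j = s'.reg 12
          · subst hjq; simp [he'.1, he'.2]
          · have hj' : j < s'.reg 12 := by omega
            rw [Function.update_of_ne hjq, Function.update_of_ne hjq,
              Function.update_of_ne (hnew j hj')]
            obtain ⟨q1, q2, q3, q4, q5⟩ := i2 j hj'
            exact ⟨by omega, q2, q3, q4, q5⟩
        · intro j hj j' hj' hjj
          by_cases hjq : j = s'.reg 12 <;> by_cases hjq' : j' = s'.reg 12
          · omega
          · rw [hjq, Function.update_self, Function.update_of_ne hjq'] at hjj
            exact absurd hjj.symm (hnew j' (by omega))
          · rw [hjq', Function.update_self, Function.update_of_ne hjq] at hjj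
            exact absurd hjj (hnew j (by omega))
          · rw [Function.update_of_ne hjq, Function.update_of_ne hjq'] at hjj
            exact i3 j (by omega) j' (by omega) hjj
        · intro v hv
          by_cases hvi : v = i
          · subst hvi; simp
          · rw [Function.update_of_ne hvi]; exact i4 v hv
        · intro v hv hv1
          by_cases hvi : v = i
          · exact ⟨s'.reg 12, by omega, by simp [hvi]⟩
          · rw [Function.update_of_ne hvi] at hv1
            obtain ⟨j, hj, hjv⟩ := i5 v hv hv1
            exact ⟨j, by omega, by rw [Function.update_of_ne hj.ne]; exact hjv⟩
        · intro v hv h1 h2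
          by_cases hvi : v = i
          · simp [hvi]
          · rw [Function.update_of_ne hvi]; exact i6 v (by omega) h1 h2
      · intro he
        refine WP.simple trivial (by simp) fun _ => ?_
        refine ⟨by simp; omega, ?_, by simpa using i3, by simpa using i4, by simpa using i5, ?_⟩
        · intro j hj
          simp only [Cmd.run, State.setReg_reg, State.setReg_arr] at hj ⊢
          obtain ⟨q1, q2, q3, q4, q5⟩ := i2 j hj
          exact ⟨by omega, q2, q3, q4, q5⟩
        · intro v hv h1 h2
          simp only [Cmd.run, State.setReg_arr] at h1 h2 ⊢
          by_cases hvi : v = i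
          · subst hvi
            exfalso
            have : s'.arr 11 v = 0 := by omega
            simp [hx, h1, this] at he
          · exact i6 v (by omega) h1 h2
    · rintro s' hf hx ⟨i1, i2, i3, i4, i5, i6⟩
      have h' := h₃.frame hf rfl rfl rfl rfl
      have a' : ∀ v < X.n, s'.arr 12 v = 0 := by rw [hf.arr 12 rfl]; exact a₃
      refine ⟨h', a', i4, ?_, i3, i5, i6, ?_, ?_, ?_, ?_⟩
      · intro j hj
        obtain ⟨q1, q2, q3, q4, q5⟩ := i2 j hj
        exact ⟨q1, q5⟩
      · intro j hj
        obtain ⟨q1, q2, q3, q4, q5⟩ := i2 j hj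
        exact Or.inl ⟨q4, q2, q3⟩
      · intro w hw h1; rw [a' w hw] at h1; omega
      · intro w hw h1; rw [a' w hw] at h1; omega
      · left; exact ⟨rfl, fun w hw h1 => by rw [a' w hw] at h1; omega⟩
  · rintro s₄ f₄ ⟨k1, k2, k3, k4⟩
    have hn' := k1.has.n
    refine WP.simple ?_ (by simp) fun hf => ?_
    · simp; omega
    · have k1' := k1.frame hf rfl rfl rfl rfl
      refine ⟨⟨k1', ?_, ?_, ?_⟩, ?_⟩
      · simpa [hn'] using k4
      · intro v hv; simp [k2 v hv]
      · intro v hv; simpa using k3 v hv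
      · simp

theorem bfs_wp (hX : X.Valid) {s : State} (h : X.FlowOk s) :
    WP X.E Prog.bfs s (210 * (X.n + X.m + 1)) 0 fun s' => X.BfsOk s' ∧
      (s'.reg 10 = X.n → X.Closed s' (s'.reg 12)) := by
  have hn := hX.n_le
  have hMB := hX.M_le
  have hB1 : 1 < X.E.B := by omega
  have hsum := hX.sum_dg
  set D := ∑ u ∈ range X.n, (X.dg u + 1) with hD
  have hDle : D ≤ 2 * X.m + X.n := by
    rw [hD, Finset.sum_add_distrib]; simpa using hsum
  refine WP.seq (start_wp hX h) (T₂ := 100 * D + 8) (K₂ := 0) ?_ (by omega) (by omega)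
  rintro s₁ - ⟨h₁, hq₁⟩
  -- The credit is proportional to the closed degrees that have not been scanned. The search stops
  -- as soon as an unmatched right vertex is found, so the final state is closed only if register
  -- `10` is still `n`.
  refine WP.loop (fun s' φ ψ => X.BfsOk s' ∧ X.Closed s' (s'.reg 11) ∧ s'.reg 11 ≤ s'.reg 12 ∧
    φ = 100 * (D - ∑ i ∈ range (s'.reg 11), (X.dg (s'.arr 16 i) + 1)) ∧ ψ = 0) (Φ := 100 * D)
    (Ψ := 0) ?_ ?_ ?_ (by simp) le_rfl
  · refine ⟨h₁, ?_, by omega, by simp [hq₁], rfl⟩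
    rw [hq₁]; intro i hi; omega
  · rintro s' φ ψ hf ⟨i1, i2, i3, rfl, rfl⟩
    have hqt := i1.search.qt_le
    have hn' := i1.has.n
    have hfd : s'.reg 10 ≤ X.n := by
      rcases i1.search.found with h1 | h1 <;> omega
    refine ⟨?_, fun he => ?_⟩
    · simp [ltN_lt hB1, eqN_lt hB1]
      refine ⟨by omega, by omega, ?_⟩
      calc _ ≤ 1 * 1 := Nat.mul_le_mul (ltN_le _ _) (eqN_le _ _)
        _ < _ := by omega
    · have he' : s'.reg 11 < s'.reg 12 ∧ s'.reg 10 = s'.reg 1 := by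
        simpa [not_or] using he
      refine ⟨_, _, (scan_wp hX i1 he'.1 i2).mono le_rfl le_rfl ?_⟩
      rintro s'' hf' ⟨k1, k2, k3, k4⟩
      have hle := k2.qt
      refine ⟨_, 0, ⟨k1, by rw [k3]; exact k4, by omega, rfl, rfl⟩, ?_, le_rfl⟩
      have e1 : ∑ i ∈ range (s''.reg 11), (X.dg (s''.arr 16 i) + 1) =
          ∑ i ∈ range (s'.reg 11), (X.dg (s'.arr 16 i) + 1) +
            (X.dg (s'.arr 16 (s'.reg 11)) + 1) := by
        rw [k3, ← Finset.sum_range_succ (fun i => X.dg (s'.arr 16 i) + 1)]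
        refine Finset.sum_congr rfl fun i hi => ?_
        rw [k2.queue i (by have := Finset.mem_range.1 hi; omega)]
      have e2 : ∑ i ∈ range (s''.reg 11), (X.dg (s''.arr 16 i) + 1) ≤ D :=
        sum_dg_queue_le (f := fun u => X.dg u + 1)
          (fun i hi => (k1.search.queue_lt i (by omega)).1)
          (fun i hi j hj hij => k1.search.queue_inj i (by omega) j (by omega) hij)
      simp only [Expr.cost]
      omega
  · rintro s' φ ψ hf ⟨i1, i2, i3, -, -⟩ he
    refine ⟨i1, fun h1 => ?_⟩
    have hn' := i1.has.n
    have : s'.reg 11 = s'.reg 12 := by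
      simp [h1, hn'] at he
      omega
    rw [← this]; exact i2

theorem augment_wp (hX : X.Valid) {s : State} (h : X.BfsOk s) (hfd : s.reg 10 ≠ X.n)
    (h9 : s.reg 9 < X.n + X.k) :
    WP X.E Prog.augment s (40 * (X.n + 1)) 0 fun s' => X.FlowOk s' ∧
      Linkage.value X.n (s'.arr 9) (s'.arr 11) = Linkage.value X.n (s.arr 9) (s.arr 11) + 1 ∧
      s'.reg 9 = s.reg 9 + 1 := by
  have hn := hX.n_le
  have hMB := hX.M_le
  have hk := hX.k_le
  have hB1 : 1 < X.E.B := by omega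
  have hqt := h.search.qt_le
  have hS := h.search
  obtain ⟨hw, hwV, hwm⟩ := (h.search.found).resolve_left (fun h1 => hfd h1.1)
  refine WP.step (T₂ := 30 * (X.n + 1) + 8) (by simp; omega) ?_ (by simp; omega)
  intro f₁
  have g16 : ((16 ::= ρ 10).run s).reg 16 = s.reg 10 := by simp
  have ga : ((16 ::= ρ 10).run s).arr = s.arr := by simp
  have g9 : ((16 ::= ρ 10).run s).reg 9 = s.reg 9 := by simp
  have gh := h.has.frame f₁ rfl
  generalize (16 ::= ρ 10).run s = s₁ at g16 ga gh g9
  have hpr := (hS.right _ hw hwV).2.1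
  refine WP.seq (T₁ := 30 * (X.n + 1)) (K₁ := 0) (T₂ := 8) (K₂ := 0)
    (Q := fun s' => s'.reg 13 < X.n ∧ s.arr 9 (s'.reg 13) = 1 ∧ s.arr 11 (s'.reg 13) ≠ 1 ∧
      Linkage.Matching X.adj X.n (s.arr 9) (Function.update (s.arr 11) (s'.reg 13) 1) (s'.arr 10)
        X.n ∧ ∀ v < X.n, s'.arr 10 v ≤ X.n) ?_ ?_ (by omega) (by omega)
  -- Either the right vertex `w` in register `16` waits for a new partner: the matching is valid
  -- apart from `w`, and the pairs belonging to queue positions up to `pr w` are still the old ones.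
  -- Or a starting source has been reached and the matching is complete. Positions decrease along
  -- the path, so `pr w + 1` bounds the remaining steps.
  · refine WP.loop (fun s' φ ψ => ψ = 0 ∧ (∀ v < X.n, s'.arr 10 v ≤ X.n) ∧ ((s'.reg 16 < X.n ∧ s.arr 12 (s'.reg 16) = 1 ∧
      Linkage.Matching X.adj X.n (s.arr 9) (s.arr 11) (s'.arr 10) (s'.reg 16) ∧
      (∀ i ≤ s.arr 14 (s'.reg 16), s.arr 15 i < X.n → s'.arr 10 (s.arr 15 i) = s.arr 16 i) ∧
      φ = 20 * (s.arr 14 (s'.reg 16) + 1)) ∨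
      (s'.reg 16 = X.n ∧ s'.reg 13 < X.n ∧ s.arr 9 (s'.reg 13) = 1 ∧ s.arr 11 (s'.reg 13) ≠ 1 ∧
      Linkage.Matching X.adj X.n (s.arr 9) (Function.update (s.arr 11) (s'.reg 13) 1) (s'.arr 10)
        X.n ∧ φ = 0))) (Φ := 20 * (s.arr 14 (s.reg 10) + 1)) (Ψ := 0) ?_ ?_ ?_ ?_ le_rfl
    · rw [g16, ga]
      refine ⟨rfl, h.mR_le, Or.inl ⟨hw, hwV, ?_, ?_, rfl⟩⟩
      · have hM := h.matching
        exact ⟨fun x hx h1 _ => hM.inner x hx h1 hx.ne, fun x hx h1 _ => hM.none x hx h1 hx.ne,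
          fun x hx h1 _ => hM.edge x hx h1 hx.ne, fun x hx h1 _ => hM.left x hx h1 hx.ne,
          -- For surjectivity it matters that the found vertex is unmatched, so ignoring it loses no
          -- pair.
          fun x hx y hy h1 h2 _ _ => hM.inj x hx y hy h1 h2 hx.ne hy.ne, fun u hu h1 => by
            obtain ⟨x, hx, h2, -, h4⟩ := hM.surj u hu h1
            refine ⟨x, hx, h2, ?_, h4⟩
            rintro rfl
            omega⟩
      · intro i hi hv
        rcases hS.entry i (by omega) with h1 | h1
        · omega
        · exact h1.2.2.1
    · rintro s' φ ψ hf ⟨rfl, hle, hI⟩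
      have a9 : s'.arr 9 = s.arr 9 := (hf.arr 9 rfl).trans (by rw [ga])
      have a14 : s'.arr 14 = s.arr 14 := (hf.arr 14 rfl).trans (by rw [ga])
      have a15 : s'.arr 15 = s.arr 15 := (hf.arr 15 rfl).trans (by rw [ga])
      have a16 : s'.arr 16 = s.arr 16 := (hf.arr 16 rfl).trans (by rw [ga])
      have n1 : s'.reg 1 = X.n := (hf.reg 1 rfl).trans gh.n
      refine ⟨?_, fun he => ?_⟩
      · simp [ltN_lt hB1]
        rcases hI with hI | hI <;> omega
      have he' : s'.reg 16 < X.n := by simpa [n1] using he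
      rcases hI with ⟨-, i2, i3, i4, rfl⟩ | hI
      swap
      · omega
      set w := s'.reg 16 with hwd
      obtain ⟨r1, r2, r3⟩ := hS.right w he' i2
      obtain ⟨q1, q2⟩ := hS.queue_lt _ r2
      have hent := hS.entry _ r2
      have hvia : s.arr 15 (s.arr 14 w) ≤ X.n := by rcases hent with h1 | h1 <;> omega
      refine ⟨14, 0, WP.simple ?_ (by simp) fun _ => ?_⟩
      · simp [a14, a15, a16, ← hwd]
        omega
      have e13 : ((14 ::= .arr 14 (ρ 16) ;; 13 ::= .arr 16 (ρ 14) ;;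
          .store 10 (ρ 16) (ρ 13) ;; 16 ::= .arr 15 (ρ 14)).run s').reg 13 = s.arr 16 (s.arr 14 w) := by
        simp [a14, a16, ← hwd]
      have e16 : ((14 ::= .arr 14 (ρ 16) ;; 13 ::= .arr 16 (ρ 14) ;;
          .store 10 (ρ 16) (ρ 13) ;; 16 ::= .arr 15 (ρ 14)).run s').reg 16 = s.arr 15 (s.arr 14 w) := by
        simp [a14, a15, ← hwd]
      have e10 : ((14 ::= .arr 14 (ρ 16) ;; 13 ::= .arr 16 (ρ 14) ;;
          .store 10 (ρ 16) (ρ 13) ;; 16 ::= .arr 15 (ρ 14)).run s').arr 10 =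
            Function.update (s'.arr 10) w (s.arr 16 (s.arr 14 w)) := by
        simp [a14, a16, ← hwd]
      simp only [e13, e16, e10]
      have hle' : ∀ v < X.n, Function.update (s'.arr 10) w (s.arr 16 (s.arr 14 w)) v ≤ X.n := by
        intro v hv
        rw [Function.update_apply]
        split_ifs
        · exact q1.le
        · exact hle v hv
      rcases hent with ⟨t1, t2, t3⟩ | ⟨t1, t2, t3, t4⟩
      · refine ⟨0, 0, ⟨rfl, hle', Or.inr ⟨t1, q1, t2, t3, ?_, rfl⟩⟩, by simp; omega, le_rfl⟩
        exact i3.augment_last he' r1 q1 t2 t3 r3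
      · have hne : s.arr 15 (s.arr 14 w) ≠ w := by intro h1; rw [h1] at t4; omega
        have hm := i4 _ le_rfl t1
        have hr' := (hS.right _ t1 t2).1
        refine ⟨_, 0, ⟨rfl, hle', Or.inl ⟨t1, t2, ?_, ?_, rfl⟩⟩, by simp; omega, le_rfl⟩
        · refine i3.augment_step he' r1 q1 ?_ r3 t1 hr' hne hm
          have := i3.left _ t1 hr' hne (by rw [hm]; exact q1)
          rwa [hm] at this
        · intro i hi hv
          -- Predecessors have smaller positions, so the pairs that are still needed do not involve
          -- the overwritten vertex `w`.
          have hlt : s.arr 14 (s.arr 15 i) < i := by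
            rcases hS.entry i (by omega) with h1 | h1
            · omega
            · exact h1.2.2.2
          have : s.arr 15 i ≠ w := by intro h1; rw [h1] at hlt; omega
          rw [Function.update_of_ne this]
          exact i4 i (by omega) hv
    · rintro s' φ ψ hf ⟨rfl, hle, hI⟩ he
      have n1 : s'.reg 1 = X.n := (hf.reg 1 rfl).trans gh.n
      have he' : X.n ≤ s'.reg 16 := by simpa [n1] using he
      rcases hI with hI | ⟨-, i1, i2, i3, i4, -⟩
      · omega
      · exact ⟨i1, i2, i3, i4, hle⟩
    · simp; omega
  · rintro s₂ f₂ ⟨i1, i2, i3, i4, i5⟩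
    have a9 : s₂.arr 9 = s.arr 9 := (f₂.arr 9 rfl).trans (by rw [ga])
    have a11 : s₂.arr 11 = s.arr 11 := (f₂.arr 11 rfl).trans (by rw [ga])
    have r9 : s₂.reg 9 = s.reg 9 := (f₂.reg 9 rfl).trans g9
    refine WP.simple ?_ (by simp) fun hf => ?_
    · simp [r9]; omega
    have hh := (gh.frame f₂ rfl).frame hf rfl
    refine ⟨⟨hh, ?_, ?_, by simpa using i5, ?_⟩, ?_, ?_⟩
    · simpa [a9] using h.role_le
    · intro v hv
      simp [a11, Function.update_apply]
      split_ifs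
      · omega
      · exact h.used_le v hv
    · simpa [a9, a11] using i4
    · simp [a9, a11]
      exact Linkage.value_update i1 i2 i3
    · simp [r9]

theorem flow_wp (hX : X.Valid) {s : State} (h : X.Has s) (hrole : ∀ v < X.n, s.arr 9 v ≤ 3)
    {cap : ℕ} (hcap : s.reg 8 = cap) (hck : cap ≤ 2 * X.k + 3) :
    WP X.E Prog.flow s (320 * (cap + 1) * (X.n + X.m + 1)) 0 fun s' => X.FlowOk s' ∧
      ((s'.reg 21 = 1 ∧ Linkage.IsCut X.adj X.n (s.arr 9)
          ((range X.n).filter fun v => s'.arr 13 v = 1)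
          ((range X.n).filter fun v => (s'.arr 12 v = 1 ∨ s.arr 9 v = 1) ∧ s'.arr 13 v ≠ 1) cap ∧
          (∀ v < X.n, s'.arr 12 v ≤ 1) ∧ (∀ v < X.n, s'.arr 13 v ≤ 1)) ∨
        (s'.reg 21 = 2 ∧ Linkage.value X.n (s'.arr 9) (s'.arr 11) = cap)) := by
  have hn := hX.n_le
  have hMB := hX.M_le
  have hk := hX.k_le
  have hB1 : 1 < X.E.B := by omega
  set W := X.n + X.m + 1 with hW
  have hWn : X.n + 1 ≤ W := by omega
  set D := 275 * W with hD
  have hT : 320 * (cap + 1) * W = (cap + 1) * D + 45 * ((cap + 1) * W) := by rw [hD]; ring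
  have hT' : W ≤ (cap + 1) * W := Nat.le_mul_of_pos_left _ (by omega)
  rw [hT]
  clear_value D
  clear_value W
  refine WP.seq (T₁ := 11 * (X.n + 1)) (K₁ := 0) (T₂ := (cap + 1) * D + 34 * W)
    (K₂ := 0) (Q := fun s' => ∀ v < X.n, s'.arr 11 v = 0)
    (WP.fill X.n (fun _ => 0) h.n (by omega) (by omega) (by simp; omega)
      (fun _ _ h1 _ => h1) (by simp)) ?_ (by omega) (by omega)
  intro s₁ f₁ a₁
  have h₁ := h.frame f₁ rfl
  have ar₁ : s₁.arr 9 = s.arr 9 := f₁.arr 9 rfl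
  have c₁ : s₁.reg 8 = cap := (f₁.reg 8 rfl).trans hcap
  refine WP.seq (T₁ := 25 * (X.n + 1)) (K₁ := 0) (T₂ := (cap + 1) * D + 9)
    (K₂ := 0) (Q := fun s' => ∀ v < X.n, s'.arr 10 v = if s.arr 9 v = 2 then v else X.n)
    (WP.fill X.n _ h₁.n (by omega) (by omega) ?_ (fun _ _ h1 _ => h1) (by simp)) ?_ (by omega)
    (by omega)
  · intro i s' hi hf hx _
    have hr := hrole i hi
    have e9 : s'.arr 9 = s.arr 9 := (hf.arr 9 rfl).trans ar₁
    have n1 : s'.reg 1 = X.n := (hf.reg 1 rfl).trans h₁.n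
    by_cases h2 : s.arr 9 i = 2
    · simp [hx, e9, n1, h2]; omega
    · simp [hx, e9, n1, h2, eqN_of_ne h2]; omega
  intro s₂ f₂ b₂
  have h₂ := h₁.frame f₂ rfl
  have a₂ : ∀ v < X.n, s₂.arr 11 v = 0 := by rw [f₂.arr 11 rfl]; exact a₁
  have ar₂ : s₂.arr 9 = s.arr 9 := (f₂.arr 9 rfl).trans ar₁
  have c₂ : s₂.reg 8 = cap := (f₂.reg 8 rfl).trans c₁
  have F₂ : X.FlowOk s₂ := by
    refine ⟨h₂, by rw [ar₂]; exact hrole, fun v hv => by rw [a₂ v hv]; omega,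
      fun v hv => by rw [b₂ v hv]; split_ifs <;> omega, ?_⟩
    have m2 : ∀ x < X.n, s₂.arr 10 x < X.n → s.arr 9 x = 2 ∧ s₂.arr 10 x = x := by
      intro x hx hm
      rw [b₂ x hx] at hm ⊢
      split_ifs at hm ⊢ with h2
      · exact ⟨h2, rfl⟩
      · omega
    rw [ar₂]
    refine ⟨?_, ?_, ?_, ?_, ?_, ?_⟩
    · intro x hx hr _; rw [b₂ x hx, if_pos hr]; exact hx
    · intro x hx _ _ hm
      rw [b₂ x hx] at hm ⊢
      split_ifs at hm ⊢
      · omega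
      · rfl
    · intro x hx _ _ hm; exact Or.inl (m2 x hx hm).2
    · intro x hx _ _ hm
      have := m2 x hx hm
      rw [this.2]; exact Or.inl this.1
    · intro x hx y hy _ _ _ _ hm hxy
      have h1 := m2 x hx hm
      have h2 := m2 y hy (by omega)
      omega
    · rintro u hu (h1 | ⟨-, h1⟩)
      · exact ⟨u, hu, h1.ge, hu.ne, by rw [b₂ u hu, if_pos h1]⟩
      · rw [a₂ u hu] at h1; omega
  have v₂ : Linkage.value X.n (s₂.arr 9) (s₂.arr 11) = 0 := by
    rw [Linkage.value, Finset.card_eq_zero, Finset.filter_eq_empty_iff]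
    intro x hx
    rw [a₂ x (Finset.mem_range.1 hx)]; omega
  clear f₁ a₁ h₁ ar₁ c₁ f₂ a₂ b₂ h₂
  refine WP.step (T₂ := (cap + 1) * D + 7) (by simp; omega) ?_ (by simp; omega)
  intro f₃
  refine WP.step (T₂ := (cap + 1) * D + 5) (by simp; omega) ?_ (by simp; omega)
  intro f₄
  have F₄ := (F₂.frame f₃ rfl rfl rfl rfl).frame f₄ rfl rfl rfl rfl
  have z9 : ((21 ::= κ 0).run ((9 ::= κ 0).run s₂)).reg 9 = 0 := by simp
  have z21 : ((21 ::= κ 0).run ((9 ::= κ 0).run s₂)).reg 21 = 0 := by simp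
  have z8 : ((21 ::= κ 0).run ((9 ::= κ 0).run s₂)).reg 8 = cap := by simp [c₂]
  have za : ((21 ::= κ 0).run ((9 ::= κ 0).run s₂)).arr = s₂.arr := by simp
  generalize (21 ::= κ 0).run ((9 ::= κ 0).run s₂) = s₄ at F₄ z9 z21 z8 za
  clear f₃ f₄
  have w₄ : Linkage.value X.n (s₄.arr 9) (s₄.arr 11) = 0 := by rw [za]; exact v₂
  have ar₄ : s₄.arr 9 = s.arr 9 := by rw [za]; exact ar₂
  clear F₂ v₂ za ar₂ c₂
  -- Each round adds one path or ends the loop, so `cap + 1` minus the number of paths bounds the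
  -- rounds that remain, each of cost at most `D`.
  refine WP.loop (fun s' φ ψ => ψ = 0 ∧ X.FlowOk s' ∧
      s'.reg 9 = Linkage.value X.n (s'.arr 9) (s'.arr 11) ∧ s'.reg 9 ≤ cap ∧ s'.reg 21 ≤ 2 ∧
      (s'.reg 21 = 0 → ∃ r, r + s'.reg 9 = cap + 1 ∧ φ = r * D) ∧
      (s'.reg 21 = 1 → Linkage.IsCut X.adj X.n (s.arr 9)
          ((range X.n).filter fun v => s'.arr 13 v = 1)
          ((range X.n).filter fun v => (s'.arr 12 v = 1 ∨ s.arr 9 v = 1) ∧ s'.arr 13 v ≠ 1) cap ∧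
          (∀ v < X.n, s'.arr 12 v ≤ 1) ∧ (∀ v < X.n, s'.arr 13 v ≤ 1)) ∧
      (s'.reg 21 = 2 → s'.reg 9 = cap)) (Φ := (cap + 1) * D) (Ψ := 0) ?_ ?_ ?_ ?_ le_rfl
  · refine ⟨rfl, F₄, by rw [z9, w₄], by omega, by omega, fun _ => ⟨cap + 1, by omega, rfl⟩,
      by omega, by omega⟩
  · rintro s' φ ψ hf ⟨rfl, i1, i2, i3, i4, i5, -, -⟩
    have e8 : s'.reg 8 = cap := (hf.reg 8 rfl).trans z8
    have e9 : s'.arr 9 = s.arr 9 := (hf.arr 9 rfl).trans ar₄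
    refine ⟨by simp [eqN_lt hB1]; omega, fun he => ?_⟩
    have he' : s'.reg 21 = 0 := by simpa using he
    obtain ⟨r, hr, rfl⟩ := i5 he'
    have hr1 : r = (r - 1) + 1 := by omega
    have hrD : r * D = (r - 1) * D + D := by rw [hr1]; simp; ring
    refine ⟨270 * W, 0, ?_⟩
    refine WP.cond (T := 266 * W) ?_ ?_ ?_ (by simp only [Expr.cost]; omega)
    · simp [eqN_lt hB1]; omega
    · intro hc
      have hc' : s'.reg 9 = s'.reg 8 := by simpa using hc
      refine WP.simple (by simp; omega) (by simp; omega) fun hf' => ?_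
      have F' := i1.frame hf' rfl rfl rfl rfl
      refine ⟨0, 0, ⟨rfl, F', by simpa using i2, by simpa using i3, by simp, by simp, by simp,
        fun _ => by simp; omega⟩, by simp only [Expr.cost]; omega, le_rfl⟩
    · intro hc
      have hc' : s'.reg 9 ≠ s'.reg 8 := by simpa using hc
      refine WP.seq (bfs_wp hX i1) (T₂ := 50 * W) (K₂ := 0) ?_ (by omega) (by omega)
      rintro s'' hf'' ⟨B, hcl⟩
      have u8 : s''.reg 8 = cap := (hf''.reg 8 rfl).trans e8
      have u9 : s''.reg 9 = s'.reg 9 := hf''.reg 9 rfl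
      have u21 : s''.reg 21 = s'.reg 21 := hf''.reg 21 rfl
      have ua9 : s''.arr 9 = s'.arr 9 := hf''.arr 9 rfl
      have ua11 : s''.arr 11 = s'.arr 11 := hf''.arr 11 rfl
      have n1 := B.has.n
      have hfd : s''.reg 10 ≤ X.n := by rcases B.search.found with h1 | h1 <;> omega
      refine WP.cond (T := 46 * W) ?_ ?_ ?_ (by simp only [Expr.cost]; omega)
      · simp [eqN_lt hB1]; omega
      · intro hd
        have hd' : s''.reg 10 = X.n := by simpa [n1] using hd
        refine WP.simple (by simp; omega) (by simp; omega) fun hf' => ?_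
        have F' := B.toFlowOk.frame hf' rfl rfl rfl rfl
        have hs := B.search
        rw [hd'] at hs
        have hcut := hs.isCut B.matching (cap := cap) (hcl hd') (by rw [ua9, ua11]; omega)
        rw [ua9, e9] at hcut
        refine ⟨0, 0, ⟨rfl, F', ?_, ?_, by simp, by simp, fun _ => ⟨?_, ?_, ?_⟩, by simp⟩,
          by simp only [Expr.cost]; omega, le_rfl⟩
        · simpa [u9, ua9, ua11] using i2
        · simpa [u9] using i3
        · simp only [Cmd.run, State.setReg_arr]; exact hcut
        · simpa using B.VR_le
        · simpa using B.VL_le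
      · intro hd
        have hd' : s''.reg 10 ≠ X.n := by simpa [n1] using hd
        have hval : s'.reg 9 ≤ X.n := by
          rw [i2, Linkage.value]
          exact (Finset.card_filter_le _ _).trans (by simp)
        by_cases h0 : X.n + X.k = 0
        · omega
        -- The bound needed to keep the counter within a word. The right vertex that was found is
        -- not a source, so the used sources cannot be all of the `n` vertices.
        have hval' : s''.reg 9 < X.n + X.k := by
          by_contra h1
          have h2 : s'.reg 9 = X.n := by omega
          have h3 : ((range X.n).filter fun u => s'.arr 9 u = 1 ∧ s'.arr 11 u = 1) = range X.n :=
            Finset.eq_of_subset_of_card_le (Finset.filter_subset _ _) (by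
              rw [i2, Linkage.value] at h2; rw [h2]; simp)
          have hfn : s''.reg 10 < X.n := by omega
          have h4 : s''.reg 10 ∈ (range X.n).filter fun u => s'.arr 9 u = 1 ∧ s'.arr 11 u = 1 := by
            rw [h3]; simpa using hfn
          have h5 := (Finset.mem_filter.1 h4).2.1
          rcases B.search.found with h6 | ⟨-, h6, -⟩
          · omega
          · have := (B.search.right _ hfn h6).1
            rw [ua9, h5] at this
            omega
        refine (augment_wp hX B hd' hval').mono (by omega) le_rfl ?_
        rintro s₅ f₅ ⟨k1, k2, k3⟩
        have v21 : s₅.reg 21 = 0 := (f₅.reg 21 rfl).trans (u21.trans he')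
        refine ⟨(r - 1) * D, 0, ⟨rfl, k1, ?_, by omega, by omega, fun _ => ⟨r - 1, by omega, rfl⟩,
          by omega, by omega⟩, by simp only [Expr.cost]; omega, le_rfl⟩
        rw [k3, k2, ua9, ua11, u9, i2]
  · rintro s' φ ψ hf ⟨rfl, i1, i2, i3, i4, -, i6, i7⟩ he
    have he' : s'.reg 21 ≠ 0 := by simpa using he
    refine ⟨i1, ?_⟩
    have : s'.reg 21 = 1 ∨ s'.reg 21 = 2 := by omega
    rcases this with h1 | h1
    · exact Or.inl ⟨h1, i6 h1⟩
    · exact Or.inr ⟨h1, by rw [← i2]; exact i7 h1⟩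
  · simp

end Ctx

/-! ### Partial tree decompositions in memory -/

open Finset WordRAM

/-- The function is the indicator function of the set on the numbers below `n`. -/
def Ind (n : ℕ) (f : ℕ → ℕ) (S : Finset ℕ) : Prop := ∀ v < n, f v = if v ∈ S then 1 else 0

theorem Ind.le {n : ℕ} {f : ℕ → ℕ} {S : Finset ℕ} (h : Ind n f S) {v : ℕ} (hv : v < n) :
    f v ≤ 1 := by rw [h v hv]; split_ifs <;> omega

theorem Ind.sum {n : ℕ} {f : ℕ → ℕ} {S : Finset ℕ} (h : Ind n f S) :
    ∑ v ∈ range n, f v = (S.filter (· < n)).card := by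
  rw [Finset.sum_congr rfl fun v hv => h v (Finset.mem_range.1 hv), ← Finset.card_filter]
  congr 1
  ext v; simp [and_comm]

/-- The row `i` of the matrix with `n` columns is the indicator function of the set. -/
def Row (n : ℕ) (f : ℕ → ℕ) (i : ℕ) (S : Finset ℕ) : Prop := Ind n (fun v => f (i * n + v)) S

theorem row_ne {n i i' v v' : ℕ} (hv : v < n) (hv' : v' < n) (hi : i ≠ i') :
    i * n + v ≠ i' * n + v' := by
  intro h
  rcases lt_or_gt_of_ne hi with h1 | h1
  · have : (i + 1) * n ≤ i' * n := Nat.mul_le_mul_right _ h1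
    rw [Nat.add_mul] at this; omega
  · have : (i' + 1) * n ≤ i * n := Nat.mul_le_mul_right _ h1
    rw [Nat.add_mul] at this; omega

namespace Prog

/-- Write a row of the matrix `3`; register `b` contains its first position. -/
def fillRow (b : ℕ) (e : Expr) : Cmd := Cmd.for 4 1 (.store 3 (ρ b +ᵣ ρ 4) e)

/-- Extend the bag of the node in register `27`. -/
def extend : Cmd :=
  5 ::= ρ 27 *ᵣ ρ 1 ;; 28 ::= κ 3 *ᵣ ρ 0 +ᵣ κ 4 ;; 29 ::= ρ 27 +ᵣ κ 1 ;;
    Cmd.sum 6 (.arr 3 (ρ 5 +ᵣ ρ 4)) ;;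
    Cmd.for 4 1 (.cond ((.arr 5 (ρ 4) =ᵣ ρ 29) *ᵣ (ρ 6 <ᵣ ρ 28))
      (.store 5 (ρ 4) (κ 0) ;; .store 3 (ρ 5 +ᵣ ρ 4) (κ 1) ;; 6 ::= ρ 6 +ᵣ κ 1) .skip)

end Prog

namespace Ctx

variable {X : Ctx}

/-- The state contains the configuration. -/
structure Rel (X : Ctx) (s : State) (c : Conf) : Prop where
  has : X.Has s
  N : s.reg 2 = c.N
  j : s.reg 3 = c.j
  par : ∀ i < c.N, s.arr 4 i = c.par i
  bag : ∀ i < c.N, Row X.n (s.arr 3) i (c.bag i)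
  lab : ∀ v < X.n, s.arr 5 v = c.lab v
  L : Ind X.n (s.arr 6) c.L
  Q : Ind X.n (s.arr 7) c.Q

theorem Rel.of_eq {s s' : State} {c : Conf} (h : X.Rel s c) (h0 : s'.reg 0 = s.reg 0)
    (h1 : s'.reg 1 = s.reg 1) (h2 : s'.reg 2 = s.reg 2) (h3 : s'.reg 3 = s.reg 3)
    (ha : s'.arr 0 = s.arr 0) (ha' : s'.arr 2 = s.arr 2) (hb : s'.arr 3 = s.arr 3)
    (hp : s'.arr 4 = s.arr 4) (hl : s'.arr 5 = s.arr 5) (hL : s'.arr 6 = s.arr 6)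
    (hQ : s'.arr 7 = s.arr 7) : X.Rel s' c :=
  ⟨h.has.of_eq h0 h1 ha ha', h2.trans h.N, h3.trans h.j, by rw [hp]; exact h.par,
    by rw [hb]; exact h.bag, by rw [hl]; exact h.lab, by rw [hL]; exact h.L, by rw [hQ]; exact h.Q⟩

/-- The program does not write the configuration. -/
def _root_.WordRAM.Cmd.keepsConf (c : Cmd) : Bool :=
  c.keeps && !(c.wr 2 || c.wr 3 || c.wa 3 || c.wa 4 || c.wa 5 || c.wa 6 || c.wa 7)

theorem Rel.frame {s s' : State} {c : Conf} (h : X.Rel s c) {p : Cmd} (hf : Frame p s s')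
    (hp : p.keepsConf = true) : X.Rel s' c := by
  simp only [Cmd.keepsConf, Cmd.keeps, Bool.and_eq_true, Bool.not_eq_true',
    Bool.or_eq_false_iff] at hp
  obtain ⟨⟨⟨⟨p0, p1⟩, a0⟩, a2⟩, ⟨⟨⟨⟨⟨p2, p3⟩, a3⟩, a4⟩, a5⟩, a6⟩, a7⟩ := hp
  exact h.of_eq (hf.reg 0 p0) (hf.reg 1 p1) (hf.reg 2 p2) (hf.reg 3 p3) (hf.arr 0 a0) (hf.arr 2 a2)
    (hf.arr 3 a3) (hf.arr 4 a4) (hf.arr 5 a5) (hf.arr 6 a6) (hf.arr 7 a7)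

theorem fillRow_wp (hX : X.Valid) {b : ℕ} {e : Expr} {s : State} {T K : ℕ} {P : State → Prop}
    (i₀ : ℕ) (S : Finset ℕ) (hn : s.reg 1 = X.n) (hb4 : b ≠ 4) (hb : s.reg b = i₀ * X.n)
    (hi₀ : i₀ ≤ 2 * X.n + 2)
    (step : ∀ i s', i < X.n → Frame (Prog.fillRow b e) s s' → s'.reg 4 = i →
      (∀ v, i ≤ v → s'.arr 3 (i₀ * X.n + v) = s.arr 3 (i₀ * X.n + v)) →
      (∀ i' S, i' ≠ i₀ → Row X.n (s.arr 3) i' S → Row X.n (s'.arr 3) i' S) →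
      e.Ok X.E.B X.E.M s' ∧ e.eval s' = if i ∈ S then 1 else 0)
    (post : ∀ s', Frame (Prog.fillRow b e) s s' → Row X.n (s'.arr 3) i₀ S →
      (∀ i' S, i' ≠ i₀ → Row X.n (s.arr 3) i' S → Row X.n (s'.arr 3) i' S) → P s')
    (hT : (e.cost + 14) * (X.n + 1) ≤ T) : WP X.E (Prog.fillRow b e) s T K P := by
  have hMB := hX.M_le
  have hnM := hX.n_le
  have hcell : ∀ v ≤ X.n, i₀ * X.n + v < X.E.M := fun v hv => hX.cell_lt hi₀ hv
  have hb4' : (4 == b) = false := by simpa using hb4.symm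
  refine WP.for_const X.n (fun i s' => (∀ v < i, s'.arr 3 (i₀ * X.n + v) = if v ∈ S then 1 else 0) ∧
    (∀ v, i ≤ v → s'.arr 3 (i₀ * X.n + v) = s.arr 3 (i₀ * X.n + v)) ∧
    (∀ i' S, i' ≠ i₀ → Row X.n (s.arr 3) i' S → Row X.n (s'.arr 3) i' S)) (e.cost + 5) rfl rfl
    (by decide) hn (by omega) (by simp) ?_ ?_ ?_
  · rintro i s' hi hf hx ⟨h1, h2, h3⟩
    obtain ⟨hok, hev⟩ := step i s' hi hf hx h2 h3
    have hbr : s'.reg b = i₀ * X.n :=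
      (hf.reg b (by simp [Cmd.for, Cmd.wr, hb4'])).trans hb
    have hc := hcell i hi.le
    refine WP.simple ?_ (by simp; omega) fun _ => ?_
    · simp only [Cmd.Safe, Expr.Ok, Expr.eval, Op.eval_add, hx, hbr, hok, true_and]
      omega
    · simp only [Cmd.run, State.setReg_arr, State.setArr_arr, if_true, Expr.eval, Op.eval_add, hx,
        hbr, hev]
      refine ⟨fun v hv => ?_, fun v hv => ?_, fun i' S' hi' hR v hv => ?_⟩
      · by_cases hvi : v = i
        · subst hvi; simp
        · rw [Function.update_of_ne (by omega)]; exact h1 v (by omega)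
      · rw [Function.update_of_ne (by omega)]; exact h2 v (by omega)
      · beta_reduce
        rw [Function.update_of_ne (row_ne hv hi hi')]; exact h3 i' S' hi' hR v hv
  · rintro s' hf - ⟨h1, -, h3⟩
    exact post s' hf h1 h3
  · refine le_trans ?_ hT; nlinarith

theorem extend_wp (hX : X.Valid) {s : State} {c : Conf} (h : X.Rel s c) {e : ℕ}
    (he : s.reg 27 = e) (heN : e < c.N) (hN : c.N ≤ 2 * X.n + 1) (hlab : ∀ v < X.n, c.lab v ≤ c.N)
    (hbag : ∀ v ∈ c.bag e, v < X.n ∧ v ∉ c.part X.n e)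
    (hsmall : c.part X.n e ≠ ∅ → (c.bag e).card ≤ 3 * X.k + 4) :
    WP X.E Prog.extend s (80 * (X.n + 1)) 0 fun s' => ∃ A, c.Fills X.n X.k e A ∧
      X.Rel s' (c.extend e A) := by
  have hn := hX.n_le
  have hMB := hX.M_le
  have hk := hX.k_le
  have hB1 : 1 < X.E.B := by omega
  have hcell : ∀ v ≤ X.n, e * X.n + v < X.E.M := fun v hv => hX.cell_lt (by omega) hv
  have h0' := hcell 0 (by omega)
  refine WP.step (T₂ := 76 * (X.n + 1)) ?_ ?_ (by simp; omega)
  · simp [he, h.has.n]; omega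
  intro f₁
  have h₁ := h.frame f₁ rfl
  have b₁ : ((5 ::= ρ 27 *ᵣ ρ 1).run s).reg 5 = e * X.n := by simp [he, h.has.n]
  have e₁ : ((5 ::= ρ 27 *ᵣ ρ 1).run s).reg 27 = e := by simp [he]
  generalize (5 ::= ρ 27 *ᵣ ρ 1).run s = s₁ at h₁ b₁ e₁
  refine WP.step (T₂ := 70 * (X.n + 1)) ?_ ?_ (by simp; omega)
  · simp [h₁.has.k]; omega
  intro f₂
  have h₂ := h₁.frame f₂ rfl
  have b₂ := (f₂.reg 5 rfl).trans b₁
  have e₂ := (f₂.reg 27 rfl).trans e₁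
  have c₂ : ((28 ::= κ 3 *ᵣ ρ 0 +ᵣ κ 4).run s₁).reg 28 = 3 * X.k + 4 := by simp [h₁.has.k]
  generalize (28 ::= κ 3 *ᵣ ρ 0 +ᵣ κ 4).run s₁ = s₂ at h₂ b₂ e₂ c₂
  refine WP.step (T₂ := 66 * (X.n + 1)) ?_ ?_ (by simp; omega)
  · simp [e₂]; omega
  intro f₃
  have h₃ := h₂.frame f₃ rfl
  have b₃ := (f₃.reg 5 rfl).trans b₂
  have c₃ := (f₃.reg 28 rfl).trans c₂
  have d₃ : ((29 ::= ρ 27 +ᵣ κ 1).run s₂).reg 29 = e + 1 := by simp [e₂]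
  generalize (29 ::= ρ 27 +ᵣ κ 1).run s₂ = s₃ at h₃ b₃ c₃ d₃
  clear f₁ f₂ f₃ h₁ h₂ b₁ b₂ e₁ e₂ c₂ h he
  have hbn : (c.bag e).filter (· < X.n) = c.bag e :=
    Finset.filter_true_of_mem fun v hv => (hbag v hv).1
  have hbc : (c.bag e).card ≤ X.n := by
    rw [← hbn]
    exact (Finset.card_le_card (t := range X.n) fun v hv => by simpa using (mem_filter.1 hv).2).trans
      (by simp)
  have hrow := h₃.bag e heN
  refine WP.seq (T₁ := 18 * (X.n + 1)) (K₁ := 0) (T₂ := X.n * (30 + 8) + 6) (K₂ := 0)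
    (Q := fun s' => s'.reg 6 = (c.bag e).card)
    (WP.sum X.n _ (by decide) (by decide) h₃.has.n (by omega) (by rw [hrow.sum, hbn]; omega)
      ?_ (fun s' _ h1 => by rw [h1, hrow.sum, hbn]) (by simp)) ?_ (by omega) (by omega)
  · intro i s' hi hf hx
    have a3 : s'.arr 3 = s₃.arr 3 := hf.arr 3 rfl
    have b5 := (hf.reg 5 rfl).trans b₃
    have := hrow.le hi
    have := hcell i hi.le
    simp [hx, a3, b5]
    omega
  intro s₄ f₄ g₄
  have h₄ := h₃.frame f₄ rfl
  have b₄ := (f₄.reg 5 rfl).trans b₃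
  have c₄ := (f₄.reg 28 rfl).trans c₃
  have d₄ := (f₄.reg 29 rfl).trans d₃
  clear f₄ h₃ b₃ c₃ d₃ hrow
  have hpart : ∀ v, v ∈ c.part X.n e ↔ v < X.n ∧ c.lab v = e + 1 := fun v => Conf.mem_part
  -- `A` collects the vertices moved so far. The last clause says that a vertex of the part is
  -- passed over only when the bag has reached 3k+4 vertices.
  refine WP.for_const X.n (fun i s' => ∃ A ⊆ c.part X.n e, (∀ v ∈ A, v < i) ∧
    X.Rel s' (c.extend e A) ∧ s'.reg 6 = (c.bag e ∪ A).card ∧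
    (A = ∅ ∨ (c.bag e ∪ A).card ≤ 3 * X.k + 4) ∧
    ((∀ v ∈ c.part X.n e, v < i → v ∈ A) ∨ 3 * X.k + 4 ≤ (c.bag e ∪ A).card)) 30 rfl rfl
    (by decide) h₄.has.n (by omega) ?_ ?_ ?_ le_rfl
  · refine ⟨∅, by simp, by simp, ?_, by simp [g₄], Or.inl rfl, Or.inl (by simp)⟩
    have hr := h₄.of_eq (s' := s₄.setReg 4 0) (by simp) (by simp) (by simp) (by simp) (by simp)
      (by simp) (by simp) (by simp) (by simp) (by simp) (by simp)
    refine ⟨hr.has, hr.N, hr.j, hr.par, fun i hi => ?_, fun v hv => ?_, hr.L, hr.Q⟩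
    · have : (c.extend e ∅).bag i = c.bag i := by
        simp [Conf.extend]
      rw [this]; exact hr.bag i hi
    · simpa [Conf.extend] using hr.lab v hv
  · rintro i s' hi hf hx ⟨A, hA, hAi, hR, hcnt, hA1, hA2⟩
    have b5 := (hf.reg 5 rfl).trans b₄
    have r28 := (hf.reg 28 rfl).trans c₄
    have r29 := (hf.reg 29 rfl).trans d₄
    have hlabi := hR.lab i hi
    have hli : (c.extend e A).lab i = c.lab i := by
      have : i ∉ A := fun h1 => (hAi i h1).ne rfl
      simp [Conf.extend, this]
    rw [hli] at hlabi
    have hle := hlab i hi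
    have hcell' := hcell i hi.le
    have hAc : (c.bag e ∪ A).card ≤ X.n := by
      refine (Finset.card_le_card (t := range X.n) fun v hv => ?_).trans (by simp)
      rcases mem_union.1 hv with h1 | h1
      · simpa using (hbag v h1).1
      · simpa using ((hpart v).1 (hA h1)).1
    refine WP.cond (T := 15) ?_ ?_ ?_ (by simp)
    · simp [hx, eqN_lt hB1, ltN_lt hB1, r28, r29, hlabi, hcnt]
      refine ⟨by omega, by omega, ?_⟩
      calc _ ≤ 1 * 1 := Nat.mul_le_mul (eqN_le _ _) (ltN_le _ _)
        _ < _ := by omega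
    · intro hc
      obtain ⟨hc1, hc2⟩ : c.lab i = e + 1 ∧ (c.bag e ∪ A).card < 3 * X.k + 4 := by
        simpa [hx, r28, r29, hlabi, hcnt, not_or] using hc
      have hip : i ∈ c.part X.n e := (hpart i).2 ⟨hi, hc1⟩
      have hiu : i ∉ c.bag e ∪ A := by
        rw [mem_union, not_or]
        exact ⟨fun h1 => (hbag i h1).2 hip, fun h1 => (hAi i h1).ne rfl⟩
      have hcard : (c.bag e ∪ insert i A).card = (c.bag e ∪ A).card + 1 := by
        rw [union_insert, card_insert_of_notMem hiu]
      refine WP.simple ?_ (by simp) fun _ => ?_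
      · simp [hx, b5, hcnt]; omega
      refine ⟨insert i A, Finset.insert_subset hip hA, ?_, ?_, ?_, Or.inr (by omega), ?_⟩
      · intro v hv
        rcases mem_insert.1 hv with rfl | h1
        · omega
        · have := hAi v h1; omega
      · refine ⟨hR.has.of_eq (by simp) (by simp) (by simp) (by simp), by simp; exact hR.N,
          by simp; exact hR.j, by simp; exact hR.par, fun i' hi' => ?_, fun v hv => ?_,
          by simp; exact hR.L, by simp; exact hR.Q⟩
        · intro v hv
          have h1 := hR.bag i' hi' v hv
          simp only [Cmd.run, Expr.eval, Op.eval_add, State.setReg_arr, State.setArr_arr,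
            State.setArr_reg, hx, b5, reduceIte, Nat.reduceEqDiff] at h1 ⊢
          by_cases hie : i' = e
          · subst hie
            simp only [Conf.extend, Function.update_self] at h1 ⊢
            by_cases hvi : v = i
            · subst hvi; simp
            · rw [Function.update_of_ne (by omega), h1]
              simp [hvi]
          · rw [Function.update_of_ne (row_ne hv hi hie), h1]
            simp [Conf.extend, hie]
        · have h1 := hR.lab v hv
          simp only [Cmd.run, Expr.eval, Op.eval_add, State.setReg_arr, State.setArr_arr,
            State.setArr_reg, hx, b5, reduceIte, Nat.reduceEqDiff,
            Conf.extend] at h1 ⊢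
          by_cases hvi : v = i
          · subst hvi; simp
          · rw [Function.update_of_ne hvi, h1]; simp [hvi]
      · rw [hcard]; simp [hcnt]
      · rcases hA2 with h1 | h1
        · left
          intro v hv hvi
          by_cases hvi' : v = i
          · simp [hvi']
          · exact mem_insert_of_mem (h1 v hv (by omega))
        · right; omega
    · intro hc
      have hc' : c.lab i ≠ e + 1 ∨ 3 * X.k + 4 ≤ (c.bag e ∪ A).card := by
        simpa [hx, r28, r29, hlabi, hcnt] using hc
      refine WP.simple trivial (by simp) fun _ => ?_
      refine ⟨A, hA, fun v hv => (hAi v hv).trans (by omega), ?_, by simpa using hcnt, hA1, ?_⟩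
      · exact hR.of_eq (by simp) (by simp) (by simp) (by simp) (by simp)
          (by simp) (by simp) (by simp) (by simp) (by simp) (by simp)
      · rcases hA2 with h1 | h1
        · rcases hc' with h2 | h2
          · left
            intro v hv hvi
            by_cases hvi' : v = i
            · subst hvi'; exact absurd ((hpart v).1 hv).2 h2
            · exact h1 v hv (by omega)
          · exact Or.inr h2
        · exact Or.inr h1
  · rintro s' hf - ⟨A, hA, -, hR, -, hA1, hA2⟩
    refine ⟨A, ⟨hA, hA1.symm, ?_⟩, hR⟩
    rcases hA2 with h1 | h1
    · exact Or.inl fun v hv => h1 v hv ((hpart v).1 hv).1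
    -- Nothing was moved although the bag has at least 3k+4 vertices. Then either the part is empty,
    -- or `hsmall` makes the size exact.
    · rcases hA1 with rfl | h2
      · by_cases hp : c.part X.n e = ∅
        · left; rw [hp]
        · right
          have := hsmall hp
          rw [union_empty] at h1 ⊢
          omega
      · right; omega

end Ctx

/-! ### Branching -/

open Finset WordRAM

namespace Prog

/-- The negation of a truth value. -/
def neg (e : Expr) : Expr := κ 1 -ᵣ e

/-- The entry of array `a` for the vertex in register `4`. -/
def at4 (a : ℕ) : Expr := .arr a (ρ 4)

/-- Finish the current node and add its two children. The arrays `12`, `14`, `15`, `11`, `16`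
contain the three bags, the untreated vertices below the first child, and the base component. -/
def branch : Cmd :=
  27 ::= ρ 2 *ᵣ ρ 1 ;; fillRow 27 (at4 14) ;; 27 ::= ρ 27 +ᵣ ρ 1 ;; fillRow 27 (at4 15) ;;
    fillRow 5 (at4 12) ;; 28 ::= ρ 2 +ᵣ κ 1 ;; 29 ::= ρ 2 +ᵣ κ 2 ;;
    Cmd.fill 5 (at4 23 *ᵣ (neg (at4 12) *ᵣ (neg (at4 16) *ᵣ (at4 11 *ᵣ ρ 28 +ᵣ neg (at4 11) *ᵣ ρ 29)))
      +ᵣ neg (at4 23) *ᵣ at4 5) ;;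
    Cmd.fill 6 (neg (neg (at4 6) *ᵣ neg (at4 16))) ;;
    .store 4 (ρ 2) (ρ 3) ;; .store 4 (ρ 2 +ᵣ κ 1) (ρ 3) ;; 2 ::= ρ 2 +ᵣ κ 2 ;; 3 ::= ρ 3 +ᵣ κ 1

/-- The vertices of the cut. -/
def cutVertices : Cmd :=
  Cmd.fill 12 (neg (at4 13) *ᵣ neg (neg (at4 12) *ᵣ neg (at4 9 =ᵣ κ 1)))

def prepareBalanced : Cmd :=
  cutVertices ;; Cmd.fill 14 (neg (neg (at4 8) *ᵣ neg (at4 12))) ;;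
    Cmd.fill 15 (neg (neg (at4 24 *ᵣ neg (at4 8)) *ᵣ neg (at4 12))) ;;
    Cmd.fill 11 (at4 13 *ᵣ at4 23) ;; Cmd.fill 16 (κ 0) ;;
    Cmd.fill 12 (neg (neg (at4 24) *ᵣ neg (at4 12)))

def prepareBase : Cmd :=
  cutVertices ;; Cmd.fill 14 (neg (neg (at4 24) *ᵣ (neg (at4 12) *ᵣ neg (at4 13)))) ;;
    Cmd.fill 15 (neg (neg (at4 24 *ᵣ neg (at4 8)) *ᵣ neg (at4 12))) ;;
    Cmd.fill 11 (κ 0) ;; Cmd.fill 16 (at4 13 *ᵣ at4 23) ;;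
    Cmd.fill 12 (neg (neg (at4 24) *ᵣ neg (at4 12)))

/-- Branch and extend the bags of the children. -/
def branchExtend : Cmd :=
  branch ;; 27 ::= ρ 2 -ᵣ κ 2 ;; extend ;; 27 ::= ρ 2 -ᵣ κ 1 ;; extend ;; 22 ::= κ 1

/-- Branch at a cut and extend the bags of the children. -/
def split : Cmd :=
  .cond (ρ 18 =ᵣ κ 1) prepareBalanced prepareBase ;; branchExtend

end Prog

namespace Ctx

variable {X : Ctx}

/-- The state contains the configuration, the untreated vertices below its current node, the bag of
this node, and a part of this bag. -/
structure Att (X : Ctx) (s : State) (c : Conf) (M : Finset ℕ) : Prop where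
  rel : X.Rel s c
  S : Ind X.n (s.arr 23) (c.part X.n c.j)
  Z : Ind X.n (s.arr 24) (c.bag c.j)
  M : Ind X.n (s.arr 8) M
  row : s.reg 5 = c.j * X.n

theorem Att.frame {s s' : State} {c : Conf} {M : Finset ℕ} (h : X.Att s c M) {p : Cmd}
    (hf : Frame p s s') (hp : (p.keepsConf && !(p.wr 5 || p.wa 8 || p.wa 23 || p.wa 24)) = true) :
    X.Att s' c M := by
  simp only [Bool.and_eq_true, Bool.not_eq_true', Bool.or_eq_false_iff] at hp
  obtain ⟨h1, ⟨⟨h5, h8⟩, h23⟩, h24⟩ := hp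
  exact ⟨h.rel.frame hf h1, by rw [hf.arr 23 h23]; exact h.S, by rw [hf.arr 24 h24]; exact h.Z,
    by rw [hf.arr 8 h8]; exact h.M, (hf.reg 5 h5).trans h.row⟩

theorem fill_ind_wp (hX : X.Valid) {a : ℕ} {e : Expr} {s : State} {T K : ℕ} {P : State → Prop}
    (S : Finset ℕ) (h : X.Has s)
    (step : ∀ i s', i < X.n → i < X.E.M → i < X.E.B → 1 < X.E.B → Frame (Cmd.fill a e) s s' →
      s'.reg 4 = i → (∀ v, i ≤ v → s'.arr a v = s.arr a v) →
      e.Ok X.E.B X.E.M s' ∧ e.eval s' = if i ∈ S then 1 else 0)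
    (post : ∀ s', Frame (Cmd.fill a e) s s' → Ind X.n (s'.arr a) S → P s')
    (hT : (e.cost + 10) * (X.n + 1) ≤ T) : WP X.E (Cmd.fill a e) s T K P := by
  have hn := hX.n_le
  have hMB := hX.M_le
  exact WP.fill X.n _ h.n (by omega) (by omega)
    (fun i s' hi hf hx hv => step i s' hi (by omega) (by omega) (by omega) hf hx hv)
    (fun s' hf h1 _ => post s' hf h1) hT

/-- The rows `N` and `N + 1` lie beyond those of the configuration, so writing them first does not
disturb it. Then the bag of `j`, the labels and `L` are replaced one after the other, each step
realising an intermediate configuration; the counters `N` and `j` are raised last. -/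
theorem branch_wp (hX : X.Valid) {s : State} {c : Conf} (h : X.Rel s c) (hj : c.j < c.N)
    (hN : c.N + 2 ≤ 2 * X.n + 1) (hlab : ∀ v < X.n, c.lab v ≤ c.N)
    (hS : Ind X.n (s.arr 23) (c.part X.n c.j)) (h5 : s.reg 5 = c.j * X.n)
    {X₀ X₁ X₂ S₁ L₁ : Finset ℕ} (hX₀ : Ind X.n (s.arr 12) X₀) (hX₁ : Ind X.n (s.arr 14) X₁)
    (hX₂ : Ind X.n (s.arr 15) X₂) (hS₁ : Ind X.n (s.arr 11) S₁) (hL₁ : Ind X.n (s.arr 16) L₁) :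
    WP X.E Prog.branch s (200 * (X.n + 1)) 0 fun s' =>
      X.Rel s' (c.branch X.n X₀ X₁ X₂ S₁ L₁) := by
  have hn := hX.n_le
  have hMB := hX.M_le
  have hB1 : 1 < X.E.B := by omega
  have hc0 := hX.cell_lt (i := c.N) (v := 0) (by omega) (by omega)
  have hc1 := hX.cell_lt (i := c.N + 1) (v := 0) (by omega) (by omega)
  have hN1 : (c.N + 1) * X.n = c.N * X.n + X.n := by ring
  have core : ∀ {p : Cmd} {s s' : State} {c : Conf}, X.Rel s c → Frame p s s' →
      (p.keeps && !(p.wr 2 || p.wr 3 || p.wa 4 || p.wa 5 || p.wa 6 || p.wa 7)) = true →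
      ∀ c' : Conf, c'.N = c.N → c'.j = c.j → c'.par = c.par → c'.lab = c.lab → c'.L = c.L →
      c'.Q = c.Q → (∀ i < c.N, Row X.n (s'.arr 3) i (c'.bag i)) → X.Rel s' c' := by
    intro p s s' c h hf hp c' hN hj hpar hl hL hQ hb
    simp only [Bool.and_eq_true, Bool.not_eq_true', Bool.or_eq_false_iff] at hp
    obtain ⟨h1, ⟨⟨⟨⟨h2, h3⟩, a4⟩, a5⟩, a6⟩, a7⟩ := hp
    exact ⟨h.has.frame hf h1, by rw [hN, hf.reg 2 h2]; exact h.N,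
      by rw [hj, hf.reg 3 h3]; exact h.j, by rw [hN, hpar, hf.arr 4 a4]; exact h.par,
      by rw [hN]; exact hb, by rw [hl, hf.arr 5 a5]; exact h.lab,
      by rw [hL, hf.arr 6 a6]; exact h.L, by rw [hQ, hf.arr 7 a7]; exact h.Q⟩
  refine WP.step (T₂ := 190 * (X.n + 1)) ?_ ?_ (by simp; omega)
  · simp [h.N, h.has.n]; omega
  intro f₁
  have h₁ := h.frame f₁ rfl
  have g₁ : ((27 ::= ρ 2 *ᵣ ρ 1).run s).reg 27 = c.N * X.n := by simp [h.N, h.has.n]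
  replace h5 := (f₁.reg 5 rfl).trans h5
  rw [← f₁.arr 11 rfl] at hS₁; rw [← f₁.arr 12 rfl] at hX₀; rw [← f₁.arr 14 rfl] at hX₁
  rw [← f₁.arr 15 rfl] at hX₂; rw [← f₁.arr 16 rfl] at hL₁; rw [← f₁.arr 23 rfl] at hS
  generalize (27 ::= ρ 2 *ᵣ ρ 1).run s = s₁ at h₁ g₁ h5 hX₀ hX₁ hX₂ hS₁ hL₁ hS
  clear f₁ h s
  refine WP.seq (T₁ := 20 * (X.n + 1)) (K₁ := 0) (T₂ := 170 * (X.n + 1)) (K₂ := 0)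
    (Q := fun s' => Row X.n (s'.arr 3) c.N X₁ ∧ X.Rel s' c)
    (fillRow_wp hX c.N X₁ h₁.has.n (by decide) g₁ (by omega) ?_ ?_ (by simp [Prog.at4])) ?_
    (by omega) (by omega)
  · intro i s' hi hf hx _ _
    have := hX₁ i hi
    have := hX₁.le hi
    have e := hf.arr 14 rfl
    simp [Prog.at4, hx, e]
    exact ⟨by omega, by assumption⟩
  · intro s' hf hr hr'
    exact ⟨hr, core h₁ hf rfl c rfl rfl rfl rfl rfl rfl fun i hi => hr' i _ (by omega) (h₁.bag i hi)⟩
  rintro s₂ f₂ ⟨rN, h₂⟩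
  have g₂ := (f₂.reg 27 rfl).trans g₁
  replace h5 := (f₂.reg 5 rfl).trans h5
  rw [← f₂.arr 11 rfl] at hS₁; rw [← f₂.arr 12 rfl] at hX₀
  rw [← f₂.arr 15 rfl] at hX₂; rw [← f₂.arr 16 rfl] at hL₁; rw [← f₂.arr 23 rfl] at hS
  clear f₂ h₁ g₁ hX₁ s₁
  refine WP.step (T₂ := 160 * (X.n + 1)) ?_ ?_ (by simp; omega)
  · simp [g₂, h₂.has.n]; omega
  intro f₁
  have h₁ := h₂.frame f₁ rfl
  have g₁ : ((27 ::= ρ 27 +ᵣ ρ 1).run s₂).reg 27 = (c.N + 1) * X.n := by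
    simp [g₂, h₂.has.n, hN1]
  replace h5 := (f₁.reg 5 rfl).trans h5
  rw [← f₁.arr 11 rfl] at hS₁; rw [← f₁.arr 12 rfl] at hX₀
  rw [← f₁.arr 15 rfl] at hX₂; rw [← f₁.arr 16 rfl] at hL₁; rw [← f₁.arr 23 rfl] at hS
  rw [← f₁.arr 3 rfl] at rN
  generalize (27 ::= ρ 27 +ᵣ ρ 1).run s₂ = s₁ at h₁ g₁ h5 hX₀ hX₂ hS₁ hL₁ hS rN
  clear f₁ h₂ s₂ g₂
  refine WP.seq (T₁ := 20 * (X.n + 1)) (K₁ := 0) (T₂ := 140 * (X.n + 1)) (K₂ := 0)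
    (Q := fun s' => Row X.n (s'.arr 3) c.N X₁ ∧ Row X.n (s'.arr 3) (c.N + 1) X₂ ∧ X.Rel s' c)
    (fillRow_wp hX (c.N + 1) X₂ h₁.has.n (by decide) g₁ (by omega) ?_ ?_ (by simp [Prog.at4])) ?_
    (by omega) (by omega)
  · intro i s' hi hf hx _ _
    have := hX₂ i hi
    have := hX₂.le hi
    have e := hf.arr 15 rfl
    simp [Prog.at4, hx, e]
    exact ⟨by omega, by assumption⟩
  · intro s' hf hr hr'
    exact ⟨hr' _ _ (by omega) rN, hr, core h₁ hf rfl c rfl rfl rfl rfl rfl rfl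
      fun i hi => hr' i _ (by omega) (h₁.bag i hi)⟩
  intro s₂ f₂ hq
  clear rN
  obtain ⟨rN, rN1, h₂⟩ := hq
  replace h5 := (f₂.reg 5 rfl).trans h5
  rw [← f₂.arr 11 rfl] at hS₁; rw [← f₂.arr 12 rfl] at hX₀
  rw [← f₂.arr 16 rfl] at hL₁; rw [← f₂.arr 23 rfl] at hS
  clear f₂ h₁ g₁ hX₂ s₁
  refine WP.seq (T₁ := 20 * (X.n + 1)) (K₁ := 0) (T₂ := 120 * (X.n + 1)) (K₂ := 0)
    (Q := fun s' => Row X.n (s'.arr 3) c.N X₁ ∧ Row X.n (s'.arr 3) (c.N + 1) X₂ ∧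
      X.Rel s' { c with bag := Function.update c.bag c.j X₀ })
    (fillRow_wp hX c.j X₀ h₂.has.n (by decide) h5 (by omega) ?_ ?_ (by simp [Prog.at4])) ?_
    (by omega) (by omega)
  · intro i s' hi hf hx _ _
    have := hX₀ i hi
    have := hX₀.le hi
    have e := hf.arr 12 rfl
    simp [Prog.at4, hx, e]
    exact ⟨by omega, by assumption⟩
  · intro s' hf hr hr'
    refine ⟨hr' _ _ (by omega) rN, hr' _ _ (by omega) rN1, core h₂ hf rfl _ rfl rfl rfl rfl rfl rfl
      fun i hi => ?_⟩
    by_cases hij : i = c.j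
    · subst hij; simpa using hr
    · simp only [Function.update_of_ne hij]
      exact hr' i _ hij (h₂.bag i hi)
  intro s₁ f₁ hq
  clear rN rN1
  obtain ⟨rN, rN1, h₁⟩ := hq
  rw [← f₁.arr 11 rfl] at hS₁; rw [← f₁.arr 12 rfl] at hX₀
  rw [← f₁.arr 16 rfl] at hL₁; rw [← f₁.arr 23 rfl] at hS
  clear f₁ h₂ h5 s₂
  set c₁ : Conf := { c with bag := Function.update c.bag c.j X₀ } with hc₁
  refine WP.step (T₂ := 116 * (X.n + 1)) ?_ ?_ (by simp; omega)
  · simp [h₁.N, hc₁]; omega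
  intro f₂
  have h₂ := h₁.frame f₂ rfl
  have g₂ : ((28 ::= ρ 2 +ᵣ κ 1).run s₁).reg 28 = c.N + 1 := by simp [h₁.N, hc₁]
  rw [← f₂.arr 11 rfl] at hS₁; rw [← f₂.arr 12 rfl] at hX₀
  rw [← f₂.arr 16 rfl] at hL₁; rw [← f₂.arr 23 rfl] at hS; rw [← f₂.arr 3 rfl] at rN rN1
  generalize (28 ::= ρ 2 +ᵣ κ 1).run s₁ = s₂ at h₂ g₂ hX₀ hS₁ hL₁ hS rN rN1
  clear f₂ h₁ s₁
  refine WP.step (T₂ := 112 * (X.n + 1)) ?_ ?_ (by simp; omega)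
  · simp [h₂.N, hc₁]; omega
  intro f₁
  have h₁ := h₂.frame f₁ rfl
  replace g₂ := (f₁.reg 28 rfl).trans g₂
  have g₁ : ((29 ::= ρ 2 +ᵣ κ 2).run s₂).reg 29 = c.N + 2 := by simp [h₂.N, hc₁]
  rw [← f₁.arr 11 rfl] at hS₁; rw [← f₁.arr 12 rfl] at hX₀
  rw [← f₁.arr 16 rfl] at hL₁; rw [← f₁.arr 23 rfl] at hS; rw [← f₁.arr 3 rfl] at rN rN1
  generalize (29 ::= ρ 2 +ᵣ κ 2).run s₂ = s₁ at h₁ g₂ g₁ hX₀ hS₁ hL₁ hS rN rN1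
  clear f₁ h₂ s₂
  set lab' : ℕ → ℕ := fun v => if v ∈ c.part X.n c.j then
      (if v ∈ X₀ ∪ L₁ then 0 else if v ∈ S₁ then c.N + 1 else c.N + 2) else c.lab v with hlab'
  refine WP.seq (T₁ := 60 * (X.n + 1)) (K₁ := 0) (T₂ := 50 * (X.n + 1)) (K₂ := 0)
    (Q := fun s' => X.Rel s' { c₁ with lab := lab' })
    (WP.fill X.n lab' h₁.has.n (by omega) (by omega) ?_ ?_ (by simp [Prog.at4, Prog.neg])) ?_
    (by omega) (by omega)
  · intro i s' hi hf hx h5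
    have e11 := (congrFun (hf.arr 11 rfl) i).trans (hS₁ i hi)
    have e12 := (congrFun (hf.arr 12 rfl) i).trans (hX₀ i hi)
    have e16 := (congrFun (hf.arr 16 rfl) i).trans (hL₁ i hi)
    have e23 := (congrFun (hf.arr 23 rfl) i).trans (hS i hi)
    have e5 := (h5 i le_rfl).trans (h₁.lab i hi)
    have e28 := (hf.reg 28 rfl).trans g₂
    have e29 := (hf.reg 29 rfl).trans g₁
    have hle := hlab i hi
    have hiM : i < X.E.M := by omega
    have hiB : i < X.E.B := by omega
    have hN1B : c.N + 1 < X.E.B := by omega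
    have hN2B : c.N + 2 < X.E.B := by omega
    have hlB : c.lab i < X.E.B := by omega
    have hB0 : 0 < X.E.B := by omega
    simp only [Prog.at4, Prog.neg, Expr.Ok, Expr.eval, hx, e11, e12, e16, e23, e5, e28, e29,
      Op.eval_add, Op.eval_mul, Op.eval_sub, hlab', hc₁, mem_union]
    by_cases b1 : i ∈ c.part X.n c.j <;> by_cases b2 : i ∈ X₀ <;> by_cases b3 : i ∈ L₁ <;>
      by_cases b4 : i ∈ S₁ <;> simp [*]
  · intro s' hf h5 _
    exact ⟨h₁.has.frame hf rfl, (hf.reg 2 rfl).trans h₁.N, (hf.reg 3 rfl).trans h₁.j,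
      by rw [hf.arr 4 rfl]; exact h₁.par, by rw [hf.arr 3 rfl]; exact h₁.bag, h5,
      by rw [hf.arr 6 rfl]; exact h₁.L, by rw [hf.arr 7 rfl]; exact h₁.Q⟩
  intro s₂ f₂ h₂
  rw [← f₂.arr 16 rfl] at hL₁; rw [← f₂.arr 3 rfl] at rN rN1
  clear f₂ h₁ g₁ g₂ hX₀ hS₁ hS s₁
  refine WP.seq (T₁ := 25 * (X.n + 1)) (K₁ := 0) (T₂ := 25 * (X.n + 1)) (K₂ := 0)
    (Q := fun s' => X.Rel s' { c₁ with lab := lab', L := c.L ∪ L₁ })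
    (fill_ind_wp hX (c.L ∪ L₁) h₂.has ?_ ?_ (by simp [Prog.at4, Prog.neg])) ?_
    (by omega) (by omega)
  · intro i s' hi hiM hiB hB hf hx h6
    have e16 := (congrFun (hf.arr 16 rfl) i).trans (hL₁ i hi)
    have e6 := (h6 i le_rfl).trans (h₂.L i hi)
    have hB0 : 0 < X.E.B := by omega
    simp only [Prog.at4, Prog.neg, Expr.Ok, Expr.eval, hx, e16, e6,
      Op.eval_mul, Op.eval_sub, hc₁, mem_union]
    by_cases b3 : i ∈ L₁ <;> by_cases b4 : i ∈ c.L <;> simp [*]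
  · intro s' hf h6
    exact ⟨h₂.has.frame hf rfl, (hf.reg 2 rfl).trans h₂.N, (hf.reg 3 rfl).trans h₂.j,
      by rw [hf.arr 4 rfl]; exact h₂.par, by rw [hf.arr 3 rfl]; exact h₂.bag,
      by rw [hf.arr 5 rfl]; exact h₂.lab, h6, by rw [hf.arr 7 rfl]; exact h₂.Q⟩
  intro s₁ f₁ h₁
  rw [← f₁.arr 3 rfl] at rN rN1
  clear f₁ h₂ hL₁ s₂
  have hN' : s₁.reg 2 = c.N := h₁.N
  have hj' : s₁.reg 3 = c.j := h₁.j
  refine WP.simple ?_ (by simp; omega) fun _ => ?_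
  · simp [hN', hj']; omega
  refine ⟨h₁.has.of_eq (by simp) (by simp) (by simp) (by simp), ?_, ?_, ?_, ?_, ?_, ?_, ?_⟩
  · simp [hN', Conf.branch]
  · simp [hj', Conf.branch]
  · intro i hi
    have hi' : i < c.N + 2 := hi
    simp only [Cmd.run, Expr.eval, Op.eval_add, State.setReg_arr, State.setArr_arr, State.setArr_reg,
      hN', hj', reduceIte, Conf.branch]
    by_cases h1 : i = c.N + 1
    · subst h1; simp
    · rw [Function.update_of_ne h1]
      by_cases h2 : i = c.N
      · subst h2; simp
      · rw [Function.update_of_ne h2, if_pos (by omega)]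
        exact h₁.par i (show i < c.N by omega)
  · intro i hi
    have hi' : i < c.N + 2 := hi
    simp only [Cmd.run, Expr.eval, Op.eval_add, State.setReg_arr, State.setArr_arr, State.setArr_reg,
      reduceIte, Conf.branch, Nat.reduceEqDiff]
    by_cases h1 : i = c.N + 1
    · subst h1
      have : c.N + 1 ≠ c.j := by omega
      simpa [this] using rN1
    · by_cases h2 : i = c.N
      · subst h2
        have : c.N ≠ c.j := by omega
        simpa [this] using rN
      · have := h₁.bag i (show i < c.N by omega)
        by_cases h3 : i = c.j
        · subst h3
          simpa [hc₁] using this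
        · simpa [hc₁, h1, h2, h3] using this
  · simp; exact h₁.lab
  · simp; exact h₁.L
  · simp; exact h₁.Q

theorem cutVertices_wp (hX : X.Valid) {s : State} (h : X.Has s) {role : ℕ → ℕ}
    (hrole : s.arr 9 = role) (hr : ∀ v < X.n, role v ≤ 3) (h12 : ∀ v < X.n, s.arr 12 v ≤ 1)
    (h13 : ∀ v < X.n, s.arr 13 v ≤ 1) {C Y : Finset ℕ}
    (hC : C = (range X.n).filter fun v => s.arr 13 v = 1)
    (hY : Y = (range X.n).filter fun v => (s.arr 12 v = 1 ∨ role v = 1) ∧ s.arr 13 v ≠ 1) :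
    WP X.E Prog.cutVertices s (30 * (X.n + 1)) 0 fun s' =>
      Ind X.n (s'.arr 12) Y ∧ Ind X.n (s'.arr 13) C := by
  refine fill_ind_wp hX Y h ?_ ?_ (by simp [Prog.at4, Prog.neg])
  · intro i s' hi hiM hiB hB hf hx h6
    have e12 := h6 i le_rfl
    have e13 := congrFun (hf.arr 13 rfl) i
    have e9 := congrFun (hf.arr 9 rfl) i
    rw [hrole] at e9
    have hB0 : 0 < X.E.B := by omega
    have hrB : role i < X.E.B := by have := hr i hi; have := hX.n_le; have := hX.M_le; omega
    simp only [Prog.at4, Prog.neg, Expr.Ok, Expr.eval, hx, e12, e13, e9,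
      Op.eval_mul, Op.eval_sub, Op.eval_eq, hY, mem_filter, mem_range, hi, true_and]
    have q12 : s.arr 12 i = 0 ∨ s.arr 12 i = 1 := by have := h12 i hi; omega
    have q13 : s.arr 13 i = 0 ∨ s.arr 13 i = 1 := by have := h13 i hi; omega
    by_cases q9 : role i = 1
    · rcases q12 with q12 | q12 <;> rcases q13 with q13 | q13 <;> simp [*]
    · rcases q12 with q12 | q12 <;> rcases q13 with q13 | q13 <;> simp [*, eqN_of_ne q9]
  · intro s' hf h1
    refine ⟨h1, fun v hv => ?_⟩
    have q13 : s.arr 13 v = 0 ∨ s.arr 13 v = 1 := by have := h13 v hv; omega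
    rw [hf.arr 13 rfl, hC]
    rcases q13 with q13 | q13 <;> simp [q13, hv]

/-- Array `12` holds the cut `Y`, from which other sets are computed; it is overwritten by the bag
of the node only at the end. -/
theorem prepareBalanced_wp (hX : X.Valid) {s : State} {c : Conf} {M : Finset ℕ} (h : X.Att s c M)
    {role : ℕ → ℕ}
    (hrole : s.arr 9 = role) (hr : ∀ v < X.n, role v ≤ 3) (h12 : ∀ v < X.n, s.arr 12 v ≤ 1)
    (h13 : ∀ v < X.n, s.arr 13 v ≤ 1) {C Y : Finset ℕ}
    (hC : C = (range X.n).filter fun v => s.arr 13 v = 1)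
    (hY : Y = (range X.n).filter fun v => (s.arr 12 v = 1 ∨ role v = 1) ∧ s.arr 13 v ≠ 1) :
    WP X.E Prog.prepareBalanced s (170 * (X.n + 1)) 0 fun s' =>
      Ind X.n (s'.arr 12) (c.bag c.j ∪ Y) ∧ Ind X.n (s'.arr 14) (M ∪ Y) ∧
      Ind X.n (s'.arr 15) ((c.bag c.j \ M) ∪ Y) ∧ Ind X.n (s'.arr 11) (C ∩ c.part X.n c.j) ∧
      Ind X.n (s'.arr 16) ∅ := by
  refine WP.seq (cutVertices_wp hX h.rel.has hrole hr h12 h13 hC hY) (T₂ := 140 * (X.n + 1))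
    (K₂ := 0) ?_ (by omega) (by omega)
  rintro s₁ f₁ ⟨Y₁, C₁⟩
  have h₁ := h.frame f₁ rfl
  clear f₁ hC hY hrole hr h12 h13
  refine WP.seq (T₁ := 22 * (X.n + 1)) (K₁ := 0) (T₂ := 118 * (X.n + 1)) (K₂ := 0)
    (Q := fun s' => Ind X.n (s'.arr 14) (M ∪ Y))
    (fill_ind_wp hX _ h₁.rel.has ?_ (fun _ _ h => h) (by simp [Prog.at4, Prog.neg])) ?_
    (by omega) (by omega)
  · intro i s' hi hiM hiB hB hf hx _
    have e12 := (congrFun (hf.arr 12 rfl) i).trans (Y₁ i hi)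
    have e8 := (congrFun (hf.arr 8 rfl) i).trans (h₁.M i hi)
    have hB0 : 0 < X.E.B := by omega
    simp only [Prog.at4, Prog.neg, Expr.Ok, Expr.eval, hx, e12, e8, Op.eval_mul, Op.eval_sub,
      mem_union]
    by_cases b1 : i ∈ M <;> by_cases b2 : i ∈ Y <;> simp [*]
  intro s₂ f₂ X₁
  have h₂ := h₁.frame f₂ rfl
  rw [← f₂.arr 12 rfl] at Y₁; rw [← f₂.arr 13 rfl] at C₁
  clear f₂ h₁
  refine WP.seq (T₁ := 30 * (X.n + 1)) (K₁ := 0) (T₂ := 88 * (X.n + 1)) (K₂ := 0)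
    (Q := fun s' => Ind X.n (s'.arr 15) ((c.bag c.j \ M) ∪ Y))
    (fill_ind_wp hX _ h₂.rel.has ?_ (fun _ _ h => h) (by simp [Prog.at4, Prog.neg])) ?_
    (by omega) (by omega)
  · intro i s' hi hiM hiB hB hf hx _
    have e12 := (congrFun (hf.arr 12 rfl) i).trans (Y₁ i hi)
    have e8 := (congrFun (hf.arr 8 rfl) i).trans (h₂.M i hi)
    have e24 := (congrFun (hf.arr 24 rfl) i).trans (h₂.Z i hi)
    have hB0 : 0 < X.E.B := by omega
    simp only [Prog.at4, Prog.neg, Expr.Ok, Expr.eval, hx, e12, e8, e24, Op.eval_mul, Op.eval_sub,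
      mem_union, mem_sdiff]
    by_cases b1 : i ∈ M <;> by_cases b2 : i ∈ Y <;> by_cases b3 : i ∈ c.bag c.j <;> simp [*]
  intro s₃ f₃ X₂
  have h₃ := h₂.frame f₃ rfl
  rw [← f₃.arr 12 rfl] at Y₁; rw [← f₃.arr 13 rfl] at C₁; rw [← f₃.arr 14 rfl] at X₁
  clear f₃ h₂
  refine WP.seq (T₁ := 15 * (X.n + 1)) (K₁ := 0) (T₂ := 58 * (X.n + 1)) (K₂ := 0)
    (Q := fun s' => Ind X.n (s'.arr 11) (C ∩ c.part X.n c.j))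
    (fill_ind_wp hX _ h₃.rel.has ?_ (fun _ _ h => h) (by simp [Prog.at4])) ?_
    (by omega) (by omega)
  · intro i s' hi hiM hiB hB hf hx _
    have e13 := (congrFun (hf.arr 13 rfl) i).trans (C₁ i hi)
    have e23 := (congrFun (hf.arr 23 rfl) i).trans (h₃.S i hi)
    have hB0 : 0 < X.E.B := by omega
    simp only [Prog.at4, Expr.Ok, Expr.eval, hx, e13, e23, Op.eval_mul, mem_inter]
    by_cases b1 : i ∈ C <;> by_cases b2 : i ∈ c.part X.n c.j <;> simp [*]
  intro s₄ f₄ S₁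
  have h₄ := h₃.frame f₄ rfl
  rw [← f₄.arr 12 rfl] at Y₁; rw [← f₄.arr 14 rfl] at X₁; rw [← f₄.arr 15 rfl] at X₂
  clear f₄ h₃ C₁
  refine WP.seq (T₁ := 11 * (X.n + 1)) (K₁ := 0) (T₂ := 30 * (X.n + 1)) (K₂ := 0)
    (Q := fun s' => Ind X.n (s'.arr 16) ∅)
    (fill_ind_wp hX _ h₄.rel.has ?_ (fun _ _ h => h) (by simp)) ?_ (by omega) (by omega)
  · intro i s' hi hiM hiB hB hf hx _
    simp; omega
  intro s₅ f₅ L₁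
  have h₅ := h₄.frame f₅ rfl
  rw [← f₅.arr 12 rfl] at Y₁; rw [← f₅.arr 14 rfl] at X₁; rw [← f₅.arr 15 rfl] at X₂
  rw [← f₅.arr 11 rfl] at S₁
  clear f₅ h₄
  refine fill_ind_wp hX (c.bag c.j ∪ Y) h₅.rel.has ?_ ?_ (by simp [Prog.at4, Prog.neg])
  · intro i s' hi hiM hiB hB hf hx h12
    have e12 := (h12 i le_rfl).trans (Y₁ i hi)
    have e24 := (congrFun (hf.arr 24 rfl) i).trans (h₅.Z i hi)
    have hB0 : 0 < X.E.B := by omega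
    simp only [Prog.at4, Prog.neg, Expr.Ok, Expr.eval, hx, e12, e24, Op.eval_mul, Op.eval_sub,
      mem_union]
    by_cases b1 : i ∈ c.bag c.j <;> by_cases b2 : i ∈ Y <;> simp [*]
  · intro s' hf h1
    exact ⟨h1, by rw [hf.arr 14 rfl]; exact X₁, by rw [hf.arr 15 rfl]; exact X₂,
      by rw [hf.arr 11 rfl]; exact S₁, by rw [hf.arr 16 rfl]; exact L₁⟩

theorem prepareBase_wp (hX : X.Valid) {s : State} {c : Conf} {M : Finset ℕ} (h : X.Att s c M)
    {role : ℕ → ℕ}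
    (hrole : s.arr 9 = role) (hr : ∀ v < X.n, role v ≤ 3) (h12 : ∀ v < X.n, s.arr 12 v ≤ 1)
    (h13 : ∀ v < X.n, s.arr 13 v ≤ 1) {C Y : Finset ℕ}
    (hC : C = (range X.n).filter fun v => s.arr 13 v = 1)
    (hY : Y = (range X.n).filter fun v => (s.arr 12 v = 1 ∨ role v = 1) ∧ s.arr 13 v ≠ 1) :
    WP X.E Prog.prepareBase s (170 * (X.n + 1)) 0 fun s' =>
      Ind X.n (s'.arr 12) (c.bag c.j ∪ Y) ∧ Ind X.n (s'.arr 14) (c.bag c.j ∪ Y ∪ C) ∧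
      Ind X.n (s'.arr 15) ((c.bag c.j \ M) ∪ Y) ∧ Ind X.n (s'.arr 11) ∅ ∧
      Ind X.n (s'.arr 16) (C ∩ c.part X.n c.j) := by
  refine WP.seq (cutVertices_wp hX h.rel.has hrole hr h12 h13 hC hY) (T₂ := 140 * (X.n + 1))
    (K₂ := 0) ?_ (by omega) (by omega)
  rintro s₁ f₁ ⟨Y₁, C₁⟩
  have h₁ := h.frame f₁ rfl
  clear f₁ hC hY hrole hr h12 h13
  refine WP.seq (T₁ := 30 * (X.n + 1)) (K₁ := 0) (T₂ := 110 * (X.n + 1)) (K₂ := 0)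
    (Q := fun s' => Ind X.n (s'.arr 14) (c.bag c.j ∪ Y ∪ C))
    (fill_ind_wp hX _ h₁.rel.has ?_ (fun _ _ h => h) (by simp [Prog.at4, Prog.neg])) ?_
    (by omega) (by omega)
  · intro i s' hi hiM hiB hB hf hx _
    have e12 := (congrFun (hf.arr 12 rfl) i).trans (Y₁ i hi)
    have e13 := (congrFun (hf.arr 13 rfl) i).trans (C₁ i hi)
    have e24 := (congrFun (hf.arr 24 rfl) i).trans (h₁.Z i hi)
    have hB0 : 0 < X.E.B := by omega
    simp only [Prog.at4, Prog.neg, Expr.Ok, Expr.eval, hx, e12, e13, e24, Op.eval_mul, Op.eval_sub,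
      mem_union]
    by_cases b1 : i ∈ C <;> by_cases b2 : i ∈ Y <;> by_cases b3 : i ∈ c.bag c.j <;> simp [*]
  intro s₂ f₂ X₁
  have h₂ := h₁.frame f₂ rfl
  rw [← f₂.arr 12 rfl] at Y₁; rw [← f₂.arr 13 rfl] at C₁
  clear f₂ h₁
  refine WP.seq (T₁ := 30 * (X.n + 1)) (K₁ := 0) (T₂ := 80 * (X.n + 1)) (K₂ := 0)
    (Q := fun s' => Ind X.n (s'.arr 15) ((c.bag c.j \ M) ∪ Y))
    (fill_ind_wp hX _ h₂.rel.has ?_ (fun _ _ h => h) (by simp [Prog.at4, Prog.neg])) ?_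
    (by omega) (by omega)
  · intro i s' hi hiM hiB hB hf hx _
    have e12 := (congrFun (hf.arr 12 rfl) i).trans (Y₁ i hi)
    have e8 := (congrFun (hf.arr 8 rfl) i).trans (h₂.M i hi)
    have e24 := (congrFun (hf.arr 24 rfl) i).trans (h₂.Z i hi)
    have hB0 : 0 < X.E.B := by omega
    simp only [Prog.at4, Prog.neg, Expr.Ok, Expr.eval, hx, e12, e8, e24, Op.eval_mul, Op.eval_sub,
      mem_union, mem_sdiff]
    by_cases b1 : i ∈ M <;> by_cases b2 : i ∈ Y <;> by_cases b3 : i ∈ c.bag c.j <;> simp [*]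
  intro s₃ f₃ X₂
  have h₃ := h₂.frame f₃ rfl
  rw [← f₃.arr 12 rfl] at Y₁; rw [← f₃.arr 13 rfl] at C₁; rw [← f₃.arr 14 rfl] at X₁
  clear f₃ h₂
  refine WP.seq (T₁ := 11 * (X.n + 1)) (K₁ := 0) (T₂ := 57 * (X.n + 1)) (K₂ := 0)
    (Q := fun s' => Ind X.n (s'.arr 11) ∅)
    (fill_ind_wp hX _ h₃.rel.has ?_ (fun _ _ h => h) (by simp)) ?_ (by omega) (by omega)
  · intro i s' hi hiM hiB hB hf hx _
    simp; omega
  intro s₄ f₄ S₁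
  have h₄ := h₃.frame f₄ rfl
  rw [← f₄.arr 12 rfl] at Y₁; rw [← f₄.arr 13 rfl] at C₁; rw [← f₄.arr 14 rfl] at X₁
  rw [← f₄.arr 15 rfl] at X₂
  clear f₄ h₃
  refine WP.seq (T₁ := 15 * (X.n + 1)) (K₁ := 0) (T₂ := 30 * (X.n + 1)) (K₂ := 0)
    (Q := fun s' => Ind X.n (s'.arr 16) (C ∩ c.part X.n c.j))
    (fill_ind_wp hX _ h₄.rel.has ?_ (fun _ _ h => h) (by simp [Prog.at4])) ?_
    (by omega) (by omega)
  · intro i s' hi hiM hiB hB hf hx _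
    have e13 := (congrFun (hf.arr 13 rfl) i).trans (C₁ i hi)
    have e23 := (congrFun (hf.arr 23 rfl) i).trans (h₄.S i hi)
    have hB0 : 0 < X.E.B := by omega
    simp only [Prog.at4, Expr.Ok, Expr.eval, hx, e13, e23, Op.eval_mul, mem_inter]
    by_cases b1 : i ∈ C <;> by_cases b2 : i ∈ c.part X.n c.j <;> simp [*]
  intro s₅ f₅ L₁
  have h₅ := h₄.frame f₅ rfl
  rw [← f₅.arr 12 rfl] at Y₁; rw [← f₅.arr 14 rfl] at X₁; rw [← f₅.arr 15 rfl] at X₂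
  rw [← f₅.arr 11 rfl] at S₁
  clear f₅ h₄ C₁
  refine fill_ind_wp hX (c.bag c.j ∪ Y) h₅.rel.has ?_ ?_ (by simp [Prog.at4, Prog.neg])
  · intro i s' hi hiM hiB hB hf hx h12
    have e12 := (h12 i le_rfl).trans (Y₁ i hi)
    have e24 := (congrFun (hf.arr 24 rfl) i).trans (h₅.Z i hi)
    have hB0 : 0 < X.E.B := by omega
    simp only [Prog.at4, Prog.neg, Expr.Ok, Expr.eval, hx, e12, e24, Op.eval_mul, Op.eval_sub,
      mem_union]
    by_cases b1 : i ∈ c.bag c.j <;> by_cases b2 : i ∈ Y <;> simp [*]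
  · intro s' hf h1
    exact ⟨h1, by rw [hf.arr 14 rfl]; exact X₁, by rw [hf.arr 15 rfl]; exact X₂,
      by rw [hf.arr 11 rfl]; exact S₁, by rw [hf.arr 16 rfl]; exact L₁⟩

end Ctx

/-! ### Splitting a node -/

open Finset WordRAM

namespace Linkage

variable {adj : ℕ → ℕ → Prop} {n : ℕ} {role role' : ℕ → ℕ}

theorem IsCut.congr {C Y : Finset ℕ} {cap : ℕ} (h : IsCut adj n role C Y cap)
    (hr : ∀ v < n, role v = role' v) : IsCut adj n role' C Y cap where
  card := h.card
  subC v hv := by have := h.subC v hv; rwa [hr v this.1] at this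
  subY v hv := by have := h.subY v hv; rwa [hr v this.1] at this
  disj := h.disj
  src v hv := by rw [← hr v hv]; exact h.src v hv
  closed u hu w hw := by rw [← hr w hw]; exact h.closed u hu w hw

theorem IsLinked.congr {E : Finset ℕ} (h : IsLinked adj n role E)
    (hr : ∀ v < n, role v = role' v) : IsLinked adj n role' E :=
  fun C X h1 h2 => h C X h1 fun v hv h3 => h2 v hv (by rw [← hr v hv]; exact h3)

end Linkage

namespace Conf

variable {H : GraphClass} {n : ℕ} {G : SimpleGraph (Fin n)} {k : ℕ}

/-- The invariants of the algorithm. -/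
structure Good (H : GraphClass) (G : SimpleGraph (Fin n)) (k : ℕ) (c : Conf) : Prop where
  inv : c.Inv H G k
  filled : c.Filled n k
  bounded : c.Bounded n

/-- The potential of a configuration with respect to the number of oracle calls. -/
def queryPot (n : ℕ) (c : Conf) : ℕ := 2 * c.todo n + c.rest n

/-- The potential of a configuration with respect to the running time. -/
def pot (n : ℕ) (c : Conf) : ℕ := c.queryPot n + (c.N - c.j)

theorem part_card_le_todo {c : Conf} {i : ℕ} : (c.part n i).card ≤ c.todo n :=
  Finset.card_le_card fun v hv => by
    have := mem_part.1 hv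
    simp only [mem_filter, mem_range]
    omega

theorem todo_pos {c : Conf} {i : ℕ} (h : c.part n i ≠ ∅) : 0 < c.todo n :=
  (Finset.card_pos.2 (Finset.nonempty_iff_ne_empty.2 h)).trans_le part_card_le_todo

end Conf

namespace Ctx

variable {X : Ctx} {H : GraphClass} {G : SimpleGraph (Fin X.n)}

/-- Branching raises `N - j` by one and lowers `2 * todo` by at least two, so both potentials drop.
The same decrease pays for the two new nodes in `Conf.Bounded`, which keeps the matrix of bags
within 2n+1 rows. -/
theorem branchExtend_wp (hX : X.Valid) (hH : H.Hereditary) {s : State} {c : Conf} {M : Finset ℕ}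
    (h : X.Att s c M) (hc : c.Good H G X.k)
    {X₀ X₁ X₂ S₁ L₁ : Finset ℕ} (hX₀ : Ind X.n (s.arr 12) X₀) (hX₁ : Ind X.n (s.arr 14) X₁)
    (hX₂ : Ind X.n (s.arr 15) X₂) (hS₁ : Ind X.n (s.arr 11) S₁) (hL₁ : Ind X.n (s.arr 16) L₁)
    (hb : c.CanBranch H G X.k X₀ X₁ X₂ S₁ L₁)
    (hX₁c : S₁ = ∅ ∨ X₁.card ≤ 3 * X.k + 3) (hX₂c : X₂.card ≤ 3 * X.k + 3) :
    WP X.E Prog.branchExtend s (380 * (X.n + 1)) 0 fun s' => s'.reg 22 = 1 ∧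
      ∃ c', X.Rel s' c' ∧ c'.Good H G X.k ∧ c'.pot X.n < c.pot X.n ∧
        c'.queryPot X.n < c.queryPot X.n := by
  have hn := hX.n_le
  have hMB := hX.M_le
  have hj := hb.lt
  have htodo := Conf.todo_pos hb.ne
  have hbd := hc.bounded
  have hbd' : c.N + 2 * c.todo X.n ≤ 2 * X.n + 1 := hbd
  have i₁ := Conf.branch_inv hc.inv hH hb
  refine WP.seq (branch_wp hX h.rel hj (by omega) hc.inv.lab_le h.S h.row hX₀ hX₁ hX₂ hS₁ hL₁)
    (T₂ := 180 * (X.n + 1)) (K₂ := 0) ?_ (by omega) (by omega)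
  intro s₁ _ h₁
  have hN₁ : s₁.reg 2 = c.N + 2 := h₁.N
  refine WP.step (T₂ := 176 * (X.n + 1)) ?_ ?_ (by simp; omega)
  · simp [hN₁]; omega
  intro f
  have h₂ := h₁.frame f rfl
  have g₂ : ((27 ::= ρ 2 -ᵣ κ 2).run s₁).reg 27 = c.N := by simp [hN₁]
  generalize (27 ::= ρ 2 -ᵣ κ 2).run s₁ = s₂ at h₂ g₂
  have bagN : ((c.branch X.n X₀ X₁ X₂ S₁ L₁).bag c.N) = X₁ := by
    simp [Conf.branch, show c.N ≠ c.j by omega]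
  have bagN1 : ((c.branch X.n X₀ X₁ X₂ S₁ L₁).bag (c.N + 1)) = X₂ := by
    simp [Conf.branch, show c.N + 1 ≠ c.j by omega]
  have bl : ∀ (c' : Conf), c'.Inv H G X.k → ∀ e < c'.N,
      ∀ v ∈ c'.bag e, v < X.n ∧ v ∉ c'.part X.n e := by
    intro c' i' e he v hv
    have hvn := i'.bag_lt _ he v hv
    exact ⟨hvn, fun h2 => (i'.fresh v hvn (by rw [(Conf.mem_part.1 h2).2]; omega)).2 _ he hv⟩
  refine WP.seq (extend_wp hX h₂ g₂ (show c.N < c.N + 2 by omega)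
    (show c.N + 2 ≤ _ by omega) i₁.lab_le (bl _ i₁ _ (show c.N < c.N + 2 by omega))
    (i₁.small _ (show c.N < c.N + 2 by omega))) (T₂ := 90 * (X.n + 1)) (K₂ := 0) ?_ (by omega) (by omega)
  rintro s₃ - ⟨A₁, hA₁, h₃⟩
  have i₂ := Conf.extend_inv i₁ hH (show c.N < c.N + 2 by omega) hA₁.sub hA₁.card
  have hN₃ : s₃.reg 2 = c.N + 2 := h₃.N
  refine WP.step (T₂ := 86 * (X.n + 1)) ?_ ?_ (by simp; omega)
  · simp [hN₃]; omega
  intro f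
  have h₄ := h₃.frame f rfl
  have g₄ : ((27 ::= ρ 2 -ᵣ κ 1).run s₃).reg 27 = c.N + 1 := by simp [hN₃]
  generalize (27 ::= ρ 2 -ᵣ κ 1).run s₃ = s₄ at h₄ g₄
  refine WP.seq (extend_wp hX h₄ g₄ (show c.N + 1 < c.N + 2 by omega)
    (show c.N + 2 ≤ _ by omega) i₂.lab_le (bl _ i₂ _ (show c.N + 1 < c.N + 2 by omega))
    (i₂.small _ (show c.N + 1 < c.N + 2 by omega))) (T₂ := 2) (K₂ := 0) ?_ (by omega) (by omega)
  rintro s₅ - ⟨A₂, hA₂, h₅⟩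
  obtain ⟨j1, j2, j3, j4⟩ := Conf.split_inv hc.inv hH hc.filled hb hX₁c hX₂c hA₁ hA₂
  refine WP.simple (by simp; omega) (by simp) fun f => ⟨by simp, _, h₅.frame f rfl, ⟨j1, j2, ?_⟩, ?_, ?_⟩
  · show c.N + 2 + 2 * (c.split X.n X₀ X₁ X₂ S₁ L₁ A₁ A₂).todo X.n ≤ 2 * X.n + 1
    omega
  · show 2 * (c.split X.n X₀ X₁ X₂ S₁ L₁ A₁ A₂).todo X.n + (c.split X.n X₀ X₁ X₂ S₁ L₁ A₁ A₂).rest X.n +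
      (c.N + 2 - (c.j + 1)) < 2 * c.todo X.n + c.rest X.n + (c.N - c.j)
    omega
  · show 2 * (c.split X.n X₀ X₁ X₂ S₁ L₁ A₁ A₂).todo X.n + (c.split X.n X₀ X₁ X₂ S₁ L₁ A₁ A₂).rest X.n
      < 2 * c.todo X.n + c.rest X.n
    omega

/-- The parts of the bag for which the search of a balanced separator or a base component is made. -/
def IsMode (k mode : ℕ) (Z M : Finset ℕ) : Prop :=
  (mode = 1 ∧ k + 2 ≤ M.card ∧ k + 2 ≤ (Z \ M).card) ∨ (mode = 2 ∧ (Z \ M).card ≤ k + 1)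

/-- The roles and the number of paths in the two modes. -/
def modeRole (mode : ℕ) (S Q Z M : Finset ℕ) : ℕ → ℕ :=
  if mode = 1 then balancedRole S Z M else baseRole S Q Z M

def modeCap (k mode : ℕ) : ℕ := if mode = 1 then k + 2 else 2 * k + 3

theorem split_wp (hX : X.Valid) (hG : X.adj = G.adjNat) (hH : H.Hereditary) {s : State} {c : Conf}
    {M : Finset ℕ} (h : X.Att s c M) (hc : c.Good H G X.k) (hj : c.j < c.N)
    (hne : c.part X.n c.j ≠ ∅) (he : H.MemNat G ∅) (hM : M ⊆ c.bag c.j) {mode : ℕ}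
    (h18 : s.reg 18 = mode) (hmode : IsMode X.k mode (c.bag c.j) M)
    (hrole : ∀ v < X.n, s.arr 9 v = modeRole mode (c.part X.n c.j) c.Q (c.bag c.j) M v)
    (hr : ∀ v < X.n, s.arr 9 v ≤ 3)
    (hcut : Linkage.IsCut X.adj X.n (s.arr 9) ((range X.n).filter fun v => s.arr 13 v = 1)
      ((range X.n).filter fun v => (s.arr 12 v = 1 ∨ s.arr 9 v = 1) ∧ s.arr 13 v ≠ 1)
      (modeCap X.k mode))
    (h12 : ∀ v < X.n, s.arr 12 v ≤ 1) (h13 : ∀ v < X.n, s.arr 13 v ≤ 1) :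
    WP X.E Prog.split s (560 * (X.n + 1)) 0 fun s' => s'.reg 22 = 1 ∧
      ∃ c', X.Rel s' c' ∧ c'.Good H G X.k ∧ c'.pot X.n < c.pot X.n ∧
        c'.queryPot X.n < c.queryPot X.n := by
  have hn := hX.n_le
  have hMB := hX.M_le
  replace hcut := hcut.congr hrole
  rw [hG] at hcut
  set C := (range X.n).filter fun v => s.arr 13 v = 1 with hC
  set Y := (range X.n).filter fun v => (s.arr 12 v = 1 ∨ s.arr 9 v = 1) ∧ s.arr 13 v ≠ 1 with hY
  have hcond : (ρ 18 =ᵣ κ 1).eval s = eqN mode 1 := by simp [h18]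
  have hok : (ρ 18 =ᵣ κ 1).Ok X.E.B X.E.M s := by
    have hB1 : 1 < X.E.B := by omega
    have : mode ≤ 2 := by rcases hmode with h1 | h1 <;> omega
    simp [h18, eqN_lt hB1]; omega
  refine WP.seq (T₁ := 174 * (X.n + 1)) (K₁ := 0) (T₂ := 380 * (X.n + 1)) (K₂ := 0)
    (Q := fun s' => ∃ X₀ X₁ X₂ S₁ L₁, Ind X.n (s'.arr 12) X₀ ∧ Ind X.n (s'.arr 14) X₁ ∧
      Ind X.n (s'.arr 15) X₂ ∧ Ind X.n (s'.arr 11) S₁ ∧ Ind X.n (s'.arr 16) L₁ ∧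
      c.CanBranch H G X.k X₀ X₁ X₂ S₁ L₁ ∧ (S₁ = ∅ ∨ X₁.card ≤ 3 * X.k + 3) ∧
      X₂.card ≤ 3 * X.k + 3) ?_ ?_ (by clear * -; omega) le_rfl
  · refine WP.cond (T := 170 * (X.n + 1)) hok ?_ ?_ (by simp; omega)
    · intro hm
      rw [hcond] at hm
      have hm : mode = 1 := by by_contra h1; exact hm (eqN_of_ne h1)
      subst hm
      have hm2 : X.k + 2 ≤ M.card ∧ X.k + 2 ≤ (c.bag c.j \ M).card := by
        rcases hmode with h1 | h1 <;> omega
      simp only [modeRole, modeCap, if_true] at hcut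
      obtain ⟨g1, g2, g3⟩ := Conf.canBranch_of_balanced hc.inv hj hc.filled hne he hM hm2.1 hm2.2 hcut
      refine (prepareBalanced_wp hX h rfl hr h12 h13 hC hY).mono le_rfl le_rfl fun s' _ h' => ?_
      exact ⟨_, _, _, _, _, h'.1, h'.2.1, h'.2.2.1, h'.2.2.2.1, h'.2.2.2.2, g1, Or.inr g2, g3⟩
    · intro hm
      rw [hcond, eqN_eq_zero] at hm
      have hm2 : (c.bag c.j \ M).card ≤ X.k + 1 := by rcases hmode with h1 | h1 <;> omega
      simp only [modeRole, modeCap, hm, if_false] at hcut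
      obtain ⟨g1, g2⟩ := Conf.canBranch_of_base hc.inv hH hj hc.filled hne hM hm2 hcut
      refine (prepareBase_wp hX h rfl hr h12 h13 hC hY).mono le_rfl le_rfl fun s' _ h' => ?_
      exact ⟨_, _, _, _, _, h'.1, h'.2.1, h'.2.2.1, h'.2.2.2.1, h'.2.2.2.2, g1, Or.inl rfl, g2⟩
  · rintro s' f ⟨X₀, X₁, X₂, S₁, L₁, a0, a1, a2, a3, a4, g1, g2, g3⟩
    exact branchExtend_wp hX hH (h.frame f rfl) hc a0 a1 a2 a3 a4 g1 g2 g3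

end Ctx

/-! ### Queries on induced subgraphs -/

open Finset WordRAM

/-- A numbering of the elements of `W` by the numbers below `N`. -/
structure Renumbering (W : Finset ℕ) (N : ℕ) (ren inv : ℕ → ℕ) : Prop where
  fwd : ∀ v ∈ W, ren v < N ∧ inv (ren v) = v
  bwd : ∀ i < N, inv i ∈ W ∧ ren (inv i) = i

namespace Renumbering

variable {W : Finset ℕ} {N n : ℕ} {ren inv : ℕ → ℕ} {H : GraphClass} {G : SimpleGraph (Fin n)}

theorem inj (h : Renumbering W N ren inv) {i j : ℕ} (hi : i < N) (hj : j < N) (hij : inv i = inv j) :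
    i = j := by
  rw [← (h.bwd i hi).2, ← (h.bwd j hj).2, hij]

/-- The vertex with a given number. -/
def toFin (h : Renumbering W N ren inv) (hW : ∀ v ∈ W, v < n) (i : Fin N) : Fin n :=
  ⟨inv i, hW _ (h.bwd i i.2).1⟩

/-- The induced subgraph with its vertices renumbered. -/
def graph (h : Renumbering W N ren inv) (hW : ∀ v ∈ W, v < n) (G : SimpleGraph (Fin n)) :
    SimpleGraph (Fin N) := G.comap (h.toFin hW)

/-- Induced subgraphs of the renumbered graph. -/
def induceIso (h : Renumbering W N ren inv) (hW : ∀ v ∈ W, v < n) (G : SimpleGraph (Fin n))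
    (D : Finset (Fin N)) : (h.graph hW G).induce ((D : Set (Fin N))ᶜ) ≃g
      G.induce {v : Fin n | (v : ℕ) ∈ W \ D.image fun i : Fin N => inv i} where
  toFun i := ⟨h.toFin hW i.1, by
    have hi := i.2
    simp only [Set.mem_compl_iff, mem_coe] at hi
    simp only [toFin, Set.mem_ofPred_eq, mem_sdiff, mem_image, not_exists, not_and]
    refine ⟨(h.bwd _ i.1.2).1, fun j hj hij => hi ?_⟩
    rwa [← Fin.ext (h.inj j.2 i.1.2 hij)]⟩
  invFun v := ⟨⟨ren v.1, (h.fwd _ (mem_sdiff.1 v.2).1).1⟩, by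
    have hv := v.2
    simp only [Set.mem_ofPred_eq, mem_sdiff, mem_image, not_exists, not_and] at hv
    simp only [Set.mem_compl_iff, mem_coe]
    exact fun hj => hv.2 _ hj (h.fwd _ hv.1).2⟩
  left_inv i := by
    ext
    exact (h.bwd _ i.1.2).2
  right_inv v := by
    ext
    exact (h.fwd _ (mem_sdiff.1 v.2).1).2
  map_rel_iff' := Iff.rfl

theorem isDeletionSet_iff (h : Renumbering W N ren inv) (hW : ∀ v ∈ W, v < n) (D : Finset (Fin N)) :
    H.IsDeletionSet (h.graph hW G) D ↔ H.MemNat G (W \ D.image fun i : Fin N => inv i) :=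
  ⟨H.mem_of_iso _ _ ⟨h.induceIso hW G D⟩, H.mem_of_iso _ _ ⟨(h.induceIso hW G D).symm⟩⟩

theorem nonempty_iso (h : Renumbering W N ren inv) (hW : ∀ v ∈ W, v < n) (G : SimpleGraph (Fin n)) :
    Nonempty (h.graph hW G ≃g G.induce {v : Fin n | (v : ℕ) ∈ W}) :=
  ⟨⟨⟨fun i => ⟨h.toFin hW i, (h.bwd i i.2).1⟩, fun v => ⟨ren v.1, (h.fwd _ v.2).1⟩,
    fun i => Fin.ext (h.bwd i i.2).2, fun v => Subtype.ext (Fin.ext (h.fwd _ v.2).2)⟩, Iff.rfl⟩⟩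

/-- If every deletion set is large, then every set of numbers that hits the graph is large. -/
theorem card_le_of_forall (h : Renumbering W N ren inv) (hW : ∀ v ∈ W, v < n) (hH : H.Hereditary)
    {l : ℕ} (hl : ∀ D : Finset (Fin N), H.IsDeletionSet (h.graph hW G) D → l ≤ D.card)
    (D : Finset ℕ) (hD : H.MemNat G (W \ D)) : l ≤ D.card := by
  refine (hl (univ.filter fun i => inv i ∈ D) ?_).trans ?_
  · rw [h.isDeletionSet_iff hW]
    refine hD.mono hH fun v hv _ => ?_
    simp only [mem_sdiff, mem_image, mem_filter, mem_univ, true_and, not_exists, not_and] at hv ⊢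
    refine ⟨hv.1, fun hvD => hv.2 ⟨ren v, (h.fwd v hv.1).1⟩ ?_ (h.fwd v hv.1).2⟩
    simpa [(h.fwd v hv.1).2] using hvD
  · refine Finset.card_le_card_of_injOn (fun i => inv i) (fun i hi => ?_) fun i _ j _ hij =>
      Fin.ext (h.inj i.2 j.2 hij)
    simpa using hi

end Renumbering

namespace Ctx

variable {X : Ctx} {H : GraphClass} {G : SimpleGraph (Fin X.n)}

/-- The numbers of the neighbours of `v` in `W` among the first entries of its adjacency list. -/
def nbrs (X : Ctx) (W : Finset ℕ) (ren : ℕ → ℕ) (v d : ℕ) : List ℕ :=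
  ((List.range d).filter fun i => 0 < i ∧ X.nb v i ∈ W).map fun i => ren (X.nb v i)

theorem nbrs_succ (W : Finset ℕ) (ren : ℕ → ℕ) (v d : ℕ) : X.nbrs W ren v (d + 1) =
    X.nbrs W ren v d ++ if 0 < d ∧ X.nb v d ∈ W then [ren (X.nb v d)] else [] := by
  simp only [nbrs, List.range_succ, List.filter_append, List.map_append, List.filter_singleton]
  split_ifs with h <;> simp [h]

theorem nbrs_length_le (W : Finset ℕ) (ren : ℕ → ℕ) (v d : ℕ) :
    (X.nbrs W ren v (d + 1)).length ≤ d := by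
  induction d with
  | zero => simp [nbrs]
  | succ d ih =>
    rw [nbrs_succ]
    split_ifs <;> simp <;> omega

/-- The entry of the encoding of the induced subgraph for the vertex `v`. -/
def nbrCode (X : Ctx) (W : Finset ℕ) (ren : ℕ → ℕ) (v : ℕ) : List ℕ :=
  (X.nbrs W ren v (X.dg v + 1)).length :: X.nbrs W ren v (X.dg v + 1)

/-- The first entries of the encoding of the induced subgraph. -/
def graphCode (X : Ctx) (W : Finset ℕ) (N : ℕ) (ren inv : ℕ → ℕ) (i : ℕ) : List ℕ :=
  N :: (List.range i).flatMap fun i => X.nbrCode W ren (inv i)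

/-- The neighbours appear in the order of the input lists, which the encoding allows. Index 0 is
left out since it stands for the vertex itself. The injectivity of `nb` and of the renumbering
excludes repetitions. -/
theorem isGraphCode (hX : X.Valid) (hG : X.adj = G.adjNat) {W : Finset ℕ} {N : ℕ}
    {ren inv : ℕ → ℕ} (h : Renumbering W N ren inv) (hW : ∀ v ∈ W, v < X.n) :
    IsGraphCode (h.graph hW G) (X.graphCode W N ren inv N) := by
  have hmem : ∀ v, ∀ x ∈ X.nbrs W ren v (X.dg v + 1), x < N := by
    intro v x hx
    simp only [nbrs, List.mem_map, List.mem_filter, decide_eq_true_eq] at hx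
    obtain ⟨i, ⟨-, -, hi⟩, rfl⟩ := hx
    exact (h.fwd _ hi).1
  refine ⟨fun i => (X.nbrs W ren (inv i) (X.dg (inv i) + 1)).pmap Fin.mk (hmem _), ?_, ?_⟩
  · intro i
    have hi := (h.bwd i i.2).1
    have hin := hW _ hi
    constructor
    · refine List.Nodup.pmap (fun a _ b _ hab => congrArg Fin.val hab) ?_
      refine (List.nodup_range.filter _).map_on ?_
      intro a ha b hb hab
      simp only [List.mem_filter, List.mem_range, decide_eq_true_eq] at ha hb
      have h1 : X.nb (inv i) a = X.nb (inv i) b := by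
        rw [← (h.fwd _ ha.2.2).2, ← (h.fwd _ hb.2.2).2, hab]
      exact hX.nb_inj _ hin a (by omega) b (by omega) h1
    · intro u
      have hu := (h.bwd u u.2).1
      have key : (h.graph hW G).Adj i u ↔ X.adj (inv i) (inv u) := by
        rw [hG]
        constructor
        · intro h1; exact ⟨hin, hW _ hu, h1⟩
        · rintro ⟨_, _, h1⟩; exact h1
      rw [key, hX.nb_adj _ hin]
      simp only [List.mem_pmap, nbrs, List.mem_map, List.mem_filter, List.mem_range,
        decide_eq_true_eq]
      constructor
      · rintro ⟨_, ⟨a, ⟨ha, ha0, haW⟩, rfl⟩, rfl⟩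
        exact ⟨a, ha0, by omega, ((h.fwd _ haW).2).symm⟩
      · rintro ⟨a, ha0, ha, hau⟩
        refine ⟨u, ⟨a, ⟨by omega, ha0, by rwa [hau]⟩, ?_⟩, rfl⟩
        rw [hau, (h.bwd u u.2).2]
  · unfold graphCode
    congr 1
    rw [List.flatMap_def]
    congr 1
    refine List.ext_getElem (by simp) fun i h1 h2 => ?_
    simp [codeList, nbrCode, List.map_pmap]

end Ctx

/-- The register `p` and the array `a` contain the length and the elements of the list. -/
def Emits (a p : ℕ) (s : State) (l : List ℕ) : Prop :=
  s.reg p = l.length ∧ ∀ i, ∀ h : i < l.length, s.arr a i = l[i]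

namespace Emits

variable {a p : ℕ} {s s' : State} {l : List ℕ}

theorem of_eq (h : Emits a p s l) (h1 : s'.reg p = s.reg p) (h2 : s'.arr a = s.arr a) :
    Emits a p s' l := ⟨h1.trans h.1, by rw [h2]; exact h.2⟩

theorem readList (h : Emits a p s l) : s.readList a l.length = l :=
  List.ext_getElem (by simp [State.readList]) fun i h1 h2 => by simpa [State.readList] using h.2 i h2

theorem append (h : Emits a p s l) {x : ℕ} (h1 : s'.reg p = s.reg p + 1)
    (h2 : s'.arr a = Function.update (s.arr a) (s.reg p) x) : Emits a p s' (l ++ [x]) := by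
  refine ⟨by simp [h1, h.1], fun i hi => ?_⟩
  rw [h2, h.1]
  by_cases hil : i < l.length
  · rw [Function.update_of_ne (by omega), h.2 i hil, List.getElem_append_left hil]
  · have : i = l.length := by simp at hi; omega
    subst this
    simp

/-- Serves to fill in a length that is known only after the elements have been written. -/
theorem set {l' : List ℕ} {x y : ℕ} (h : Emits a p s (l ++ x :: l')) (h1 : s'.reg p = s.reg p)
    (h2 : s'.arr a = Function.update (s.arr a) l.length y) : Emits a p s' (l ++ y :: l') := by
  refine ⟨by simp [h1, h.1], fun i hi => ?_⟩
  rw [h2]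
  by_cases hil : i = l.length
  · subst hil; simp
  · rw [Function.update_of_ne hil, h.2 i (by simpa using hi)]
    rcases lt_or_gt_of_ne hil with h3 | h3
    · rw [List.getElem_append_left h3, List.getElem_append_left h3]
    · rw [List.getElem_append_right h3.le, List.getElem_append_right h3.le]
      obtain ⟨d, rfl⟩ := Nat.exists_eq_add_of_lt h3
      simp [show l.length + d + 1 - l.length = d + 1 by omega]

end Emits

/-! ### Writing a query -/

open Finset WordRAM

theorem Renumbering.insert {W : Finset ℕ} {N i : ℕ} {ren inv : ℕ → ℕ} (h : Renumbering W N ren inv)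
    (hi : i ∉ W) :
    Renumbering (insert i W) (N + 1) (Function.update ren i N) (Function.update inv N i) where
  fwd v hv := by
    by_cases hvi : v = i
    · subst hvi; simp
    · have := h.fwd v (mem_of_mem_insert_of_ne hv hvi)
      rw [Function.update_of_ne hvi, Function.update_of_ne this.1.ne]
      exact ⟨by omega, this.2⟩
  bwd j hj := by
    by_cases hjN : j = N
    · subst hjN; simp
    · have := h.bwd j (by omega)
      have hne : inv j ≠ i := by rintro rfl; exact hi this.1
      rw [Function.update_of_ne hjN, Function.update_of_ne hne]
      exact ⟨mem_insert_of_mem this.1, this.2⟩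

namespace Prog

/-- Number the vertices of the set `21`. -/
def renumber : Cmd :=
  25 ::= κ 0 ;; Cmd.for 4 1 (.cond (at4 21)
    (.store 17 (ρ 4) (ρ 25) ;; .store 18 (ρ 25) (ρ 4) ;; 25 ::= ρ 25 +ᵣ κ 1) .skip)

/-- Write the adjacency list of the vertex with the number in register `4`. -/
def emitVertex : Cmd :=
  13 ::= .arr 18 (ρ 4) ;; 15 ::= (.arr 0 (.arr 2 (ρ 13)) +ᵣ κ 1) ;; 6 ::= ρ 24 ;;
    .store 19 (ρ 24) (κ 0) ;; 24 ::= ρ 24 +ᵣ κ 1 ;;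
    Cmd.for 14 15 (nbr ;; .cond ((κ 0 <ᵣ ρ 14) *ᵣ .arr 21 (ρ 16))
      (.store 19 (ρ 24) (.arr 17 (ρ 16)) ;; 24 ::= ρ 24 +ᵣ κ 1) .skip) ;;
    .store 19 (ρ 6) (ρ 24 -ᵣ (ρ 6 +ᵣ κ 1))

/-- Write the query on the subgraph induced by the set `21`. -/
def emitGraph : Cmd :=
  .store 19 (κ 0) (κ 2 *ᵣ ρ 0 +ᵣ κ 2) ;; .store 19 (κ 1) (ρ 25) ;; 24 ::= κ 2 ;;
    Cmd.for 4 25 emitVertex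

end Prog

namespace Ctx

variable {X : Ctx} {H : GraphClass} {G : SimpleGraph (Fin X.n)}

theorem card_le_of_lt {W : Finset ℕ} {n : ℕ} (hW : ∀ v ∈ W, v < n) : W.card ≤ n := by
  simpa using Finset.card_le_card (t := range n) fun v hv => by simpa using hW v hv

theorem renumber_wp (hX : X.Valid) {s : State} (h : X.Has s) {W : Finset ℕ}
    (hW : ∀ v ∈ W, v < X.n) (h21 : Ind X.n (s.arr 21) W) :
    WP X.E Prog.renumber s (30 * (X.n + 1)) 0 fun s' => s'.reg 25 = W.card ∧
      Renumbering W W.card (s'.arr 17) (s'.arr 18) := by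
  have hn := hX.n_le
  have hMB := hX.M_le
  refine WP.step (T₂ := X.n * (15 + 8) + 6) (by simp; omega) ?_ (by simp; omega)
  intro f
  have h₁ := h.frame f rfl
  rw [← f.arr 21 rfl] at h21
  have h25 : ((25 ::= κ 0).run s).reg 25 = 0 := by simp
  generalize (25 ::= κ 0).run s = s₁ at h₁ h21 h25
  refine WP.for_const X.n (fun i s' => s'.reg 25 = (W.filter (· < i)).card ∧
    Renumbering (W.filter (· < i)) (W.filter (· < i)).card (s'.arr 17) (s'.arr 18)) 15 rfl rfl
    (by decide) h₁.n (by omega) ?_ ?_ ?_ le_rfl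
  · exact ⟨by simpa using h25, by simp, by simp⟩
  · rintro i s' hi hf hx ⟨h1, h2⟩
    have e21 := (congrFun (hf.arr 21 rfl) i).trans (h21 i hi)
    have hc : (W.filter (· < i)).card ≤ i := card_le_of_lt fun v hv => (mem_filter.1 hv).2
    refine WP.cond (T := 11) ?_ ?_ ?_ (by simp [Prog.at4])
    · simp [Prog.at4, hx, e21]
      exact ⟨by omega, by split_ifs <;> omega⟩
    · intro hne
      have hiW : i ∈ W := by
        by_contra h3; simp [Prog.at4, hx, e21, h3] at hne
      have hins : W.filter (· < i + 1) = insert i (W.filter (· < i)) := by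
        ext v; simp only [mem_filter, mem_insert]
        by_cases hv : v = i
        · subst hv; simp [hiW]
        · have : v < i + 1 ↔ v < i := by omega
          simp [hv, this]
      have hni : i ∉ W.filter (· < i) := by simp
      have hc' := card_insert_of_notMem hni
      refine WP.simple ?_ (by simp) fun _ => ?_
      · simp [hx, h1]; omega
      · rw [hins, hc']
        refine ⟨by simp [h1], ?_⟩
        have := h2.insert hni
        simpa [hx, h1] using this
    · intro hne
      have hiW : i ∉ W := by
        intro h3; simp [Prog.at4, hx, e21, h3] at hne
      have hins : W.filter (· < i + 1) = W.filter (· < i) := by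
        ext v; simp only [mem_filter]
        by_cases hv : v = i
        · subst hv; simp [hiW]
        · have : v < i + 1 ↔ v < i := by omega
          simp [this]
      refine WP.simple trivial (by simp) fun _ => ?_
      rw [hins]
      simpa using ⟨h1, h2⟩
  · rintro s' - - ⟨h1, h2⟩
    rw [Finset.filter_true_of_mem hW] at h1 h2
    exact ⟨h1, h2⟩

theorem emitVertex_wp (hX : X.Valid) {s : State} (h : X.Has s) {W : Finset ℕ} {N i : ℕ}
    (hW : ∀ v ∈ W, v < X.n) (h21 : Ind X.n (s.arr 21) W)
    (hren : Renumbering W N (s.arr 17) (s.arr 18)) (hN : N ≤ X.n) (h4 : s.reg 4 = i) (hi : i < N)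
    {l : List ℕ} (hl : Emits 19 24 s l) (hlM : l.length + X.n + 2 < X.E.M) :
    WP X.E Prog.emitVertex s (64 * (X.dg (s.arr 18 i) + 1)) 0 fun s' =>
      Emits 19 24 s' (l ++ X.nbrCode W (s.arr 17) (s.arr 18 i)) := by
  have hn := hX.n_le
  have hMB := hX.M_le
  have hB1 : 1 < X.E.B := by omega
  obtain ⟨v, hv⟩ : ∃ v, v = s.arr 18 i := ⟨_, rfl⟩
  rw [← hv]
  have hvn : v < X.n := hv ▸ hW _ (hren.bwd i hi).1
  have hdg := hX.dg_lt hvn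
  have hoff := hX.off_lt v hvn
  have hl24 := hl.1
  set ren := s.arr 17 with hrdef
  have hrlt : ∀ w ∈ W, ren w < N := fun w hw => (hren.fwd w hw).1
  clear_value ren
  refine WP.step (T₂ := 64 * (X.dg v + 1) - 3) ?_ ?_ (by simp; omega)
  · simp [h4, ← hv]; omega
  intro f₁
  have h₁ := h.frame f₁ rfl
  have g13 : ((13 ::= .arr 18 (ρ 4)).run s).reg 13 = v := by simp [h4, hv]
  rw [← f₁.arr 21 rfl] at h21
  rw [← f₁.arr 17 rfl] at hrdef
  replace hl := hl.of_eq (f₁.reg 24 rfl) (f₁.arr 19 rfl)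
  generalize (13 ::= .arr 18 (ρ 4)).run s = s₁ at h₁ g13 h21 hrdef hl
  clear f₁ h hv h4 hren
  have e0 := h₁.off v hvn
  have e1 := h₁.dg v hvn
  refine WP.step (T₂ := 64 * (X.dg v + 1) - 9) ?_ ?_ (by simp; omega)
  · simp [g13, e0, e1]; omega
  intro f₂
  have h₂ := h₁.frame f₂ rfl
  have g15 : ((15 ::= (.arr 0 (.arr 2 (ρ 13)) +ᵣ κ 1)).run s₁).reg 15 = X.dg v + 1 := by
    simp [g13, e0, e1]
  replace g13 := (f₂.reg 13 rfl).trans g13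
  rw [← f₂.arr 21 rfl] at h21
  rw [← f₂.arr 17 rfl] at hrdef
  replace hl := hl.of_eq (f₂.reg 24 rfl) (f₂.arr 19 rfl)
  generalize (15 ::= (.arr 0 (.arr 2 (ρ 13)) +ᵣ κ 1)).run s₁ = s₂ at h₂ g13 g15 h21 hrdef hl
  clear f₂ h₁ e0 e1 s₁
  refine WP.step (T₂ := 64 * (X.dg v + 1) - 11) ?_ ?_ (by simp; omega)
  · simp [hl.1]; omega
  intro f₁
  have h₁ := h₂.frame f₁ rfl
  have g6 : ((6 ::= ρ 24).run s₂).reg 6 = l.length := by simp [hl.1]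
  replace g13 := (f₁.reg 13 rfl).trans g13
  replace g15 := (f₁.reg 15 rfl).trans g15
  rw [← f₁.arr 21 rfl] at h21
  rw [← f₁.arr 17 rfl] at hrdef
  replace hl := hl.of_eq (f₁.reg 24 rfl) (f₁.arr 19 rfl)
  generalize (6 ::= ρ 24).run s₂ = s₁ at h₁ g13 g15 g6 h21 hrdef hl
  clear f₁ h₂ s₂
  have hl1 := hl.1
  refine WP.step (T₂ := 64 * (X.dg v + 1) - 14) ?_ ?_ (by simp; omega)
  · simp [hl1]; omega
  intro f₂
  refine WP.step (T₂ := 64 * (X.dg v + 1) - 18) ?_ ?_ (by simp; omega)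
  · simp [hl1]; omega
  intro f₃
  have h₂ := (h₁.frame f₂ rfl).frame f₃ rfl
  replace hl : Emits 19 24 ((24 ::= ρ 24 +ᵣ κ 1).run ((Cmd.store 19 (ρ 24) (κ 0)).run s₁)) (l ++ [0]) :=
    hl.append (x := 0) (by simp) (by simp)
  replace g6 := (f₃.reg 6 rfl).trans ((f₂.reg 6 rfl).trans g6)
  replace g13 := (f₃.reg 13 rfl).trans ((f₂.reg 13 rfl).trans g13)
  replace g15 := (f₃.reg 15 rfl).trans ((f₂.reg 15 rfl).trans g15)
  rw [← f₂.arr 21 rfl, ← f₃.arr 21 rfl] at h21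
  rw [← f₂.arr 17 rfl, ← f₃.arr 17 rfl] at hrdef
  generalize (24 ::= ρ 24 +ᵣ κ 1).run ((Cmd.store 19 (ρ 24) (κ 0)).run s₁) = s₂ at h₂ g13 g15 g6 h21 hrdef hl
  clear f₂ f₃ h₁ s₁ hl1
  refine WP.seq (T₁ := (X.dg v + 1) * (25 + 8) + 6) (K₁ := 0) (T₂ := 7) (K₂ := 0)
    (Q := fun s' => s'.reg 6 = l.length ∧ Emits 19 24 s' (l ++ 0 :: X.nbrs W ren v (X.dg v + 1)))
    (WP.for_const (X.dg v + 1) (fun d s' => Emits 19 24 s' (l ++ 0 :: X.nbrs W ren v d)) 25 rfl rfl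
      (by decide) g15 (by omega) ?_ ?_ (fun s' hf _ h1 => ⟨(hf.reg 6 rfl).trans g6, h1⟩) le_rfl) ?_
    (by omega) (by omega)
  · exact hl.of_eq (by simp) (by simp)
  · intro d s' hd hf hx hl
    have h' := h₂.frame hf rfl
    have g13' := (hf.reg 13 rfl).trans g13
    have hnb := hX.nb_lt v hvn d (by omega)
    refine WP.seq (T₁ := 10) (K₁ := 0) (Q := fun s'' => s'' = s'.setReg 16 (X.nb v d))
      (nbr_wp hX h' (by rw [g13']; exact hvn) (by rw [g13', hx]; omega) (by rw [g13', hx]))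
      (T₂ := 15) (K₂ := 0) ?_ (by omega) (by omega)
    rintro _ - rfl
    have e21 := (congrFun (hf.arr 21 rfl) (X.nb v d)).trans (h21 _ hnb)
    have e17 := (congrFun (hf.arr 17 rfl) (X.nb v d)).trans (congrFun hrdef.symm _)
    have hlen : (X.nbrs W ren v d).length ≤ d := by
      cases d with
      | zero => simp [nbrs]
      | succ d => exact (nbrs_length_le ..).trans (by omega)
    have hl1 : s'.reg 24 = l.length + 1 + (X.nbrs W ren v d).length := by
      rw [hl.1]; simp; omega
    have hval : ((κ 0 <ᵣ ρ 14) *ᵣ .arr 21 (ρ 16)).eval (s'.setReg 16 (X.nb v d)) =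
        if 0 < d ∧ X.nb v d ∈ W then 1 else 0 := by
      simp only [Expr.eval, Op.eval_mul, Op.eval_lt, State.setReg_reg, State.setReg_arr, hx]
      by_cases b1 : 0 < d <;> by_cases b2 : X.nb v d ∈ W <;> simp [b1, b2, ltN, e21]
    refine WP.cond (T := 8) ?_ ?_ ?_ (by simp)
    · refine ⟨⟨by simp; omega, by simp [hx]; omega, by simpa using ltN_lt hB1⟩,
        ⟨by simp; omega, by simp; omega, ?_⟩, ?_⟩
      · simp [e21]; split_ifs <;> omega
      · change Expr.eval _ ((κ 0 <ᵣ ρ 14) *ᵣ .arr 21 (ρ 16)) < _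
        rw [hval]; split_ifs <;> omega
    · intro hc
      rw [hval] at hc
      have hc' : 0 < d ∧ X.nb v d ∈ W := by by_contra h1; simp [h1] at hc
      have hr := hrlt _ hc'.2
      refine WP.simple ?_ (by simp) fun _ => ?_
      · simp [hl1, e17]; omega
      · rw [nbrs_succ, if_pos hc', ← List.cons_append, ← List.append_assoc]
        exact hl.append (x := ren (X.nb v d)) (by simp) (by simp [e17])
    · intro hc
      rw [hval] at hc
      have hc' : ¬ (0 < d ∧ X.nb v d ∈ W) := by intro h1; simp [h1] at hc
      refine WP.simple trivial (by simp) fun _ => ?_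
      rw [nbrs_succ, if_neg hc', List.append_nil]
      exact hl.of_eq (by simp) (by simp)
  · rintro s₃ - ⟨g6, hl⟩
    have hlen := nbrs_length_le (X := X) W ren v (X.dg v)
    have hl1 : s₃.reg 24 = l.length + 1 + (X.nbrs W ren v (X.dg v + 1)).length := by
      rw [hl.1]; simp; omega
    refine WP.simple ?_ (by simp) fun _ => ?_
    · simp [g6, hl1]; omega
    · refine hl.set (by simp) ?_
      simp [g6, hl1]

theorem emitGraph_wp (hX : X.Valid) {s : State} (h : X.Has s) {W : Finset ℕ} {N : ℕ}
    (hW : ∀ v ∈ W, v < X.n) (h21 : Ind X.n (s.arr 21) W) (h25 : s.reg 25 = N)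
    (hren : Renumbering W N (s.arr 17) (s.arr 18)) (hN : N ≤ X.n) :
    WP X.E Prog.emitGraph s (160 * (X.n + X.m + 1)) 0 fun s' =>
      Emits 19 24 s' ((2 * X.k + 2) :: X.graphCode W N (s.arr 17) (s.arr 18) N) ∧
      ((2 * X.k + 2) :: X.graphCode W N (s.arr 17) (s.arr 18) N).length < X.E.M ∧
      ((2 * X.k + 2) :: X.graphCode W N (s.arr 17) (s.arr 18) N).length ≤ 2 * (X.n + X.m + 1) := by
  have hn := hX.n_le
  have hMB := hX.M_le
  have hk := hX.k_le
  have hB1 : 1 < X.E.B := by omega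
  have hsq : 64 * (X.n + 2) ^ 2 ≤ X.E.M := by
    refine le_trans ?_ hX.cube_le
    exact Nat.mul_le_mul_left _ (Nat.pow_le_pow_right (by omega) (by omega))
  have hlt : ∀ i ≤ N, 2 + i * X.n + X.n + 2 < X.E.M := by
    intro i hi
    have : i * X.n ≤ X.n * X.n := Nat.mul_le_mul_right _ (by omega)
    nlinarith
  set ren := s.arr 17 with hrdef
  set inv := s.arr 18 with hidef
  -- A quadratic bound for the length of the query, used for the memory limit.
  have hlen : ∀ i ≤ N, ((2 * X.k + 2) :: X.graphCode W N ren inv i).length ≤ 2 + i * X.n := by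
    intro i hi
    induction i with
    | zero => simp [graphCode]
    | succ i ih =>
      have h1 := ih (by omega)
      have h2 := nbrs_length_le (X := X) W ren (inv i) (X.dg (inv i))
      have h3 := hX.dg_lt (hW _ (hren.bwd i hi).1)
      simp only [graphCode, List.range_succ, List.flatMap_append, List.length_cons,
        List.length_append, List.flatMap_singleton, nbrCode, Nat.add_mul] at h1 ⊢
      omega
  refine WP.step (T₂ := 160 * (X.n + X.m + 1) - 7) ?_ ?_ (by simp; omega)
  · simp [h.k]; omega
  intro f₁
  refine WP.step (T₂ := 160 * (X.n + X.m + 1) - 10) ?_ ?_ (by simp; omega)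
  · simp [h25]; omega
  intro f₂
  refine WP.step (T₂ := 160 * (X.n + X.m + 1) - 12) ?_ ?_ (by simp; omega)
  · simp; omega
  intro f₃
  have h₃ := ((h.frame f₁ rfl).frame f₂ rfl).frame f₃ rfl
  set s₃ := (24 ::= κ 2).run ((Cmd.store 19 (κ 1) (ρ 25)).run ((Cmd.store 19 (κ 0) (κ 2 *ᵣ ρ 0 +ᵣ κ 2)).run s))
    with hs₃
  have hl : Emits 19 24 s₃ ((2 * X.k + 2) :: X.graphCode W N ren inv 0) := by
    refine ⟨by simp [hs₃, graphCode], fun i hi => ?_⟩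
    have hi2 : i < 2 := by simpa [graphCode] using hi
    interval_cases i
    · simp [hs₃, graphCode, h.k]
    · simp [hs₃, graphCode, h25]
  have a17 : s₃.arr 17 = ren := (f₃.arr 17 rfl).trans ((f₂.arr 17 rfl).trans (f₁.arr 17 rfl))
  have a18 : s₃.arr 18 = inv := (f₃.arr 18 rfl).trans ((f₂.arr 18 rfl).trans (f₁.arr 18 rfl))
  have a21 : s₃.arr 21 = s.arr 21 := (f₃.arr 21 rfl).trans ((f₂.arr 21 rfl).trans (f₁.arr 21 rfl))
  have r25 : s₃.reg 25 = N := ((f₃.reg 25 rfl).trans ((f₂.reg 25 rfl).trans (f₁.reg 25 rfl))).trans h25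
  clear_value s₃
  clear f₁ f₂ f₃ hs₃
  rw [← a21] at h21
  -- A bound by the sum of the degrees, used for the running time: the query has O(n+m) words.
  have hlen' : ∀ i ≤ N, ((2 * X.k + 2) :: X.graphCode W N ren inv i).length ≤
      2 + i + ∑ j ∈ range i, X.dg (inv j) := by
    intro i hi
    induction i with
    | zero => simp [graphCode]
    | succ i ih =>
      have h1 := ih (by omega)
      have h2 := nbrs_length_le (X := X) W ren (inv i) (X.dg (inv i))
      simp only [graphCode, List.range_succ, List.flatMap_append, List.length_cons,
        List.length_append, List.flatMap_singleton, nbrCode, sum_range_succ] at h1 ⊢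
      omega
  have hsum : ∑ i ∈ range N, X.dg (inv i) ≤ 2 * X.m :=
    (sum_dg_queue_le (fun i hi => hW _ (hren.bwd i hi).1) fun i hi j hj hij =>
      hren.inj hi hj hij).trans hX.sum_dg
  refine WP.for N (fun i s' => Emits 19 24 s' ((2 * X.k + 2) :: X.graphCode W N ren inv i))
    (fun i => 64 * (X.dg (inv i) + 1)) rfl rfl (by decide) r25 (by omega)
    (hl.of_eq (by simp) (by simp)) ?_ ?_ ?_
  · intro i s' hi hf hx hl
    have b17 := (hf.arr 17 rfl).trans a17
    have b18 := (hf.arr 18 rfl).trans a18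
    have b21 := hf.arr 21 rfl
    have := hlen i hi.le
    have := hlt i hi.le
    have key := emitVertex_wp hX (h₃.frame hf rfl) hW (by rw [b21]; exact h21)
      (by rw [b17, b18]; exact hren) hN hx hi hl (by omega)
    rw [b17, b18] at key
    refine key.mono le_rfl le_rfl fun s'' _ h'' => ?_
    have : X.graphCode W N ren inv (i + 1) = X.graphCode W N ren inv i ++ X.nbrCode W ren (inv i) := by
      simp [graphCode, List.range_succ]
    rw [this]
    exact h''.of_eq (by simp) (by simp)
  · intro s' _ _ h1
    have := hlen N le_rfl
    have := hlt N le_rfl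
    have := hlen' N le_rfl
    exact ⟨h1, by omega, by omega⟩
  · rw [Finset.sum_congr rfl fun i _ => show 64 * (X.dg (inv i) + 1) + 8 = 64 * X.dg (inv i) + 72 by ring,
      sum_add_distrib, ← mul_sum]
    simp only [sum_const, card_range, smul_eq_mul]
    omega

end Ctx

/-! ### Improving the set `Q` -/

open Finset WordRAM

namespace Prog

/-- Add the set `21` to `Q` and remove the deletion set that the oracle has found. -/
def commit : Cmd :=
  Cmd.fill 22 (κ 0) ;; 15 ::= .arr 20 (κ 1) ;;
    Cmd.for 4 15 (.store 22 (.arr 18 (.arr 20 (ρ 4 +ᵣ κ 2))) (κ 1)) ;;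
    Cmd.fill 7 (neg (neg (at4 7) *ᵣ neg (at4 21)) *ᵣ neg (at4 22)) ;; 22 ::= κ 2

/-- Evaluate the answer of the oracle. -/
def decode : Cmd :=
  .cond (.arr 20 (κ 0)) (.cond (κ 2 *ᵣ ρ 0 +ᵣ κ 2 <ᵣ .arr 20 (κ 1)) .skip commit) .skip

/-- Ask for a deletion set of the part of `Q` below the node and the ends of the paths. -/
def improve : Cmd :=
  Cmd.fill 21 ((κ 1 <ᵣ at4 9) *ᵣ (at4 10 <ᵣ ρ 1)) ;; renumber ;; emitGraph ;;
    .query 19 (ρ 24) 20 ;; decode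

end Prog

namespace Ctx

variable {X : Ctx} {H : GraphClass} {G : SimpleGraph (Fin X.n)}

theorem commit_wp (hX : X.Valid) {s : State} {c : Conf} (h : X.Rel s c) {W : Finset ℕ} {N : ℕ}
    (hW : ∀ v ∈ W, v < X.n) (h21 : Ind X.n (s.arr 21) W)
    (hren : Renumbering W N (s.arr 17) (s.arr 18)) (hN : N ≤ X.n) {l : List ℕ}
    (hl : ∀ i ∈ l, i < N) (hlN : l.length ≤ N) (h1 : s.arr 20 1 = l.length)
    (h2 : ∀ i, ∀ h : i < l.length, s.arr 20 (i + 2) = l[i]) :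
    WP X.E Prog.commit s (75 * (X.n + 1)) 0 fun s' => s'.reg 22 = 2 ∧
      X.Rel s' { c with Q := (c.Q ∪ W) \ (l.map (s.arr 18)).toFinset } := by
  have hn := hX.n_le
  have hMB := hX.M_le
  set inv := s.arr 18 with hidef
  refine WP.seq (T₁ := 11 * (X.n + 1)) (K₁ := 0) (T₂ := 64 * (X.n + 1)) (K₂ := 0)
    (Q := fun s' => Ind X.n (s'.arr 22) ∅)
    (fill_ind_wp hX _ h.has ?_ (fun _ _ h => h) (by simp)) ?_ (by omega) (by omega)
  · intro i s' hi hiM hiB hB hf hx _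
    simp; omega
  intro s₁ f₁ h22
  have h₁ := h.frame f₁ rfl
  rw [← f₁.arr 21 rfl] at h21
  rw [← f₁.arr 18 rfl] at hidef
  rw [← f₁.arr 20 rfl] at h1 h2
  clear_value inv
  refine WP.step (T₂ := 61 * (X.n + 1)) ?_ ?_ (by simp; omega)
  · simp [h1]; omega
  intro f₂
  have h₂ := h₁.frame f₂ rfl
  have g15 : ((15 ::= .arr 20 (κ 1)).run s₁).reg 15 = l.length := by simp [h1]
  rw [← f₂.arr 21 rfl] at h21
  rw [← f₂.arr 18 rfl] at hidef
  rw [← f₂.arr 20 rfl] at h2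
  rw [← f₂.arr 22 rfl] at h22
  generalize (15 ::= .arr 20 (κ 1)).run s₁ = s₂ at h₂ g15 h21 hidef h2 h22
  clear f₁ f₂ h₁ h1 h
  refine WP.seq (T₁ := X.n * (8 + 8) + 6) (K₁ := 0) (T₂ := 28 * (X.n + 1)) (K₂ := 0)
    (Q := fun s' => Ind X.n (s'.arr 22) (l.map inv).toFinset)
    (WP.for_const l.length (fun i s' => Ind X.n (s'.arr 22) ((l.take i).map inv).toFinset) 8
      rfl rfl (by decide) g15 (by omega) ?_ ?_ ?_ ?_) ?_ (by omega) (by omega)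
  · simpa using h22
  · intro i s' hi hf hx h'
    have e18 : s'.arr 18 = inv := (hf.arr 18 rfl).trans hidef.symm
    have e20 : s'.arr 20 (i + 2) = l[i] := (congrFun (hf.arr 20 rfl) _).trans (h2 i hi)
    have hli := hl l[i] (List.getElem_mem hi)
    have hiv := hW _ (hren.bwd _ hli).1
    refine WP.simple ?_ (by simp) fun _ => ?_
    · simp [hx, e18, e20]; omega
    · intro v hv
      have := h' v hv
      simp only [Cmd.run, Expr.eval, Op.eval_add, State.setArr_arr, State.setReg_arr, reduceIte, hx,
        e18, e20]
      have hmem : v ∈ ((l.take (i + 1)).map inv).toFinset ↔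
          v ∈ ((l.take i).map inv).toFinset ∨ v = inv l[i] := by
        rw [List.take_succ_eq_append_getElem hi, List.map_append, List.toFinset_append, mem_union]
        simp
      by_cases hvi : v = inv l[i]
      · rw [if_pos (hmem.2 (Or.inr hvi)), hvi, Function.update_self]
      · rw [Function.update_of_ne hvi, this]
        simp only [hmem, hvi, or_false]
  · intro s' _ _ h'
    simpa using h'
  · have : l.length * (8 + 8) ≤ X.n * (8 + 8) := Nat.mul_le_mul_right _ (by omega)
    omega
  intro s₃ f₃ h22
  have h₃ := h₂.frame f₃ rfl
  rw [← f₃.arr 21 rfl] at h21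
  clear f₃ h₂ hidef h2 g15
  refine WP.seq (T₁ := 26 * (X.n + 1)) (K₁ := 0) (T₂ := 2) (K₂ := 0)
    (Q := fun s' => X.Rel s' { c with Q := (c.Q ∪ W) \ (l.map inv).toFinset })
    (fill_ind_wp hX ((c.Q ∪ W) \ (l.map inv).toFinset) h₃.has ?_ ?_ (by simp [Prog.at4, Prog.neg])) ?_
    (by omega) (by omega)
  · intro i s' hi hiM hiB hB hf hx h7
    have e21 := (congrFun (hf.arr 21 rfl) i).trans (h21 i hi)
    have e22 := (congrFun (hf.arr 22 rfl) i).trans (h22 i hi)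
    have e7 := (h7 i le_rfl).trans (h₃.Q i hi)
    have hB0 : 0 < X.E.B := by omega
    generalize (l.map inv).toFinset = D at *
    clear hl hlN h21 h22 hren hW
    simp only [Prog.at4, Prog.neg, Expr.Ok, Expr.eval, hx, e21, e22, e7, Op.eval_mul, Op.eval_sub,
      mem_union, mem_sdiff]
    by_cases b1 : i ∈ c.Q <;> by_cases b2 : i ∈ W <;> by_cases b3 : i ∈ D <;> simp [*]
  · intro s' hf h7
    exact ⟨h₃.has.frame hf rfl, (hf.reg 2 rfl).trans h₃.N, (hf.reg 3 rfl).trans h₃.j,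
      by rw [hf.arr 4 rfl]; exact h₃.par, by rw [hf.arr 3 rfl]; exact h₃.bag,
      by rw [hf.arr 5 rfl]; exact h₃.lab, by rw [hf.arr 6 rfl]; exact h₃.L, h7⟩
  intro s₄ _ h₄
  exact WP.simple (by simp; omega) (by simp) fun f => ⟨by simp, h₄.frame f rfl⟩

/-- `E` and `D` lie within the part below `j`, so `Q` keeps its meaning at the other nodes, and at
`j` it is what the oracle has certified. Bags, labels and nodes are untouched; `rest` drops because
`D` is smaller than `E`. -/
theorem commit_good {c : Conf} (hH : H.Hereditary) (hc : c.Good H G X.k) {E D : Finset ℕ}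
    (hE : E ⊆ c.part X.n c.j) (hEQ : ∀ v ∈ E, v ∉ c.Q) (hED : D.card < E.card)
    (hD : D ⊆ (c.Q ∩ c.part X.n c.j) ∪ E)
    (hmem : H.MemNat G (((c.Q ∩ c.part X.n c.j) ∪ E) \ D)) {c' : Conf}
    (hc' : c' = { c with Q := (c.Q ∪ ((c.Q ∩ c.part X.n c.j) ∪ E)) \ D }) :
    c'.Good H G X.k ∧ c'.pot X.n < c.pot X.n ∧ c'.queryPot X.n < c.queryPot X.n := by
  have hQ : (c.Q ∪ ((c.Q ∩ c.part X.n c.j) ∪ E)) \ D = (c.Q ∪ E) \ D := by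
    ext v; simp only [mem_sdiff, mem_union, mem_inter]; tauto
  rw [hQ] at hc'
  have hr := Conf.commit_rest hE hEQ hED
  rw [← hc'] at hr
  have hpot : c'.todo X.n = c.todo X.n := by rw [hc']; rfl
  have hN : c'.N = c.N := by rw [hc']
  have hj : c'.j = c.j := by rw [hc']
  refine ⟨⟨?_, ?_, ?_⟩, ?_, ?_⟩
  · rw [hc']
    refine Conf.commit_inv hc.inv hH ?_ ?_
    · intro v hv
      have hvp : v ∉ c.part X.n c.j := fun h1 => hv (Conf.mem_part.1 h1).2
      have h1 : v ∉ E := fun h2 => hvp (hE h2)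
      have h2 : v ∉ D := fun h3 => by
        rcases mem_union.1 (hD h3) with h4 | h4
        · exact hvp (mem_inter.1 h4).2
        · exact h1 h4
      simp [h1, h2]
    · refine hmem.mono hH fun v hv _ => ?_
      simp only [mem_sdiff, mem_union, mem_inter] at hv ⊢
      tauto
  · rw [hc']; exact hc.filled
  · rw [hc']; exact hc.bounded
  · unfold Conf.pot Conf.queryPot
    omega
  · unfold Conf.queryPot
    omega

/-- The ends `E` of the 2k+3 disjoint paths lie in `S \ Q`. A deletion set of `(Q ∩ S) ∪ E` with at
most 2k+2 vertices enlarges `Q`; if there is none, `E` is the certificate that `PartFails` asks for.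
-/
theorem improve_wp (hX : X.Valid) (hG : X.adj = G.adjNat) (hH : H.Hereditary)
    (hA : SolvesDeletion H X.E.A) (hok : ∀ q, IsInducedQuery G (2 * X.k + 2) q → X.E.ok q)
    {s : State} {c : Conf} {M : Finset ℕ} (h : X.Att s c M) (hc : c.Good H G X.k)
    (hflow : X.FlowOk s)
    (hrole : ∀ v < X.n, s.arr 9 v = baseRole (c.part X.n c.j) c.Q (c.bag c.j) M v)
    (hval : Linkage.value X.n (s.arr 9) (s.arr 11) = 2 * X.k + 3) (h22 : s.reg 22 = 0) :
    WP X.E Prog.improve s (320 * (X.n + X.m + 1)) 1 fun s' =>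
      (s'.reg 22 = 0 ∧ X.Att s' c M ∧ ∃ E : Finset ℕ, E.card = 2 * X.k + 3 ∧
        (∀ v ∈ E, v < X.n ∧ baseRole (c.part X.n c.j) c.Q (c.bag c.j) M v = 3) ∧
        Linkage.IsLinked G.adjNat X.n (baseRole (c.part X.n c.j) c.Q (c.bag c.j) M) E ∧
        ∀ D : Finset ℕ, H.MemNat G (((c.Q ∩ c.part X.n c.j) ∪ E) \ D) → 2 * X.k + 3 ≤ D.card) ∨
      (s'.reg 22 = 2 ∧ ∃ c', X.Rel s' c' ∧ c'.Good H G X.k ∧ c'.pot X.n < c.pot X.n ∧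
        c'.queryPot X.n < c.queryPot X.n) := by
  have hn := hX.n_le
  have hMB := hX.M_le
  have hk := hX.k_le
  have hB1 : 1 < X.E.B := by omega
  set S := c.part X.n c.j with hS
  set Z := c.bag c.j with hZ
  set E := Linkage.ends X.n (s.arr 9) (s.arr 10) with hE
  set W := (c.Q ∩ S) ∪ E with hWdef
  have hEc : E.card = 2 * X.k + 3 := by
    rw [hE, hflow.matching.card_ends hflow.role_le, hval]
  have hE3 : ∀ v, v ∈ E ↔ v < X.n ∧ s.arr 9 v = 3 ∧ s.arr 10 v < X.n := by
    intro v; simp [hE, Linkage.ends]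
  have hErole : ∀ v ∈ E, v < X.n ∧ baseRole S c.Q Z M v = 3 := fun v hv => by
    have := (hE3 v).1 hv
    exact ⟨this.1, by rw [← hrole v this.1]; exact this.2.1⟩
  have hES : ∀ v ∈ E, v ∈ S ∧ v ∉ c.Q := fun v hv => by
    have := (hErole v hv).2
    unfold baseRole at this
    by_cases h1 : v ∈ S
    · refine ⟨h1, fun h2 => ?_⟩
      simp [h1, h2] at this
    · rw [if_neg h1] at this
      split_ifs at this
      omega
  have hlink : Linkage.IsLinked G.adjNat X.n (baseRole S c.Q Z M) E := by
    rw [← hG]; exact hflow.matching.isLinked.congr hrole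
  have hWn : ∀ v ∈ W, v < X.n := fun v hv => by
    rcases mem_union.1 hv with h1 | h1
    · exact (Conf.mem_part.1 (mem_inter.1 h1).2).1
    · exact (hErole v h1).1
  refine WP.seq (T₁ := 19 * (X.n + 1)) (K₁ := 0) (T₂ := 300 * (X.n + X.m + 1)) (K₂ := 1)
    (Q := fun s' => Ind X.n (s'.arr 21) W)
    (fill_ind_wp hX W h.rel.has ?_ (fun _ _ h => h) (by simp [Prog.at4])) ?_ (by clear * -; omega) le_rfl
  · intro i s' hi hiM hiB hB hf hx _
    have e9 := congrFun (hf.arr 9 rfl) i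
    have e10 := congrFun (hf.arr 10 rfl) i
    have e1 := (hf.reg 1 rfl).trans h.rel.has.n
    have r3 := hflow.role_le i hi
    have m3 := hflow.mR_le i hi
    -- Inner vertices are always matched, so the matched right vertices are exactly `Q ∩ S` and the
    -- ends of the paths. This allows the program to read off `W` from the roles and the matching.
    have hiW : i ∈ W ↔ 1 < s.arr 9 i ∧ s.arr 10 i < X.n := by
      rw [hWdef, mem_union, hE3, mem_inter]
      have h2 : s.arr 9 i = 2 ↔ i ∈ c.Q ∧ i ∈ S := by
        rw [hrole i hi]; unfold baseRole
        by_cases b1 : i ∈ S <;> by_cases b2 : i ∈ c.Q <;> by_cases b3 : i ∈ Z <;>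
          by_cases b4 : i ∈ M <;> simp [b1, b2, b3, b4]
      rw [← h2]
      constructor
      · rintro (h3 | h3)
        · exact ⟨by omega, hflow.matching.inner i hi h3 hi.ne⟩
        · exact ⟨by omega, h3.2.2⟩
      · intro h3
        by_cases h4 : s.arr 9 i = 2
        · exact Or.inl h4
        · exact Or.inr ⟨hi, by omega, h3.2⟩
    have hev : ((κ 1 <ᵣ Prog.at4 9) *ᵣ (Prog.at4 10 <ᵣ ρ 1)).eval s' = if i ∈ W then 1 else 0 := by
      simp only [Prog.at4, Expr.eval, Op.eval_mul, Op.eval_lt, hx, e9, e10, e1]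
      by_cases b1 : 1 < s.arr 9 i <;> by_cases b2 : s.arr 10 i < X.n <;> simp [hiW, b1, b2, ltN]
    refine ⟨⟨?_, ?_, ?_⟩, hev⟩
    · simp [Prog.at4, hx, e9, ltN_lt hB1]; omega
    · simp [Prog.at4, hx, e10, e1, ltN_lt hB1]; omega
    · change Expr.eval _ ((κ 1 <ᵣ Prog.at4 9) *ᵣ (Prog.at4 10 <ᵣ ρ 1)) < _
      rw [hev]; split_ifs <;> omega
  intro s₁ f₁ h21
  have h₁ := h.frame f₁ rfl
  replace h22 := (f₁.reg 22 rfl).trans h22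
  clear f₁ h hflow hval
  clear_value E
  refine WP.seq (renumber_wp hX h₁.rel.has hWn h21) (T₂ := 270 * (X.n + X.m + 1)) (K₂ := 1) ?_
    (by clear * -; omega) (by clear * -; omega)
  rintro s₂ f₂ ⟨h25, hren⟩
  have h₂ := h₁.frame f₂ rfl
  replace h22 := (f₂.reg 22 rfl).trans h22
  rw [← f₂.arr 21 rfl] at h21
  clear f₂ h₁
  have hN : W.card ≤ X.n := card_le_of_lt hWn
  refine WP.seq (emitGraph_wp hX h₂.rel.has hWn h21 h25 hren hN) (T₂ := 110 * (X.n + X.m + 1))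
    (K₂ := 1) ?_ (by omega) (by omega)
  rintro s₃ f₃ ⟨hem, hlM, hlT⟩
  have h₃ := h₂.frame f₃ rfl
  replace h22 := (f₃.reg 22 rfl).trans h22
  rw [← f₃.arr 21 rfl] at h21
  rw [← f₃.arr 17 rfl, ← f₃.arr 18 rfl] at hren hem hlM hlT
  clear f₃ h₂ h25
  have hcode := isGraphCode hX hG hren hWn
  have hans := hA _ _ _ (2 * X.k + 2) hcode
  have hq : IsInducedQuery G (2 * X.k + 2)
      ((2 * X.k + 2) :: X.graphCode W W.card (s₃.arr 17) (s₃.arr 18) W.card) :=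
    ⟨_, _, _, _, hren.nonempty_iso hWn G, hcode, rfl⟩
  set q := (2 * X.k + 2) :: X.graphCode W W.card (s₃.arr 17) (s₃.arr 18) W.card with hqdef
  have hread : s₃.readList 19 q.length = q := hem.readList
  have hqB : ∀ w ∈ q, w < X.E.B := by
    have h1 : ∀ v, ∀ x ∈ X.nbrs W (s₃.arr 17) v (X.dg v + 1), x < X.n := by
      intro v x hx
      simp only [nbrs, List.mem_map, List.mem_filter, decide_eq_true_eq] at hx
      obtain ⟨i, ⟨-, -, hi⟩, rfl⟩ := hx
      have := (hren.fwd _ hi).1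
      omega
    intro w hw
    rw [hqdef, List.mem_cons, graphCode, List.mem_cons, List.mem_flatMap] at hw
    rcases hw with rfl | rfl | ⟨i, hi, hw⟩
    · omega
    · omega
    · have hi' : i < W.card := by simpa using hi
      have h2 := nbrs_length_le (X := X) W (s₃.arr 17) (s₃.arr 18 i) (X.dg (s₃.arr 18 i))
      have h3 := hX.dg_lt (hWn _ (hren.bwd i hi').1)
      rcases List.mem_cons.1 hw with rfl | hw
      · omega
      · have := h1 _ _ hw; omega
  set ans := X.E.A q with hansdef
  -- The oracle may return a minimum deletion set larger than the parameter, but it has no more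
  -- vertices than the query, so the answer always fits.
  have hansl : ans.length ≤ X.n + 2 ∧ ∀ w ∈ ans, w ≤ X.n + 1 := by
    rcases hans with ⟨h1, -⟩ | ⟨l, hnd, -, h1⟩
    · rw [h1]; simp
    · have : l.length ≤ W.card := by simpa using hnd.length_le_card
      rw [h1]
      refine ⟨by simp [codeList]; omega, fun w hw => ?_⟩
      simp only [codeList, List.mem_cons, List.mem_map] at hw
      rcases hw with rfl | rfl | ⟨i, -, rfl⟩
      · omega
      · omega
      · have := i.2; omega
  have h24 := hem.1
  refine WP.seq (T₁ := 2 + q.length + ans.length) (K₁ := 1) (T₂ := 100 * (X.n + 1)) (K₂ := 0)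
    (Q := fun s' => s' = s₃.writeList 20 ans)
    (WP.query (by simp [h24]; omega) (by simp [h24]; omega) ?_ ?_ ?_ ?_ ?_ le_rfl ?_) ?_ (by omega)
    le_rfl
  · simp only [Expr.eval, h24, hread, ← hansdef]; omega
  · simp only [Expr.eval, h24, hread]; exact hqB
  · simp only [Expr.eval, h24, hread, ← hansdef]
    intro w hw
    have := hansl.2 w hw
    omega
  · simp only [Expr.eval, h24, hread]; exact hok q hq
  · simp [h24, hread, ← hansdef]
  · simp only [Expr.eval, h24, hread, ← hansdef]
  rintro s₄ f₄ rfl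
  have h₄ := h₃.frame f₄ rfl
  replace h22 := (f₄.reg 22 rfl).trans h22
  have r20 : (s₃.writeList 20 ans).arr 20 = fun i => ans.getD i (s₃.arr 20 i) := by
    simp [State.writeList]
  rw [← f₄.arr 21 rfl] at h21
  have e18 := f₄.arr 18 rfl
  have e17 := f₄.arr 17 rfl
  generalize s₃.writeList 20 ans = s₄ at h₄ h22 r20 h21 e18 e17
  clear f₄ h₃ hem hread h24
  clear_value q ans
  have fails : (∀ D : Finset (Fin W.card), H.IsDeletionSet (hren.graph hWn G) D →
      2 * X.k + 3 ≤ D.card) → ∃ E : Finset ℕ, E.card = 2 * X.k + 3 ∧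
        (∀ v ∈ E, v < X.n ∧ baseRole S c.Q Z M v = 3) ∧
        Linkage.IsLinked G.adjNat X.n (baseRole S c.Q Z M) E ∧
        ∀ D : Finset ℕ, H.MemNat G (((c.Q ∩ S) ∪ E) \ D) → 2 * X.k + 3 ≤ D.card :=
    fun hD => ⟨E, hEc, hErole, hlink, fun D hDm => hren.card_le_of_forall hWn hH hD D hDm⟩
  rcases hans with ⟨h1, h2⟩ | ⟨l, hnd, hmin, h1⟩
  · have e0 : s₄.arr 20 0 = 0 := by rw [r20, h1]; simp
    refine WP.cond (T := 90 * (X.n + 1)) (by simp [e0]; omega) (fun h3 => absurd (by simpa using e0) h3) ?_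
      (by simp; omega)
    intro _
    refine WP.simple trivial (by simp; omega) fun f => Or.inl ⟨h22, h₄, fails fun D hD => ?_⟩
    have := h2 D hD
    omega
  · have hlen : l.length ≤ W.card := by simpa using hnd.length_le_card
    have e0 : s₄.arr 20 0 = 1 := by rw [r20, h1]; simp
    have e1 : s₄.arr 20 1 = l.length := by rw [r20, h1]; simp [codeList]
    refine WP.cond (T := 90 * (X.n + 1)) (by simp [e0]; omega) ?_ (fun h3 => absurd h3 (by simp [e0]))
      (by simp; omega)
    intro _
    refine WP.cond (T := 80 * (X.n + 1)) ?_ ?_ ?_ (by simp; omega)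
    · simp [h₄.rel.has.k, e1, ltN_lt hB1]; omega
    · intro h3
      -- The returned set is large but of minimum size, so there is no small deletion set, just as
      -- for the answer `[0]`.
      have h4 : 2 * X.k + 2 < l.length := by simpa [h₄.rel.has.k, e1] using h3
      refine WP.simple trivial (by simp; omega) fun f => Or.inl ⟨h22, h₄, fails fun D hD => ?_⟩
      have := hmin.2 D hD
      rw [List.toFinset_card_of_nodup hnd] at this
      omega
    · intro h3
      have h4 : l.length ≤ 2 * X.k + 2 := by simpa [h₄.rel.has.k, e1] using h3
      have hdel := (hren.isDeletionSet_iff hWn l.toFinset).1 hmin.1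
      rw [← e18] at hdel
      rw [← e17, ← e18] at hren
      refine (commit_wp hX h₄.rel hWn h21 hren hN (l := l.map Fin.val) ?_ (by simpa using hlen)
        (by simpa using e1) ?_).mono (by omega) le_rfl fun s' _ h' => Or.inr ⟨h'.1, _, h'.2, ?_⟩
      · simp only [List.mem_map]
        rintro _ ⟨i, -, rfl⟩
        exact i.2
      · intro i hi
        rw [r20, h1]
        have hi' : i < l.length := by simpa using hi
        simp [codeList, hi']
      · have himg : (l.toFinset.image fun i : Fin W.card => s₄.arr 18 i) =
            ((l.map Fin.val).map (s₄.arr 18)).toFinset := by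
          ext v; simp
        rw [himg] at hdel
        refine commit_good hH hc (fun v hv => (hES v hv).1) (fun v hv => (hES v hv).2)
          (D := ((l.map Fin.val).map (s₄.arr 18)).toFinset) ?_ ?_ hdel rfl
        · have := List.toFinset_card_le ((l.map Fin.val).map (s₄.arr 18))
          simp only [List.length_map] at this
          omega
        · intro v hv
          simp only [List.mem_toFinset, List.mem_map] at hv
          obtain ⟨_, ⟨i, -, rfl⟩, rfl⟩ := hv
          exact (hren.bwd _ i.2).1

end Ctx

/-! ### The search for one part of the bag -/

open Finset WordRAM

namespace Prog

/-- Search for paths in the given mode. -/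
def search (mode : ℕ) (cap e : Expr) : Cmd :=
  18 ::= κ mode ;; 8 ::= cap ;; Cmd.fill 9 e ;; flow

def searchBase : Cmd :=
  search 2 (κ 2 *ᵣ ρ 0 +ᵣ κ 3) (at4 23 *ᵣ (κ 3 -ᵣ at4 7) +ᵣ neg (at4 23) *ᵣ (at4 24 *ᵣ at4 8))

def searchBalanced : Cmd :=
  search 1 (ρ 0 +ᵣ κ 2)
    (at4 23 *ᵣ κ 2 +ᵣ neg (at4 23) *ᵣ (at4 24 *ᵣ (κ 3 -ᵣ κ 2 *ᵣ at4 8)))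

/-- Try to split the current node or to improve `Q` by means of the part `8` of the bag. -/
def tryPart : Cmd :=
  Cmd.sum 19 (at4 24 *ᵣ at4 8) ;; Cmd.sum 20 (at4 24 *ᵣ neg (at4 8)) ;;
    .cond (ρ 20 <ᵣ ρ 0 +ᵣ κ 2) (searchBase ;; .cond (ρ 21 =ᵣ κ 1) split improve)
      (.cond (ρ 0 +ᵣ κ 1 <ᵣ ρ 19) (searchBalanced ;; .cond (ρ 21 =ᵣ κ 1) split .skip) .skip)

end Prog

namespace Ctx

variable {X : Ctx} {H : GraphClass} {G : SimpleGraph (Fin X.n)}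

theorem search_wp (hX : X.Valid) {s : State} {c : Conf} {M : Finset ℕ} (h : X.Att s c M)
    {mode : ℕ} {cap e : Expr} (hmode : mode ≤ 2)
    (hcap : ∀ s', X.Has s' → cap.Ok X.E.B X.E.M s' ∧ cap.eval s' = modeCap X.k mode)
    (he : ∀ i s', i < X.n → i < X.E.M → i < X.E.B → 6 < X.E.B → s'.reg 4 = i →
      (s'.arr 23 i = if i ∈ c.part X.n c.j then 1 else 0) →
      (s'.arr 24 i = if i ∈ c.bag c.j then 1 else 0) →
      (s'.arr 8 i = if i ∈ M then 1 else 0) → (s'.arr 7 i = if i ∈ c.Q then 1 else 0) →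
      e.Ok X.E.B X.E.M s' ∧
        e.eval s' = modeRole mode (c.part X.n c.j) c.Q (c.bag c.j) M i)
    (hc : cap.cost ≤ 10) (hec : e.cost ≤ 25) :
    WP X.E (Prog.search mode cap e) s (1330 * ((X.k + 1) * (X.n + X.m + 1))) 0 fun s' =>
      X.Att s' c M ∧ s'.reg 18 = mode ∧ X.FlowOk s' ∧
      (∀ v < X.n, s'.arr 9 v = modeRole mode (c.part X.n c.j) c.Q (c.bag c.j) M v) ∧
      ((s'.reg 21 = 1 ∧ Linkage.IsCut X.adj X.n (s'.arr 9)
          ((range X.n).filter fun v => s'.arr 13 v = 1)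
          ((range X.n).filter fun v => (s'.arr 12 v = 1 ∨ s'.arr 9 v = 1) ∧ s'.arr 13 v ≠ 1)
          (modeCap X.k mode) ∧
          (∀ v < X.n, s'.arr 12 v ≤ 1) ∧ (∀ v < X.n, s'.arr 13 v ≤ 1)) ∨
        (s'.reg 21 = 2 ∧ Linkage.value X.n (s'.arr 9) (s'.arr 11) = modeCap X.k mode)) := by
  have hn := hX.n_le
  have hMB := hX.M_le
  have hk := hX.k_le
  have hcap2 : modeCap X.k mode ≤ 2 * X.k + 3 := by unfold modeCap; split_ifs <;> omega
  have hflowT : 320 * (modeCap X.k mode + 1) * (X.n + X.m + 1) ≤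
      1280 * ((X.k + 1) * (X.n + X.m + 1)) := by
    rw [← mul_assoc]
    exact Nat.mul_le_mul_right _ (by omega)
  have hW : X.n + X.m + 1 ≤ (X.k + 1) * (X.n + X.m + 1) := Nat.le_mul_of_pos_left _ (by omega)
  set W := (X.k + 1) * (X.n + X.m + 1) with hWd
  clear_value W
  refine WP.step (T₂ := 1330 * W - 2) (by simp; omega) ?_ (by simp; omega)
  intro f₁
  have h₁ := h.frame f₁ rfl
  have g18 : ((18 ::= κ mode).run s).reg 18 = mode := by simp
  generalize (18 ::= κ mode).run s = s₁ at h₁ g18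
  obtain ⟨hc1, hc2⟩ := hcap s₁ h₁.rel.has
  refine WP.step (T₂ := 1330 * W - 13) hc1 ?_ (by simp; omega)
  intro f₂
  have h₂ := h₁.frame f₂ rfl
  have g8 : ((8 ::= cap).run s₁).reg 8 = modeCap X.k mode := by simp [hc2]
  replace g18 := (f₂.reg 18 rfl).trans g18
  generalize (8 ::= cap).run s₁ = s₂ at h₂ g8 g18
  clear f₁ f₂ h₁ h hc1 hc2
  refine WP.seq (T₁ := 35 * (X.n + 1)) (K₁ := 0) (T₂ := 1280 * W) (K₂ := 0)
    (Q := fun s' => ∀ v < X.n, s'.arr 9 v = modeRole mode (c.part X.n c.j) c.Q (c.bag c.j) M v)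
    (WP.fill X.n _ h₂.rel.has.n (by omega) (by omega) ?_ (fun _ _ h1 _ => h1)
      (Nat.mul_le_mul_right _ (by omega))) ?_ (by omega) le_rfl
  · intro i s' hi hf hx _
    exact he i s' hi (by omega) (by omega) (by omega) hx
      ((congrFun (hf.arr 23 rfl) i).trans (h₂.S i hi))
      ((congrFun (hf.arr 24 rfl) i).trans (h₂.Z i hi))
      ((congrFun (hf.arr 8 rfl) i).trans (h₂.M i hi))
      ((congrFun (hf.arr 7 rfl) i).trans (h₂.rel.Q i hi))
  intro s₃ f₃ hrole
  have h₃ := h₂.frame f₃ rfl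
  replace g18 := (f₃.reg 18 rfl).trans g18
  replace g8 := (f₃.reg 8 rfl).trans g8
  clear f₃ h₂
  have hr3 : ∀ v < X.n, s₃.arr 9 v ≤ 3 := by
    intro v hv
    rw [hrole v hv]
    unfold modeRole
    split_ifs
    · unfold balancedRole; split_ifs <;> omega
    · unfold baseRole; split_ifs <;> omega
  refine (flow_wp hX h₃.rel.has hr3 g8 hcap2).mono hflowT le_rfl ?_
  rintro s' f ⟨hfl, hres⟩
  have e9 : s'.arr 9 = s₃.arr 9 := f.arr 9 rfl
  refine ⟨h₃.frame f rfl, (f.reg 18 rfl).trans g18, hfl, by rw [e9]; exact hrole, ?_⟩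
  rw [← e9] at hres
  exact hres

/-- A part requires a single flow computation of O(k) augmentations. The oracle is consulted only in
the base mode, and then only once. -/
theorem tryPart_wp (hX : X.Valid) (hG : X.adj = G.adjNat) (hH : H.Hereditary) (he : H.MemNat G ∅)
    (hA : SolvesDeletion H X.E.A) (hok : ∀ q, IsInducedQuery G (2 * X.k + 2) q → X.E.ok q)
    {s : State} {c : Conf} {M : Finset ℕ} (h : X.Att s c M) (hc : c.Good H G X.k) (hj : c.j < c.N)
    (hne : c.part X.n c.j ≠ ∅) (hM : M ⊆ c.bag c.j) (h22 : s.reg 22 = 0) :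
    WP X.E Prog.tryPart s (2000 * ((X.k + 1) * (X.n + X.m + 1))) 1 fun s' =>
      (s'.reg 22 = 0 ∧ X.Att s' c M ∧ PartFails H G X.k (c.part X.n c.j) c.Q (c.bag c.j) M) ∨
      ((s'.reg 22 = 1 ∨ s'.reg 22 = 2) ∧ ∃ c', X.Rel s' c' ∧ c'.Good H G X.k ∧
        c'.pot X.n < c.pot X.n ∧ c'.queryPot X.n < c.queryPot X.n) := by
  have hn := hX.n_le
  have hMB := hX.M_le
  have hk := hX.k_le
  have hB1 : 1 < X.E.B := by omega
  have hW : X.n + X.m + 1 ≤ (X.k + 1) * (X.n + X.m + 1) := Nat.le_mul_of_pos_left _ (by omega)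
  set W := (X.k + 1) * (X.n + X.m + 1) with hWd
  clear_value W
  have hZn : ∀ v ∈ c.bag c.j, v < X.n := hc.inv.bag_lt _ hj
  have hZc : (c.bag c.j).card ≤ X.n := card_le_of_lt hZn
  have hM1 : M.card ≤ (c.bag c.j).card := card_le_card hM
  have hM2 : (c.bag c.j \ M).card ≤ (c.bag c.j).card := card_le_card sdiff_subset
  have s1 : ∑ v ∈ range X.n, (if v ∈ M then 1 else 0) = M.card := by
    rw [sum_boole]
    simp only [Nat.cast_id]
    congr 1
    ext v; simp only [mem_filter, mem_range, and_iff_right_iff_imp]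
    exact fun hv => hZn v (hM hv)
  have s2 : ∑ v ∈ range X.n, (if v ∈ c.bag c.j \ M then 1 else 0) = (c.bag c.j \ M).card := by
    rw [sum_boole]
    simp only [Nat.cast_id]
    congr 1
    ext v; simp only [mem_filter, mem_range, and_iff_right_iff_imp]
    exact fun hv => hZn v (mem_sdiff.1 hv).1
  refine WP.seq (T₁ := 19 * (X.n + 1)) (K₁ := 0) (T₂ := 1981 * W) (K₂ := 1)
    (Q := fun s' => s'.reg 19 = M.card)
    (WP.sum X.n _ (by decide) (by decide) h.rel.has.n (by omega) (by rw [s1]; omega) ?_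
      (fun s' _ h1 => h1.trans s1) (by simp [Prog.at4])) ?_ (by omega) le_rfl
  · intro i s' hi hf hx
    have e24 := (congrFun (hf.arr 24 rfl) i).trans (h.Z i hi)
    have e8 := (congrFun (hf.arr 8 rfl) i).trans (h.M i hi)
    have hiM : i < X.E.M := by omega
    have hiB : i < X.E.B := by omega
    have hB0 : 0 < X.E.B := by omega
    simp only [Prog.at4, Expr.Ok, Expr.eval, hx, e24, e8, Op.eval_mul]
    by_cases b1 : i ∈ M
    · simp [b1, hM b1, hiM, hiB, hB1]
    · by_cases b2 : i ∈ c.bag c.j <;> simp [b1, b2, hiM, hiB, hB1, hB0]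
  intro s₁ f₁ g19
  have h₁ := h.frame f₁ rfl
  replace h22 := (f₁.reg 22 rfl).trans h22
  clear f₁ h
  refine WP.seq (T₁ := 21 * (X.n + 1)) (K₁ := 0) (T₂ := 1960 * W) (K₂ := 1)
    (Q := fun s' => s'.reg 20 = (c.bag c.j \ M).card)
    (WP.sum X.n _ (by decide) (by decide) h₁.rel.has.n (by omega) (by rw [s2]; omega) ?_
      (fun s' _ h1 => h1.trans s2) (by simp [Prog.at4, Prog.neg])) ?_ (by omega) le_rfl
  · intro i s' hi hf hx
    have e24 := (congrFun (hf.arr 24 rfl) i).trans (h₁.Z i hi)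
    have e8 := (congrFun (hf.arr 8 rfl) i).trans (h₁.M i hi)
    have hiM : i < X.E.M := by omega
    have hiB : i < X.E.B := by omega
    have hB0 : 0 < X.E.B := by omega
    simp only [Prog.at4, Prog.neg, Expr.Ok, Expr.eval, hx, e24, e8, Op.eval_mul, Op.eval_sub,
      mem_sdiff]
    by_cases b1 : i ∈ M <;> by_cases b2 : i ∈ c.bag c.j <;> simp [b1, b2, hiM, hiB, hB1, hB0]
  intro s₂ f₂ g20
  have h₂ := h₁.frame f₂ rfl
  replace h22 := (f₂.reg 22 rfl).trans h22
  replace g19 := (f₂.reg 19 rfl).trans g19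
  clear f₂ h₁ s1 s2
  have hk0 := h₂.rel.has.k
  refine WP.cond (T := 1950 * W) ?_ ?_ ?_ (by simp; omega)
  · simp [g20, hk0, ltN_lt hB1]; omega
  · intro hz
    have hz : (c.bag c.j \ M).card ≤ X.k + 1 := by
      have : (c.bag c.j \ M).card < X.k + 2 := by simpa [g20, hk0] using hz
      omega
    refine WP.seq (search_wp hX h₂ (mode := 2) le_rfl ?_ ?_ (by simp)
      (by simp [Prog.at4, Prog.neg])) (T₂ := 600 * W) (K₂ := 1) ?_ (by omega) le_rfl
    · intro s' hs'
      simp [hs'.k, modeCap]; omega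
    · intro i s' hi hiM hiB hB hx e23 e24 e8 e7
      have hB0 : 0 < X.E.B := by omega
      have hB3 : 3 < X.E.B := by omega
      have hB2 : 2 < X.E.B := by omega
      simp only [Prog.at4, Prog.neg, Expr.Ok, Expr.eval, hx, e23, e24, e8, e7, Op.eval_mul,
        Op.eval_sub, Op.eval_add, modeRole]
      by_cases b1 : i ∈ M <;> by_cases b2 : i ∈ c.bag c.j <;> by_cases b3 : i ∈ c.Q <;>
        by_cases b4 : i ∈ c.part X.n c.j <;> simp [b1, b2, b3, b4, hiM, hiB, hB1, hB0, hB2, hB3, baseRole]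
    rintro s₃ f₃ ⟨h₃, g18, hfl, hrole, hres⟩
    replace h22 := (f₃.reg 22 rfl).trans h22
    have h21 : s₃.reg 21 = 1 ∨ s₃.reg 21 = 2 := hres.imp (·.1) (·.1)
    refine WP.cond (T := 560 * W) ?_ ?_ ?_ (by simp; omega)
    · rcases h21 with h1 | h1 <;> simp [h1, eqN_lt hB1] <;> omega
    · intro h1
      have h1 : s₃.reg 21 = 1 := by
        rcases h21 with h3 | h3
        · exact h3
        · simp [h3, eqN] at h1
      rcases hres with h3 | h3
      · refine (split_wp hX hG hH h₃ hc hj hne he hM g18 (Or.inr ⟨rfl, hz⟩) hrole hfl.role_le h3.2.1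
          h3.2.2.1 h3.2.2.2).mono (by omega) (by omega) fun s' _ h' => Or.inr ⟨Or.inl h'.1, h'.2⟩
      · omega
    · intro h1
      have h1 : s₃.reg 21 = 2 := by
        rcases h21 with h3 | h3
        · simp [h3] at h1
        · exact h3
      rcases hres with h3 | h3
      · omega
      · refine (improve_wp hX hG hH hA hok h₃ hc hfl (by simpa [modeRole] using hrole)
          (by simpa [modeCap] using h3.2) h22).mono (by omega) le_rfl fun s' _ h' => ?_
        rcases h' with h' | h'
        · exact Or.inl ⟨h'.1, h'.2.1, fun h4 => absurd h4 (by omega), fun _ => h'.2.2⟩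
        · exact Or.inr ⟨Or.inr h'.1, h'.2⟩
  · intro hz
    have hz : X.k + 2 ≤ (c.bag c.j \ M).card := by simpa [g20, hk0] using hz
    refine WP.cond (T := 1940 * W) ?_ ?_ ?_ (by simp; omega)
    · simp [g19, hk0, ltN_lt hB1]; omega
    · intro hm
      have hm : X.k + 2 ≤ M.card := by
        have : X.k + 1 < M.card := by simpa [g19, hk0] using hm
        omega
      refine WP.seq (search_wp hX h₂ (mode := 1) (by omega) ?_ ?_ (by simp)
        (by simp [Prog.at4, Prog.neg])) (T₂ := 600 * W) (K₂ := 1) ?_ (by omega) le_rfl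
      · intro s' hs'
        simp [hs'.k, modeCap]; omega
      · intro i s' hi hiM hiB hB hx e23 e24 e8 e7
        have hB0 : 0 < X.E.B := by omega
        have hB3 : 3 < X.E.B := by omega
        have hB2 : 2 < X.E.B := by omega
        simp only [Prog.at4, Prog.neg, Expr.Ok, Expr.eval, hx, e23, e24, e8, Op.eval_mul,
          Op.eval_sub, Op.eval_add, modeRole]
        by_cases b1 : i ∈ M <;> by_cases b2 : i ∈ c.bag c.j <;>
          by_cases b4 : i ∈ c.part X.n c.j <;>
          simp [b1, b2, b4, hiM, hiB, hB1, hB0, hB2, hB3, balancedRole]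
      rintro s₃ f₃ ⟨h₃, g18, hfl, hrole, hres⟩
      replace h22 := (f₃.reg 22 rfl).trans h22
      have h21 : s₃.reg 21 = 1 ∨ s₃.reg 21 = 2 := hres.imp (·.1) (·.1)
      refine WP.cond (T := 560 * W) ?_ ?_ ?_ (by simp; omega)
      · rcases h21 with h1 | h1 <;> simp [h1, eqN_lt hB1] <;> omega
      · intro h1
        have h1 : s₃.reg 21 = 1 := by
          rcases h21 with h3 | h3
          · exact h3
          · simp [h3, eqN] at h1
        rcases hres with h3 | h3
        · refine (split_wp hX hG hH h₃ hc hj hne he hM g18 (Or.inl ⟨rfl, hm, hz⟩) hrole hfl.role_le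
            h3.2.1 h3.2.2.1 h3.2.2.2).mono (by omega) (by omega)
            fun s' _ h' => Or.inr ⟨Or.inl h'.1, h'.2⟩
        · omega
      · intro h1
        have h1 : s₃.reg 21 = 2 := by
          rcases h21 with h3 | h3
          · simp [h3] at h1
          · exact h3
        rcases hres with h3 | h3
        · omega
        · have hmat := hfl.matching
          refine WP.simple trivial (by simp; omega) fun f => Or.inl ⟨h22, h₃, fun _ _ => ?_,
            fun h4 => absurd h4 (by omega)⟩
          simp only [modeRole, modeCap, if_true] at hrole h3
          refine ⟨Linkage.ends X.n (s₃.arr 9) (s₃.arr 10),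
            by rw [hmat.card_ends hfl.role_le, h3.2], fun v hv => ?_, ?_⟩
          · simp only [Linkage.ends, mem_filter, mem_range] at hv
            exact ⟨hv.1, by rw [← hrole v hv.1]; exact hv.2.1⟩
          · rw [← hG]; exact hmat.isLinked.congr hrole
    -- `M` is too small for the balanced mode and `Z \ M` too large for the base mode; such a part
    -- fails vacuously.
    · intro hm
      have hm : M.card ≤ X.k + 1 := by simpa [g19, hk0] using hm
      exact WP.simple trivial (by simp; omega) fun f => Or.inl ⟨h22, h₂,
        fun _ h4 => absurd h4 (by omega), fun h4 => absurd h4 (by omega)⟩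

end Ctx

/-! ### The search for all parts of the bag -/

open Finset WordRAM

/-- The number of elements of `Z` below `v`. -/
def rank (Z : Finset ℕ) (v : ℕ) : ℕ := (Z.filter (· < v)).card

/-- The subsets of `Z` in binary. -/
def binCode (Z M : Finset ℕ) : ℕ := ∑ v ∈ M, 2 ^ rank Z v

/-- The largest element carries the most significant bit and does not affect the ranks of the
others, so it can be split off in an induction. -/
theorem binCode_insert_max {Z M : Finset ℕ} {a : ℕ} (ha : ∀ v ∈ Z, v < a) (hM : M ⊆ insert a Z) :
    binCode (insert a Z) M = binCode Z (M.erase a) + if a ∈ M then 2 ^ Z.card else 0 := by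
  have h1 : ∀ v ∈ M.erase a, 2 ^ rank (insert a Z) v = 2 ^ rank Z v := by
    intro v hv
    have hvZ := mem_of_mem_insert_of_ne (hM (mem_of_mem_erase hv)) (ne_of_mem_erase hv)
    unfold rank
    rw [filter_insert, if_neg (by have := ha v hvZ; omega)]
  have h2 : rank (insert a Z) a = Z.card := by
    unfold rank
    rw [filter_insert, if_neg (lt_irrefl a), filter_true_of_mem ha]
  unfold binCode
  split_ifs with h
  · rw [← sum_erase_add _ _ h, sum_congr rfl h1, h2]
  · rw [erase_eq_of_notMem h] at h1 ⊢
    rw [sum_congr rfl h1, add_zero]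

/-- Counting through the codes thus meets no subset twice, and once all codes below `2 ^ Z.card`
have been passed, every subset has been tried. -/
theorem binCode_lt_inj (Z : Finset ℕ) : (∀ M ⊆ Z, binCode Z M < 2 ^ Z.card) ∧
    ∀ M ⊆ Z, ∀ M' ⊆ Z, binCode Z M = binCode Z M' → M = M' := by
  induction Z using Finset.induction_on_max with
  | empty =>
    simp only [subset_empty, card_empty]
    exact ⟨by rintro _ rfl; simp [binCode], by rintro _ rfl _ rfl _; rfl⟩
  | insert a Z ha ih =>
    have haZ : a ∉ Z := fun h => lt_irrefl a (ha a h)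
    have hsub : ∀ M ⊆ insert a Z, M.erase a ⊆ Z := fun M hM v hv =>
      mem_of_mem_insert_of_ne (hM (mem_of_mem_erase hv)) (ne_of_mem_erase hv)
    rw [card_insert_of_notMem haZ, pow_succ]
    constructor
    · intro M hM
      rw [binCode_insert_max ha hM]
      have := ih.1 _ (hsub M hM)
      split_ifs <;> omega
    · intro M hM M' hM' h
      rw [binCode_insert_max ha hM, binCode_insert_max ha hM'] at h
      have h1 := ih.1 _ (hsub M hM)
      have h2 := ih.1 _ (hsub M' hM')
      by_cases b1 : a ∈ M <;> by_cases b2 : a ∈ M' <;> simp only [b1, b2, if_true, if_false] at h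
      · rw [← insert_erase b1, ← insert_erase b2, ih.2 _ (hsub M hM) _ (hsub M' hM') (by omega)]
      · omega
      · omega
      · rw [← erase_eq_of_notMem b1, ← erase_eq_of_notMem b2,
          ih.2 _ (hsub M hM) _ (hsub M' hM') (by omega)]

namespace Prog

/-- The next part of the bag in the order of the binary numbers. -/
def nextPart : Cmd :=
  23 ::= κ 1 ;; Cmd.for 4 1 (.cond (at4 24 *ᵣ ρ 23)
    (.cond (at4 8) (.store 8 (ρ 4) (κ 0)) (.store 8 (ρ 4) (κ 1) ;; 23 ::= κ 0)) .skip) ;;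
    .cond (ρ 23) (22 ::= κ 3) .skip

/-- Try all parts of the bag. -/
def tryAll : Cmd :=
  .loop (ρ 22 =ᵣ κ 0) (tryPart ;; .cond (ρ 22 =ᵣ κ 0) nextPart .skip)

/-- Handle the current node. -/
def attempt : Cmd :=
  Cmd.fill 23 (at4 5 =ᵣ ρ 3 +ᵣ κ 1) ;; Cmd.sum 6 (at4 23) ;;
    .cond (ρ 6)
      (5 ::= ρ 3 *ᵣ ρ 1 ;; Cmd.fill 24 (.arr 3 (ρ 5 +ᵣ ρ 4)) ;; Cmd.fill 8 (κ 0) ;; 22 ::= κ 0 ;;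
        tryAll ;; .cond (ρ 22 =ᵣ κ 3) (26 ::= κ 1) .skip)
      (3 ::= ρ 3 +ᵣ κ 1)

end Prog

namespace Ctx

variable {X : Ctx} {H : GraphClass} {G : SimpleGraph (Fin X.n)}

theorem Att.setReg {s : State} {c : Conf} {M : Finset ℕ} (h : X.Att s c M) {x v : ℕ}
    (hx : x ≠ 0 ∧ x ≠ 1 ∧ x ≠ 2 ∧ x ≠ 3 ∧ x ≠ 5) : X.Att (s.setReg x v) c M :=
  ⟨h.rel.of_eq (by simp [hx.1.symm]) (by simp [hx.2.1.symm]) (by simp [hx.2.2.1.symm])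
    (by simp [hx.2.2.2.1.symm]) rfl rfl rfl rfl rfl rfl rfl, h.S, h.Z, h.M,
    by simpa [hx.2.2.2.2.symm] using h.row⟩

theorem Att.setPart {s : State} {c : Conf} {M M' : Finset ℕ} (h : X.Att s c M) {i v : ℕ}
    (hM : Ind X.n (Function.update (s.arr 8) i v) M') : X.Att (s.setArr 8 i v) c M' :=
  ⟨h.rel.of_eq rfl rfl rfl rfl (by simp) (by simp) (by simp) (by simp) (by simp) (by simp) (by simp),
    by simpa using h.S, by simpa using h.Z, by simpa using hM, h.row⟩

/-- A binary increment with the elements of `Z` as digits. Register `23` is the carry, whose weight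
before vertex `i` is `2 ^ rank Z i`. A carry that is left at the end signals that `M` was the last
subset. -/
theorem nextPart_wp (hX : X.Valid) {s : State} {c : Conf} {M : Finset ℕ} (h : X.Att s c M)
    (hZn : ∀ v ∈ c.bag c.j, v < X.n) (hM : M ⊆ c.bag c.j) (h22 : s.reg 22 = 0) :
    WP X.E Prog.nextPart s (40 * (X.n + 1)) 0 fun s' =>
      (s'.reg 22 = 0 ∧ ∃ M' ⊆ c.bag c.j, X.Att s' c M' ∧
        binCode (c.bag c.j) M' = binCode (c.bag c.j) M + 1) ∨
      (s'.reg 22 = 3 ∧ 2 ^ (c.bag c.j).card ≤ binCode (c.bag c.j) M + 1) := by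
  have hn := hX.n_le
  have hMB := hX.M_le
  have hB1 : 1 < X.E.B := by omega
  set Z := c.bag c.j with hZ
  refine WP.step (T₂ := 38 * (X.n + 1)) (by simp; omega) ?_ (by simp; omega)
  intro f₁
  have h₁ := h.frame f₁ rfl
  have g23 : ((23 ::= κ 1).run s).reg 23 = 1 := by simp
  replace h22 := (f₁.reg 22 rfl).trans h22
  generalize (23 ::= κ 1).run s = s₁ at h₁ g23 h22
  clear f₁ h
  refine WP.seq (T₁ := X.n * (13 + 8) + 6) (K₁ := 0) (T₂ := 4) (K₂ := 0)
    (Q := fun s' => ∃ M' ⊆ Z, X.Att s' c M' ∧ s'.reg 23 ≤ 1 ∧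
      binCode Z M' + s'.reg 23 * 2 ^ rank Z X.n = binCode Z M + 1)
    (WP.for_const X.n (fun i s' => ∃ M' ⊆ Z, X.Att s' c M' ∧ s'.reg 23 ≤ 1 ∧
      binCode Z M' + s'.reg 23 * 2 ^ rank Z i = binCode Z M + 1) 13 rfl rfl (by decide)
      h₁.rel.has.n (by omega) ?_ ?_ (fun _ _ _ h => h) le_rfl) ?_ (by omega) le_rfl
  · exact ⟨M, hM, h₁.setReg (by decide), by simp [g23], by simp [g23, rank]⟩
  · rintro i s' hi hf hx ⟨M', hM', h', h23, hcode⟩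
    have e24 := h'.Z i hi
    have e8 := h'.M i hi
    have hrk : rank Z (i + 1) = rank Z i + if i ∈ Z then 1 else 0 := by
      unfold rank
      have : Z.filter (· < i + 1) = Z.filter (· < i) ∪ Z.filter (· = i) := by
        ext v; simp only [mem_filter, mem_union]
        rw [← and_or_left]; refine and_congr_right fun _ => by omega
      rw [this, card_union_of_disjoint]
      · congr 1
        split_ifs with h1
        · rw [card_eq_one]; refine ⟨i, ?_⟩; ext v; simp only [mem_filter, mem_singleton]
          constructor
          · exact fun h2 => h2.2
          · rintro rfl; exact ⟨h1, rfl⟩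
        · rw [card_eq_zero, filter_eq_empty_iff]
          rintro v hv rfl; exact h1 hv
      · rw [Finset.disjoint_left]; intro v; simp only [mem_filter]; omega
    have hZle : (if i ∈ Z then 1 else 0) ≤ 1 := by split_ifs <;> omega
    refine WP.cond (T := 8) ?_ ?_ ?_ (by simp [Prog.at4])
    · have : (if i ∈ Z then 1 else 0) * s'.reg 23 ≤ 1 := Nat.mul_le_mul hZle h23
      simp [Prog.at4, hx, e24] at this ⊢
      refine ⟨⟨by omega, by omega, ?_⟩, by omega, ?_⟩ <;> split_ifs at this ⊢ <;> omega
    · intro hc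
      have hc' : i ∈ Z ∧ s'.reg 23 = 1 := by
        simp only [Prog.at4, Expr.eval, Op.eval_mul, hx, ← hZ, e24] at hc
        by_cases h1 : i ∈ Z
        · simp [h1] at hc; exact ⟨h1, by omega⟩
        · simp [h1] at hc
      rw [hc'.2, one_mul] at hcode
      simp only [hc'.1, if_true] at hrk
      refine WP.cond (T := 5) ?_ ?_ ?_ (by simp [Prog.at4])
      · simp only [Prog.at4, Expr.Ok, Expr.eval, hx, e8]
        refine ⟨by omega, by omega, ?_⟩
        split_ifs <;> omega
      · intro hm
        have hm' : i ∈ M' := by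
          by_contra h1
          simp [Prog.at4, hx, e8, h1] at hm
        have hsum : binCode Z (M'.erase i) + 2 ^ rank Z i = binCode Z M' :=
          sum_erase_add _ _ hm'
        refine WP.simple ?_ (by simp) fun _ => ?_
        · simp [hx]; omega
        · refine ⟨M'.erase i, (erase_subset _ _).trans hM', ?_, by simp [hc'.2], ?_⟩
          · simp only [Cmd.run, Expr.eval, hx]
            refine (h'.setPart fun v hv => ?_).setReg (by decide)
            by_cases hvi : v = i
            · subst hvi; simp
            · rw [Function.update_of_ne hvi, h'.M v hv]; simp [hvi]
          · simp [hc'.2, hrk, pow_succ]; omega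
      · intro hm
        have hm' : i ∉ M' := by
          intro h1
          simp [Prog.at4, hx, e8, h1] at hm
        have hsum : binCode Z (insert i M') = 2 ^ rank Z i + binCode Z M' := sum_insert hm'
        refine WP.simple ?_ (by simp) fun _ => ?_
        · simp [hx]; omega
        · refine ⟨insert i M', insert_subset hc'.1 hM', ?_, by simp, ?_⟩
          · simp only [Cmd.run, Expr.eval, hx]
            refine Att.setReg (Att.setReg (h'.setPart fun v hv => ?_) (by decide)) (by decide)
            by_cases hvi : v = i
            · subst hvi; simp
            · rw [Function.update_of_ne hvi, h'.M v hv]; simp [hvi]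
          · simp; omega
    · intro hc
      refine WP.simple trivial (by simp) fun _ => ?_
      refine ⟨M', hM', h'.setReg (by decide), by simpa using h23, ?_⟩
      simp only [Cmd.run, State.setReg_reg]
      rw [← hcode, if_neg (by decide)]
      by_cases h1 : i ∈ Z
      · have : s'.reg 23 = 0 := by simpa [Prog.at4, hx, ← hZ, e24, h1] using hc
        simp [this]
      · simp [hrk, h1]
  · rintro s₂ f₂ ⟨M', hM', h', h23, hcode⟩
    replace h22 := (f₂.reg 22 rfl).trans h22
    have hrk : rank Z X.n = Z.card := by
      unfold rank; rw [filter_true_of_mem hZn]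
    rw [hrk] at hcode
    refine WP.cond (T := 2) (by simp; omega) ?_ ?_ (by simp)
    · intro h1
      have h1 : s₂.reg 23 = 1 := by
        have : s₂.reg 23 ≠ 0 := h1
        omega
      rw [h1, one_mul] at hcode
      exact WP.simple (by simp; omega) (by simp) fun _ => Or.inr ⟨by simp, by omega⟩
    · intro h1
      have h1 : s₂.reg 23 = 0 := h1
      rw [h1, zero_mul, add_zero] at hcode
      exact WP.simple trivial (by simp) fun _ => Or.inl ⟨h22, M', hM', h', hcode⟩

theorem tryAll_wp (hX : X.Valid) (hG : X.adj = G.adjNat) (hH : H.Hereditary) (he : H.MemNat G ∅)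
    (hA : SolvesDeletion H X.E.A) (hok : ∀ q, IsInducedQuery G (2 * X.k + 2) q → X.E.ok q)
    {s : State} {c : Conf} (h : X.Att s c ∅) (hc : c.Good H G X.k) (hj : c.j < c.N)
    (hne : c.part X.n c.j ≠ ∅) (h22 : s.reg 22 = 0) :
    WP X.E Prog.tryAll s (2060 * (2 ^ (3 * X.k + 4) * ((X.k + 1) * (X.n + X.m + 1))))
      (2 ^ (3 * X.k + 4)) fun s' =>
      (s'.reg 22 = 3 ∧ X.Rel s' c ∧ ∀ M ⊆ c.bag c.j, PartFails H G X.k (c.part X.n c.j) c.Q (c.bag c.j) M) ∨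
      ((s'.reg 22 = 1 ∨ s'.reg 22 = 2) ∧ ∃ c', X.Rel s' c' ∧ c'.Good H G X.k ∧
        c'.pot X.n < c.pot X.n ∧ c'.queryPot X.n < c.queryPot X.n) := by
  have hn := hX.n_le
  have hMB := hX.M_le
  have hB1 : 1 < X.E.B := by omega
  have hZn : ∀ v ∈ c.bag c.j, v < X.n := hc.inv.bag_lt _ hj
  have hZc : (c.bag c.j).card = 3 * X.k + 4 := hc.filled _ le_rfl hj hne
  obtain ⟨hlt, hinj⟩ := binCode_lt_inj (c.bag c.j)
  rw [hZc] at hlt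
  have hW : X.n + X.m + 1 ≤ (X.k + 1) * (X.n + X.m + 1) := Nat.le_mul_of_pos_left _ (by omega)
  have hpow : 0 < 2 ^ (3 * X.k + 4) := by positivity
  set W := (X.k + 1) * (X.n + X.m + 1) with hWd
  set m := 2 ^ (3 * X.k + 4) with hm
  have hmW : W ≤ m * W := Nat.le_mul_of_pos_left _ hpow
  clear_value W m
  -- While the loop runs, all subsets with a smaller code have failed, and the credits cover the
  -- remaining codes. Once register `22` is non-zero the result is fixed and no credit is needed.
  refine WP.loop (fun s φ ψ => (s.reg 22 = 0 ∧ ∃ M ⊆ c.bag c.j, X.Att s c M ∧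
      (∀ M' ⊆ c.bag c.j, binCode (c.bag c.j) M' < binCode (c.bag c.j) M →
        PartFails H G X.k (c.part X.n c.j) c.Q (c.bag c.j) M') ∧
      φ = (m - binCode (c.bag c.j) M) * (2056 * W) ∧ ψ = m - binCode (c.bag c.j) M) ∨
    (((s.reg 22 = 3 ∧ X.Rel s c ∧ ∀ M ⊆ c.bag c.j, PartFails H G X.k (c.part X.n c.j) c.Q (c.bag c.j) M) ∨
      ((s.reg 22 = 1 ∨ s.reg 22 = 2) ∧ ∃ c', X.Rel s c' ∧ c'.Good H G X.k ∧
        c'.pot X.n < c.pot X.n ∧ c'.queryPot X.n < c.queryPot X.n)) ∧ φ = 0 ∧ ψ = 0))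
    (Φ := m * (2056 * W)) (Ψ := m)
    (Or.inl ⟨h22, ∅, empty_subset _, h, by simp [binCode], by simp [binCode], by simp [binCode]⟩)
    ?_ ?_ ?_ le_rfl
  · intro s φ ψ _ hI
    have h3 : s.reg 22 ≤ 3 := by
      rcases hI with h1 | h1
      · omega
      · rcases h1.1 with h2 | h2 <;> omega
    refine ⟨by simp [eqN_lt hB1]; omega, fun h0 => ?_⟩
    have h0 : s.reg 22 = 0 := by
      by_contra h1
      simp [eqN_of_ne h1] at h0
    rcases hI with ⟨-, M, hM, hatt, hall, rfl, rfl⟩ | ⟨h1, -⟩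
    swap
    · rcases h1 with h2 | h2 <;> omega
    have hcM := hlt M hM
    have hsucc : (m - binCode (c.bag c.j) M) = (m - (binCode (c.bag c.j) M + 1)) + 1 := by omega
    refine ⟨2050 * W, 1, WP.seq (tryPart_wp hX hG hH he hA hok hatt hc hj hne hM h0)
      (T₂ := 50 * W) (K₂ := 0) ?_ (by rw [hWd]; clear * -; omega) le_rfl⟩
    rintro s₁ - (⟨g22, hatt', hpf⟩ | ⟨g22, hres⟩)
    · have hall' : ∀ M' ⊆ c.bag c.j, binCode (c.bag c.j) M' < binCode (c.bag c.j) M + 1 →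
          PartFails H G X.k (c.part X.n c.j) c.Q (c.bag c.j) M' := by
        intro M' hM' hlt'
        rcases Nat.lt_succ_iff_lt_or_eq.1 hlt' with h1 | h1
        · exact hall M' hM' h1
        · rw [hinj M' hM' M hM h1]; exact hpf
      refine WP.cond (T := 40 * W) (by simp [g22]; omega) ?_
        (fun h1 => absurd h1 (by simp [g22])) (by simp; omega)
      intro _
      refine (nextPart_wp hX hatt' hZn hM g22).mono (by omega) le_rfl ?_
      rintro s₂ f₂ (⟨k22, M', hM', hatt'', hcode⟩ | ⟨k22, hcode⟩)
      · refine ⟨_, _, Or.inl ⟨k22, M', hM', hatt'', by rw [hcode]; exact hall', rfl, rfl⟩, ?_, ?_⟩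
        · rw [hcode, hsucc, Nat.add_mul, one_mul]; simp; omega
        · rw [hcode]; omega
      -- After the overflow no code is larger than that of `M`, so all subsets have failed.
      · refine ⟨0, 0, Or.inr ⟨Or.inl ⟨k22, hatt'.rel.frame f₂ rfl, fun M' hM' => hall' M' hM' ?_⟩, rfl, rfl⟩, ?_, by omega⟩
        · rw [hZc] at hcode
          have := hlt M' hM'
          omega
        · rw [hsucc, Nat.add_mul, one_mul]; simp; omega
    · have hne0 : s₁.reg 22 ≠ 0 := by omega
      refine WP.cond (T := 1) (by simp [eqN_lt hB1]; omega)
        (fun h1 => absurd h1 (by simp [eqN_of_ne hne0])) ?_ (by simp; omega)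
      intro _
      refine WP.simple trivial le_rfl fun _ => ⟨0, 0, Or.inr ⟨Or.inr ⟨g22, hres⟩, rfl, rfl⟩, ?_, ?_⟩
      · rw [hsucc, Nat.add_mul, one_mul]; simp; omega
      · omega
  · intro s φ ψ _ hI h0
    have h0 : s.reg 22 ≠ 0 := by simpa using h0
    rcases hI with h1 | h1
    · exact absurd h1.1 h0
    · exact h1.1
  · rw [show m * (2056 * W) = 2056 * (m * W) by ring]; simp; omega

/-- An empty part costs no query. Queries are therefore charged to `queryPot` alone, which never
grows and drops whenever a non-empty part is handled with success; this makes their number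
proportional to `n` and independent of the number of nodes. -/
theorem attempt_wp (hX : X.Valid) (hG : X.adj = G.adjNat) (hH : H.Hereditary) (hU : H.UnionClosed)
    (he : H.MemNat G ∅)
    (hA : SolvesDeletion H X.E.A) (hok : ∀ q, IsInducedQuery G (2 * X.k + 2) q → X.E.ok q)
    {s : State} {c : Conf} (h : X.Rel s c) (hc : c.Good H G X.k) (hj : c.j < c.N)
    (h26 : s.reg 26 = 0) :
    WP X.E Prog.attempt s (2160 * (2 ^ (3 * X.k + 4) * ((X.k + 1) * (X.n + X.m + 1))))
      (if c.part X.n c.j = ∅ then 0 else 2 ^ (3 * X.k + 4)) fun s' =>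
      (s'.reg 26 = 0 ∧ ∃ c', X.Rel s' c' ∧ c'.Good H G X.k ∧ c'.pot X.n < c.pot X.n ∧
        c'.queryPot X.n ≤ c.queryPot X.n ∧
        (c.part X.n c.j ≠ ∅ → c'.queryPot X.n < c.queryPot X.n)) ∨
      (s'.reg 26 = 1 ∧ (c.part X.n c.j ≠ ∅ → 0 < c.queryPot X.n) ∧ X.Rel s' c ∧
        ∀ D : TreeHDecomposition H G, X.k < D.width) := by
  have hn := hX.n_le
  have hMB := hX.M_le
  have hB1 : 1 < X.E.B := by omega
  have hbd : c.N + 2 * c.todo X.n ≤ 2 * X.n + 1 := hc.bounded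
  have hW : X.n + X.m + 1 ≤ (X.k + 1) * (X.n + X.m + 1) := Nat.le_mul_of_pos_left _ (by omega)
  have hpow : 0 < 2 ^ (3 * X.k + 4) := by positivity
  have hmW : (X.k + 1) * (X.n + X.m + 1) ≤ 2 ^ (3 * X.k + 4) * ((X.k + 1) * (X.n + X.m + 1)) :=
    Nat.le_mul_of_pos_left _ hpow
  have hn1 : X.n + 1 ≤ 2 ^ (3 * X.k + 4) * ((X.k + 1) * (X.n + X.m + 1)) := by omega
  have htry := fun s h h22 hne => tryAll_wp (s := s) (c := c) hX hG hH he hA hok h hc hj hne h22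
  set W := 2 ^ (3 * X.k + 4) * ((X.k + 1) * (X.n + X.m + 1)) with hWd
  clear_value W
  refine WP.seq (T₁ := 16 * (X.n + 1)) (K₁ := 0) (T₂ := 2140 * W) (K₂ := _)
    (Q := fun s' => Ind X.n (s'.arr 23) (c.part X.n c.j))
    (fill_ind_wp hX (c.part X.n c.j) h.has ?_ (fun _ _ h => h) (by simp [Prog.at4])) ?_ (by omega)
    (Nat.zero_add _).le
  · intro i s' hi hiM hiB hB hf hx _
    have e5 := (congrFun (hf.arr 5 rfl) i).trans (h.lab i hi)
    have e3 := (hf.reg 3 rfl).trans h.j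
    have hle := hc.inv.lab_le i hi
    simp only [Prog.at4, Expr.Ok, Expr.eval, hx, e5, e3, Op.eval_add, Op.eval_eq, Conf.mem_part]
    refine ⟨⟨by omega, by omega, eqN_lt hB1⟩, ?_⟩
    simp [eqN, hi]
  intro s₁ f₁ h23
  have h₁ := h.frame f₁ rfl
  replace h26 := (f₁.reg 26 rfl).trans h26
  clear f₁ h
  have hpl : (c.part X.n c.j).filter (· < X.n) = c.part X.n c.j :=
    filter_true_of_mem fun v hv => (Conf.mem_part.1 hv).1
  have hpc : (c.part X.n c.j).card ≤ X.n := card_le_of_lt fun v hv => (Conf.mem_part.1 hv).1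
  have hsum : ∑ v ∈ range X.n, s₁.arr 23 v = (c.part X.n c.j).card := by rw [h23.sum, hpl]
  refine WP.seq (T₁ := 16 * (X.n + 1)) (K₁ := 0) (T₂ := 2120 * W) (K₂ := _)
    (Q := fun s' => s'.reg 6 = (c.part X.n c.j).card)
    (WP.sum X.n (s₁.arr 23) (by decide) (by decide) h₁.has.n (by omega) (by rw [hsum]; omega) ?_
      (fun s' _ h1 => h1.trans hsum) (by simp [Prog.at4])) ?_ (by omega) (Nat.zero_add _).le
  · intro i s' hi hf hx
    have e23 := congrFun (hf.arr 23 rfl) i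
    have := h23.le hi
    simp [Prog.at4, hx, e23]; omega
  intro s₂ f₂ g6
  have h₂ := h₁.frame f₂ rfl
  replace h26 := (f₂.reg 26 rfl).trans h26
  rw [← f₂.arr 23 rfl] at h23
  clear f₂ h₁ hsum
  refine WP.cond (T := 2110 * W) (by simp [g6]; omega) ?_ ?_ (by simp; omega)
  · intro hne
    have hne : c.part X.n c.j ≠ ∅ := by
      intro h1; simp [g6, h1] at hne
    rw [if_neg hne]
    have hqp : 0 < c.queryPot X.n := by
      have := Conf.todo_pos hne
      unfold Conf.queryPot; omega
    have hcell : ∀ v ≤ X.n, c.j * X.n + v < X.E.M := fun v hv => hX.cell_lt (by omega) hv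
    have hc0 := hcell 0 (by omega)
    refine WP.step (T₂ := 2105 * W) ?_ ?_ (by simp; omega)
    · simp [h₂.j, h₂.has.n]; omega
    intro f₁
    have h₁ := h₂.frame f₁ rfl
    have g5 : ((5 ::= ρ 3 *ᵣ ρ 1).run s₂).reg 5 = c.j * X.n := by simp [h₂.j, h₂.has.n]
    replace h26 := (f₁.reg 26 rfl).trans h26
    rw [← f₁.arr 23 rfl] at h23
    generalize (5 ::= ρ 3 *ᵣ ρ 1).run s₂ = s₁ at h₁ g5 h26 h23
    clear f₁ h₂ g6
    refine WP.seq (T₁ := 16 * (X.n + 1)) (K₁ := 0) (T₂ := 2085 * W) (K₂ := _)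
      (Q := fun s' => Ind X.n (s'.arr 24) (c.bag c.j))
      (fill_ind_wp hX (c.bag c.j) h₁.has ?_ (fun _ _ h => h) (by simp)) ?_ (by omega)
      (Nat.zero_add _).le
    · intro i s' hi hiM hiB hB hf hx _
      have e3 := hf.arr 3 rfl
      have e5 := (hf.reg 5 rfl).trans g5
      have hb : s₁.arr 3 (c.j * X.n + i) = if i ∈ c.bag c.j then 1 else 0 := h₁.bag c.j hj i hi
      have := hcell i hi.le
      have hb1 : s₁.arr 3 (c.j * X.n + i) ≤ 1 := by rw [hb]; split_ifs <;> omega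
      simp [hx, e3, e5]
      exact ⟨by omega, hb⟩
    intro s₂ f₂ h24
    have h₂ := h₁.frame f₂ rfl
    replace h26 := (f₂.reg 26 rfl).trans h26
    replace g5 := (f₂.reg 5 rfl).trans g5
    rw [← f₂.arr 23 rfl] at h23
    clear f₂ h₁
    refine WP.seq (T₁ := 11 * (X.n + 1)) (K₁ := 0) (T₂ := 2070 * W) (K₂ := _)
      (Q := fun s' => Ind X.n (s'.arr 8) ∅)
      (fill_ind_wp hX ∅ h₂.has ?_ (fun _ _ h => h) (by simp)) ?_ (by omega)
      (Nat.zero_add _).le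
    · intro i s' hi hiM hiB hB hf hx _
      simp; omega
    intro s₁ f₁ h8
    have h₁ := h₂.frame f₁ rfl
    replace h26 := (f₁.reg 26 rfl).trans h26
    replace g5 := (f₁.reg 5 rfl).trans g5
    rw [← f₁.arr 23 rfl] at h23
    rw [← f₁.arr 24 rfl] at h24
    clear f₁ h₂
    have hatt : X.Att s₁ c ∅ := ⟨h₁, h23, h24, h8, g5⟩
    refine WP.step (T₂ := 2066 * W) (by simp; omega) ?_ (by simp; omega)
    intro f₂
    replace hatt := hatt.frame f₂ rfl
    replace h26 := (f₂.reg 26 rfl).trans h26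
    refine WP.seq (htry _ hatt (by simp) hne) (T₂ := 6 * W) (K₂ := 0) ?_ (by omega) le_rfl
    intro s₃ f₃ hres
    replace h26 := (f₃.reg 26 rfl).trans h26
    rcases hres with ⟨h22, hrel, hall⟩ | ⟨h22, c', h1, h2, h3, h4⟩
    · refine WP.cond (T := 2) (by simp [h22]; omega) ?_
        (fun h1 => absurd h1 (by simp [h22])) (by simp; omega)
      intro _
      refine WP.simple (by simp; omega) (by simp) fun f => Or.inr ⟨by simp, fun _ => hqp, hrel.frame f rfl, ?_⟩
      exact lt_width_of_partFails hH hU (hc.inv.bag_lt _ hj) (hc.filled _ le_rfl hj hne)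
        (hc.inv.Q_mem _ hj) hall
    · have hne3 : s₃.reg 22 ≠ 3 := by omega
      refine WP.cond (T := 1) (by simp [eqN_lt hB1]; omega)
        (fun h1 => absurd h1 (by simp [eqN_of_ne hne3])) ?_ (by simp; omega)
      intro _
      exact WP.simple trivial (by simp) fun _ => Or.inl ⟨h26, c', h1, h2, h3, h4.le, fun _ => h4⟩
  · intro hem
    have hem : c.part X.n c.j = ∅ := by
      rw [← card_eq_zero, ← g6]; exact hem
    refine WP.simple (by simp [h₂.j]; omega) (by simp; omega) fun f => Or.inl
      ⟨by simpa using h26, { c with j := c.j + 1 }, ?_, ⟨Conf.skip_inv hc.inv hj hem, ?_, hc.bounded⟩,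
        ?_, le_rfl, fun h1 => absurd hem h1⟩
    · exact ⟨h₂.has.frame f rfl, by simp [h₂.N], by simp [h₂.j], by simpa using h₂.par,
        by simpa using h₂.bag, by simpa using h₂.lab, by simpa using h₂.L, by simpa using h₂.Q⟩
    · intro i h1 h2 h3
      have h1 : c.j + 1 ≤ i := h1
      exact hc.filled i (by omega) h2 h3
    · show c.queryPot X.n + (c.N - (c.j + 1)) < c.queryPot X.n + (c.N - c.j)
      omega

end Ctx

/-! ### Input and output -/

open Finset WordRAM

namespace Prog

/-- Read the input, and start with one node. -/
def init : Cmd :=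
  1 ::= .arr 0 (κ 0) ;; 13 ::= κ 1 ;;
    Cmd.for 4 1 (.store 2 (ρ 4) (ρ 13) ;; 13 ::= ρ 13 +ᵣ .arr 0 (ρ 13) +ᵣ κ 1) ;;
    Cmd.fill 5 (κ 1) ;; 2 ::= κ 1 ;; 27 ::= κ 0 ;; extend

/-- Append a word to the output. -/
def append (e : Expr) : Cmd := .store 1 (ρ 24) e ;; 24 ::= ρ 24 +ᵣ κ 1

/-- Write a set of vertices. -/
def emitRow (e : Expr) : Cmd :=
  Cmd.sum 6 e ;; append (ρ 6) ;; Cmd.for 4 1 (.cond e (append (ρ 4)) .skip)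

/-- Write the tree decomposition. -/
def output : Cmd :=
  append (κ 1) ;; append (ρ 2) ;; append (κ 0) ;; Cmd.for 4 2 (append (at4 4)) ;;
    emitRow (at4 6) ;;
    Cmd.for 13 2 (5 ::= ρ 13 *ᵣ ρ 1 ;; emitRow (.arr 3 (ρ 5 +ᵣ ρ 4)))

/-- The algorithm. -/
def main : Cmd :=
  init ;; .loop ((ρ 3 <ᵣ ρ 2) *ᵣ (κ 1 -ᵣ ρ 26)) attempt ;; .cond (ρ 26) .skip (24 ::= κ 0 ;; output)

end Prog

namespace Ctx

variable {X : Ctx} {H : GraphClass} {G : SimpleGraph (Fin X.n)}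

/-- The list encodes the graph. -/
structure Reads (X : Ctx) (code : List ℕ) : Prop where
  head : code.getD 0 0 = X.n
  off_zero : X.off 0 = 1
  off_succ : ∀ v < X.n, X.off (v + 1) = X.off v + X.dg v + 1
  off_lt : ∀ v ≤ X.n, X.off v < X.E.M
  dg : ∀ v < X.n, code.getD (X.off v) 0 = X.dg v
  nb : ∀ v < X.n, ∀ i, 0 < i → i ≤ X.dg v → code.getD (X.off v + i) 0 = X.nb v i

/-- The parts of the state that have not yet been written. -/
structure Fresh (X : Ctx) (code : List ℕ) (s : State) : Prop where
  k : s.reg 0 = X.k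
  j : s.reg 3 = 0
  input : s.arr 0 = fun i => code.getD i 0
  zero : ∀ a ∈ [3, 4, 6, 7], s.arr a = fun _ => 0

theorem Fresh.frame {code : List ℕ} {s s' : State} (h : X.Fresh code s) {p : Cmd}
    (hf : Frame p s s')
    (hp : (!(p.wr 0 || p.wr 3 || p.wa 0 || p.wa 3 || p.wa 4 || p.wa 6 || p.wa 7)) = true) :
    X.Fresh code s' := by
  simp only [Bool.not_eq_true', Bool.or_eq_false_iff] at hp
  obtain ⟨⟨⟨⟨⟨⟨r0, r3⟩, a0⟩, a3⟩, a4⟩, a6⟩, a7⟩ := hp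
  refine ⟨(hf.reg 0 r0).trans h.k, (hf.reg 3 r3).trans h.j, (hf.arr 0 a0).trans h.input, ?_⟩
  intro a ha
  have : p.wa a = false := by
    simp only [List.mem_cons, List.not_mem_nil, or_false] at ha
    rcases ha with rfl | rfl | rfl | rfl <;> assumption
  exact (hf.arr a this).trans (h.zero a ha)

theorem init_wp (hX : X.Valid) (hH : H.Hereditary) (he : H.MemNat G ∅) {code : List ℕ}
    (hcode : X.Reads code) :
    WP X.E Prog.init (State.init code X.k) (150 * (X.n + 1)) 0 fun s' =>
      ∃ c, X.Rel s' c ∧ c.Good H G X.k ∧ c.pot X.n ≤ 3 * X.n + 1 ∧ c.queryPot X.n ≤ 3 * X.n := by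
  have hn := hX.n_le
  have hMB := hX.M_le
  have h0 : X.Fresh code (State.init code X.k) := by
    refine ⟨rfl, rfl, by simp [State.init], fun a ha => ?_⟩
    have : a ≠ 0 := by rintro rfl; simp at ha
    simp [State.init, this]
  have hhead := hcode.head
  refine WP.step (T₂ := 147 * (X.n + 1)) ?_ ?_ (by simp; omega)
  · simp only [Cmd.Safe, Expr.Ok, Expr.eval, h0.input, hhead]; omega
  intro f₁
  have h₁ := h0.frame f₁ rfl
  have g1 : ((1 ::= .arr 0 (κ 0)).run (State.init code X.k)).reg 1 = X.n := by
    simp only [Cmd.run, State.setReg_reg, if_true, Expr.eval, h0.input, hhead]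
  generalize (1 ::= .arr 0 (κ 0)).run (State.init code X.k) = s₁ at h₁ g1
  clear f₁ h0
  refine WP.step (T₂ := 145 * (X.n + 1)) (by simp; omega) ?_ (by simp; omega)
  intro f₂
  have h₂ := h₁.frame f₂ rfl
  replace g1 := (f₂.reg 1 rfl).trans g1
  have g13 : ((13 ::= κ 1).run s₁).reg 13 = X.off 0 := by simp [hcode.off_zero]
  generalize (13 ::= κ 1).run s₁ = s₂ at h₂ g1 g13
  clear f₂ h₁
  refine WP.seq (T₁ := X.n * (10 + 8) + 6) (K₁ := 0) (T₂ := 120 * (X.n + 1)) (K₂ := 0)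
    (Q := fun s' => ∀ u < X.n, s'.arr 2 u = X.off u)
    (WP.for_const X.n (fun i s' => s'.reg 13 = X.off i ∧ ∀ u < i, s'.arr 2 u = X.off u) 10
      rfl rfl (by decide) g1 (by omega) (by simp [g13]) ?_ (fun _ _ _ h => h.2) le_rfl) ?_
      (by omega) le_rfl
  · rintro i s' hi hf hx ⟨h1, h2⟩
    have e0 := (h₂.frame hf rfl).input
    have e1 := hcode.dg i hi
    have e2 := hcode.off_succ i hi
    have e3 := hcode.off_lt i hi.le
    have e4 := hcode.off_lt (i + 1) hi
    refine WP.simple ?_ (by simp) fun _ => ?_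
    · simp only [Cmd.Safe, Expr.Ok, Expr.eval, Cmd.run, State.setArr_reg, State.setArr_arr, hx, h1, e0,
        Op.eval_add]
      simp at e1 ⊢
      omega
    · refine ⟨?_, fun u hu => ?_⟩
      · simp [h1, e0] at e1 ⊢; omega
      · simp [hx, h1]
        by_cases hui : u = i
        · subst hui; simp
        · rw [Function.update_of_ne hui]; exact h2 u (by omega)
  intro s₃ f₃ g2
  have h₃ := h₂.frame f₃ rfl
  replace g1 := (f₃.reg 1 rfl).trans g1
  clear f₃ h₂ g13
  have hhas : X.Has s₃ := by
    refine ⟨h₃.k, g1, g2, fun u hu => ?_, fun u hu i h1 h2 => ?_⟩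
    · rw [h₃.input]; exact hcode.dg u hu
    · rw [h₃.input]; exact hcode.nb u hu i h1 h2
  clear g2
  refine WP.seq (T₁ := 11 * (X.n + 1)) (K₁ := 0) (T₂ := 100 * (X.n + 1)) (K₂ := 0)
    (Q := fun s' => ∀ u < X.n, s'.arr 5 u = 1)
    (WP.fill X.n (fun _ => 1) g1 (by omega) (by omega) (by simp; omega) (fun _ _ h1 _ => h1)
      (by simp)) ?_ (by omega) le_rfl
  intro s₁ f₁ g5
  have h₁ := h₃.frame f₁ rfl
  replace hhas := hhas.frame f₁ rfl
  clear f₁ h₃ g1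
  refine WP.step (T₂ := 95 * (X.n + 1)) (by simp; omega) ?_ (by simp; omega)
  intro f₂
  refine WP.step (T₂ := 90 * (X.n + 1)) (by simp; omega) ?_ (by simp; omega)
  intro f₃
  have h₃ := (h₁.frame f₂ rfl).frame f₃ rfl
  replace hhas := (hhas.frame f₂ rfl).frame f₃ rfl
  have g2 : ((27 ::= κ 0).run ((2 ::= κ 1).run s₁)).reg 2 = 1 := by simp
  have g27 : ((27 ::= κ 0).run ((2 ::= κ 1).run s₁)).reg 27 = 0 := by simp
  rw [← f₂.arr 5 rfl, ← f₃.arr 5 rfl] at g5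
  generalize (27 ::= κ 0).run ((2 ::= κ 1).run s₁) = s₂ at h₃ hhas g2 g27 g5
  clear f₂ f₃ h₁
  -- All arrays start with zeros, which already represent the empty bag and the empty sets `L` and
  -- `Q`. Only the labels had to be set to 1, placing every vertex below the root.
  have hrel : X.Rel s₂ Conf.init := by
    refine ⟨hhas, g2, h₃.j, fun i _ => ?_, fun i _ v _ => ?_, g5, fun v _ => ?_, fun v _ => ?_⟩
    · rw [h₃.zero 4 (by simp)]; rfl
    · simp only [h₃.zero 3 (by simp)]; simp [Conf.init]
    · simp only [h₃.zero 6 (by simp)]; simp [Conf.init]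
    · simp only [h₃.zero 7 (by simp)]; simp [Conf.init]
  have hinv : Conf.init.Inv H G X.k := Conf.init_inv he
  refine (extend_wp hX hrel g27 (by simp [Conf.init]) (by simp [Conf.init]) hinv.lab_le
    (by simp [Conf.init]) (hinv.small 0 (by simp [Conf.init]))).mono (by omega) le_rfl ?_
  rintro s' - ⟨A, hA, hR⟩
  have htodo : (Conf.init.extend 0 A).todo X.n ≤ X.n := (card_filter_le _ _).trans (by simp)
  have hrest : (Conf.init.extend 0 A).rest X.n ≤ X.n := (card_filter_le _ _).trans (by simp)
  refine ⟨_, hR, ⟨Conf.extend_inv hinv hH (by simp [Conf.init]) hA.sub hA.card, ?_, ?_⟩, ?_, ?_⟩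
  · intro i _ hi hne
    have : i = 0 := by
      have : i < 1 := hi
      omega
    subst this
    exact Conf.extend_filled hA hne
  · show 1 + 2 * _ ≤ _
    omega
  · show 2 * _ + _ + (1 - 0) ≤ _
    omega
  · show 2 * _ + _ ≤ _
    omega

end Ctx

/-! ### Writing the output and the main loop -/

open Finset WordRAM

namespace Ctx

variable {X : Ctx} {H : GraphClass} {G : SimpleGraph (Fin X.n)}

theorem append_wp (hX : X.Valid) {s : State} {l : List ℕ} {e : Expr} (h : Emits 1 24 s l)
    (hl : l.length + 1 < X.E.M) (he : e.Ok X.E.B X.E.M s) :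
    WP X.E (Prog.append e) s (e.cost + 6) 0 fun s' => Emits 1 24 s' (l ++ [e.eval s]) := by
  have hMB := hX.M_le
  have h1 := h.1
  unfold Prog.append
  refine WP.simple ?_ (by simp; omega) fun _ => h.append (by simp) (by simp)
  simp [h1, he]; omega

/-- The expression is evaluated twice, first to write the number of elements and then to list them.
Hence its value may not depend on the registers and the array written in between. -/
theorem emitRow_wp (hX : X.Valid) {s : State} {l : List ℕ} {e : Expr} {S : Finset ℕ}
    (h : Emits 1 24 s l) (hl : l.length + X.n + 3 < X.E.M) (hn1 : s.reg 1 = X.n)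
    (he : ∀ i s', i < X.n → (∀ x, x ≠ 4 → x ≠ 6 → x ≠ 24 → s'.reg x = s.reg x) →
      (∀ a, a ≠ 1 → s'.arr a = s.arr a) → s'.reg 4 = i →
      e.Ok X.E.B X.E.M s' ∧ e.eval s' = if i ∈ S then 1 else 0) (hec : e.cost ≤ 5) :
    WP X.E (Prog.emitRow e) s (55 * (X.n + 1)) 0 fun s' =>
      Emits 1 24 s' (l ++ Conf.rowCode X.n S) := by
  have hn := hX.n_le
  have hMB := hX.M_le
  have hsum : ∑ v ∈ range X.n, (if v ∈ S then 1 else 0) = (S.filter (· < X.n)).card := by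
    rw [sum_boole]
    simp only [Nat.cast_id]
    congr 1
    ext v; simp [and_comm]
  have hcard : (S.filter (· < X.n)).card ≤ X.n := card_le_of_lt fun v hv => (mem_filter.1 hv).2
  refine WP.seq (T₁ := (e.cost + 14) * (X.n + 1)) (K₁ := 0) (T₂ := 34 * (X.n + 1)) (K₂ := 0)
    (Q := fun s' => s'.reg 6 = (S.filter (· < X.n)).card)
    (WP.sum X.n _ (by decide) (by decide) hn1 (by omega) (by rw [hsum]; omega) ?_
      (fun s' _ h1 => h1.trans hsum) le_rfl) ?_ (by nlinarith) le_rfl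
  · intro i s' hi hf hx
    refine he i s' hi (fun x h4 h6 _ => hf.reg x ?_) (fun a _ => hf.arr a ?_) hx
    · simp [Cmd.sum, Cmd.for, Cmd.wr]; omega
    · simp [Cmd.sum, Cmd.for, Cmd.wa]
  intro s₁ f₁ h6
  have h₁ : Emits 1 24 s₁ l := h.of_eq (f₁.reg 24 rfl) (f₁.arr 1 rfl)
  have k₁ : ∀ x, x ≠ 4 → x ≠ 6 → x ≠ 24 → s₁.reg x = s.reg x := fun x _ _ _ => f₁.reg x (by
    simp [Cmd.sum, Cmd.for, Cmd.wr]; omega)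
  have a₁ : ∀ a, a ≠ 1 → s₁.arr a = s.arr a := fun a _ => f₁.arr a (by
    simp [Cmd.sum, Cmd.for, Cmd.wa])
  refine WP.seq (append_wp hX h₁ (by omega) (by simp [h6]; omega)) (T₂ := X.n * (5 + 1 + 7 + 8) + 6)
    (K₂ := 0) ?_ (by simp; omega) le_rfl
  intro s₂ f₂ h₂
  have k₂ : ∀ x, x ≠ 4 → x ≠ 6 → x ≠ 24 → s₂.reg x = s.reg x := fun x h4 h6 h24 => (f₂.reg x (by
    simp [Prog.append, Cmd.wr]; omega)).trans (k₁ x h4 h6 h24)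
  have a₂ : ∀ a, a ≠ 1 → s₂.arr a = s.arr a := fun a h1 => (f₂.arr a (by
    simp [Prog.append, Cmd.wa]; omega)).trans (a₁ a h1)
  simp only [Expr.eval, h6] at h₂
  refine WP.for_const X.n (fun i s' => Emits 1 24 s' (l ++ [(S.filter (· < X.n)).card] ++
    (List.range i).filter (· ∈ S))) (5 + 1 + 7) rfl rfl (by decide)
    ((k₂ 1 (by decide) (by decide) (by decide)).trans hn1) (by omega)
    (by simpa using h₂.of_eq (s' := s₂.setReg 4 0) (by simp) rfl) ?_ ?_ le_rfl
  · intro i s' hi hf hx hE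
    have hev := he i s' hi (fun x h4 h6 h24 => (hf.reg x (by
        simp [Cmd.for, Prog.append, Cmd.wr]; omega)).trans (k₂ x h4 h6 h24))
      (fun a h1 => (hf.arr a (by simp [Cmd.for, Prog.append, Cmd.wa]; omega)).trans (a₂ a h1)) hx
    have hlen : ((List.range i).filter (· ∈ S)).length ≤ i := by
      simpa using List.length_filter_le (· ∈ S) (List.range i)
    refine WP.cond (T := 7) hev.1 ?_ ?_ (by omega)
    · intro h1
      have hi' : i ∈ S := by
        by_contra h2; rw [hev.2, if_neg h2] at h1; exact h1 rfl
      refine (append_wp hX hE (by simp; omega) (by simp [hx]; omega)).mono (by simp) le_rfl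
        fun s'' _ h'' => ?_
      rw [List.range_succ, List.filter_append, ← List.append_assoc]
      simp only [List.filter_singleton, hi', decide_true]
      simp only [Expr.eval, hx] at h''
      exact h''.of_eq (by simp) rfl
    · intro h1
      have hi' : i ∉ S := by
        intro h2; rw [hev.2, if_pos h2] at h1; exact one_ne_zero h1
      refine WP.simple trivial (by simp) fun _ => ?_
      rw [List.range_succ, List.filter_append]
      simp only [List.filter_singleton, hi', decide_false]
      simpa using hE.of_eq (s' := s'.setReg 4 (i + 1)) (by simp) rfl
  · intro s' _ _ h'
    simpa [Conf.rowCode] using h'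

theorem output_wp (hX : X.Valid) {s : State} {c : Conf} (h : X.Rel s c) (hN : c.N ≤ 2 * X.n + 1)
    (hpar : ∀ i < c.N, c.par i ≤ c.N) (h24 : s.reg 24 = 0) :
    WP X.E Prog.output s (300 * ((X.n + 1) * (X.n + 1))) 0 fun s' => Emits 1 24 s' (c.out X.n) := by
  have hn := hX.n_le
  have hMB := hX.M_le
  have hsq : 64 * ((X.n + 1) * (X.n + 1)) ≤ X.E.M := by
    refine le_trans ?_ hX.cube_le
    refine Nat.mul_le_mul_left _ ?_
    calc (X.n + 1) * (X.n + 1) ≤ (X.n + 2) * (X.n + 2) := Nat.mul_le_mul (by omega) (by omega)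
      _ = (X.n + 2) ^ 2 := by ring
      _ ≤ _ := Nat.pow_le_pow_right (by omega) (by omega)
  have hW : X.n + 1 ≤ (X.n + 1) * (X.n + 1) := Nat.le_mul_of_pos_left _ (by omega)
  have hNW : c.N * (X.n + 1) ≤ 2 * ((X.n + 1) * (X.n + 1)) := by
    rw [← mul_assoc]; exact Nat.mul_le_mul_right _ (by omega)
  set W := (X.n + 1) * (X.n + 1) with hWd
  clear_value W
  have e₀ : Emits 1 24 s [] := ⟨h24, by simp⟩
  refine WP.seq (append_wp hX e₀ (by simp; omega) (by simp; omega)) (T₂ := 293 * W) (K₂ := 0) ?_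
    (by simp; omega) le_rfl
  intro s₁ f₁ e₁
  have h₁ := h.frame f₁ rfl
  clear f₁ h e₀ h24
  refine WP.seq (append_wp hX e₁ (by simp; omega) (by simp [h₁.N]; omega)) (T₂ := 286 * W) (K₂ := 0) ?_
    (by simp; omega) le_rfl
  intro s₂ f₂ e₂
  have h₂ := h₁.frame f₂ rfl
  simp only [Expr.eval, h₁.N] at e₂
  clear f₂ h₁ e₁
  refine WP.seq (append_wp hX e₂ (by simp; omega) (by simp; omega)) (T₂ := 279 * W) (K₂ := 0) ?_
    (by simp; omega) le_rfl
  intro s₃ f₃ e₃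
  have h₃ := h₂.frame f₃ rfl
  clear f₃ h₂ e₂
  simp only [Expr.eval, List.nil_append, List.cons_append] at e₃
  refine WP.seq (T₁ := c.N * (8 + 8) + 6) (K₁ := 0) (T₂ := 240 * W) (K₂ := 0)
    (Q := fun s' => Emits 1 24 s' ([1, c.N, 0] ++ (List.range c.N).map c.par))
    (WP.for_const c.N (fun i s' => Emits 1 24 s' ([1, c.N, 0] ++ (List.range i).map c.par)) 8 rfl rfl
      (by decide) h₃.N (by omega) (by simpa using e₃.of_eq (s' := s₃.setReg 4 0) (by simp) rfl) ?_
      (fun _ _ _ h => h) le_rfl) ?_ (by omega) le_rfl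
  · intro i s' hi hf hx hE
    have e4 := (congrFun (hf.arr 4 rfl) i).trans (h₃.par i hi)
    have := hpar i hi
    refine (append_wp hX hE (by simp; omega) (by simp [Prog.at4, hx, e4]; omega)).mono
      (by simp [Prog.at4]) le_rfl fun s'' _ h'' => ?_
    simp only [Prog.at4, Expr.eval, hx, e4] at h''
    rw [List.range_succ, List.map_append, ← List.append_assoc]
    exact h''.of_eq (by simp) rfl
  intro s₄ f₄ e₄
  have h₄ := h₃.frame f₄ rfl
  clear f₄ h₃ e₃
  refine WP.seq (emitRow_wp hX (S := c.L) e₄ (by simp; omega) h₄.has.n ?_ (by simp [Prog.at4]))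
    (T₂ := c.N * ((60 * (X.n + 1)) + 8) + 6) (K₂ := 0) ?_ (by nlinarith) le_rfl
  · intro i s' hi hr ha hx
    have e6 := (congrFun (ha 6 (by decide)) i).trans (h₄.L i hi)
    simp only [Prog.at4, Expr.Ok, Expr.eval, hx, e6]
    refine ⟨⟨by omega, by omega, ?_⟩, trivial⟩
    split_ifs <;> omega
  intro s₅ f₅ e₅
  have h₅ := h₄.frame f₅ rfl
  clear f₅ h₄ e₄
  have hrl : ∀ S : Finset ℕ, (Conf.rowCode X.n S).length ≤ X.n + 1 := by
    intro S
    have := List.length_filter_le (· ∈ S) (List.range X.n)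
    simp [Conf.rowCode] at this ⊢
    omega
  have hlen : ∀ i, ((List.range i).flatMap fun i => Conf.rowCode X.n (c.bag i)).length ≤
      i * (X.n + 1) := by
    intro i
    induction i with
    | zero => simp
    | succ i ih =>
      have := hrl (c.bag i)
      rw [List.range_succ, List.flatMap_append, List.length_append, List.flatMap_singleton, Nat.add_mul]
      omega
  refine WP.for_const c.N (fun i s' => Emits 1 24 s' ([1, c.N, 0] ++ (List.range c.N).map c.par ++
    Conf.rowCode X.n c.L ++ (List.range i).flatMap fun i => Conf.rowCode X.n (c.bag i)))
    (60 * (X.n + 1)) rfl rfl (by decide) h₅.N (by omega)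
    (by simpa using e₅.of_eq (s' := s₅.setReg 13 0) (by simp) rfl) ?_ (fun _ _ _ h => h) le_rfl
  intro i s' hi hf hx hE
  have h' := h₅.frame hf rfl
  have hcell : ∀ v ≤ X.n, i * X.n + v < X.E.M := fun v hv => hX.cell_lt (by omega) hv
  have hc0 := hcell 0 (by omega)
  refine WP.step (T₂ := 55 * (X.n + 1)) ?_ ?_ (by simp; omega)
  · simp [hx, h'.has.n]; omega
  intro f
  have h'' := h'.frame f rfl
  have g5 : ((5 ::= ρ 13 *ᵣ ρ 1).run s').reg 5 = i * X.n := by simp [hx, h'.has.n]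
  replace hE := hE.of_eq (f.reg 24 rfl) (f.arr 1 rfl)
  generalize (5 ::= ρ 13 *ᵣ ρ 1).run s' = s'' at h'' g5 hE
  have hl1 := hlen i
  have hl2 := hrl c.L
  have hl3 : i * (X.n + 1) ≤ c.N * (X.n + 1) := Nat.mul_le_mul_right _ hi.le
  refine (emitRow_wp hX (S := c.bag i) hE ?_ h''.has.n ?_ (by simp)).mono le_rfl le_rfl
    fun s₆ _ h₆ => ?_
  · rw [List.length_append, List.length_append, List.length_append, List.length_map, List.length_range]
    simp only [List.length_cons, List.length_nil]
    omega
  · intro v s₆ hv hr ha hx6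
    have e5 := (hr 5 (by decide) (by decide) (by decide)).trans g5
    have e3 : s₆.arr 3 (i * X.n + v) = if v ∈ c.bag i then 1 else 0 :=
      (congrFun (ha 3 (by decide)) _).trans (h''.bag i hi v hv)
    have := hcell v hv.le
    simp only [Expr.Ok, Expr.eval, hx6, e5, Op.eval_add, e3]
    refine ⟨⟨by omega, by omega, ?_⟩, trivial⟩
    split_ifs <;> omega
  · rw [List.range_succ, List.flatMap_append, List.flatMap_singleton, ← List.append_assoc]
    exact h₆.of_eq (by simp) rfl

/-- The potential `pot` is at most 3n+1 at the start, and each attempt lowers it at a cost of O(8^k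
(k+1)(n+m+1)) steps, unless it ends the loop. Likewise `queryPot` is at most 3n, and an attempt
makes at most 16·8^k queries; hence the constant 48. Initialisation and output take O((n+1)^2)
steps, which is of no larger order. -/
theorem main_wp (hX : X.Valid) (hG : X.adj = G.adjNat) (hH : H.Hereditary) (hU : H.UnionClosed)
    (he : H.MemNat G ∅) {code : List ℕ} (hcode : X.Reads code)
    (hA : SolvesDeletion H X.E.A) (hok : ∀ q, IsInducedQuery G (2 * X.k + 2) q → X.E.ok q) :
    WP X.E Prog.main (State.init code X.k)
      (200000 * (8 ^ X.k * (X.k + 1) * (X.n + 1) * (X.n + X.m + 1))) (48 * (8 ^ X.k * X.n)) fun s' =>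
      (s'.Outputs [0] ∧ ∀ D : TreeHDecomposition H G, X.k < D.width) ∨
      ∃ (D : TreeHDecomposition H G) (out : List ℕ), D.width ≤ 5 * X.k + 5 ∧
        D.nodes ≤ 2 * X.n + 1 ∧ IsDecompositionCode D out ∧ s'.Outputs out := by
  have hn := hX.n_le
  have hMB := hX.M_le
  have hB1 : 1 < X.E.B := by omega
  have hatt := fun s c h hc hj h26 =>
    attempt_wp (s := s) (c := c) hX hG hH hU he hA hok h hc hj h26
  have hpow : 2 ^ (3 * X.k + 4) = 16 * 8 ^ X.k := by
    rw [pow_add, pow_mul]; norm_num [mul_comm]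
  rw [hpow] at hatt
  set e := 8 ^ X.k with hed
  have hepos : 0 < e := by positivity
  clear_value e
  set Y := e * ((X.k + 1) * (X.n + X.m + 1)) with hY
  have hY1 : X.n + 1 ≤ Y := by
    have h1 : X.n + X.m + 1 ≤ (X.k + 1) * (X.n + X.m + 1) := Nat.le_mul_of_pos_left _ (by omega)
    have h2 : (X.k + 1) * (X.n + X.m + 1) ≤ Y := Nat.le_mul_of_pos_left _ hepos
    omega
  have hT : 200000 * (e * (X.k + 1) * (X.n + 1) * (X.n + X.m + 1)) = 200000 * ((X.n + 1) * Y) := by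
    rw [hY]; ring
  have hYe : 2160 * (16 * e * ((X.k + 1) * (X.n + X.m + 1))) = 34560 * Y := by rw [hY]; ring
  simp only [hYe] at hatt
  rw [hT]
  clear_value Y
  set U := (X.n + 1) * Y with hU
  have hU1 : (X.n + 1) * (X.n + 1) ≤ U := Nat.mul_le_mul_left _ hY1
  have hU2 : X.n + 1 ≤ (X.n + 1) * (X.n + 1) := Nat.le_mul_of_pos_left _ (by omega)
  have hU3 : (3 * X.n + 1) * (34640 * Y) ≤ 103920 * U := by
    rw [hU, show 103920 * ((X.n + 1) * Y) = (3 * (X.n + 1)) * (34640 * Y) by ring]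
    exact Nat.mul_le_mul_right _ (by omega)
  clear_value U
  refine WP.seq (init_wp hX hH he hcode) (T₂ := 199000 * U) (K₂ := 48 * (e * X.n)) ?_ (by omega)
    (Nat.zero_add _).le
  rintro s₁ f₁ ⟨c₁, h₁, hc₁, hp₁, hq₁⟩
  have g26 : s₁.reg 26 = 0 := (f₁.reg 26 rfl).trans rfl
  -- Array `1` is not written before the output phase, so in the negative case it already reads
  -- `[0]`.
  have g1 : s₁.arr 1 = fun _ => 0 := (f₁.arr 1 rfl).trans (by simp [State.init])
  refine WP.seq (T₁ := 110000 * U) (K₁ := 48 * (e * X.n)) (T₂ := 400 * U) (K₂ := 0)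
    (Q := fun s' => (s'.reg 26 = 0 ∧ ∃ c, X.Rel s' c ∧ c.Good H G X.k ∧ c.j = c.N) ∨
      (s'.reg 26 = 1 ∧ ∀ D : TreeHDecomposition H G, X.k < D.width))
    (WP.loop (fun s φ ψ => (s.reg 26 = 0 ∧ ∃ c, X.Rel s c ∧ c.Good H G X.k ∧
        φ = c.pot X.n * (34640 * Y) ∧ ψ = c.queryPot X.n * (16 * e)) ∨
      (s.reg 26 = 1 ∧ (∀ D : TreeHDecomposition H G, X.k < D.width) ∧
        (∃ c, X.Rel s c ∧ c.N ≤ 2 * X.n + 1 ∧ c.j ≤ 2 * X.n + 1) ∧ φ = 0 ∧ ψ = 0))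
      (Φ := c₁.pot X.n * (34640 * Y)) (Ψ := c₁.queryPot X.n * (16 * e))
      (Or.inl ⟨g26, c₁, h₁, hc₁, rfl, rfl⟩) ?_ ?_ ?_ ?_) ?_ (by omega) le_rfl
  · rintro s φ ψ - (⟨h26, c, h, hc, rfl, rfl⟩ | ⟨h26, hD, ⟨c, h, hcN, hcj⟩, rfl, rfl⟩)
    · have hbd : c.N + 2 * c.todo X.n ≤ 2 * X.n + 1 := hc.bounded
      have hjN := hc.inv.j_le
      refine ⟨?_, fun hne => ?_⟩
      · simp [h.N, h.j, h26, ltN_lt hB1]; omega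
      have hj : c.j < c.N := by simpa [h.N, h.j, h26] using hne
      refine ⟨_, _, (hatt s c h hc hj h26).mono le_rfl le_rfl ?_⟩
      rintro s' - (⟨k26, c', h', hc', hp, hq, hq'⟩ | ⟨k26, hq, hR, hD⟩)
      · refine ⟨_, _, Or.inl ⟨k26, c', h', hc', rfl, rfl⟩, ?_, ?_⟩
        · have := Nat.mul_le_mul_right (34640 * Y) (Nat.succ_le_of_lt hp)
          rw [Nat.succ_mul] at this
          simp; omega
        · split_ifs with hem
          · rw [zero_add]; exact Nat.mul_le_mul_right _ hq
          · have := Nat.mul_le_mul_right (16 * e) (Nat.succ_le_of_lt (hq' hem))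
            rw [Nat.succ_mul] at this
            omega
      · refine ⟨0, 0, Or.inr ⟨k26, hD, ⟨c, hR, by omega, by omega⟩, rfl, rfl⟩, ?_, ?_⟩
        -- A failing attempt does not change the configuration; it is paid for by the potential,
        -- which is positive because `j < N`.
        · have hp : 1 ≤ c.pot X.n := by unfold Conf.pot; omega
          have := Nat.mul_le_mul_right (34640 * Y) hp
          simp; omega
        · split_ifs with hem
          · omega
          · have := Nat.mul_le_mul_right (16 * e) (Nat.succ_le_of_lt (hq hem))
            omega
    · refine ⟨?_, fun hne => absurd hne (by simp [h26])⟩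
      simp [h26, h.N, h.j, ltN_lt hB1]; omega
  · rintro s φ ψ - (⟨h26, c, h, hc, -, -⟩ | ⟨h26, hD, -⟩) h0
    · have hjN := hc.inv.j_le
      have : c.N ≤ c.j := by simpa [h.N, h.j, h26] using h0
      exact Or.inl ⟨h26, c, h, hc, by omega⟩
    · exact Or.inr ⟨h26, hD⟩
  · have := Nat.mul_le_mul_right (34640 * Y) hp₁
    simp; omega
  · calc _ ≤ 3 * X.n * (16 * e) := Nat.mul_le_mul_right _ hq₁
      _ = _ := by ring
  rintro s₂ f₂ (⟨h26, c, h, hc, hj⟩ | ⟨h26, hD⟩)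
  · obtain ⟨D, hw, hnodes, hD⟩ := Conf.exists_decomposition hc.inv hj
    have hbd : c.N + 2 * c.todo X.n ≤ 2 * X.n + 1 := hc.bounded
    refine WP.cond (T := 390 * U) (by simp [h26]; omega) (fun h1 => absurd h26 h1) ?_ (by simp; omega)
    intro _
    refine WP.step (T₂ := 300 * U) (by simp; omega) ?_ (by simp; omega)
    intro f₃
    refine (output_wp hX (h.frame f₃ rfl) (by omega) (fun i hi => ?_) (by simp)).mono (by omega) le_rfl
      fun s' _ h' => Or.inr ⟨D, _, hw, by omega, hD, h'.readList⟩
    by_cases h0 : 0 < i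
    · have := hc.inv.par_lt i hi h0
      omega
    · rw [show i = 0 by omega, hc.inv.par_zero]; omega
  · refine WP.cond (T := 1) (by simp [h26]; omega) ?_ (fun h1 => absurd h1 (by simp [h26])) (by simp; omega)
    intro _
    refine WP.simple trivial le_rfl fun _ => Or.inl ⟨?_, hD⟩
    have : s₂.arr 1 = fun _ => 0 := (f₂.arr 1 rfl).trans g1
    simp [State.Outputs, State.readList, this]

end Ctx

/-! ### The theorem -/

open Finset WordRAM

namespace Ctx

variable {n : ℕ}

/-- The input graph given by its adjacency lists. -/
noncomputable def ofGraph (G : SimpleGraph (Fin n)) (adj : Fin n → List (Fin n)) (k : ℕ) (E : Machine) : Ctx where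
  n := n
  k := k
  m := G.edgeSet.ncard
  adj := G.adjNat
  dg v := if h : v < n then (adj ⟨v, h⟩).length else 0
  off v := 1 + ∑ u ∈ range v, ((if h : u < n then (adj ⟨u, h⟩).length else 0) + 1)
  nb u i := if i = 0 then u else
    if h : u < n then ((adj ⟨u, h⟩).map Fin.val).getD (i - 1) 0 else 0
  E := E

variable {G : SimpleGraph (Fin n)} {adj : Fin n → List (Fin n)} {k : ℕ} {E : Machine}

theorem ofGraph_dg {v : ℕ} (hv : v < n) : (ofGraph G adj k E).dg v = (adj ⟨v, hv⟩).length := by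
  simp [ofGraph, hv]

theorem ofGraph_nb {v i : ℕ} (hv : v < n) (hi : i < (adj ⟨v, hv⟩).length) :
    (ofGraph G adj k E).nb v (i + 1) = (adj ⟨v, hv⟩)[i] := by
  simp [ofGraph, hv, hi]

theorem ofGraph_valid (hadj : ∀ v, (adj v).Nodup ∧ ∀ u, u ∈ adj v ↔ G.Adj v u)
    (hM : 64 * (n + 2) ^ 3 ≤ E.M) (hMB : E.M ≤ E.B) (hB : 512 * (n + k + 2) ≤ E.B) :
    (ofGraph G adj k E).Valid := by
  classical
  have hdeg : ∀ v : Fin n, (adj v).length = G.degree v := by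
    intro v
    rw [← List.toFinset_card_of_nodup (hadj v).1, ← G.card_neighborFinset_eq_degree]
    congr 1
    ext u; simp [(hadj v).2]
  have hnb : ∀ u : ℕ, ∀ hu : u < n, ∀ i, 0 < i → i ≤ (adj ⟨u, hu⟩).length →
      ∃ hi : i - 1 < (adj ⟨u, hu⟩).length, (ofGraph G adj k E).nb u i = (adj ⟨u, hu⟩)[i - 1] := by
    intro u hu i h0 hi
    refine ⟨by omega, ?_⟩
    have := ofGraph_nb (G := G) (adj := adj) (k := k) (E := E) hu (i := i - 1) (by omega)
    rwa [show i - 1 + 1 = i by omega] at this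
  have hdg : ∀ u, ∀ hu : u < n, (adj ⟨u, hu⟩).length < n := by
    intro u hu
    rw [hdeg]
    simpa using G.degree_lt_card_verts ⟨u, hu⟩
  refine ⟨?_, ?_, ?_, ?_, ?_, ?_, hM, hMB, hB⟩
  · intro u hu i hi
    replace hu : u < n := hu
    rw [ofGraph_dg (n := n) (G := G) (adj := adj) hu] at hi
    rcases Nat.eq_zero_or_pos i with rfl | h0
    · simpa [ofGraph] using hu
    · obtain ⟨h1, h2⟩ := hnb u hu i h0 hi
      rw [h2]
      exact Fin.is_lt _
  · intro u; simp [ofGraph]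
  · intro u hu w
    replace hu : u < n := hu
    rw [ofGraph_dg (n := n) (G := G) (adj := adj) hu]
    constructor
    · rintro ⟨_, hw, h⟩
      obtain ⟨i, hi, h1⟩ := List.getElem_of_mem (((hadj ⟨u, hu⟩).2 ⟨w, hw⟩).2 h)
      refine ⟨i + 1, by omega, by omega, ?_⟩
      rw [ofGraph_nb hu hi, h1]
    · rintro ⟨i, h0, hi, rfl⟩
      obtain ⟨h1, h2⟩ := hnb u hu i h0 hi
      rw [h2]
      exact ⟨hu, Fin.is_lt _, ((hadj ⟨u, hu⟩).2 _).1 (List.getElem_mem h1)⟩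
  · intro u hu i hi j hj hij
    replace hu : u < n := hu
    rw [ofGraph_dg (n := n) (G := G) (adj := adj) hu] at hi hj
    have key : ∀ j, 0 < j → j ≤ (adj ⟨u, hu⟩).length → (ofGraph G adj k E).nb u j ≠ u := by
      intro j h0 hj h
      obtain ⟨h1, h2⟩ := hnb u hu j h0 hj
      rw [h2] at h
      have h3 := ((hadj ⟨u, hu⟩).2 _).1 (List.getElem_mem h1)
      exact h3.ne (Fin.ext h.symm)
    have hz : (ofGraph G adj k E).nb u 0 = u := by simp [ofGraph]
    rcases Nat.eq_zero_or_pos i with rfl | hi0 <;> rcases Nat.eq_zero_or_pos j with rfl | hj0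
    · rfl
    · rw [hz] at hij; exact absurd hij.symm (key j hj0 hj)
    · rw [hz] at hij; exact absurd hij (key i hi0 hi)
    · obtain ⟨h1, h2⟩ := hnb u hu i hi0 hi
      obtain ⟨h3, h4⟩ := hnb u hu j hj0 hj
      rw [h2, h4] at hij
      have := (hadj ⟨u, hu⟩).1.getElem_inj_iff.1 (Fin.ext hij)
      omega
  · have h1 : ∑ u ∈ range n, (ofGraph G adj k E).dg u = ∑ v : Fin n, G.degree v := by
      rw [Finset.sum_range]
      exact sum_congr rfl fun v _ => by rw [ofGraph_dg v.2, hdeg]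
    show ∑ u ∈ range n, (ofGraph G adj k E).dg u ≤ 2 * G.edgeSet.ncard
    rw [h1, G.sum_degrees_eq_twice_card_edges, ← SimpleGraph.coe_edgeFinset, Set.ncard_coe_finset]
  · intro u hu
    replace hu : u < n := hu
    have h1 : ∀ v ≤ n, ∑ u ∈ range v, ((if h : u < n then (adj ⟨u, h⟩).length else 0) + 1) ≤ v * n := by
      intro v hv
      calc _ ≤ ∑ u ∈ range v, n := by
            refine sum_le_sum fun u hu => ?_
            have hun : u < n := by have := mem_range.1 hu; omega
            have := hdg u hun
            simp only [hun, dif_pos]; omega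
        _ = v * n := by simp
    have h2 := h1 u hu.le
    have h3 := hdg u hu
    have h4 : u * n ≤ n * n := Nat.mul_le_mul_right _ hu.le
    rw [ofGraph_dg (n := n) (G := G) (adj := adj) hu]
    show 1 + _ + _ < E.M
    have h5 : n * n + n + 2 ≤ (n + 2) ^ 3 := by nlinarith [Nat.zero_le (n * n * n), Nat.zero_le (n * n)]
    omega

theorem ofGraph_reads (hX : (ofGraph G adj k E).Valid) {code : List ℕ}
    (hcode : code = n :: (List.ofFn fun v => codeList (adj v)).flatten) :
    (ofGraph G adj k E).Reads code := by
  -- An encoded list has one word more than its vertex has neighbours. The initial 1 in `off`,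
  -- absent here, accounts for the leading word `n`.
  have hlen : ∀ v ≤ n, (((List.ofFn fun v => codeList (adj v)).map List.length).take v).sum =
      ∑ u ∈ range v, ((if h : u < n then (adj ⟨u, h⟩).length else 0) + 1) := by
    intro v hv
    induction v with
    | zero => simp
    | succ v ih =>
      have hvn : v < n := by omega
      rw [sum_range_succ, ← ih (by omega), List.take_succ_eq_append_getElem (by simpa using hvn),
        List.sum_append]
      simp [codeList, hvn]
  have hget : ∀ v, ∀ hv : v < n, ∀ i ≤ (adj ⟨v, hv⟩).length,
      code.getD ((ofGraph G adj k E).off v + i) 0 = (codeList (adj ⟨v, hv⟩)).getD i 0 := by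
    intro v hv i hi
    have h1 : (ofGraph G adj k E).off v + i =
        ((((List.ofFn fun v => codeList (adj v)).map List.length).take v).sum + i) + 1 := by
      rw [hlen v hv.le]; simp only [ofGraph]; omega
    rw [h1, hcode, List.getD_cons_succ]
    have h2 := List.drop_sum_flatten (List.ofFn fun v => codeList (adj v)) v
    have h3 : v < (List.ofFn fun v => codeList (adj v)).length := by simpa using hv
    rw [List.drop_eq_getElem_cons h3, List.flatten_cons] at h2
    simp only [List.getD_eq_getElem?_getD]
    rw [← List.getElem?_drop, h2, List.getElem?_append_left (by simp [codeList]; omega)]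
    simp
  refine ⟨by rw [hcode]; rfl, by simp [ofGraph], ?_, ?_, ?_, ?_⟩
  · intro v hv
    simp only [ofGraph, sum_range_succ]; omega
  · intro v hv
    have h1 : ∀ v ≤ n, (ofGraph G adj k E).off v ≤ 1 + v * n := by
      intro v hv
      induction v with
      | zero => simp [ofGraph]
      | succ v ih =>
        have h2 : (ofGraph G adj k E).off (v + 1) =
            (ofGraph G adj k E).off v + (ofGraph G adj k E).dg v + 1 := by
          simp only [ofGraph, sum_range_succ]; omega
        have h3 : (ofGraph G adj k E).dg v < n := hX.dg_lt (show v < n by omega)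
        have h4 := ih (by omega)
        have h5 : (v + 1) * n = v * n + n := by ring
        omega
    have h2 := h1 v hv
    have h3 : v * n ≤ n * n := Nat.mul_le_mul_right _ hv
    have h4 : 64 * (n + 2) ^ 3 ≤ (ofGraph G adj k E).E.M := hX.cube_le
    have h5 : n * n + n + 2 ≤ (n + 2) ^ 3 := by nlinarith [Nat.zero_le (n * n * n), Nat.zero_le (n * n)]
    omega
  · intro v hv
    replace hv : v < n := hv
    have h1 := hget v hv 0 (by omega)
    rw [ofGraph_dg (n := n) (G := G) (adj := adj) hv]
    simpa [codeList] using h1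
  · intro v hv i h0 hi
    replace hv : v < n := hv
    rw [ofGraph_dg (n := n) (G := G) (adj := adj) hv] at hi
    obtain ⟨j, rfl⟩ : ∃ j, i = j + 1 := ⟨i - 1, by omega⟩
    rw [hget v hv _ hi, ofGraph_nb hv (by omega)]
    have hj : j < (adj ⟨v, hv⟩).length := by omega
    simp [codeList, hj]

end Ctx

theorem theorem1 (H : GraphClass) (hher : H.Hereditary) (hunion : H.UnionClosed) :
    ∃ (P : WordRAM.Cmd) (C c : ℕ),
      ∀ A : List ℕ → List ℕ, SolvesDeletion H A →
      ∀ (n : ℕ) (G : SimpleGraph (Fin n)) (code : List ℕ) (k : ℕ), IsGraphCode G code →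
      ∃ (s : WordRAM.State) (t : ℕ) (qs : List (List ℕ)),
        -- the run, on words smaller than `(n+k+2)^c` and arrays with `(n+2)^c` cells
        WordRAM.Exec A ((n + k + 2) ^ c) ((n + 2) ^ c) P (WordRAM.State.init code k) s t qs ∧
        -- the running time
        t ≤ C * (8 ^ k * (k + 1) * (n + 1) * (n + G.edgeSet.ncard + 1)) ∧
        -- the oracle calls
        qs.length ≤ C * (8 ^ k * n) ∧
        (∀ q ∈ qs, IsInducedQuery G (2 * k + 2) q) ∧
        -- the output
        ((s.Outputs [0] ∧ (k : ℕ∞) < hTreewidth H G) ∨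
          ∃ (D : TreeHDecomposition H G) (out : List ℕ),
            D.width ≤ 5 * k + 5 ∧ D.nodes ≤ C * (n + 1) ∧
            IsDecompositionCode D out ∧ s.Outputs out) := by
  -- A non-empty hereditary class contains the empty graph, from which the initial configuration
  -- starts. The empty class is treated separately, since it admits no decomposition at all.
  by_cases hne : ∃ (V : Type) (_ : Finite V) (G : SimpleGraph V), H.mem G
  -- As n+2 ≥ 2, the exponent 10 absorbs the factors 64 and 512 in the memory and word limits.
  · refine ⟨Prog.main, 200000, 10, fun A hA n G code k hG => ?_⟩
    obtain ⟨adj, hadj, hcode⟩ := hG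
    let E : Machine := ⟨A, (n + k + 2) ^ 10, (n + 2) ^ 10, IsInducedQuery G (2 * k + 2)⟩
    have hM : 64 * (n + 2) ^ 3 ≤ E.M := by
      show _ ≤ (n + 2) ^ 10
      calc 64 * (n + 2) ^ 3 = 2 ^ 6 * (n + 2) ^ 3 := by norm_num
        _ ≤ (n + 2) ^ 6 * (n + 2) ^ 3 := Nat.mul_le_mul_right _ (Nat.pow_le_pow_left (by omega) _)
        _ = (n + 2) ^ 9 := by ring
        _ ≤ _ := Nat.pow_le_pow_right (by omega) (by norm_num)
    have hB : 512 * (n + k + 2) ≤ E.B := by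
      show _ ≤ (n + k + 2) ^ 10
      calc 512 * (n + k + 2) = 2 ^ 9 * (n + k + 2) := by norm_num
        _ ≤ (n + k + 2) ^ 9 * (n + k + 2) := Nat.mul_le_mul_right _ (Nat.pow_le_pow_left (by omega) _)
        _ = _ := by ring
    have hX := Ctx.ofGraph_valid (E := E) hadj hM (Nat.pow_le_pow_left (by omega) _) hB
    obtain ⟨s, t, qs, h1, h2, h3, h4, h5⟩ := Ctx.main_wp (G := G) hX rfl hher hunion
      (GraphClass.memNat_empty hher hne) (Ctx.ofGraph_reads hX hcode) hA
      (show ∀ q, IsInducedQuery G (2 * k + 2) q → E.ok q from fun _ h => h)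
    refine ⟨s, t, qs, h1, h2, h3.trans (Nat.mul_le_mul_right _ (by norm_num)), h4, ?_⟩
    rcases h5 with ⟨h5, h6⟩ | ⟨D, out, h5, h6, h7, h8⟩
    -- All widths are at least k+1, hence so is their infimum, even if there is no decomposition.
    · refine Or.inl ⟨h5, lt_of_lt_of_le (b := ((k + 1 : ℕ) : ℕ∞)) (by exact_mod_cast Nat.lt_succ_self k)
        (le_iInf fun D => by exact_mod_cast h6 D)⟩
    · have h6 : D.nodes ≤ 2 * n + 1 := h6
      exact Or.inr ⟨D, out, h5, by omega, h7, h8⟩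
  -- Doing nothing is enough: array `1` is zero and reads `[0]`, and the infimum over no
  -- decompositions is infinite.
  · refine ⟨.skip, 1, 1, fun A _ n G code k _ => ⟨_, 1, [], .skip _, ?_, by simp, by simp, Or.inl
      ⟨by simp [State.Outputs, State.readList, State.init], ?_⟩⟩⟩
    · rw [one_mul]
      exact Nat.one_le_iff_ne_zero.2 (by positivity)
    · have : IsEmpty (TreeHDecomposition H G) :=
        ⟨fun D => hne ⟨_, inferInstance, _, D.base D.root⟩⟩
      rw [hTreewidth, iInf_of_empty]
      exact WithTop.coe_lt_top k
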